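/- Let $k$ be a field and $A$ a nonzero finite-dimensional (associative, unital) $k$-algebra of finite global dimension. Write $(-)^*=\mathrm{Hom}_k(-,k)$, let $D^b(A)$ be the full subcategory of the derived category of right $A$-modules formed by the complexes with finite-dimensional total cohomology, and consider on $D^b(A)$ the Nakayama functor $\nu=\mathrm{RHom}_A(-,A)^*$ and the Serre functor $S=-\otimes^L_AA^*$. Assume that $A$ is twisted $\frac qp$-Calabi–Yau: $p\ge 1$ and $q$ are integers, and there are an algebra automorphism $\varphi$ of $A$ and an isomorphism of functors $\nu^p\cong\varphi^*[q]$ on $D^b(A)$, where $\varphi^*$ is induced by $M\mapsto M_\varphi$, the module $M$ with the new action $m\cdot a=m\varphi(a)$. Call an object $G$ of $D^b(A)$ a generator if the smallest thick triangulated subcategory containing it is $D^b(A)$. For objects $E_1,E_2$ and $t\in\mathbb R$ let the complexity $\delta_t(E_1,E_2)\in[0,\infty]$ be the infimum of $\sum_{i=1}^m e^{n_it}$ over all towers of triangles $T_{i-1}\to T_i\to E_1[n_i]\to T_{i-1}[1]$ $(1\le i\le m)$ with $T_0=0$ and $T_m\cong E_2\oplus E_2'$ for some object $E_2'$. Then $D^b(A)$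 has a generator, and: (1) For every generator $G$ and every $t\in\mathbb R$, the limit defining the entropy of $S$ exists and $$h_t(S):=\lim_{n\to\infty}\frac1n\log\delta_t(G,S^nG)=\frac qp\,t.$$ (2) For every generator $G$ and every $t\in\mathbb R$, the polynomial entropy of $S$ is $$h^{\mathrm{pol}}_t(S):=\limsup_{n\to\infty}\frac{\log\delta_t(G,S^nG)-n\,h_t(S)}{\log n}=0.$$ (3) Suppose moreover that $A$ is elementary, that is, $A/\mathrm{rad}\,A\cong k\times\cdots\times k$ as $k$-algebras. Let $A^e$ be the enveloping algebra of $A$ and $\Theta=\mathrm{RHom}_{A^e}(A,A^e)$ the inverse dualizing complex. Then the Hochschild cohomology entropy and the Hochschild homology entropy of the Serre quasi-functor $\tilde S$ (the quasi-functor given by a projective resolution of the $A$-bimodule $A^*$) both vanish: $$h^{HH^\bullet}(\tilde S):=\limsup_{n\to\infty}\frac1n\log\sum_{i\in\mathbb Z}\dim_kH^i\big(\mathrm{RHom}_{A^e}(A,(A^*)^{\otimes^L_An})\big)=0,$$ $$h^{HH_\bullet}(\tilde S):=\limsup_{n\to\infty}\frac1n\log\sum_{i\in\mathbb Z}\dim_kH^{-i}\big(\mathrm{RHom}_{A^e}(\Theta,(A^*)^{\otimes^L_An})\big)=0.$$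 (4) For all generators $G,G'$, the upper and the lower Serre dimension of $A$ are $$\overline{\mathrm{Sdim}}A:=\limsup_{n\to\infty}\frac{-\inf\{i\mid\mathrm{Hom}(G,S^n(G')[i])\ne0\}}{n}=\frac qp,\qquad \underline{\mathrm{Sdim}}A:=\liminf_{n\to\infty}\frac{-\sup\{i\mid\mathrm{Hom}(G,S^n(G')[i])\ne0\}}{n}=\frac qp,$$ the Homs being taken in $D^b(A)$. -/

import Mathlib

open CategoryTheory CategoryTheory.Limits CategoryTheory.Pretriangulated ZeroObject
universe u
noncomputable section
namespace CYEntropy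

instance instHasDerivedModuleCat (R : Type u) [Ring R] :
    HasDerivedCategory.{u + 1} (ModuleCat.{u} R) := HasDerivedCategory.standard _

section general
variable (R : Type u) [Ring R]

/-- The unbounded derived category of left `R`-modules. -/
abbrev DMod := DerivedCategory (ModuleCat.{u} R)


/-- The ring `R` has finite (left) global dimension. -/
class FinGlobalDim : Prop where
  exists_bound : ∃ d : ℕ, ∀ M : ModuleCat.{u} R, HasProjectiveDimensionLE M d

/-- Complexes with finitely generated cohomology modules. -/
def fgCohomology : ObjectProperty (DMod R) :=
  fun X => ∀ i : ℤ, Module.Finite R ((DerivedCategory.homologyFunctor (ModuleCat.{u} R) i).obj X)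

/-- Complexes with bounded finitely generated cohomology. -/
def boundedFG : ObjectProperty (DMod R) :=
  (DerivedCategory.TStructure.t (C := ModuleCat.{u} R)).bounded ⊓ fgCohomology R

/-- Bounded complexes of finitely generated projective modules. -/
def IsStrictPerfect : ObjectProperty (CochainComplex (ModuleCat.{u} R) ℤ) := fun K =>
  (∃ a : ℤ, K.IsStrictlyGE a) ∧ (∃ b : ℤ, K.IsStrictlyLE b) ∧
    ∀ i : ℤ, Projective (K.X i) ∧ Module.Finite R (K.X i)

/-- The same complexes, as objects of the homotopy category. -/
def strictPerfectHo : ObjectProperty (HomotopyCategory (ModuleCat.{u} R) (ComplexShape.up ℤ)) :=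
  (IsStrictPerfect R).strictMap (HomotopyCategory.quotient _ _)

variable {R}

lemma finite_of_exact [IsNoetherianRing R] {S : ShortComplex (ModuleCat.{u} R)} (hS : S.Exact)
    (h1 : Module.Finite R S.X₁) (h3 : Module.Finite R S.X₃) : Module.Finite R S.X₂ := by
  have h := (ShortComplex.moduleCat_exact_iff_range_eq_ker S).1 hS
  have : IsNoetherian R S.X₂ :=
    isNoetherian_of_range_eq_ker S.f.hom S.g.hom h
  infer_instance

instance [IsNoetherianRing R] : (fgCohomology R).IsTriangulated where
  exists_zero := ⟨0, isZero_zero _, fun i => by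
    have : IsZero ((DerivedCategory.homologyFunctor (ModuleCat.{u} R) i).obj 0) :=
      Functor.map_isZero _ (isZero_zero _)
    have := ModuleCat.subsingleton_of_isZero this
    infer_instance⟩
  isStableUnderShiftBy n := ⟨fun X hX i => by
    have : Module.Finite R (((DerivedCategory.homologyFunctor (ModuleCat.{u} R) 0).shift (n + i)).obj X) :=
      hX (n + i)
    exact Module.Finite.equiv
      (((DerivedCategory.homologyFunctor (ModuleCat.{u} R) 0).shiftIso n i (n + i) rfl).symm.app X).toLinearEquiv⟩
  toIsTriangulatedClosed₂ := by
    refine ⟨fun T hT h1 h3 => ObjectProperty.le_isoClosure _ _ fun i => ?_⟩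
    exact finite_of_exact (DerivedCategory.HomologySequence.exact₂ T hT i) (h1 i) (h3 i)

instance : (fgCohomology R).IsClosedUnderIsomorphisms where
  of_iso e h i := by
    have := h i
    exact Module.Finite.equiv
      ((DerivedCategory.homologyFunctor (ModuleCat.{u} R) i).mapIso e).toLinearEquiv

instance [IsNoetherianRing R] : (boundedFG R).IsTriangulated :=
  inferInstanceAs (_ ⊓ _ : ObjectProperty _).IsTriangulated

instance : (boundedFG R).IsClosedUnderIsomorphisms :=
  inferInstanceAs (_ ⊓ _ : ObjectProperty _).IsClosedUnderIsomorphisms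

lemma IsStrictPerfect.isKProjective {K : CochainComplex (ModuleCat.{u} R) ℤ}
    (hK : IsStrictPerfect R K) : K.IsKProjective := by
  obtain ⟨_, ⟨b, _⟩, h⟩ := hK
  have (n : ℤ) : Projective (K.X n) := (h n).1
  exact CochainComplex.isKProjective_of_projective K b

lemma strictPerfectHo_quotient_iff (K : CochainComplex (ModuleCat.{u} R) ℤ) :
    strictPerfectHo R ((HomotopyCategory.quotient _ _).obj K) ↔ IsStrictPerfect R K := by
  refine ⟨?_, fun h ↦ ⟨_, h⟩⟩
  simp only [strictPerfectHo, ObjectProperty.strictMap_iff]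
  rintro ⟨L, h, hL⟩
  obtain rfl : L = K := congr_arg Quotient.as hL
  exact h

lemma IsStrictPerfect.zero : IsStrictPerfect R (0 : CochainComplex (ModuleCat.{u} R) ℤ) := by
  refine ⟨⟨0, inferInstance⟩, ⟨0, inferInstance⟩, fun i => ?_⟩
  have h : IsZero ((0 : CochainComplex (ModuleCat.{u} R) ℤ).X i) :=
    Functor.map_isZero (HomologicalComplex.eval _ _ i) (isZero_zero _)
  have := ModuleCat.subsingleton_of_isZero h
  exact ⟨h.projective, inferInstance⟩

lemma IsStrictPerfect.shift {K : CochainComplex (ModuleCat.{u} R) ℤ}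
    (hK : IsStrictPerfect R K) (n : ℤ) : IsStrictPerfect R (K⟦n⟧) := by
  obtain ⟨⟨a, _⟩, ⟨b, _⟩, h⟩ := hK
  exact ⟨⟨a - n, K.isStrictlyGE_shift a n (a - n) (by lia)⟩,
    ⟨b - n, K.isStrictlyLE_shift b n (b - n) (by lia)⟩, fun i => h (i + n)⟩

lemma IsStrictPerfect.mappingCone {K L : CochainComplex (ModuleCat.{u} R) ℤ}
    (hK : IsStrictPerfect R K) (hL : IsStrictPerfect R L) (f : K ⟶ L) :
    IsStrictPerfect R (CochainComplex.mappingCone f) := by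
  obtain ⟨⟨a, _⟩, ⟨b, _⟩, h⟩ := hK
  obtain ⟨⟨a', _⟩, ⟨b', _⟩, h'⟩ := hL
  refine ⟨⟨min (a - 1) a', CochainComplex.isStrictlyGE_mappingCone f a a' _ (by simp) (by simp)⟩,
    ⟨max b b', ?_⟩, fun i => ?_⟩
  · rw [CochainComplex.isStrictlyLE_iff]
    intro i hi
    simp only [CochainComplex.mappingCone.isZero_X_iff]
    exact ⟨K.isZero_of_isStrictlyLE b _ (by lia), L.isZero_of_isStrictlyLE b' _ (by lia)⟩
  · let e := HomologicalComplex.homotopyCofiber.XIsoBiprod f i (i + 1) rfl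
    have := (h (i + 1)).1
    have := (h' i).1
    have := (h (i + 1)).2
    have := (h' i).2
    refine ⟨Projective.of_iso e.symm inferInstance, ?_⟩
    exact Module.Finite.equiv (e ≪≫ ModuleCat.biprodIsoProd _ _).toLinearEquiv.symm

instance : (strictPerfectHo R).IsTriangulated where
  exists_zero := ⟨(HomotopyCategory.quotient _ _).obj 0, Functor.map_isZero _ (isZero_zero _),
    (strictPerfectHo_quotient_iff _).2 IsStrictPerfect.zero⟩
  isStableUnderShiftBy n :=
    { le_shift K hK := by
        obtain ⟨K : CochainComplex _ _, rfl⟩ := K.quotient_obj_surjective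
        rw [ObjectProperty.prop_shift_iff, HomotopyCategory.shift_quotient_obj,
          strictPerfectHo_quotient_iff]
        exact ((strictPerfectHo_quotient_iff _).1 hK).shift n }
  toIsTriangulatedClosed₂ := by
    have : (strictPerfectHo R).IsStableUnderShift ℤ := 
      { isStableUnderShiftBy n :=
        { le_shift K hK := by
            obtain ⟨K : CochainComplex _ _, rfl⟩ := K.quotient_obj_surjective
            rw [ObjectProperty.prop_shift_iff, HomotopyCategory.shift_quotient_obj,
              strictPerfectHo_quotient_iff]
            exact ((strictPerfectHo_quotient_iff _).1 hK).shift n } }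
    have : (strictPerfectHo R).IsTriangulatedClosed₃ := by
      refine ⟨fun T hT h₁ h₂ => ?_⟩
      obtain ⟨f : T.obj₁.as ⟶ T.obj₂.as, hf⟩ :=
        (HomotopyCategory.quotient _ _).map_surjective T.mor₁
      refine ⟨_, (strictPerfectHo_quotient_iff _).2 (IsStrictPerfect.mappingCone
        ((strictPerfectHo_quotient_iff T.obj₁.as).1 h₁)
        ((strictPerfectHo_quotient_iff T.obj₂.as).1 h₂) f), 
        ⟨Triangle.π₃.mapIso (isoTriangleOfIso₁₂ T _ hT
          (HomotopyCategory.mappingCone_triangleh_distinguished f)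
          (Iso.refl _) (Iso.refl _) ?_)⟩⟩
      exact (Category.comp_id _).trans (hf.symm.trans (Category.id_comp _).symm)
    exact .of_isTriangulatedClosed₃

variable (R) in
/-- The homotopy category `K^b(proj R)` of bounded complexes of finitely generated projectives. -/
abbrev KbProj := (strictPerfectHo R).FullSubcategory

variable (R) in
/-- The functor `K^b(proj R) ⥤ D(R)`; it is fully faithful. -/
abbrev KbProj.toD : KbProj R ⥤ DMod R := (strictPerfectHo R).ι ⋙ DerivedCategory.Qh

lemma KbProj.map_bijective (K L : KbProj R) :
    Function.Bijective (fun f : K ⟶ L => (KbProj.toD R).map f) := by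
  obtain ⟨K, hK⟩ := K
  obtain ⟨K' : CochainComplex _ _, rfl⟩ := K.quotient_obj_surjective
  have := ((strictPerfectHo_quotient_iff _).1 hK).isKProjective
  exact (CochainComplex.IsKProjective.Qh_map_bijective K' L.obj).comp
    ((strictPerfectHo R).fullyFaithfulι.homEquiv.bijective)

instance : (KbProj.toD R).Full := ⟨fun f => (KbProj.map_bijective _ _).2 f⟩
instance : (KbProj.toD R).Faithful := ⟨fun h => (KbProj.map_bijective _ _).1 h⟩


lemma single_mem_of_projective (M : ModuleCat.{u} R) [Projective M] [Module.Finite R M] :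
    (KbProj.toD R).essImage ((DerivedCategory.singleFunctor _ 0).obj M) := by
  let K := (CochainComplex.singleFunctor (ModuleCat.{u} R) 0).obj M
  have hK : IsStrictPerfect R K := by
    refine ⟨⟨0, inferInstance⟩, ⟨0, inferInstance⟩, fun i => ?_⟩
    by_cases hi : i = 0
    · subst hi
      let e : K.X 0 ≅ M := HomologicalComplex.singleObjXSelf (ComplexShape.up ℤ) 0 M
      exact ⟨Projective.of_iso e.symm inferInstance, Module.Finite.equiv e.symm.toLinearEquiv⟩
    · have h : IsZero (K.X i) := HomologicalComplex.isZero_single_obj_X _ _ _ _ hi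
      have := ModuleCat.subsingleton_of_isZero h
      exact ⟨h.projective, inferInstance⟩
  exact ⟨⟨(HomotopyCategory.quotient _ _).obj K, (strictPerfectHo_quotient_iff _).2 hK⟩,
    ⟨(DerivedCategory.quotientCompQhIso _).app K ≪≫
      ((DerivedCategory.singleFunctorIsoCompQ _ 0).app M).symm⟩⟩

lemma single_mem_of_projectiveDimension [IsNoetherianRing R] (d : ℕ) :
    ∀ (M : ModuleCat.{u} R) [Module.Finite R M] [HasProjectiveDimensionLE M d],
    (KbProj.toD R).essImage ((DerivedCategory.singleFunctor _ 0).obj M) := by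
  induction d with
  | zero =>
    intro M _ hM
    have := (projective_iff_hasProjectiveDimensionLE_zero (X := M)).2 hM
    exact single_mem_of_projective M
  | succ d ih =>
    intro M _ hM
    obtain ⟨n, f, hf⟩ := Module.Finite.exists_fin' R M
    let F : ModuleCat.{u} R := ModuleCat.of R (ULift.{u} (Fin n) → R)
    let g : F ⟶ M := ModuleCat.ofHom (f ∘ₗ LinearMap.funLeft R R ULift.up)
    have hg : Function.Surjective g :=
      hf.comp (LinearMap.funLeft_surjective_of_injective R R _ ULift.up_injective)
    have : Epi g := (ModuleCat.epi_iff_surjective _).2 hg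
    have : Projective F := inferInstance
    have hS : (ShortComplex.mk (kernel.ι g) g (kernel.condition g)).ShortExact :=
      { exact := ShortComplex.exact_kernel g }
    have hfin : Module.Finite R (kernel g : ModuleCat.{u} R) :=
      Module.Finite.of_injective (kernel.ι g).hom ((ModuleCat.mono_iff_injective _).1 inferInstance)
    have hpd : HasProjectiveDimensionLE (kernel g) d := by
      exact hS.hasProjectiveDimensionLT_X₁ (d+1) inferInstance hM
    have h1 := ih (kernel g)
    have h2 := single_mem_of_projective F
    exact (KbProj.toD R).essImage.ext_of_isTriangulatedClosed₃ _ hS.singleTriangle_distinguished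
      h1 h2
lemma boundedFG_le_essImage [IsNoetherianRing R] [FinGlobalDim R] :
    boundedFG R ≤ (KbProj.toD R).essImage := by
  obtain ⟨d, hd⟩ := FinGlobalDim.exists_bound (R := R)
  have key0 : ∀ (a : ℤ) (X : DMod R), X.IsGE a → X.IsLE a → fgCohomology R X →
      (KbProj.toD R).essImage X := by
    intro a X h1 h2 hX
    obtain ⟨M, ⟨e⟩⟩ := X.exists_iso_singleFunctor_obj_of_isGE_of_isLE a
    let e' : X⟦a⟧ ≅ (DerivedCategory.singleFunctor _ 0).obj M :=
      (shiftFunctor _ a).mapIso e ≪≫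
        ((DerivedCategory.singleFunctors (ModuleCat.{u} R)).shiftIso a 0 a (add_zero a)).app M
    have hM : Module.Finite R M := by
      have : Module.Finite R ((DerivedCategory.homologyFunctor (ModuleCat.{u} R) 0).obj
          ((DerivedCategory.singleFunctor _ 0).obj M)) :=
        (fgCohomology R).prop_of_iso e' ((fgCohomology R).le_shift a _ hX) 0
      exact Module.Finite.equiv (((DerivedCategory.homologyFunctor _ 0).mapIso
        ((DerivedCategory.singleFunctorIsoCompQ _ 0).app M)) ≪≫
        (DerivedCategory.homologyFunctorFactors _ 0).app _ ≪≫
        (HomologicalComplex.homologyFunctorSingleIso (ModuleCat.{u} R) _ 0).app M).toLinearEquiv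
    have := hd M
    have h3 := single_mem_of_projectiveDimension d M
    rw [← (KbProj.toD R).essImage.prop_iff_of_iso e'] at h3
    have h4 := (KbProj.toD R).essImage.le_shift (-a) _ h3
    exact ((KbProj.toD R).essImage.prop_iff_of_iso
      ((shiftEquiv (DMod R) a).unitIso.app X)).2 h4
  have key : ∀ (n : ℕ) (a : ℤ) (X : DMod R), X.IsGE a → X.IsLE (a + n) → fgCohomology R X →
      (KbProj.toD R).essImage X := by
    intro n
    induction n with
    | zero =>
      intro a X h1 h2 hX
      exact key0 a X h1 (by simpa using h2) hX
    | succ n ih =>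
      intro a X h1 h2 hX
      obtain ⟨X', Y, hX', hY, f, g, h, hT⟩ :=
        DerivedCategory.TStructure.t.exists_triangle X a (a + 1) rfl
      replace hX' : X'.IsLE a := ⟨hX'⟩
      replace hY : Y.IsGE (a + 1) := ⟨hY⟩
      have ex1 (i : ℤ) := DerivedCategory.HomologySequence.exact₁ _ hT (i - 1) i (by lia)
      have ex3 (i : ℤ) := DerivedCategory.HomologySequence.exact₃ _ hT i (i + 1) (by lia)
      have fX' : fgCohomology R X' := by
        intro i
        by_cases hi : a < i
        · have := ModuleCat.subsingleton_of_isZero (X'.isZero_of_isLE a i hi)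
          infer_instance
        · have := ModuleCat.subsingleton_of_isZero (Y.isZero_of_isGE (a + 1) (i - 1) (by lia))
          exact finite_of_exact (ex1 i)
            (@Module.Finite.of_finite _ _ _ _ _ (@Finite.of_subsingleton _ this)) (hX i)
      have fY : fgCohomology R Y := fun i => finite_of_exact (ex3 i) (hX i) (fX' (i + 1))
      have gX' : X'.IsGE a := by
        rw [DerivedCategory.isGE_iff]
        intro i hi
        exact (ex1 i).isZero_X₂ ((Y.isZero_of_isGE (a + 1) (i - 1) (by lia)).eq_of_src _ _)
          ((X.isZero_of_isGE a i hi).eq_of_tgt _ _)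
      have lY : Y.IsLE (a + 1 + n) := by
        rw [DerivedCategory.isLE_iff]
        intro i hi
        exact (ex3 i).isZero_X₂
          ((X.isZero_of_isLE (a + (n + 1 : ℕ)) i (by push_cast; lia)).eq_of_src _ _)
          ((X'.isZero_of_isLE a (i + 1) (by lia)).eq_of_tgt _ _)
      exact (KbProj.toD R).essImage.ext_of_isTriangulatedClosed₂ _ hT
        (key0 a X' gX' hX' fX')
        (ih (a + 1) Y hY lY fY)
  rintro X ⟨⟨⟨a, ha⟩, ⟨b, hb⟩⟩, hX⟩
  refine key (b - a).toNat a X ha ?_ hX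
  exact DerivedCategory.TStructure.t.isLE_of_le X b _ (by lia)

section triangulated
variable {C : Type*} [Category* C]

/-- The powers of an endofunctor. -/
def iter (F : C ⥤ C) : ℕ → (C ⥤ C)
  | 0 => 𝟭 C
  | n + 1 => iter F n ⋙ F

variable [Preadditive C] [HasZeroObject C] [HasShift C ℤ] [∀ n : ℤ, (shiftFunctor C n).Additive]
  [Pretriangulated C]

/-- `HasTower E X [n₁, …, nₘ]`: there is a tower of distinguished triangles
`Tᵢ₋₁ ⟶ Tᵢ ⟶ E⟦nᵢ⟧ ⟶ Tᵢ₋₁⟦1⟧` with `T₀ = 0` and `Tₘ = X` (the shifts being listed from the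
last one to the first one). -/
inductive HasTower (E : C) : C → List ℤ → Prop
  | zero (X : C) (hX : IsZero X) : HasTower E X []
  | step (X Y : C) (n : ℤ) (l : List ℤ) (f : X ⟶ Y) (g : Y ⟶ E⟦n⟧) (h : E⟦n⟧ ⟶ X⟦(1 : ℤ)⟧)
      (hT : Triangle.mk f g h ∈ distTriang C) (hX : HasTower E X l) : HasTower E Y (n :: l)

/-- The complexity `δ_t(E₁, E₂)`, with value `∞` if there is no tower. -/
def complexity (t : ℝ) (E₁ E₂ : C) : ENNReal :=
  ⨅ (l : List ℤ) (_ : ∃ E' : C, HasTower E₁ (E₂ ⊞ E') l),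
    (l.map fun n : ℤ => ENNReal.ofReal (Real.exp (n * t))).sum

/-- `G` is a split (classical) generator. -/
def IsGenerator (G : C) : Prop :=
  (ObjectProperty.singleton G).IsClassicalTriangulatedGenerator

/-- The sequence whose limit is the entropy. -/
def entropySeq (t : ℝ) (G : C) (F : C ⥤ C) (n : ℕ) : EReal :=
  ENNReal.log (complexity t G ((iter F n).obj G)) / (n : EReal)

/-- The entropy `h_t(F)`, computed with `G`. -/
def entropy (t : ℝ) (G : C) (F : C ⥤ C) : EReal :=
  Filter.limsup (entropySeq t G F) Filter.atTop

/-- The polynomial entropy `h_t^pol(F)`, computed with `G`. -/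
def polyEntropy (t : ℝ) (G : C) (F : C ⥤ C) : EReal :=
  Filter.limsup (fun n : ℕ =>
    (ENNReal.log (complexity t G ((iter F n).obj G)) - (n : EReal) * entropy t G F) /
      ((Real.log n : ℝ) : EReal)) Filter.atTop

/-- The degrees `i` with `Hom(G, F^n(G')[i]) ≠ 0`, as extended reals. -/
def homDegrees (G G' : C) (F : C ⥤ C) (n : ℕ) : Set EReal :=
  (fun i : ℤ => ((i : ℝ) : EReal)) '' {i : ℤ | ∃ f : G ⟶ ((iter F n).obj G')⟦i⟧, f ≠ 0}

/-- The upper Serre dimension, computed with `G` and `G'`. -/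
def upperSerreDim (G G' : C) (S : C ⥤ C) : EReal :=
  Filter.limsup (fun n : ℕ => -sInf (homDegrees G G' S n) / (n : EReal)) Filter.atTop

/-- The lower Serre dimension, computed with `G` and `G'`. -/
def lowerSerreDim (G G' : C) (S : C ⥤ C) : EReal :=
  Filter.liminf (fun n : ℕ => -sSup (homDegrees G G' S n) / (n : EReal)) Filter.atTop

end triangulated

end general

section dims
variable (k : Type u) [Field k] (A : Type u) [Ring A] [Algebra k A]
open scoped ModuleCat TensorProduct
open MulOpposite

/-- Complexes of right `A`-modules (modules over `Aᵐᵒᵖ`) whose total cohomology is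
finite-dimensional over `k`. -/
def boundedFD : ObjectProperty (DMod Aᵐᵒᵖ) :=
  (DerivedCategory.TStructure.t (C := ModuleCat.{u} Aᵐᵒᵖ)).bounded ⊓
    fun X => ∀ i : ℤ, Module.Finite k
      ((DerivedCategory.homologyFunctor (ModuleCat.{u} Aᵐᵒᵖ) i).obj X)

section
variable {k A}
lemma finite_iff_finite_base [Module.Finite k A] (M : ModuleCat.{u} Aᵐᵒᵖ) :
    Module.Finite k M ↔ Module.Finite Aᵐᵒᵖ M :=
  ⟨fun _ => Module.Finite.of_restrictScalars_finite k Aᵐᵒᵖ M,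
    fun _ => Module.Finite.trans Aᵐᵒᵖ M⟩

lemma isNoetherianRing_op (k : Type u) [Field k] [Algebra k A] [Module.Finite k A] :
    IsNoetherianRing Aᵐᵒᵖ := IsNoetherianRing.of_finite k Aᵐᵒᵖ

lemma boundedFD_eq [Module.Finite k A] : boundedFD k A = boundedFG Aᵐᵒᵖ := by
  ext X
  exact and_congr_right fun _ => forall_congr' fun i => finite_iff_finite_base _

instance [Module.Finite k A] : (boundedFD k A).IsTriangulated := by
  rw [boundedFD_eq]
  have := isNoetherianRing_op (A := A) k
  infer_instance

instance [Module.Finite k A] : (boundedFD k A).IsClosedUnderIsomorphisms := by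
  rw [boundedFD_eq]
  infer_instance

end

/-- The bounded derived category `D^b(A)` of finite-dimensional right `A`-modules, as the full
subcategory of the derived category of all right `A`-modules on the complexes with
finite-dimensional total cohomology. -/
abbrev Db := (boundedFD k A).FullSubcategory

lemma finite_homology {R : Type u} [Ring R] [IsNoetherianRing R]
    (K : CochainComplex (ModuleCat.{u} R) ℤ) (i : ℤ) (h : Module.Finite R (K.X i)) :
    Module.Finite R (K.homology i) := by
  have h1 : Module.Finite R (K.cycles i) :=
    Module.Finite.of_injective (K.iCycles i).hom
      ((ModuleCat.mono_iff_injective _).1 inferInstance)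
  exact Module.Finite.of_surjective (K.homologyπ i).hom
      ((ModuleCat.epi_iff_surjective _).1 inferInstance)

/-- A functor preserving finitely generated modules, applied termwise to a bounded complex of
finitely generated projectives. -/
def termwise [Module.Finite k A] (N : ModuleCat.{u} Aᵐᵒᵖ ⥤ ModuleCat.{u} Aᵐᵒᵖ) [N.Additive]
    (hN : ∀ M : ModuleCat.{u} Aᵐᵒᵖ, Module.Finite Aᵐᵒᵖ M → Module.Finite Aᵐᵒᵖ (N.obj M)) :
    KbProj Aᵐᵒᵖ ⥤ Db k A :=
  (boundedFD k A).lift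
    ((strictPerfectHo Aᵐᵒᵖ).ι ⋙ N.mapHomotopyCategory (ComplexShape.up ℤ) ⋙ DerivedCategory.Qh) (by
      rintro ⟨K, hK⟩
      obtain ⟨K : CochainComplex _ _, rfl⟩ := K.quotient_obj_surjective
      obtain ⟨⟨a, _⟩, ⟨b, _⟩, h⟩ := (strictPerfectHo_quotient_iff _).1 hK
      have := isNoetherianRing_op (A := A) k
      let L : CochainComplex (ModuleCat.{u} Aᵐᵒᵖ) ℤ :=
        (N.mapHomologicalComplex (ComplexShape.up ℤ)).obj K
      have hL : boundedFG Aᵐᵒᵖ (DerivedCategory.Q.obj L) := by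
        refine ⟨⟨⟨a, ?_⟩, ⟨b, ?_⟩⟩, fun i => ?_⟩
        · have : L.IsStrictlyGE a := by
            rw [CochainComplex.isStrictlyGE_iff]
            intro i hi
            exact N.map_isZero (K.isZero_of_isStrictlyGE a i hi)
          infer_instance
        · have : L.IsStrictlyLE b := by
            rw [CochainComplex.isStrictlyLE_iff]
            intro i hi
            exact N.map_isZero (K.isZero_of_isStrictlyLE b i hi)
          infer_instance
        · have : Module.Finite Aᵐᵒᵖ ((HomologicalComplex.homologyFunctor (ModuleCat.{u} Aᵐᵒᵖ)
            (ComplexShape.up ℤ) i).obj L) :=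
            finite_homology L i (hN _ (h i).2)
          exact Module.Finite.equiv
            ((DerivedCategory.homologyFunctorFactors _ i).app L).toLinearEquiv.symm
      rw [boundedFD_eq]
      exact (boundedFG Aᵐᵒᵖ).prop_of_iso
        ((DerivedCategory.quotientCompQhIso _).symm.app L) hL)

/-- The functor `K^b(proj A) ⥤ D^b(A)`. It is an equivalence if `A` has finite global dimension. -/
def KbProj.toDb [Module.Finite k A] : KbProj Aᵐᵒᵖ ⥤ Db k A :=
  (boundedFD k A).lift (KbProj.toD Aᵐᵒᵖ) (fun K => by
    have h := (termwise k A (𝟭 _) (fun _ h => h)).obj K |>.property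
    obtain ⟨K, hK⟩ := K
    obtain ⟨K : CochainComplex _ _, rfl⟩ := K.quotient_obj_surjective
    exact h)

instance [Module.Finite k A] [FinGlobalDim Aᵐᵒᵖ] : (KbProj.toDb k A).IsEquivalence where
  faithful := inferInstanceAs ((boundedFD k A).lift _ _).Faithful
  full := inferInstanceAs ((boundedFD k A).lift _ _).Full
  essSurj := ⟨fun X => by
    have := isNoetherianRing_op (A := A) k
    have h : boundedFG Aᵐᵒᵖ X.obj := boundedFD_eq.le _ X.property
    obtain ⟨K, ⟨e⟩⟩ := boundedFG_le_essImage _ h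
    exact ⟨K, ⟨(boundedFD k A).fullyFaithfulι.preimageIso e⟩⟩⟩

/-- The total left derived functor on `D^b(A)` of an additive endofunctor `N` of the category of
right `A`-modules: replace a complex by a bounded complex of finitely generated projectives and
apply `N` in each degree. -/
def leftDerivedDb [Module.Finite k A] [FinGlobalDim Aᵐᵒᵖ]
    (N : ModuleCat.{u} Aᵐᵒᵖ ⥤ ModuleCat.{u} Aᵐᵒᵖ) [N.Additive]
    (hN : ∀ M : ModuleCat.{u} Aᵐᵒᵖ, Module.Finite Aᵐᵒᵖ M → Module.Finite Aᵐᵒᵖ (N.obj M)) :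
    Db k A ⥤ Db k A := (KbProj.toDb k A).inv ⋙ termwise k A N hN

/-! ### modules from actions -/

section actions
variable {k}
/-- The left `W`-module given by an action of the `k`-algebra `W` on a `k`-module. -/
def modOfAct {W : Type u} [Ring W] [Algebra k W] {V : Type u} [AddCommGroup V] [Module k V]
    (ρ : W →ₐ[k] Module.End k V) : ModuleCat.{u} W :=
  @ModuleCat.of W _ V _ (Module.compHom V ρ.toRingHom)

/-- A `k`-linear map compatible with two actions, as a homomorphism of modules. -/
def homOfAct {W : Type u} [Ring W] [Algebra k W] {V V' : Type u} [AddCommGroup V] [Module k V]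
    [AddCommGroup V'] [Module k V'] {ρ : W →ₐ[k] Module.End k V} {ρ' : W →ₐ[k] Module.End k V'}
    (f : V →ₗ[k] V') (hf : ∀ w v, f (ρ w v) = ρ' w (f v)) : modOfAct ρ ⟶ modOfAct ρ' :=
  letI := Module.compHom V ρ.toRingHom
  letI := Module.compHom V' ρ'.toRingHom
  ModuleCat.ofHom (X := V) (Y := V') { f with map_smul' := hf }

lemma homOfAct_id {W : Type u} [Ring W] [Algebra k W] {V : Type u} [AddCommGroup V]
    [Module k V] (ρ : W →ₐ[k] Module.End k V) :
    homOfAct (ρ := ρ) (ρ' := ρ) LinearMap.id (fun _ _ => rfl) = 𝟙 _ := rfl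

lemma homOfAct_congr {W : Type u} [Ring W] [Algebra k W] {V V' : Type u} [AddCommGroup V]
    [Module k V] [AddCommGroup V'] [Module k V'] {ρ : W →ₐ[k] Module.End k V}
    {ρ' : W →ₐ[k] Module.End k V'} {f g : V →ₗ[k] V'} (hf : ∀ w v, f (ρ w v) = ρ' w (f v))
    (hg : ∀ w v, g (ρ w v) = ρ' w (g v)) (h : f = g) :
    homOfAct f hf = homOfAct g hg := by
  subst h
  rfl

lemma homOfAct_comp {W : Type u} [Ring W] [Algebra k W] {V V' V'' : Type u} [AddCommGroup V]
    [Module k V] [AddCommGroup V'] [Module k V'] [AddCommGroup V''] [Module k V'']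
    {ρ : W →ₐ[k] Module.End k V} {ρ' : W →ₐ[k] Module.End k V'} {ρ'' : W →ₐ[k] Module.End k V''}
    (f : V →ₗ[k] V') (g : V' →ₗ[k] V'') (hf : ∀ w v, f (ρ w v) = ρ' w (f v))
    (hg : ∀ w v, g (ρ' w v) = ρ'' w (g v)) :
    homOfAct f hf ≫ homOfAct g hg =
      homOfAct (g ∘ₗ f) (fun w v => (congrArg g (hf w v)).trans (hg w (f v))) := rfl

lemma homOfAct_add {W : Type u} [Ring W] [Algebra k W] {V V' : Type u} [AddCommGroup V]
    [Module k V] [AddCommGroup V'] [Module k V'] {ρ : W →ₐ[k] Module.End k V}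
    {ρ' : W →ₐ[k] Module.End k V'} (f g : V →ₗ[k] V') (hf : ∀ w v, f (ρ w v) = ρ' w (f v))
    (hg : ∀ w v, g (ρ w v) = ρ' w (g v)) :
    homOfAct f hf + homOfAct g hg = homOfAct (f + g) (fun w v => by simp [hf, hg]) := rfl

lemma modOfAct_finite {W : Type u} [Ring W] [Algebra k W] {V : Type u} [AddCommGroup V]
    [Module k V] (ρ : W →ₐ[k] Module.End k V) [hV : Module.Finite k V] :
    Module.Finite W (modOfAct ρ) := by
  let := Module.compHom V ρ.toRingHom
  have : IsScalarTower k W V := ⟨fun c w v => by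
    change ρ (c • w) v = c • ρ w v
    simp⟩
  exact (Module.Finite.of_restrictScalars_finite k W V : Module.Finite W V)

/-- The action of a `k`-algebra on its module. -/
def actOf {W : Type u} [Ring W] [Algebra k W] (M : ModuleCat.{u} W) : W →ₐ[k] Module.End k M :=
  Algebra.lsmul k k M

/-- The contragredient action on the dual space. -/
def dualAct {W : Type u} [Ring W] [Algebra k W] {V : Type u} [AddCommGroup V] [Module k V]
    (ρ : W →ₐ[k] Module.End k V) : Wᵐᵒᵖ →ₐ[k] Module.End k (Module.Dual k V) where
  toFun w := Module.Dual.transpose (ρ w.unop)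
  map_one' := by ext; simp [Module.Dual.transpose_apply]
  map_mul' a b := by ext; simp [Module.Dual.transpose_apply]
  map_zero' := by ext; simp
  map_add' a b := by ext; simp
  commutes' c := by ext; simp [Module.Dual.transpose_apply, Module.algebraMap_end_apply]

@[simp] lemma dualAct_apply {W : Type u} [Ring W] [Algebra k W] {V : Type u} [AddCommGroup V]
    [Module k V] (ρ : W →ₐ[k] Module.End k V) (w : Wᵐᵒᵖ) (ξ : Module.Dual k V) (v : V) :
    dualAct ρ w ξ v = ξ (ρ w.unop v) := rfl

end actions

/-- The enveloping algebra `A^e`. -/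
abbrev Env := A ⊗[k] Aᵐᵒᵖ
/-- The category of `A`-bimodules (with `k` acting centrally), as modules over `A^e`, where
`a ⊗ b` acts by `m ↦ a m b`. -/
abbrev BimodCat := ModuleCat.{u} (Env k A)

variable {k A}
/-- The left action of `A` on a bimodule. -/
def leftAct (M : BimodCat k A) : A →ₐ[k] Module.End k M :=
  (actOf M).comp Algebra.TensorProduct.includeLeft

/-- The right action of `A` on a bimodule. -/
def rightAct (M : BimodCat k A) : Aᵐᵒᵖ →ₐ[k] Module.End k M :=
  (actOf M).comp Algebra.TensorProduct.includeRight

lemma leftAct_rightAct_comm (M : BimodCat k A) (a : A) (b : Aᵐᵒᵖ) :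
    Commute (leftAct M a) (rightAct M b) := by
  unfold leftAct rightAct
  simp only [AlgHom.comp_apply]
  refine Commute.map (f := actOf M) ?_
  simp [Commute, SemiconjBy]

variable (k A)
/-- The bimodule `A`. -/
def regularBimod : BimodCat k A :=
  modOfAct (Algebra.TensorProduct.lift (Algebra.lsmul k k A : A →ₐ[k] Module.End k A)
    (Algebra.lsmul k k A : Aᵐᵒᵖ →ₐ[k] Module.End k A)
    (fun a b => by ext x; simp [mul_assoc]))

/-- The left action on `A^* = Hom_k(A, k)`, `(a ξ)(x) = ξ(x a)`. -/
def dualLeft : A →ₐ[k] Module.End k (Module.Dual k A) :=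
    ((dualAct (Algebra.lsmul k k A : Aᵐᵒᵖ →ₐ[k] Module.End k A)).comp
      (AlgEquiv.opOp k A).toAlgHom)

/-- The right action on `A^*`, `(ξ a)(x) = ξ(a x)`. -/
def dualRight : Aᵐᵒᵖ →ₐ[k] Module.End k (Module.Dual k A) :=
    (dualAct (Algebra.lsmul k k A : A →ₐ[k] Module.End k A))

lemma dualLeft_apply (a : A) (ξ : Module.Dual k A) (x : A) :
  dualLeft k A a ξ x = ξ (x * a) := rfl
lemma dualRight_apply (a : A) (ξ : Module.Dual k A) (x : A) :
  dualRight k A (op a) ξ x = ξ (a * x) := rfl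

/-- The bimodule `A^*`. -/
def dualBimod : BimodCat k A :=
  modOfAct (Algebra.TensorProduct.lift (dualLeft k A) (dualRight k A)
    (fun a b => by ext ξ x; simp [dualLeft, dualRight, mul_assoc]))

/-! ### the Nakayama functor on modules -/

section nak
variable {A}

/-- The right action of `A` on `Hom_A(M, A)^*`, coming from the left action on the values in
`A`. -/
def nakAct (M : ModuleCat.{u} Aᵐᵒᵖ) :
    Aᵐᵒᵖ →ₐ[k] Module.End k (Module.Dual k (M →ₗ[Aᵐᵒᵖ] A)) :=
  dualAct (Algebra.lsmul k k (M →ₗ[Aᵐᵒᵖ] A) : A →ₐ[k] Module.End k (M →ₗ[Aᵐᵒᵖ] A))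

variable (A)
/-- The functor `M ↦ Hom_A(M, A)^*` on right `A`-modules. -/
def nakayama : ModuleCat.{u} Aᵐᵒᵖ ⥤ ModuleCat.{u} Aᵐᵒᵖ where
  obj M := modOfAct (nakAct k M)
  map {M M'} f := homOfAct
    (Module.Dual.transpose
      ({ toFun := fun g => g ∘ₗ f.hom
         map_add' := fun _ _ => rfl
         map_smul' := fun _ _ => rfl } : (M' →ₗ[Aᵐᵒᵖ] A) →ₗ[k] (M →ₗ[Aᵐᵒᵖ] A)))
    (fun _ _ => rfl)
  map_id _ := rfl
  map_comp _ _ := rfl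

instance : (nakayama k A).Additive where
  map_add {M M' f g} := by
    refine Eq.trans ?_ (homOfAct_add _ _ _ _).symm
    refine homOfAct_congr _ _ ?_
    refine LinearMap.ext fun ξ => LinearMap.ext fun h => ?_
    exact (congrArg (fun z => (ξ : Module.Dual k (M →ₗ[Aᵐᵒᵖ] A)) z)
      (show h ∘ₗ (f + g).hom = h ∘ₗ f.hom + h ∘ₗ g.hom by ext; simp)).trans (map_add _ _ _)

lemma nakayama_finite [Module.Finite k A] (M : ModuleCat.{u} Aᵐᵒᵖ)
    (h : Module.Finite Aᵐᵒᵖ M) : Module.Finite Aᵐᵒᵖ ((nakayama k A).obj M) := by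
  have : Module.Finite k M := (finite_iff_finite_base M).2 h
  let i : (M →ₗ[Aᵐᵒᵖ] A) →ₗ[k] (M →ₗ[k] A) :=
    { toFun := fun g => g.restrictScalars k
      map_add' := fun _ _ => rfl
      map_smul' := fun _ _ => rfl }
  have : Module.Finite k (M →ₗ[Aᵐᵒᵖ] A) :=
    Module.Finite.of_injective i (LinearMap.restrictScalars_injective k)
  exact modOfAct_finite _
end nak

section tensor
variable {k A}
variable {V V' V'' W W' W'' : Type u} [AddCommGroup V] [Module k V] [AddCommGroup V'] [Module k V']
  [AddCommGroup V''] [Module k V''] [AddCommGroup W''] [Module k W'']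
  [AddCommGroup W] [Module k W] [AddCommGroup W'] [Module k W']

/-- The relations `v a ⊗ w = v ⊗ a w`. -/
def balancedRel (r : Aᵐᵒᵖ →ₐ[k] Module.End k V) (l : A →ₐ[k] Module.End k W) :
    Submodule k (V ⊗[k] W) :=
  Submodule.span k {z | ∃ (v : V) (a : A) (w : W), z = r (op a) v ⊗ₜ w - v ⊗ₜ l a w}

/-- The tensor product over `A` of a right `A`-module and a left `A`-module. -/
abbrev BalTensor (r : Aᵐᵒᵖ →ₐ[k] Module.End k V) (l : A →ₐ[k] Module.End k W) : Type u :=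
  (V ⊗[k] W) ⧸ balancedRel r l

/-- Pure tensors. -/
def BalTensor.tmul (r : Aᵐᵒᵖ →ₐ[k] Module.End k V) (l : A →ₐ[k] Module.End k W) (v : V) (w : W) :
    BalTensor r l := Submodule.Quotient.mk (v ⊗ₜ w)

lemma BalTensor.hom_ext {r : Aᵐᵒᵖ →ₐ[k] Module.End k V} {l : A →ₐ[k] Module.End k W}
    {f g : BalTensor r l →ₗ[k] V'}
    (h : ∀ v w, f (BalTensor.tmul r l v w) = g (BalTensor.tmul r l v w)) : f = g := by
  apply Submodule.linearMap_qext
  apply TensorProduct.ext'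
  exact h

/-- The tensor product of two homomorphisms. -/
def BalTensor.map {r : Aᵐᵒᵖ →ₐ[k] Module.End k V} {l : A →ₐ[k] Module.End k W}
    {r' : Aᵐᵒᵖ →ₐ[k] Module.End k V'} {l' : A →ₐ[k] Module.End k W'}
    (f : V →ₗ[k] V') (g : W →ₗ[k] W') (hf : ∀ a v, f (r a v) = r' a (f v))
    (hg : ∀ a w, g (l a w) = l' a (g w)) : BalTensor r l →ₗ[k] BalTensor r' l' :=
  Submodule.mapQ _ _ (TensorProduct.map f g) (by
    unfold balancedRel
    rw [Submodule.span_le]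
    rintro _ ⟨v, a, w, rfl⟩
    refine Submodule.subset_span ⟨f v, a, g w, ?_⟩
    simp [hf, hg])

@[simp] lemma BalTensor.map_tmul {r : Aᵐᵒᵖ →ₐ[k] Module.End k V} {l : A →ₐ[k] Module.End k W}
    {r' : Aᵐᵒᵖ →ₐ[k] Module.End k V'} {l' : A →ₐ[k] Module.End k W'}
    (f : V →ₗ[k] V') (g : W →ₗ[k] W') (hf : ∀ a v, f (r a v) = r' a (f v))
    (hg : ∀ a w, g (l a w) = l' a (g w)) (v : V) (w : W) :
    BalTensor.map f g hf hg (BalTensor.tmul r l v w) = BalTensor.tmul r' l' (f v) (g w) := rfl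

lemma BalTensor.add_tmul (r : Aᵐᵒᵖ →ₐ[k] Module.End k V) (l : A →ₐ[k] Module.End k W) (v v' : V)
    (w : W) : tmul r l (v + v') w = tmul r l v w + tmul r l v' w := by
  simp [tmul, TensorProduct.add_tmul]
lemma BalTensor.tmul_add (r : Aᵐᵒᵖ →ₐ[k] Module.End k V) (l : A →ₐ[k] Module.End k W) (v : V)
    (w w' : W) : tmul r l v (w + w') = tmul r l v w + tmul r l v w' := by
  simp [tmul, TensorProduct.tmul_add]
lemma BalTensor.zero_tmul (r : Aᵐᵒᵖ →ₐ[k] Module.End k V) (l : A →ₐ[k] Module.End k W)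
    (w : W) : tmul r l 0 w = 0 := by
  simp [tmul]
lemma BalTensor.tmul_zero (r : Aᵐᵒᵖ →ₐ[k] Module.End k V) (l : A →ₐ[k] Module.End k W)
    (v : V) : tmul r l v 0 = 0 := by
  simp [tmul]
lemma BalTensor.smul_tmul (r : Aᵐᵒᵖ →ₐ[k] Module.End k V) (l : A →ₐ[k] Module.End k W) (c : k)
    (v : V) (w : W) : tmul r l (c • v) w = c • tmul r l v w := rfl
lemma BalTensor.tmul_smul (r : Aᵐᵒᵖ →ₐ[k] Module.End k V) (l : A →ₐ[k] Module.End k W) (c : k)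
    (v : V) (w : W) : tmul r l v (c • w) = c • tmul r l v w := by
  unfold tmul
  rw [TensorProduct.tmul_smul]
  rfl

lemma BalTensor.map_comp {r : Aᵐᵒᵖ →ₐ[k] Module.End k V} {l : A →ₐ[k] Module.End k W}
    {r' : Aᵐᵒᵖ →ₐ[k] Module.End k V'} {l' : A →ₐ[k] Module.End k W'}
    {r'' : Aᵐᵒᵖ →ₐ[k] Module.End k V''} {l'' : A →ₐ[k] Module.End k W''}
    (f : V →ₗ[k] V') (g : W →ₗ[k] W') (hf : ∀ a v, f (r a v) = r' a (f v))
    (hg : ∀ a w, g (l a w) = l' a (g w))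
    (f' : V' →ₗ[k] V'') (g' : W' →ₗ[k] W'') (hf' : ∀ a v, f' (r' a v) = r'' a (f' v))
    (hg' : ∀ a w, g' (l' a w) = l'' a (g' w)) :
    BalTensor.map f' g' hf' hg' ∘ₗ BalTensor.map f g hf hg =
      BalTensor.map (f' ∘ₗ f) (g' ∘ₗ g) (fun a v => (congrArg f' (hf a v)).trans (hf' a (f v)))
        (fun a v => (congrArg g' (hg a v)).trans (hg' a (g v))) :=
  BalTensor.hom_ext fun _ _ => rfl

lemma BalTensor.map_id (r : Aᵐᵒᵖ →ₐ[k] Module.End k V) (l : A →ₐ[k] Module.End k W) :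
    BalTensor.map (r := r) (l := l) LinearMap.id LinearMap.id (fun _ _ => rfl) (fun _ _ => rfl) =
      LinearMap.id :=
  BalTensor.hom_ext fun _ _ => rfl

lemma BalTensor.map_congr {r : Aᵐᵒᵖ →ₐ[k] Module.End k V} {l : A →ₐ[k] Module.End k W}
    {r' : Aᵐᵒᵖ →ₐ[k] Module.End k V'} {l' : A →ₐ[k] Module.End k W'}
    {f f' : V →ₗ[k] V'} {g g' : W →ₗ[k] W'} (hf : ∀ a v, f (r a v) = r' a (f v))
    (hg : ∀ a w, g (l a w) = l' a (g w)) (hf' : ∀ a v, f' (r a v) = r' a (f' v))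
    (hg' : ∀ a w, g' (l a w) = l' a (g' w)) (h : f = f') (h' : g = g') :
    BalTensor.map f g hf hg = BalTensor.map f' g' hf' hg' := by
  subst h h'
  rfl

lemma BalTensor.map_add_left {r : Aᵐᵒᵖ →ₐ[k] Module.End k V} {l : A →ₐ[k] Module.End k W}
    {r' : Aᵐᵒᵖ →ₐ[k] Module.End k V'} {l' : A →ₐ[k] Module.End k W'}
    (f f' : V →ₗ[k] V') (g : W →ₗ[k] W') (hf : ∀ a v, f (r a v) = r' a (f v))
    (hf' : ∀ a v, f' (r a v) = r' a (f' v)) (hg : ∀ a w, g (l a w) = l' a (g w)) :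
    BalTensor.map f g hf hg + BalTensor.map f' g hf' hg =
      BalTensor.map (f + f') g (fun a v => by simp [hf, hf']) hg :=
  BalTensor.hom_ext fun v w => (BalTensor.add_tmul _ _ (f v) (f' v) (g w)).symm

lemma BalTensor.map_add_right {r : Aᵐᵒᵖ →ₐ[k] Module.End k V} {l : A →ₐ[k] Module.End k W}
    {r' : Aᵐᵒᵖ →ₐ[k] Module.End k V'} {l' : A →ₐ[k] Module.End k W'}
    (f : V →ₗ[k] V') (g g' : W →ₗ[k] W') (hf : ∀ a v, f (r a v) = r' a (f v))
    (hg : ∀ a w, g (l a w) = l' a (g w)) (hg' : ∀ a w, g' (l a w) = l' a (g' w)) :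
    BalTensor.map f g hf hg + BalTensor.map f g' hf hg' =
      BalTensor.map f (g + g') hf (fun a v => by simp [hg, hg']) :=
  BalTensor.hom_ext fun v w => (BalTensor.tmul_add _ _ (f v) (g w) (g' w)).symm

/-- The action on `V ⊗_A W` induced by an action on `V` commuting with that of `A`. -/
def BalTensor.leftFactorAct (r : Aᵐᵒᵖ →ₐ[k] Module.End k V) (l : A →ₐ[k] Module.End k W)
    {B : Type u} [Ring B] [Algebra k B] (ρ : B →ₐ[k] Module.End k V)
    (h : ∀ b a, Commute (ρ b) (r a)) : B →ₐ[k] Module.End k (BalTensor r l) where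
  toFun b := BalTensor.map (ρ b) LinearMap.id (fun a v => LinearMap.congr_fun (h b a) v)
    (fun _ _ => rfl)
  map_one' := BalTensor.hom_ext fun v w => by simp
  map_mul' a b := BalTensor.hom_ext fun v w => by simp
  map_zero' := BalTensor.hom_ext fun v w => by simp [BalTensor.zero_tmul]
  map_add' a b := BalTensor.hom_ext fun v w => by simp [BalTensor.add_tmul]
  commutes' c := BalTensor.hom_ext fun v w => by
    simp [BalTensor.smul_tmul, Module.algebraMap_end_apply]

/-- The action on `V ⊗_A W` induced by an action on `W` commuting with that of `A`. -/
def BalTensor.rightFactorAct (r : Aᵐᵒᵖ →ₐ[k] Module.End k V) (l : A →ₐ[k] Module.End k W)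
    {B : Type u} [Ring B] [Algebra k B] (ρ : B →ₐ[k] Module.End k W)
    (h : ∀ b a, Commute (ρ b) (l a)) : B →ₐ[k] Module.End k (BalTensor r l) where
  toFun b := BalTensor.map LinearMap.id (ρ b) (fun _ _ => rfl)
    (fun a v => LinearMap.congr_fun (h b a) v)
  map_one' := BalTensor.hom_ext fun v w => by simp
  map_mul' a b := BalTensor.hom_ext fun v w => by simp
  map_zero' := BalTensor.hom_ext fun v w => by simp [BalTensor.tmul_zero]
  map_add' a b := BalTensor.hom_ext fun v w => by simp [BalTensor.tmul_add]
  commutes' c := BalTensor.hom_ext fun v w => by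
    simp [BalTensor.tmul_smul, Module.algebraMap_end_apply]

lemma BalTensor.map_rightFactorAct {r : Aᵐᵒᵖ →ₐ[k] Module.End k V} {l : A →ₐ[k] Module.End k W}
    {r' : Aᵐᵒᵖ →ₐ[k] Module.End k V'} {l' : A →ₐ[k] Module.End k W'}
    (f : V →ₗ[k] V') (g : W →ₗ[k] W') (hf : ∀ a v, f (r a v) = r' a (f v))
    (hg : ∀ a w, g (l a w) = l' a (g w)) {B : Type u} [Ring B] [Algebra k B]
    (ρ : B →ₐ[k] Module.End k W) (ρ' : B →ₐ[k] Module.End k W')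
    (h : ∀ b a, Commute (ρ b) (l a)) (h' : ∀ b a, Commute (ρ' b) (l' a))
    (hρ : ∀ b w, g (ρ b w) = ρ' b (g w)) (b : B) (x : BalTensor r l) :
    BalTensor.map f g hf hg (BalTensor.rightFactorAct r l ρ h b x) =
      BalTensor.rightFactorAct r' l' ρ' h' b (BalTensor.map f g hf hg x) := by
  change (BalTensor.map f g hf hg ∘ₗ BalTensor.rightFactorAct r l ρ h b) x =
    (BalTensor.rightFactorAct r' l' ρ' h' b ∘ₗ BalTensor.map f g hf hg) x
  congr 1
  refine BalTensor.hom_ext fun v w => ?_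
  exact congrArg (BalTensor.tmul r' l' (f v)) (hρ b w)

lemma BalTensor.map_leftFactorAct {r : Aᵐᵒᵖ →ₐ[k] Module.End k V} {l : A →ₐ[k] Module.End k W}
    {r' : Aᵐᵒᵖ →ₐ[k] Module.End k V'} {l' : A →ₐ[k] Module.End k W'}
    (f : V →ₗ[k] V') (g : W →ₗ[k] W') (hf : ∀ a v, f (r a v) = r' a (f v))
    (hg : ∀ a w, g (l a w) = l' a (g w)) {B : Type u} [Ring B] [Algebra k B]
    (ρ : B →ₐ[k] Module.End k V) (ρ' : B →ₐ[k] Module.End k V')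
    (h : ∀ b a, Commute (ρ b) (r a)) (h' : ∀ b a, Commute (ρ' b) (r' a))
    (hρ : ∀ b v, f (ρ b v) = ρ' b (f v)) (b : B) (x : BalTensor r l) :
    BalTensor.map f g hf hg (BalTensor.leftFactorAct r l ρ h b x) =
      BalTensor.leftFactorAct r' l' ρ' h' b (BalTensor.map f g hf hg x) := by
  change (BalTensor.map f g hf hg ∘ₗ BalTensor.leftFactorAct r l ρ h b) x =
    (BalTensor.leftFactorAct r' l' ρ' h' b ∘ₗ BalTensor.map f g hf hg) x
  congr 1
  refine BalTensor.hom_ext fun v w => ?_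
  exact congrArg (fun z => BalTensor.tmul r' l' z (g w)) (hρ b v)

end tensor

section serre
variable {k A}
/-- A module homomorphism as a `k`-linear map. -/
def linOf {W : Type u} [Ring W] [Algebra k W] {M M' : ModuleCat.{u} W} (f : M ⟶ M') :
    M →ₗ[k] M' := f.hom.restrictScalars k

lemma linOf_actOf {W : Type u} [Ring W] [Algebra k W] {M M' : ModuleCat.{u} W} (f : M ⟶ M')
   (w : W) (m : M) : linOf (k := k) f (actOf (k := k) M w m) = actOf (k := k) M' w (linOf (k := k) f m) :=
  f.hom.map_smul w m

variable (k A)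
/-- The right action of `A` on `M ⊗_A A^*`. -/
def tensorDualAct (M : ModuleCat.{u} Aᵐᵒᵖ) :
    Aᵐᵒᵖ →ₐ[k] Module.End k (BalTensor (actOf (k := k) M) (leftAct (dualBimod k A))) :=
  BalTensor.rightFactorAct _ _ (rightAct (dualBimod k A))
    (fun b a => (leftAct_rightAct_comm _ a b).symm)

/-- The functor `M ↦ M ⊗_A A^*` on right `A`-modules. -/
def tensorDual : ModuleCat.{u} Aᵐᵒᵖ ⥤ ModuleCat.{u} Aᵐᵒᵖ where
  obj M := modOfAct (tensorDualAct k A M)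
  map f := homOfAct (BalTensor.map (linOf f) LinearMap.id (linOf_actOf f)
      (fun _ _ => rfl))
    (BalTensor.map_rightFactorAct _ _ _ _ _ _ _ _ (fun _ _ => rfl))
  map_id _ := (homOfAct_congr _ _ (BalTensor.map_id _ _)).trans (homOfAct_id _)
  map_comp _ _ := Eq.symm <| (homOfAct_comp _ _ _ _).trans
    (homOfAct_congr _ _ (BalTensor.map_comp _ _ _ _ _ _ _ _))

instance : (tensorDual k A).Additive where
  map_add := Eq.symm <| (homOfAct_add _ _ _ _).trans
    (homOfAct_congr _ _ (BalTensor.map_add_left _ _ _ _ _ _))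

lemma modOfAct_finite_base {W : Type u} [Ring W] [Algebra k W] {V : Type u} [AddCommGroup V]
    [Module k V] (ρ : W →ₐ[k] Module.End k V) [Module.Finite k V] :
    Module.Finite k (modOfAct ρ) := by
  let e : V →ₗ[k] modOfAct ρ :=
    { toFun := fun v => v
      map_add' := fun _ _ => rfl
      map_smul' := fun c v => by
        change c • v = ρ (algebraMap k W c) v
        simp [Module.algebraMap_end_apply] }
  exact Module.Finite.of_surjective e (fun v => ⟨v, rfl⟩)

instance finite_dualBimod [Module.Finite k A] : Module.Finite k (dualBimod k A) :=
  modOfAct_finite_base k _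

lemma tensorDual_finite [Module.Finite k A] (M : ModuleCat.{u} Aᵐᵒᵖ)
    (h : Module.Finite Aᵐᵒᵖ M) : Module.Finite Aᵐᵒᵖ ((tensorDual k A).obj M) := by
  have : Module.Finite k M := (finite_iff_finite_base M).2 h
  exact modOfAct_finite _
end serre

section bimod
variable {k A}

lemma tensorBimodAct_comm (M N : BimodCat k A) (a : A) (b : Aᵐᵒᵖ) :
    Commute (BalTensor.leftFactorAct (rightAct M) (leftAct N) (leftAct M)
        (fun a b => leftAct_rightAct_comm M a b) a)
      (BalTensor.rightFactorAct (rightAct M) (leftAct N) (rightAct N)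
        (fun b a => (leftAct_rightAct_comm N a b).symm) b) :=
  BalTensor.hom_ext fun _ _ => rfl

/-- The bimodule structure on `M ⊗_A N`. -/
def tensorBimodAct (M N : BimodCat k A) :
    Env k A →ₐ[k] Module.End k (BalTensor (rightAct M) (leftAct N)) :=
  Algebra.TensorProduct.lift
    (BalTensor.leftFactorAct _ _ (leftAct M) (fun a b => leftAct_rightAct_comm M a b))
    (BalTensor.rightFactorAct _ _ (rightAct N) (fun b a => (leftAct_rightAct_comm N a b).symm))
    (tensorBimodAct_comm M N)

lemma linOf_leftAct {M M' : BimodCat k A} (f : M ⟶ M') (a : A) (m : M) :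
    linOf (k := k) f (leftAct M a m) = leftAct M' a (linOf (k := k) f m) := linOf_actOf f _ m

lemma linOf_rightAct {M M' : BimodCat k A} (f : M ⟶ M') (a : Aᵐᵒᵖ) (m : M) :
    linOf (k := k) f (rightAct M a m) = rightAct M' a (linOf (k := k) f m) := linOf_actOf f _ m

lemma map_tensorBimodAct {M M' N N' : BimodCat k A} (f : M ⟶ M') (g : N ⟶ N') (w : Env k A)
    (x : BalTensor (rightAct M) (leftAct N)) :
    BalTensor.map (linOf f) (linOf g) (linOf_rightAct f) (linOf_leftAct g)
      (tensorBimodAct M N w x) = tensorBimodAct M' N' w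
      (BalTensor.map (linOf f) (linOf g) (linOf_rightAct f) (linOf_leftAct g) x) := by
  induction w using TensorProduct.induction_on generalizing x with
  | zero => simp
  | add a b ha hb => simp [ha, hb]
  | tmul a b =>
    simp only [tensorBimodAct, Algebra.TensorProduct.lift_tmul, Module.End.mul_apply]
    rw [BalTensor.map_leftFactorAct _ _ _ _ (leftAct M) (leftAct M') _
        (fun a b => leftAct_rightAct_comm M' a b) (linOf_leftAct f),
      BalTensor.map_rightFactorAct _ _ _ _ (rightAct N) (rightAct N') _
        (fun b a => (leftAct_rightAct_comm N' a b).symm) (linOf_rightAct g)]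

/-- The tensor product over `A` of two bimodule homomorphisms. -/
def tensorBimodMap {M M' N N' : BimodCat k A} (f : M ⟶ M') (g : N ⟶ N') :
    modOfAct (tensorBimodAct M N) ⟶ modOfAct (tensorBimodAct M' N') :=
  homOfAct (BalTensor.map (linOf f) (linOf g) (linOf_rightAct f) (linOf_leftAct g))
    (map_tensorBimodAct f g)

lemma tensorBimodMap_id (M N : BimodCat k A) : tensorBimodMap (𝟙 M) (𝟙 N) = 𝟙 _ :=
  (homOfAct_congr _ _ (BalTensor.map_id _ _)).trans (homOfAct_id _)

lemma tensorBimodMap_comp {M M' M'' N N' N'' : BimodCat k A} (f : M ⟶ M') (g : N ⟶ N')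
    (f' : M' ⟶ M'') (g' : N' ⟶ N'') :
    tensorBimodMap f g ≫ tensorBimodMap f' g' = tensorBimodMap (f ≫ f') (g ≫ g') :=
  (homOfAct_comp _ _ _ _).trans (homOfAct_congr _ _ (BalTensor.map_comp _ _ _ _ _ _ _ _))

lemma tensorBimodMap_add_left {M M' N N' : BimodCat k A} (f f' : M ⟶ M') (g : N ⟶ N') :
    tensorBimodMap (f + f') g = tensorBimodMap f g + tensorBimodMap f' g :=
  Eq.symm <| (homOfAct_add _ _ _ _).trans
      (homOfAct_congr _ _ (BalTensor.map_add_left _ _ _ _ _ _))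

lemma tensorBimodMap_add_right {M M' N N' : BimodCat k A} (f : M ⟶ M') (g g' : N ⟶ N') :
    tensorBimodMap f (g + g') = tensorBimodMap f g + tensorBimodMap f g' :=
  Eq.symm <| (homOfAct_add _ _ _ _).trans
      (homOfAct_congr _ _ (BalTensor.map_add_right _ _ _ _ _ _))

variable (k A)
/-- The tensor product over `A` of bimodules. -/
def tensorBimod : BimodCat k A ⥤ BimodCat k A ⥤ BimodCat k A where
  obj M :=
    { obj := fun N => modOfAct (tensorBimodAct M N)
      map := fun {N N'} g => tensorBimodMap (𝟙 M) g
      map_id := fun N => tensorBimodMap_id M N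
      map_comp := fun f g => by rw [tensorBimodMap_comp, Category.comp_id] }
  map {M M'} f :=
    { app := fun N => tensorBimodMap f (𝟙 N)
      naturality := fun N N' g => by
        simp only [tensorBimodMap_comp, Category.comp_id, Category.id_comp] }
  map_id M := by
    ext N : 2
    exact tensorBimodMap_id M N
  map_comp f g := by
    ext N : 2
    simp only [NatTrans.comp_app, tensorBimodMap_comp, Category.comp_id]

instance : (tensorBimod k A).Additive where
  map_add := by
    intros
    ext N : 2
    exact tensorBimodMap_add_left _ _ _

instance (M : BimodCat k A) : ((tensorBimod k A).obj M).Additive where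
  map_add := tensorBimodMap_add_right _ _ _

/-- The tensor product over `A` of complexes of bimodules (the total complex). -/
def tensorComplex (X Y : CochainComplex (BimodCat k A) ℤ) : CochainComplex (BimodCat k A) ℤ :=
  CochainComplex.mapBifunctor X Y (tensorBimod k A)

end bimod

section hochschild
/-- The complex on all integers obtained by applying a contravariant additive functor to a
projective resolution. -/
def dualComplex {C : Type*} [Category* C] [Abelian C] (D : Cᵒᵖ ⥤ C) [D.Additive] {X : C}
    (P : ProjectiveResolution X) : CochainComplex C ℤ :=
  ((D.mapHomologicalComplex (ComplexShape.up ℕ)).obj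
    (HomologicalComplex.op P.complex : CochainComplex Cᵒᵖ ℕ)).extend ComplexShape.embeddingUpNat

/-- The algebra anti-automorphism `a ⊗ b ↦ b ⊗ a` of the enveloping algebra. -/
def envSwap : Env k A →ₐ[k] (Env k A)ᵐᵒᵖ :=
  Algebra.TensorProduct.lift
    ((AlgHom.op (Algebra.TensorProduct.includeRight : Aᵐᵒᵖ →ₐ[k] Env k A)).comp
      (AlgEquiv.opOp k A).toAlgHom)
    (AlgHom.op (Algebra.TensorProduct.includeLeft : A →ₐ[k] Env k A))
    (fun a b => unop_injective (by simp))

lemma envSwap_tmul (a b : A) : envSwap k A (a ⊗ₜ op b) = op (b ⊗ₜ op a) := by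
  refine (Algebra.TensorProduct.lift_tmul _ _ _ _ _).trans ?_
  simp [← op_mul]

variable {A} in
/-- The space `Hom_{A^e}(M, A^e)`. -/
def BimodDual (M : BimodCat k A) : Type u := M →ₗ[Env k A] Env k A

section
variable {A} (M : BimodCat k A)

instance : AddCommGroup (BimodDual k M) :=
  inferInstanceAs (AddCommGroup (M →ₗ[Env k A] Env k A))

instance : Module k (BimodDual k M) :=
  inferInstanceAs (Module k (M →ₗ[Env k A] Env k A))

instance : FunLike (BimodDual k M) M (Env k A) :=
  inferInstanceAs (FunLike (M →ₗ[Env k A] Env k A) M (Env k A))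

variable {k M}

lemma BimodDual.ext {f g : BimodDual k M} (h : ∀ m, f m = g m) : f = g := LinearMap.ext h

lemma BimodDual.add_apply (f g : BimodDual k M) (m : M) : (f + g) m = f m + g m := rfl

lemma BimodDual.smul_apply (c : k) (f : BimodDual k M) (m : M) : (c • f) m = c • f m := rfl

/-- Multiplication of the values by `c` on the right. -/
def BimodDual.mulRight (c : Env k A) : BimodDual k M →ₗ[k] BimodDual k M where
  toFun f := LinearMap.comp (LinearMap.toSpanSingleton (Env k A) (Env k A) c) f
  map_add' f g := BimodDual.ext fun m => add_mul (f m) (g m) c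
  map_smul' r f := BimodDual.ext fun m => smul_mul_assoc r (f m) c

lemma BimodDual.mulRight_apply (c : Env k A) (f : BimodDual k M) (m : M) :
    BimodDual.mulRight c f m = f m * c := rfl

variable (k M)

/-- The bimodule structure on `Hom_{A^e}(M, A^e)`, `(a f b)(m) = f(m) (b ⊗ a)`. -/
def bimodDualAct : Env k A →ₐ[k] Module.End k (BimodDual k M) where
  toFun w := BimodDual.mulRight (envSwap k A w).unop
  map_one' := LinearMap.ext fun f => BimodDual.ext fun m => by
    simp [BimodDual.mulRight_apply]
  map_mul' v w := LinearMap.ext fun f => BimodDual.ext fun m => by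
    simp [BimodDual.mulRight_apply, mul_assoc]
  map_zero' := LinearMap.ext fun f => BimodDual.ext fun m =>
    (BimodDual.mulRight_apply _ f m).trans (by rw [map_zero, MulOpposite.unop_zero, mul_zero]; rfl)
  map_add' v w := LinearMap.ext fun f => BimodDual.ext fun m =>
    (BimodDual.mulRight_apply _ f m).trans (by rw [map_add, MulOpposite.unop_add, mul_add]; rfl)
  commutes' c := LinearMap.ext fun f => BimodDual.ext fun m =>
    (BimodDual.mulRight_apply _ f m).trans (by
      rw [AlgHom.commutes, MulOpposite.algebraMap_apply, unop_op, ← Algebra.commutes,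
        ← Algebra.smul_def]
      rfl)

lemma bimodDualAct_apply (w : Env k A) (f : BimodDual k M) (m : M) :
    bimodDualAct k M w f m = f m * (envSwap k A w).unop := rfl

variable {M} {M' : BimodCat k A}

/-- Precomposition with a homomorphism of bimodules, as a linear map. -/
def bimodPrecomp (f : M ⟶ M') : BimodDual k M' →ₗ[k] BimodDual k M where
  toFun g := LinearMap.comp g f.hom
  map_add' _ _ := rfl
  map_smul' _ _ := rfl

lemma bimodPrecomp_act (f : M ⟶ M') (w : Env k A) (g : BimodDual k M') :
    bimodPrecomp k f (bimodDualAct k M' w g) = bimodDualAct k M w (bimodPrecomp k f g) :=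
  BimodDual.ext fun _ => rfl

/-- The contravariant functoriality of `Hom_{A^e}(-, A^e)`. -/
def bimodDualMap (f : M ⟶ M') :
    modOfAct (bimodDualAct k M') ⟶ modOfAct (bimodDualAct k M) :=
  homOfAct (bimodPrecomp k f) (bimodPrecomp_act k f)

end

/-- The functor `M ↦ Hom_{A^e}(M, A^e)` on bimodules. Applied to a projective resolution of `A`
it gives the inverse dualizing complex `RHom_{A^e}(A, A^e)`. -/
def bimodDual : (BimodCat k A)ᵒᵖ ⥤ BimodCat k A where
  obj M := modOfAct (bimodDualAct k M.unop)
  map f := bimodDualMap k f.unop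
  map_id _ := rfl
  map_comp _ _ := rfl

instance : (bimodDual k A).Additive where
  map_add {M M' f g} := by
    change bimodDualMap k (f.unop + g.unop) = bimodDualMap k f.unop + bimodDualMap k g.unop
    refine Eq.trans ?_ (homOfAct_add _ _ _ _).symm
    refine homOfAct_congr _ _ ?_
    exact LinearMap.ext fun h => BimodDual.ext fun x => LinearMap.map_add h _ _

variable {k A}

/-- The complex of bimodules representing the `n`-th derived tensor power of `A^*` over `A`: the
complex `Δ ⊗_A N ⊗_A ⋯ ⊗_A N` with `n` factors `N`, for projective resolutions `Δ` of `A` and `N`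
of `A^*` as bimodules. -/
def tensorPow (Δ : ProjectiveResolution (regularBimod k A))
    (N : ProjectiveResolution (dualBimod k A)) : ℕ → CochainComplex (BimodCat k A) ℤ
  | 0 => Δ.cochainComplex
  | n + 1 => tensorComplex k A (tensorPow Δ N n) N.cochainComplex

/-- The dimension of a `k`-vector space, with `∞` for infinite dimensions. -/
def dimk (k : Type u) [Field k] (V : Type*) [AddCommGroup V] [Module k V] : ENNReal :=
  ((Cardinal.toENat (Module.rank k V) : ℕ∞) : ENNReal)

/-- The homomorphisms of degree `i` in the derived category of bimodules. -/
abbrev BimodHom (X Y : CochainComplex (BimodCat k A) ℤ) (i : ℤ) :=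
  DerivedCategory.Q.obj X ⟶ (DerivedCategory.Q.obj Y)⟦i⟧

/-- The Hochschild cohomology `HH^i` of the `n`-th power of the Serre quasi-functor,
`H^i(RHom_{A^e}(A, (A^*)^{⊗ n}))`. -/
abbrev serreHHCoh (Δ : ProjectiveResolution (regularBimod k A))
    (N : ProjectiveResolution (dualBimod k A)) (n : ℕ) (i : ℤ) :=
  BimodHom Δ.cochainComplex (tensorPow Δ N n) i

/-- The Hochschild homology `HH_i` of the `n`-th power of the Serre quasi-functor, that is,
`H^{-i}(RHom_{A^e}(Θ, (A^*)^{⊗ n}))` with `Θ = RHom_{A^e}(A, A^e)` the inverse dualizing complex,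
which represents the inverse Serre quasi-functor. -/
abbrev serreHHHom (Δ : ProjectiveResolution (regularBimod k A))
    (N : ProjectiveResolution (dualBimod k A)) (n : ℕ) (i : ℤ) :=
  BimodHom (dualComplex (bimodDual k A) Δ) (tensorPow Δ N n) (-i)

/-- The Hochschild cohomology entropy of the Serre quasi-functor. -/
def hhCohEntropy (Δ : ProjectiveResolution (regularBimod k A))
    (N : ProjectiveResolution (dualBimod k A)) : EReal :=
  Filter.limsup (fun n : ℕ => ENNReal.log (∑' i : ℤ, dimk k (serreHHCoh Δ N n i)) / (n : EReal))
    Filter.atTop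

/-- The Hochschild homology entropy of the Serre quasi-functor. -/
def hhHomEntropy (Δ : ProjectiveResolution (regularBimod k A))
    (N : ProjectiveResolution (dualBimod k A)) : EReal :=
  Filter.limsup (fun n : ℕ => ENNReal.log (∑' i : ℤ, dimk k (serreHHHom Δ N n i)) / (n : EReal))
    Filter.atTop

end hochschild

section cy
/-- The Serre functor `- ⊗^L_A A^*` of `D^b(A)`. -/
def serreFunctor [Module.Finite k A] [FinGlobalDim Aᵐᵒᵖ] : Db k A ⥤ Db k A :=
  leftDerivedDb k A (tensorDual k A) (tensorDual_finite k A)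

/-- The Nakayama functor `ν = RHom_A(-, A)^*` of `D^b(A)`. -/
def nakayamaFunctor [Module.Finite k A] [FinGlobalDim Aᵐᵒᵖ] : Db k A ⥤ Db k A :=
  leftDerivedDb k A (nakayama k A) (nakayama_finite k A)

/-- The restriction functor `φ^* : M ↦ M_φ`, where `a` acts on `M_φ` as `φ(a)` does on `M`. -/
abbrev twist (φ : A ≃ₐ[k] A) : ModuleCat.{u} Aᵐᵒᵖ ⥤ ModuleCat.{u} Aᵐᵒᵖ :=
  (ModuleCat.restrictScalarsEquivalenceOfRingEquiv (AlgEquiv.op φ).toRingEquiv).functor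

variable {k A} in
lemma twist_smul (φ : A ≃ₐ[k] A) (M : ModuleCat.{u} Aᵐᵒᵖ) (a : A) (m : M) :
    (op a • (show (twist k A φ).obj M from m) : (twist k A φ).obj M) = (op (φ a) • m : M) := rfl

/-- `A` is twisted `q/p`-Calabi-Yau: `ν^p ≅ φ^*[q]` as functors on `D^b(A)` for some algebra
automorphism `φ` of `A`. (Both sides are compared inside `D(A)`, in which `D^b(A)` is full.) -/
def IsTwistedCY [Module.Finite k A] [FinGlobalDim Aᵐᵒᵖ] (p : ℕ) (q : ℤ) : Prop :=
  0 < p ∧ ∃ φ : A ≃ₐ[k] A, Nonempty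
    (iter (nakayamaFunctor k A) p ⋙ (boundedFD k A).ι ≅
      (boundedFD k A).ι ⋙ (twist k A φ).mapDerivedCategory ⋙ shiftFunctor (DMod Aᵐᵒᵖ) q)

/-- `A` is elementary: `A / rad A ≅ k × ⋯ × k` as algebras. -/
def IsElementary : Prop :=
  ∃ (r : ℕ) (f : A →ₐ[k] (Fin r → k)), Function.Surjective f ∧ RingHom.ker f = Ring.jacobson A
end cy
end dims

end CYEntropy

end

open CYEntropy

noncomputable section
namespace CYEntropy

/-! ### Towers of triangles and the calculus of complexity -/

section towers
variable {C : Type*} [Category* C] [Preadditive C] [HasZeroObject C] [HasShift C ℤ]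
  [∀ n : ℤ, (shiftFunctor C n).Additive] [Pretriangulated C]

open ObjectProperty

/-! Everything rests on periodicity up to a bounded error. The natural map M ⊗_A A^* → Hom_A(M, A)^*
is an isomorphism on finitely generated projective modules, so the Serre functor S agrees with ν and
S^p ≅ φ^*[q]. Writing n = r + pm, the object S^n X is S^r X twisted m times by φ and shifted by mq.
Twisting is exact, preserves and detects vanishing of cohomology, and fixes the right module A up to
isomorphism.

Entropy. Finite global dimension makes A a generator, and changing generators changes complexities
only by constant factors (`complexity_le_mul`). A tower of S^r G over A becomes a tower of S^n G
once its shifts are translated by mq; this bounds the complexity from above by a constant times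
e^{mqt}. Conversely A[s] has cohomology only in degree -s, so a tower of X over A must contain the
shift -j whenever H^j(X) ≠ 0 (`neg_mem_of_splitTower`); one nonzero cohomology group of S^r G then
gives a lower bound of the same order. Hence log δ_t(G, S^n G) = n(q/p)t + O(1)
(`IsTwistedCY.complexity_bounds`), and the bounded error disappears after division by n or by log n.

Serre dimensions. Hom(A, Z[i]) is controlled by H^i(Z), so a nonzero map G → S^n G'[i] forces i =
-nq/p + O(1). Such maps exist because S^n G' ≠ 0 and G generates, so infimum and supremum have the
same growth.

Hochschild entropies, upper bound. As a complex of right modules, the n-fold tensor power represents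
S^n(A), and left multiplication by a corresponds to S^n applied to left multiplication
(`exists_tensorPow_iso`). Its total cohomology therefore has dimension bounded in n. For elementary
A of finite global dimension, A has finite projective dimension over A^e: a finite-dimensional left
projective bimodule K is projective once all the right modules k_χ ⊗_A K are, χ running over the
characters of A (`projective_of_charQuot`). So A and Θ are perfect over A^e, and the Hochschild sums
are bounded by a constant multiple of the total cohomology.

Hochschild entropies, lower bound. Boundedness makes the limsup at most 0; equality needs nonzero
sums for infinitely many n. There are finitely many characters χ : A → k, so each is fixed by a
positive power of φ. For n = 1 + pm with χ ∘ φ^m = χ, the only cohomology is A^* with right action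
twisted by φ^m; the element χ is central in it and gives a nonzero map from A. For n = pm it is A
with the right action twisted by φ^m, on which χ is a trace; the trace detects a nonzero class of
degree zero (`exists_Q_dualComplex_ne_zero`). -/

lemma HasTower.of_triangle {E X Y : C} {n : ℤ} {l : List ℤ} (T : Triangle C)
    (hT : T ∈ distTriang C) (e₁ : T.obj₁ ≅ X) (e₂ : T.obj₂ ≅ Y) (e₃ : T.obj₃ ≅ E⟦n⟧)
    (hX : HasTower E X l) : HasTower E Y (n :: l) := by
  refine HasTower.step X Y n l (e₁.inv ≫ T.mor₁ ≫ e₂.hom) (e₂.inv ≫ T.mor₂ ≫ e₃.hom)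
    (e₃.inv ≫ T.mor₃ ≫ e₁.hom⟦(1 : ℤ)⟧') (isomorphic_distinguished _ hT _ ?_) hX
  have h₁ : (e₁.inv ≫ T.mor₁ ≫ e₂.hom) ≫ e₂.inv = e₁.inv ≫ T.mor₁ := by simp
  have h₂ : (e₂.inv ≫ T.mor₂ ≫ e₃.hom) ≫ e₃.inv = e₂.inv ≫ T.mor₂ := by simp
  have h₃ : (e₃.inv ≫ T.mor₃ ≫ e₁.hom⟦(1 : ℤ)⟧') ≫ e₁.inv⟦(1 : ℤ)⟧' = e₃.inv ≫ T.mor₃ := by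
    simp [← Functor.map_comp]
  exact Triangle.isoMk _ _ e₁.symm e₂.symm e₃.symm h₁ h₂ h₃

lemma HasTower.of_iso {E X Y : C} {l : List ℤ} (h : HasTower E X l) (e : X ≅ Y) :
    HasTower E Y l := by
  cases h with
  | zero _ hX => exact .zero _ (hX.of_iso e.symm)
  | step X' _ n l f g h hT hX =>
    exact .of_triangle _ hT (Iso.refl _) e (Iso.refl _) hX

lemma HasTower.of_iso_left {E E' X : C} {l : List ℤ} (h : HasTower E X l) (e : E ≅ E') :
    HasTower E' X l := by
  induction h with
  | zero _ hX => exact .zero _ hX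
  | step X' _ n l f g h hT hX ih =>
    exact .of_triangle _ hT (Iso.refl _) (Iso.refl _) ((shiftFunctor C n).mapIso e) ih

lemma HasTower.shift {E X : C} {l : List ℤ} (h : HasTower E X l) (m : ℤ) :
    HasTower E (X⟦m⟧) (l.map (· + m)) := by
  induction h with
  | zero _ hX => exact .zero _ ((shiftFunctor C m).map_isZero hX)
  | step X' _ n l f g h hT hX ih =>
    exact .of_triangle _ (Triangle.shift_distinguished _ hT m) (Iso.refl _) (Iso.refl _)
      ((shiftFunctorAdd C n m).symm.app E) ih

lemma HasTower.map {D : Type*} [Category* D] [Preadditive D] [HasZeroObject D] [HasShift D ℤ]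
    [∀ n : ℤ, (shiftFunctor D n).Additive] [Pretriangulated D] (F : C ⥤ D) [F.CommShift ℤ]
    [F.IsTriangulated] {E X : C} {l : List ℤ} (h : HasTower E X l) :
    HasTower (F.obj E) (F.obj X) l := by
  induction h with
  | zero _ hX => exact .zero _ (F.map_isZero hX)
  | step X' _ n l f g h hT hX ih =>
    exact .of_triangle _ (F.map_distinguished _ hT) (Iso.refl _) (Iso.refl _)
      ((F.commShiftIso n).app E) ih

lemma HasTower.single (E : C) (n : ℤ) : HasTower E (E⟦n⟧) [n] :=
  .of_triangle _ (contractible_distinguished₁ (E⟦n⟧)) (Iso.refl _) (Iso.refl _) (Iso.refl _)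
    (.zero _ (isZero_zero C))

/-- A tower of an object of a triangulated subcategory stays in the subcategory. -/
lemma HasTower.lift (P : ObjectProperty C) [P.IsTriangulated] [P.IsClosedUnderIsomorphisms]
    {E : P.FullSubcategory} {X : C} {l : List ℤ} (h : HasTower E.obj X l) (hX : P X) :
    HasTower E ⟨X, hX⟩ l := by
  induction h with
  | zero X h0 =>
    exact .zero _ ((IsZero.iff_id_eq_zero _).2
      (P.hom_ext ((IsZero.iff_id_eq_zero X).1 h0)))
  | step X' Y n l f g h hT hX' ih =>
    have hE : P (E.obj⟦n⟧) := P.le_shift n _ E.property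
    -- Membership in `P` descends the tower: the upper stage and the layer lie in `P`, hence so does
    -- the lower stage.
    have hPX : P X' := P.ext_of_isTriangulatedClosed₁ _ hT hX hE
    let X₀ : P.FullSubcategory := ⟨X', hPX⟩
    let Y₀ : P.FullSubcategory := ⟨Y, hX⟩
    let e : (E⟦n⟧).obj ≅ E.obj⟦n⟧ := (P.ι.commShiftIso n).app E
    let e' : (X₀⟦(1 : ℤ)⟧).obj ≅ X'⟦(1 : ℤ)⟧ := (P.ι.commShiftIso (1 : ℤ)).app X₀
    let T : Triangle P.FullSubcategory :=
      Triangle.mk (homMk f : X₀ ⟶ Y₀) (homMk (g ≫ e.inv) : Y₀ ⟶ E⟦n⟧)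
        (homMk (e.hom ≫ h ≫ e'.inv) : E⟦n⟧ ⟶ X₀⟦(1 : ℤ)⟧)
    refine .of_triangle T ?_ (Iso.refl _) (Iso.refl _) (Iso.refl _) (ih hPX)
    rw [← P.ι.map_distinguished_iff]
    have h₁ : f ≫ 𝟙 _ = 𝟙 _ ≫ f := by simp
    have h₂ : (g ≫ e.inv) ≫ e.hom = 𝟙 _ ≫ g := by simp
    have h₃ : ((e.hom ≫ h ≫ e'.inv) ≫ e'.hom) ≫ (𝟙 X')⟦(1 : ℤ)⟧' = e.hom ≫ h := by simp
    exact isomorphic_distinguished _ hT _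
      (Triangle.isoMk _ _ (Iso.refl _) (Iso.refl _) e h₁ h₂ h₃)

/-- The objects `E`-built by a tower with given shifts. -/
def towerProp (E : C) (l : List ℤ) : ObjectProperty C := fun X => HasTower E X l

lemma towerProp_cons (E : C) (n : ℤ) (l : List ℤ) :
    towerProp E (n :: l) = (towerProp E l).extensionProduct (ObjectProperty.singleton (E⟦n⟧)) := by
  ext X
  constructor
  · rintro (_ | ⟨X', _, _, _, f, g, h, hT, hX⟩)
    exact ⟨_, _, f, g, h, hT, hX, (ObjectProperty.singleton_iff _ _).2 rfl⟩
  · rintro ⟨Y, Z, f, g, h, hT, hY, hZ⟩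
    obtain rfl := (ObjectProperty.singleton_iff _ _).1 hZ
    exact .step _ _ _ _ f g h hT hY

/-- Towers can be stacked because extension products are associative, which is the octahedral axiom.
The list of the quotient comes first since shifts are listed from the top of the tower. -/
lemma extensionProduct_towerProp [IsTriangulated C] (E : C) (l l' : List ℤ) :
    (towerProp E l).extensionProduct (towerProp E l') ≤ towerProp E (l' ++ l) := by
  induction l' with
  | nil =>
    rintro X ⟨Y, Z, f, g, h, hT, hY, hZ⟩
    obtain ⟨_, hZ⟩ := hZ
    have : IsIso f := (Triangle.isZero₃_iff_isIso₁ _ hT).1 hZ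
    exact HasTower.of_iso hY (asIso f)
  | cons n l' ih =>
    rw [towerProp_cons, List.cons_append, towerProp_cons, ← extensionProduct_assoc]
    exact monotone_extensionProduct_left _ ih

/-- Direct summands of objects built by a tower. -/
abbrev splitTower (E : C) (l : List ℤ) : ObjectProperty C := (towerProp E l).retractClosure

/-- Retracts split in a triangulated category: the cone of the inclusion is a complement because the
connecting map, composed with a monomorphism, is zero. The complement in the definition of
complexity may thus be replaced by closure under retracts, which is compatible with extensions. -/
lemma splitTower_iff (E : C) (l : List ℤ) (X : C) :
    splitTower E l X ↔ ∃ E', HasTower E (X ⊞ E') l := by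
  constructor
  · rintro ⟨Y, hY, ⟨r⟩⟩
    obtain ⟨Z, g, h, hT⟩ := distinguished_cocone_triangle r.i
    have h0 : h = 0 := by
      have : h ≫ r.i⟦(1 : ℤ)⟧' = 0 := comp_distTriang_mor_zero₃₁ _ hT
      rw [← cancel_mono (r.i⟦(1 : ℤ)⟧'), zero_comp, this]
    obtain ⟨e, -⟩ := exists_iso_binaryBiproduct_of_distTriang _ hT h0
    exact ⟨Z, HasTower.of_iso hY e⟩
  · rintro ⟨E', h⟩
    exact ⟨_, h, ⟨⟨biprod.inl, biprod.fst, by simp⟩⟩⟩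

lemma extensionProduct_splitTower [IsTriangulated C] (E : C) (l l' : List ℤ) :
    (splitTower E l).extensionProduct (splitTower E l') ≤ splitTower E (l' ++ l) :=
  (extensionProduct_retractClosure_retractClosure_le _ _).trans
    (monotone_retractClosure (extensionProduct_towerProp E l l'))

lemma splitTower.shift {E X : C} {l : List ℤ} (h : splitTower E l X) (m : ℤ) :
    splitTower E (l.map (· + m)) (X⟦m⟧) := by
  obtain ⟨Y, hY, ⟨r⟩⟩ := h
  exact ⟨_, HasTower.shift hY m, ⟨r.map (shiftFunctor C m)⟩⟩

/-- Substitution: each layer E'[n] of the given tower is replaced by the tower of E' over E, all of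
its shifts raised by n. -/
lemma splitTower.trans_tower [IsTriangulated C] {E E' X : C} {l l' : List ℤ}
    (h : splitTower E l E') (h' : HasTower E' X l') :
    splitTower E (l'.flatMap fun n => l.map (· + n)) X := by
  induction h' with
  | zero X hX => exact ⟨X, .zero _ hX, ⟨.refl X⟩⟩
  | step X Y n l' f g k hT hX ih =>
    exact extensionProduct_splitTower E _ _ _ ⟨_, _, f, g, k, hT, ih, h.shift n⟩

lemma splitTower.trans [IsTriangulated C] {E E' X : C} {l l' : List ℤ}
    (h : splitTower E l E') (h' : splitTower E' l' X) :
    splitTower E (l'.flatMap fun n => l.map (· + n)) X := by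
  obtain ⟨Y, hY, ⟨r⟩⟩ := h'
  exact ObjectProperty.prop_of_retract _ r (h.trans_tower hY)

/-- The weight of a tower. -/
def towerWeight (t : ℝ) (l : List ℤ) : ENNReal :=
  (l.map fun n : ℤ => ENNReal.ofReal (Real.exp (n * t))).sum

lemma towerWeight_map_add (t : ℝ) (l : List ℤ) (m : ℤ) :
    towerWeight t (l.map (· + m)) =
      towerWeight t l * ENNReal.ofReal (Real.exp (m * t)) := by
  induction l with
  | nil => simp [towerWeight]
  | cons n l ih =>
    simp only [towerWeight, List.map_cons, List.sum_cons] at ih ⊢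
    rw [ih, add_mul, ← ENNReal.ofReal_mul (Real.exp_pos _).le, ← Real.exp_add]
    push_cast
    ring_nf

/-- Shifts add under substitution, so their exponential weights multiply. -/
lemma towerWeight_flatMap (t : ℝ) (l l' : List ℤ) :
    towerWeight t (l'.flatMap fun n => l.map (· + n)) = towerWeight t l * towerWeight t l' := by
  induction l' with
  | nil => simp [towerWeight]
  | cons n l' ih =>
    have h1 : towerWeight t ((n :: l').flatMap fun n => l.map (· + n)) =
        towerWeight t (l.map (· + n)) + towerWeight t (l'.flatMap fun n => l.map (· + n)) := by
      simp [towerWeight]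
    have h2 : towerWeight t (n :: l') = ENNReal.ofReal (Real.exp (n * t)) + towerWeight t l' := rfl
    rw [h1, ih, towerWeight_map_add, h2, mul_add]

lemma towerWeight_ne_top (t : ℝ) (l : List ℤ) : towerWeight t l ≠ ⊤ := by
  induction l with
  | nil => simp [towerWeight]
  | cons n l ih => exact ENNReal.add_ne_top.2 ⟨ENNReal.ofReal_ne_top, ih⟩

lemma le_towerWeight_of_mem (t : ℝ) {l : List ℤ} {n : ℤ} (h : n ∈ l) :
    ENNReal.ofReal (Real.exp (n * t)) ≤ towerWeight t l :=
  List.le_sum_of_mem (List.mem_map_of_mem h)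

lemma towerWeight_ne_zero (t : ℝ) {l : List ℤ} (hl : l ≠ []) : towerWeight t l ≠ 0 := by
  obtain ⟨n, l, rfl⟩ := List.exists_cons_of_ne_nil hl
  intro h
  have := (le_towerWeight_of_mem t (List.mem_cons_self (a := n) (l := l))).trans_eq h
  simp [Real.exp_pos, not_le.2] at this

lemma complexity_eq (t : ℝ) (E X : C) :
    complexity t E X = ⨅ (l : List ℤ) (_ : splitTower E l X), towerWeight t l := by
  simp only [splitTower_iff]
  rfl

lemma complexity_le {t : ℝ} {E X : C} {l : List ℤ} (h : splitTower E l X) :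
    complexity t E X ≤ towerWeight t l := by
  rw [complexity_eq]
  exact iInf₂_le l h

/-- Submultiplicativity, by substituting towers. Since E' is nonzero the list l is nonempty, so its
weight is neither 0 nor ∞ and may be moved past the infimum in `ENNReal`. -/
lemma complexity_le_mul [IsTriangulated C] {t : ℝ} {E E' X : C} {l : List ℤ}
    (h : splitTower E l E') (hE' : ¬ IsZero E') :
    complexity t E X ≤ towerWeight t l * complexity t E' X := by
  have h0 : towerWeight t l ≠ 0 := towerWeight_ne_zero t fun hl => hE' (by
    subst hl
    obtain ⟨Y, ⟨_, hY⟩, ⟨r⟩⟩ := h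
    exact (IsZero.iff_id_eq_zero _).2 (by rw [← r.retract, hY.eq_of_tgt r.i 0, zero_comp]))
  rw [complexity_eq t E' X, ENNReal.mul_iInf_of_ne h0 (towerWeight_ne_top t l)]
  refine le_iInf fun l' => ?_
  rw [ENNReal.mul_iInf_of_ne h0 (towerWeight_ne_top t l)]
  refine le_iInf fun h' => ?_
  rw [← towerWeight_flatMap]
  exact complexity_le (h.trans h')

variable {G : C}

instance (E : C) : ObjectProperty.IsStableUnderRetracts (fun X : C => ∃ l, splitTower E l X) where
  of_retract := fun r ⟨l, h⟩ => ⟨l, ObjectProperty.prop_of_retract _ r h⟩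

instance [IsTriangulated C] (E : C) :
    ObjectProperty.IsTriangulated (fun X : C => ∃ l, splitTower E l X) where
  exists_zero := ⟨0, isZero_zero C, [], 0, .zero _ (isZero_zero C), ⟨.refl _⟩⟩
  isStableUnderShiftBy n := ⟨fun X ⟨l, h⟩ => ⟨_, h.shift n⟩⟩
  toIsTriangulatedClosed₂ := .mk' (by
    rintro T hT ⟨l, h⟩ ⟨l', h'⟩
    exact ⟨_, extensionProduct_splitTower E l l' _ ⟨_, _, _, _, _, hT, h, h'⟩⟩)

lemma IsGenerator.prop_of [IsTriangulated C] (hG : IsGenerator G) (Q : ObjectProperty C)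
    [Q.IsStableUnderRetracts] [Q.IsTriangulated] (h : Q G) (X : C) : Q X := by
  have : (ObjectProperty.singleton G).triangEnvelope ≤ Q :=
    (triangEnvelope_le_iff _).2 (by
      intro Y hY
      obtain rfl := (ObjectProperty.singleton_iff _ _).1 hY
      exact h)
  exact this X (by rw [(hG : _ = _)]; trivial)

/-- The objects admitting some tower over G, up to summands, form a thick subcategory containing G.
In particular all complexities with respect to a generator are finite. -/
lemma IsGenerator.exists_splitTower [IsTriangulated C] (hG : IsGenerator G) (X : C) :
    ∃ l, splitTower G l X :=
  hG.prop_of (fun X : C => ∃ l, splitTower G l X)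
    ⟨[0], _, .single G 0, ⟨.ofIso ((shiftFunctorZero C ℤ).symm.app G)⟩⟩ X

end towers

/-! ### Building perfect complexes from the regular module -/

section perfect
variable {R : Type u} [Ring R]

lemma prop_single_of_isTriangulated (W : ObjectProperty (DMod R)) [W.IsTriangulated]
    [W.IsClosedUnderIsomorphisms] {M : ModuleCat.{u} R}
    (h : W ((DerivedCategory.singleFunctor _ 0).obj M)) (a : ℤ) :
    W ((DerivedCategory.singleFunctor _ a).obj M) :=
  W.prop_of_iso ((shiftEquiv (DMod R) a).unitIso.app
      ((DerivedCategory.singleFunctor _ a).obj M)).symm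
    (W.le_shift (-a) _ (W.prop_of_iso
      (((DerivedCategory.singleFunctors (ModuleCat.{u} R)).shiftIso a 0 a (add_zero a)).app M).symm
      h))

/-- A triangulated property of objects of `D(R)` which holds for finitely generated projective
modules holds for bounded complexes of finitely generated projective modules. -/
lemma IsStrictPerfect.prop_of_isTriangulated (W : ObjectProperty (DMod R)) [W.IsTriangulated]
    [W.IsClosedUnderIsomorphisms]
    (hW : ∀ M : ModuleCat.{u} R, Projective M → Module.Finite R M →
      W ((DerivedCategory.singleFunctor _ 0).obj M))
    {K : CochainComplex (ModuleCat.{u} R) ℤ} (hK : IsStrictPerfect R K) :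
    W (DerivedCategory.Q.obj K) := by
  obtain ⟨⟨a, ha⟩, ⟨b, hb⟩, h⟩ := hK
  -- Induction on the number of degrees in which the complex may live; the strict inequality makes n
  -- = 0 the zero complex.
  obtain ⟨n, hn⟩ : ∃ n : ℕ, b < a + n := ⟨(b - a + 1).toNat, by lia⟩
  induction n generalizing a K with
  | zero =>
    have hK0 : IsZero K := by
      rw [IsZero.iff_id_eq_zero]
      ext i : 1
      by_cases hi : i < a
      · exact (K.isZero_of_isStrictlyGE a i hi).eq_of_src _ _
      · exact (K.isZero_of_isStrictlyLE b i (by lia)).eq_of_src _ _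
    exact W.prop_of_isZero (DerivedCategory.Q.map_isZero hK0)
  | succ n ih =>
    -- The lowest term is peeled off: since K vanishes below a, the identity of its term in degree a
    -- extends to a chain map onto the stalk complex, and the kernel is the part of K in degrees
    -- above a.
    let L := (HomologicalComplex.single (ModuleCat.{u} R) (ComplexShape.up ℤ) a).obj (K.X a)
    let f : K ⟶ L := HomologicalComplex.mkHomToSingle (𝟙 _)
      (fun i hi => (K.isZero_of_isStrictlyGE a i (by simp at hi; lia)).eq_of_src _ _)
    have hfa : IsIso (f.f a) := by
      simp only [f, HomologicalComplex.mkHomToSingle_f]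
      infer_instance
    have hf0 (i : ℤ) (hi : i ≠ a) : IsZero (L.X i) :=
      HomologicalComplex.isZero_single_obj_X _ _ _ _ hi
    have hepi : Epi f := by
      have (i : ℤ) : Epi (f.f i) := by
        by_cases hi : i = a
        · subst hi
          infer_instance
        · exact ⟨fun _ _ _ => (hf0 i hi).eq_of_src _ _⟩
      exact HomologicalComplex.epi_of_epi_f _ this
    let S := ShortComplex.mk (kernel.ι f) f (kernel.condition f)
    have hS : S.ShortExact := { exact := ShortComplex.exact_kernel f }
    have hSi (i : ℤ) : (S.map (HomologicalComplex.eval _ _ i)).ShortExact :=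
      hS.map_of_exact _
    have hmem := DerivedCategory.triangleOfSES_distinguished hS
    have hZa : IsZero ((kernel f).X a) := by
      have h1 : Mono ((kernel.ι f).f a) := (hSi a).mono_f
      have h2 : (kernel.ι f).f a ≫ f.f a = 0 := (S.map (HomologicalComplex.eval _ _ a)).zero
      rw [IsZero.iff_id_eq_zero, ← cancel_mono ((kernel.ι f).f a), ← cancel_mono (f.f a)]
      simp [h2]
    have hiso (i : ℤ) (hi : i ≠ a) : Nonempty ((kernel f).X i ≅ K.X i) := by
      have h1 : Mono ((kernel.ι f).f i) := (hSi i).mono_f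
      have : Epi ((kernel.ι f).f i) := (hSi i).exact.epi_f ((hf0 i hi).eq_of_tgt _ _)
      have := isIso_of_mono_of_epi ((kernel.ι f).f i)
      exact ⟨asIso ((kernel.ι f).f i)⟩
    refine W.ext_of_isTriangulatedClosed₂ _ hmem ?_ ?_
    · refine ih (a + 1) ?_ ?_ ?_ (by push_cast at hn ⊢; lia)
      · rw [CochainComplex.isStrictlyGE_iff]
        intro i hi
        by_cases hi' : i = a
        · subst hi'
          exact hZa
        · exact (K.isZero_of_isStrictlyGE a i (by lia)).of_iso (hiso i hi').some
      · intro i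
        by_cases hi' : i = a
        · subst hi'
          have := ModuleCat.subsingleton_of_isZero hZa
          exact ⟨hZa.projective, inferInstanceAs (Module.Finite R ((kernel f).X i))⟩
        · have e := (hiso i hi').some
          have := (h i).1
          have := (h i).2
          exact ⟨Projective.of_iso e.symm inferInstance, Module.Finite.equiv e.symm.toLinearEquiv⟩
      · rw [CochainComplex.isStrictlyLE_iff]
        intro i hi
        by_cases hi' : i = a
        · subst hi'
          exact hZa
        · exact (K.isZero_of_isStrictlyLE b i (by lia)).of_iso (hiso i hi').some
    · exact W.prop_of_iso ((DerivedCategory.singleFunctorIsoCompQ _ a).app (K.X a))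
        (prop_single_of_isTriangulated W (hW _ (h a).1 (h a).2) a)

end perfect

section
variable {R : Type u} [Ring R]

/-- Free modules of finite rank are iterated extensions by R, and a finitely generated projective
module is a retract of one. -/
lemma prop_single_of_projective (W : ObjectProperty (DMod R)) [W.IsTriangulated]
    [W.IsStableUnderRetracts] (hR : W ((DerivedCategory.singleFunctor _ 0).obj (ModuleCat.of R R)))
    (M : ModuleCat.{u} R) (_ : Projective M) (_ : Module.Finite R M) :
    W ((DerivedCategory.singleFunctor _ 0).obj M) := by
  have hfree (n : ℕ) : W ((DerivedCategory.singleFunctor _ 0).obj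
      (ModuleCat.of R (ULift.{u} (Fin n) → R))) := by
    induction n with
    | zero =>
      exact W.prop_of_isZero (Functor.map_isZero _ (ModuleCat.isZero_of_subsingleton _))
    | succ n ih =>
      let i : R →ₗ[R] (ULift.{u} (Fin (n + 1)) → R) := LinearMap.single R (fun _ => R) ⟨0⟩
      let p : (ULift.{u} (Fin (n + 1)) → R) →ₗ[R] (ULift.{u} (Fin n) → R) :=
        LinearMap.funLeft R R fun j => ⟨j.down.succ⟩
      have hi0 (r : R) : i r ⟨0⟩ = r :=
        Pi.single_eq_same (M := fun _ : ULift.{u} (Fin (n + 1)) => R) ⟨0⟩ r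
      have hij (r : R) (j : Fin n) : i r ⟨j.succ⟩ = 0 :=
        Pi.single_eq_of_ne (M := fun _ : ULift.{u} (Fin (n + 1)) => R)
          (fun h => Fin.succ_ne_zero j (congrArg ULift.down h)) r
      let S := ShortComplex.mk (ModuleCat.ofHom i) (ModuleCat.ofHom p)
        (ModuleCat.hom_ext (LinearMap.ext fun r => funext fun j => hij r j.down))
      have hS : S.ShortExact :=
        { exact := by
            rw [ShortComplex.moduleCat_exact_iff]
            intro (x : ULift.{u} (Fin (n + 1)) → R) (hx : p x = 0)
            refine ⟨x ⟨0⟩, funext fun j => ?_⟩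
            obtain ⟨j⟩ := j
            refine Fin.cases (hi0 _) (fun j => ?_) j
            exact (hij _ j).trans (congrFun hx ⟨j⟩).symm
          mono_f := (ModuleCat.mono_iff_injective _).2 fun a b h =>
            (hi0 a).symm.trans ((congrFun h ⟨0⟩).trans (hi0 b))
          epi_g := (ModuleCat.epi_iff_surjective _).2
            (LinearMap.funLeft_surjective_of_injective R R _ fun a b h => by
              have := Fin.succ_injective _ (congrArg ULift.down h)
              exact ULift.down_injective this) }
      exact W.ext_of_isTriangulatedClosed₂ _ hS.singleTriangle_distinguished hR ih
  obtain ⟨n, f, hf⟩ := Module.Finite.exists_fin' R M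
  let g : ModuleCat.of R (ULift.{u} (Fin n) → R) ⟶ M :=
    ModuleCat.ofHom (f ∘ₗ LinearMap.funLeft R R ULift.up)
  have hg : Function.Surjective g :=
    hf.comp (LinearMap.funLeft_surjective_of_injective R R _ ULift.up_injective)
  have : Epi g := (ModuleCat.epi_iff_surjective _).2 hg
  let r : Retract M (ModuleCat.of R (ULift.{u} (Fin n) → R)) :=
    ⟨Projective.factorThru (𝟙 M) g, g, by simp⟩
  exact W.prop_of_retract (r.map _) (hfree n)

/-- Bounded complexes of finitely generated projective modules are in the thick subcategory
generated by the regular module. -/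
lemma IsStrictPerfect.prop_of_regular (W : ObjectProperty (DMod R)) [W.IsTriangulated]
    [W.IsStableUnderRetracts] (hR : W ((DerivedCategory.singleFunctor _ 0).obj (ModuleCat.of R R)))
    {K : CochainComplex (ModuleCat.{u} R) ℤ} (hK : IsStrictPerfect R K) :
    W (DerivedCategory.Q.obj K) :=
  hK.prop_of_isTriangulated W (prop_single_of_projective W hR)

end

/-! ### The regular module generates D^b(A) -/

section generator
variable (k : Type u) [Field k] (A : Type u) [Ring A] [Algebra k A]
open scoped ModuleCat TensorProduct
open MulOpposite

lemma boundedFD_of_toD [Module.Finite k A] (K : KbProj Aᵐᵒᵖ) :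
    boundedFD k A ((KbProj.toD Aᵐᵒᵖ).obj K) :=
  ((KbProj.toDb k A).obj K).property

lemma boundedFD_single [Module.Finite k A] (M : ModuleCat.{u} Aᵐᵒᵖ) [Projective M]
    [Module.Finite Aᵐᵒᵖ M] : boundedFD k A ((DerivedCategory.singleFunctor _ 0).obj M) := by
  obtain ⟨K, ⟨e⟩⟩ := single_mem_of_projective M
  exact (boundedFD k A).prop_of_iso e (boundedFD_of_toD k A K)

instance finite_regular_op : Module.Finite Aᵐᵒᵖ A :=
  Module.Finite.of_surjective (LinearMap.toSpanSingleton Aᵐᵒᵖ A (1 : A))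
    fun a => ⟨op a, by simp⟩

/-- The right module `A` is free of rank one. -/
def opRegularEquiv : Aᵐᵒᵖ ≃ₗ[Aᵐᵒᵖ] A where
  toFun a := a.unop
  invFun := op
  map_add' _ _ := rfl
  map_smul' _ _ := rfl
  left_inv _ := rfl
  right_inv _ := rfl

instance : Projective (ModuleCat.of Aᵐᵒᵖ A) :=
  Projective.of_iso (opRegularEquiv A).toModuleIso inferInstance

/-- The right module `A`, as an object of `D^b(A)`. -/
def regularDb [Module.Finite k A] : Db k A :=
  ⟨(DerivedCategory.singleFunctor _ 0).obj (ModuleCat.of Aᵐᵒᵖ A),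
    have : Module.Finite Aᵐᵒᵖ (ModuleCat.of Aᵐᵒᵖ A) := finite_regular_op A
    boundedFD_single k A _⟩

instance : (boundedFD k A).IsStableUnderRetracts where
  of_retract {X Y} r := by
    have hz {i : ℤ} (h : IsZero ((DerivedCategory.homologyFunctor _ i).obj Y)) :
        IsZero ((DerivedCategory.homologyFunctor (ModuleCat.{u} Aᵐᵒᵖ) i).obj X) := by
      let r' := r.map (DerivedCategory.homologyFunctor (ModuleCat.{u} Aᵐᵒᵖ) i)
      rw [IsZero.iff_id_eq_zero, ← r'.retract, h.eq_of_tgt r'.i 0, zero_comp]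
    rintro ⟨⟨⟨a, ha⟩, ⟨b, hb⟩⟩, hf⟩
    refine ⟨⟨⟨a, ?_⟩, ⟨b, ?_⟩⟩, fun i => ?_⟩
    · have : Y.IsGE a := ha
      exact (DerivedCategory.isGE_iff X a).2 fun i hi => hz (Y.isZero_of_isGE a i hi)
    · have : Y.IsLE b := hb
      exact (DerivedCategory.isLE_iff X b).2 fun i hi => hz (Y.isZero_of_isLE b i hi)
    · have := hf i
      let r' := r.map (DerivedCategory.homologyFunctor (ModuleCat.{u} Aᵐᵒᵖ) i)
      refine Module.Finite.of_surjective (linOf (k := k) r'.r) fun x => ⟨r'.i x, ?_⟩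
      exact congrArg (fun f => f.hom x) r'.retract

/-- Finite global dimension turns every object into a bounded complex of finitely generated
projectives, which the regular module builds. The building lemma lives in the unbounded derived
category, so the thick envelope W is replaced by its essential image W' there; this image is closed
under retracts because `boundedFD` is. -/
lemma isGenerator_regularDb [Module.Finite k A] [FinGlobalDim Aᵐᵒᵖ] :
    IsGenerator (regularDb k A) := by
  have : (ObjectProperty.singleton (regularDb k A)).Nonempty := inferInstance
  let W := (ObjectProperty.singleton (regularDb k A)).triangEnvelope
  let W' : ObjectProperty (DMod Aᵐᵒᵖ) := (W.ι ⋙ (boundedFD k A).ι).essImage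
  have : W'.IsTriangulated := inferInstance
  have hW' (X : Db k A) : W' X.obj ↔ W X := by
    constructor
    · rintro ⟨Y, ⟨e⟩⟩
      exact W.prop_of_iso ((boundedFD k A).fullyFaithfulι.preimageIso e) Y.property
    · intro h
      exact ⟨⟨X, h⟩, ⟨Iso.refl _⟩⟩
  have : W'.IsStableUnderRetracts := ⟨by
    rintro X Y r hY
    obtain ⟨Z, ⟨e⟩⟩ := id hY
    have hYb : boundedFD k A Y := (boundedFD k A).prop_of_iso e Z.obj.property
    have hXb : boundedFD k A X := (boundedFD k A).prop_of_retract r hYb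
    exact (hW' ⟨X, hXb⟩).2 (W.prop_of_retract
      (⟨ObjectProperty.homMk r.i, ObjectProperty.homMk r.r,
        (boundedFD k A).hom_ext r.retract⟩ : Retract (⟨X, hXb⟩ : Db k A) ⟨Y, hYb⟩) ((hW' ⟨Y, hYb⟩).1 hY))⟩
  have hR : W' ((DerivedCategory.singleFunctor _ 0).obj (ModuleCat.of Aᵐᵒᵖ Aᵐᵒᵖ)) :=
    W'.prop_of_iso ((DerivedCategory.singleFunctor _ 0).mapIso (opRegularEquiv A).toModuleIso.symm)
      ((hW' (regularDb k A)).2 (ObjectProperty.le_triangEnvelope _ _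
        ((ObjectProperty.singleton_iff _ _).2 rfl)))
  refine eq_top_iff.2 fun X _ => (hW' X).1 ?_
  have := isNoetherianRing_op (A := A) k
  obtain ⟨⟨K, hK⟩, ⟨e⟩⟩ := boundedFG_le_essImage _ (boundedFD_eq.le _ X.property)
  obtain ⟨K : CochainComplex _ _, rfl⟩ := K.quotient_obj_surjective
  exact W'.prop_of_iso ((DerivedCategory.quotientCompQhIso _).symm.app K ≪≫ e)
    (((strictPerfectHo_quotient_iff K).1 hK).prop_of_regular W' hR)

end generator

/-! ### The Serre functor is the Nakayama functor; powers of the Serre functor -/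

section serreNakayama
variable (k : Type u) [Field k] (A : Type u) [Ring A] [Algebra k A]
open scoped ModuleCat TensorProduct
open MulOpposite

/-- The base change action on a module given by an action is the original one. -/
lemma modOfAct_smul_base {k : Type u} [Field k] {W : Type u} [Ring W] [Algebra k W] {V : Type u}
    [AddCommGroup V] [Module k V] (ρ : W →ₐ[k] Module.End k V) (c : k) (v : V) :
    (c • (show modOfAct ρ from v) : modOfAct ρ) = (c • v : V) := by
  change ρ (algebraMap k W c) v = c • v
  simp [Module.algebraMap_end_apply]

/-- The elements of the bimodule `A^*` as functionals. -/
def toDual : dualBimod k A ≃ₗ[k] Module.Dual k A where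
  toFun ξ := ξ
  invFun ξ := ξ
  map_add' _ _ := rfl
  map_smul' c ξ := modOfAct_smul_base _ c (show Module.Dual k A from ξ)
  left_inv _ := rfl
  right_inv _ := rfl

variable {k A}

lemma dualLeft_commute_dualRight (a : A) (b : Aᵐᵒᵖ) :
    Commute (dualLeft k A a) (dualRight k A b) := by
  ext ξ x
  simp [dualLeft, dualRight, mul_assoc]

lemma toDual_leftAct (a : A) (ξ : dualBimod k A) (x : A) :
    toDual k A (leftAct (dualBimod k A) a ξ) x = toDual k A ξ (x * a) := by
  change (Algebra.TensorProduct.lift (dualLeft k A) (dualRight k A)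
    dualLeft_commute_dualRight (a ⊗ₜ (1 : Aᵐᵒᵖ)))
    (toDual k A ξ) x = _
  rw [Algebra.TensorProduct.lift_tmul, map_one]
  rfl

lemma toDual_rightAct (a : A) (ξ : dualBimod k A) (x : A) :
    toDual k A (rightAct (dualBimod k A) (op a) ξ) x = toDual k A ξ (a * x) := by
  change (Algebra.TensorProduct.lift (dualLeft k A) (dualRight k A)
    dualLeft_commute_dualRight ((1 : A) ⊗ₜ op a))
    (toDual k A ξ) x = _
  rw [Algebra.TensorProduct.lift_tmul, map_one]
  rfl

section
variable {V V' W : Type u} [AddCommGroup V] [Module k V] [AddCommGroup V'] [Module k V']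
  [AddCommGroup W] [Module k W]

/-- The linear map on `V ⊗_A W` defined by a balanced bilinear map. -/
def BalTensor.lift {r : Aᵐᵒᵖ →ₐ[k] Module.End k V} {l : A →ₐ[k] Module.End k W}
    (f : V →ₗ[k] W →ₗ[k] V') (h : ∀ v a w, f (r (op a) v) w = f v (l a w)) :
    BalTensor r l →ₗ[k] V' :=
  (balancedRel r l).liftQ (TensorProduct.lift f) (by
    unfold balancedRel
    rw [Submodule.span_le]
    rintro _ ⟨v, a, w, rfl⟩
    simp [h])

/-- Pure tensors as a bilinear map. -/
def BalTensor.mk (r : Aᵐᵒᵖ →ₐ[k] Module.End k V) (l : A →ₐ[k] Module.End k W) :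
    V →ₗ[k] W →ₗ[k] BalTensor r l :=
  LinearMap.mk₂ k (BalTensor.tmul r l) (BalTensor.add_tmul r l) (BalTensor.smul_tmul r l)
    (BalTensor.tmul_add r l) (BalTensor.tmul_smul r l)

lemma BalTensor.mk_apply (r : Aᵐᵒᵖ →ₐ[k] Module.End k V) (l : A →ₐ[k] Module.End k W)
    (v : V) (w : W) : BalTensor.mk r l v w = BalTensor.tmul r l v w := rfl

lemma BalTensor.tmul_balanced (r : Aᵐᵒᵖ →ₐ[k] Module.End k V) (l : A →ₐ[k] Module.End k W)
    (v : V) (a : A) (w : W) :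
    BalTensor.tmul r l (r (op a) v) w = BalTensor.tmul r l v (l a w) :=
  (Submodule.Quotient.eq _).2 (Submodule.subset_span ⟨v, a, w, rfl⟩)

end

/-- The map `M ⊗_A A^* ⟶ Hom_A(M, A)^*`, `m ⊗ ξ ↦ (g ↦ ξ(g(m)))`. -/
def tensorDualToNak (M : ModuleCat.{u} Aᵐᵒᵖ) :
    BalTensor (actOf (k := k) M) (leftAct (dualBimod k A)) →ₗ[k]
      Module.Dual k (M →ₗ[Aᵐᵒᵖ] A) :=
  BalTensor.lift
    (LinearMap.mk₂ k (fun (m : M) (ξ : dualBimod k A) =>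
        (toDual k A ξ).comp
          ({ toFun := fun g => g m
             map_add' := fun _ _ => rfl
             map_smul' := fun _ _ => rfl } : (M →ₗ[Aᵐᵒᵖ] A) →ₗ[k] A))
      (fun m m' ξ => by ext g; simp)
      (fun c m ξ => by
        ext g
        have : g (c • m) = c • g m := (g.restrictScalars k).map_smul c m
        exact (congrArg (toDual k A ξ) this).trans (map_smul _ _ _))
      (fun m ξ ξ' => by ext g; simp)
      (fun c m ξ => by ext g; simp))
    (fun m a ξ => by
      ext g
      have h1 : g (actOf (k := k) M (op a) m) = g m * a := g.map_smul (op a) m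
      change toDual k A ξ (g (actOf (k := k) M (op a) m)) =
        toDual k A (leftAct (dualBimod k A) a ξ) (g m)
      rw [h1, toDual_leftAct])

lemma tensorDualToNak_act (M : ModuleCat.{u} Aᵐᵒᵖ) (w : Aᵐᵒᵖ)
    (x : BalTensor (actOf (k := k) M) (leftAct (dualBimod k A))) :
    tensorDualToNak M (tensorDualAct k A M w x) = nakAct k M w (tensorDualToNak M x) := by
  change (tensorDualToNak M ∘ₗ tensorDualAct k A M w) x =
    (nakAct k M w ∘ₗ tensorDualToNak M) x
  congr 1
  refine BalTensor.hom_ext fun m ξ => LinearMap.ext fun g => ?_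
  obtain ⟨a, rfl⟩ := op_surjective w
  change toDual k A (rightAct (dualBimod k A) (op a) ξ) (g m) = toDual k A ξ (a * g m)
  exact toDual_rightAct a ξ _

variable (k A) in
/-- The natural transformation `M ⊗_A A^* ⟶ Hom_A(M, A)^*`. -/
def tensorDualNat : tensorDual k A ⟶ nakayama k A where
  app M := homOfAct (tensorDualToNak M) (tensorDualToNak_act M)
  naturality M M' f := by
    refine (homOfAct_comp _ _ _ _).trans (Eq.trans ?_ (homOfAct_comp _ _ _ _).symm)
    refine homOfAct_congr _ _ ?_
    exact BalTensor.hom_ext fun m ξ => rfl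

lemma isIso_homOfAct {W : Type u} [Ring W] [Algebra k W] {V V' : Type u} [AddCommGroup V]
    [Module k V] [AddCommGroup V'] [Module k V'] {ρ : W →ₐ[k] Module.End k V}
    {ρ' : W →ₐ[k] Module.End k V'} (f : V →ₗ[k] V') (hf : ∀ w v, f (ρ w v) = ρ' w (f v))
    (h : Function.Bijective f) : IsIso (homOfAct f hf) := by
  have : Mono (homOfAct f hf) := (ModuleCat.mono_iff_injective _).2 h.1
  have : Epi (homOfAct f hf) := (ModuleCat.epi_iff_surjective _).2 h.2
  exact isIso_of_mono_of_epi _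

/-- Finitely generated projective modules have dual bases. -/
lemma exists_dualBasis {R : Type u} [Ring R] (M : ModuleCat.{u} R) [Projective M]
    [Module.Finite R M] :
    ∃ (n : ℕ) (x : Fin n → M) (f : Fin n → (M →ₗ[R] R)), ∀ m, m = ∑ s, f s m • x s := by
  have : Module.Projective R M := (IsProjective.iff_projective M).2 inferInstance
  obtain ⟨n, f, g, -, -, h⟩ := Module.Finite.exists_comp_eq_id_of_projective R M
  refine ⟨n, fun s => f (Pi.single s 1), fun s => LinearMap.proj s ∘ₗ g, fun m => ?_⟩
  have h1 : f (g m) = m := LinearMap.congr_fun h m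
  conv_lhs => rw [← h1, pi_eq_sum_univ' (g m), map_sum]
  refine Finset.sum_congr rfl fun s _ => ?_
  rw [map_smul]
  rfl

/-- With a dual basis (x_s, F_s) of M, the inverse sends η to the sum of x_s ⊗ (a ↦ η(a F_s)). One
composite is the identity by the expansion of m in the basis and balancedness of the tensor product,
the other by the expansion of g ∈ Hom_A(M, A) as the sum of g(x_s) F_s. -/
lemma isIso_tensorDualNat (M : ModuleCat.{u} Aᵐᵒᵖ) [Projective M] [Module.Finite Aᵐᵒᵖ M] :
    IsIso ((tensorDualNat k A).app M) := by
  obtain ⟨n, x, f, hxf⟩ := exists_dualBasis M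
  let F (s : Fin n) : M →ₗ[Aᵐᵒᵖ] A := (opRegularEquiv A).toLinearMap ∘ₗ f s
  have hxF (m : M) : m = ∑ s, op (F s m) • x s := hxf m
  let mulF (s : Fin n) : A →ₗ[k] (M →ₗ[Aᵐᵒᵖ] A) :=
    { toFun := fun a => a • F s
      map_add' := fun a b => add_smul a b _
      map_smul' := fun c a => smul_assoc c a _ }
  let inv : Module.Dual k (M →ₗ[Aᵐᵒᵖ] A) →ₗ[k]
      BalTensor (actOf (k := k) M) (leftAct (dualBimod k A)) :=
    ∑ s, BalTensor.mk _ _ (x s) ∘ₗ (toDual k A).symm.toLinearMap ∘ₗ Module.Dual.transpose (mulF s)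
  refine isIso_homOfAct _ _ (Function.bijective_iff_has_inverse.2 ⟨inv, fun z => ?_, fun η => ?_⟩)
  · suffices h : inv ∘ₗ tensorDualToNak M = LinearMap.id from LinearMap.congr_fun h z
    refine BalTensor.hom_ext fun m ξ => ?_
    have h1 (s : Fin n) : (toDual k A).symm (Module.Dual.transpose (mulF s)
        (tensorDualToNak M (BalTensor.tmul (actOf (k := k) M) (leftAct (dualBimod k A)) m ξ))) =
        leftAct (dualBimod k A) (F s m) ξ := by
      refine (toDual k A).injective (LinearMap.ext fun a => ?_)
      rw [toDual_leftAct]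
      rfl
    simp only [inv, LinearMap.comp_apply, LinearMap.sum_apply, LinearEquiv.coe_coe, h1,
      LinearMap.id_apply, BalTensor.mk_apply]
    conv_rhs => rw [hxF m]
    rw [← BalTensor.mk_apply, map_sum, LinearMap.sum_apply]
    refine Finset.sum_congr rfl fun s _ => ?_
    exact (BalTensor.tmul_balanced _ _ _ _ _).symm
  · refine LinearMap.ext fun g => ?_
    have h1 : g = ∑ s, g (x s) • F s := by
      refine LinearMap.ext fun m => ?_
      conv_lhs => rw [hxF m, map_sum]
      rw [LinearMap.sum_apply]
      refine Finset.sum_congr rfl fun s _ => ?_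
      rw [map_smul]
      rfl
    simp only [inv, LinearMap.sum_apply, map_sum, LinearMap.comp_apply]
    conv_rhs => rw [h1, map_sum]
    rfl

section
variable {N N' : ModuleCat.{u} Aᵐᵒᵖ ⥤ ModuleCat.{u} Aᵐᵒᵖ} [N.Additive] [N'.Additive]

lemma isIso_mapHomotopyCategory_app (α : N ⟶ N')
    {K : CochainComplex (ModuleCat.{u} Aᵐᵒᵖ) ℤ} (h : ∀ i, IsIso (α.app (K.X i))) :
    IsIso ((NatTrans.mapHomotopyCategory α (ComplexShape.up ℤ)).app
      ((HomotopyCategory.quotient _ _).obj K)) := by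
  have (i : ℤ) : IsIso (((NatTrans.mapHomologicalComplex α (ComplexShape.up ℤ)).app K).f i) := h i
  have : IsIso ((NatTrans.mapHomologicalComplex α (ComplexShape.up ℤ)).app K) :=
    HomologicalComplex.Hom.isIso_of_components _
  exact inferInstanceAs (IsIso ((HomotopyCategory.quotient _ _).map
    ((NatTrans.mapHomologicalComplex α (ComplexShape.up ℤ)).app K)))

variable [Module.Finite k A] [FinGlobalDim Aᵐᵒᵖ]
/-- The derived functors of two additive functors which agree on finitely generated projective
modules agree. -/
lemma nonempty_leftDerivedDb_iso (α : N ⟶ N')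
    (hα : ∀ M : ModuleCat.{u} Aᵐᵒᵖ, Projective M → Module.Finite Aᵐᵒᵖ M → IsIso (α.app M))
    (hN : ∀ M : ModuleCat.{u} Aᵐᵒᵖ, Module.Finite Aᵐᵒᵖ M → Module.Finite Aᵐᵒᵖ (N.obj M))
    (hN' : ∀ M : ModuleCat.{u} Aᵐᵒᵖ, Module.Finite Aᵐᵒᵖ M → Module.Finite Aᵐᵒᵖ (N'.obj M)) :
    Nonempty (leftDerivedDb k A N hN ≅ leftDerivedDb k A N' hN') := by
  let β := Functor.whiskerLeft (strictPerfectHo Aᵐᵒᵖ).ι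
    (Functor.whiskerRight (NatTrans.mapHomotopyCategory α (ComplexShape.up ℤ))
      (DerivedCategory.Qh (C := ModuleCat.{u} Aᵐᵒᵖ)))
  have hβ (K : KbProj Aᵐᵒᵖ) : IsIso (β.app K) := by
    obtain ⟨K, hK⟩ := K
    obtain ⟨K : CochainComplex _ _, rfl⟩ := K.quotient_obj_surjective
    have h := ((strictPerfectHo_quotient_iff K).1 hK).2.2
    have := isIso_mapHomotopyCategory_app α (K := K) fun i => hα _ (h i).1 (h i).2
    exact inferInstanceAs (IsIso ((DerivedCategory.Qh (C := ModuleCat.{u} Aᵐᵒᵖ)).map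
      ((NatTrans.mapHomotopyCategory α (ComplexShape.up ℤ)).app
        ((HomotopyCategory.quotient _ _).obj K))))
  have : IsIso β := NatIso.isIso_of_isIso_app β
  exact ⟨Functor.isoWhiskerLeft _
    (NatIso.ofComponents (fun K => (boundedFD k A).isoMk ((asIso β).app K))
      (fun f => (boundedFD k A).hom_ext (β.naturality f)))⟩

variable (k A) in
lemma nonempty_serre_iso_nakayama : Nonempty (serreFunctor k A ≅ nakayamaFunctor k A) :=
  nonempty_leftDerivedDb_iso (tensorDualNat k A)
    (fun M _ _ => isIso_tensorDualNat M) _ _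

end

section iter
variable {C D : Type*} [Category* C] [Category* D]

lemma iter_congr {F G : C ⥤ C} (e : F ≅ G) (n : ℕ) : Nonempty (iter F n ≅ iter G n) := by
  induction n with
  | zero => exact ⟨Iso.refl _⟩
  | succ n ih => exact ⟨Functor.isoWhiskerRight ih.some F ≪≫ Functor.isoWhiskerLeft _ e⟩

lemma iter_add (F : C ⥤ C) (m n : ℕ) : iter F (m + n) = iter F m ⋙ iter F n := by
  induction n with
  | zero => rfl
  | succ n ih => exact congrArg (· ⋙ F) ih

/-- The isomorphism on p-th powers holds only after the embedding J into a larger category, so the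
powers of H accumulate on the far side of J. The exponent r + p m is the shape produced by division
with remainder. -/
lemma iter_comp_of_iso {F : C ⥤ C} {H : D ⥤ D} {J : C ⥤ D} {p : ℕ}
    (e : iter F p ⋙ J ≅ J ⋙ H) (r m : ℕ) :
    Nonempty (iter F (r + p * m) ⋙ J ≅ iter F r ⋙ J ⋙ iter H m) := by
  induction m with
  | zero => exact ⟨Iso.refl _⟩
  | succ m ih =>
    have h : r + p * (m + 1) = (r + p * m) + p := by ring
    rw [h, iter_add]
    exact ⟨Functor.associator _ _ _ ≪≫ Functor.isoWhiskerLeft _ e ≪≫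
      (Functor.associator _ _ _).symm ≪≫ Functor.isoWhiskerRight ih.some H⟩

end iter

variable [Module.Finite k A] [FinGlobalDim Aᵐᵒᵖ]

variable (k) in
/-- The endofunctor `φ^*[q]` of `D(A)`. -/
abbrev twistShift (φ : A ≃ₐ[k] A) (q : ℤ) : DMod Aᵐᵒᵖ ⥤ DMod Aᵐᵒᵖ :=
  (twist k A φ).mapDerivedCategory ⋙ shiftFunctor (DMod Aᵐᵒᵖ) q

/-- The powers of the Serre functor of a twisted Calabi-Yau algebra. -/
lemma IsTwistedCY.exists_iter_serre_iso {p : ℕ} {q : ℤ} (h : IsTwistedCY k A p q) :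
    ∃ φ : A ≃ₐ[k] A, ∀ r m : ℕ, Nonempty
      (iter (serreFunctor k A) (r + p * m) ⋙ (boundedFD k A).ι ≅
        iter (serreFunctor k A) r ⋙ (boundedFD k A).ι ⋙ iter (twistShift k φ q) m) := by
  obtain ⟨-, φ, ⟨e⟩⟩ := h
  obtain ⟨e'⟩ := iter_congr (nonempty_serre_iso_nakayama k A).some p
  exact ⟨φ, fun r m => iter_comp_of_iso (Functor.isoWhiskerRight e' _ ≪≫ e) r m⟩

end serreNakayama

/-! ### Cohomology of derived functors; morphisms out of a projective module -/

section homology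
universe v₁ v₂ u₁ u₂ w₁ w₂
variable {C : Type u₁} [Category.{v₁} C] [Abelian C] {D : Type u₂} [Category.{v₂} D] [Abelian D]

/-- An exact functor commutes with the homology of complexes. -/
def mapHomologicalComplexHomologyIso (F : C ⥤ D) [F.Additive] [PreservesFiniteLimits F]
    [PreservesFiniteColimits F] (i : ℤ) :
    F.mapHomologicalComplex (ComplexShape.up ℤ) ⋙ HomologicalComplex.homologyFunctor D _ i ≅
      HomologicalComplex.homologyFunctor C _ i ⋙ F :=
  NatIso.ofComponents (fun K => (K.sc i).mapHomologyIso F)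
    (fun f => ShortComplex.mapHomologyIso_hom_naturality
      ((HomologicalComplex.shortComplexFunctor C (ComplexShape.up ℤ) i).map f) F)

/-- Naturality in the functor rather than in the complex. Left multiplications are endomorphisms of
the functor `toRight`, and this moves them through cohomology. -/
lemma mapHomologicalComplexHomologyIso_natTrans {F G : C ⥤ D} [F.Additive]
    [PreservesFiniteLimits F] [PreservesFiniteColimits F] [G.Additive] [PreservesFiniteLimits G]
    [PreservesFiniteColimits G] (τ : F ⟶ G) (i : ℤ) (K : CochainComplex C ℤ) :
    HomologicalComplex.homologyMap
        ((NatTrans.mapHomologicalComplex τ (ComplexShape.up ℤ)).app K) i ≫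
      (mapHomologicalComplexHomologyIso G i).hom.app K =
    (mapHomologicalComplexHomologyIso F i).hom.app K ≫ τ.app (K.homology i) := by
  let S := K.sc i
  have h : ShortComplex.homologyMap (S.mapNatTrans τ) ≫ (S.mapHomologyIso G).hom =
      (S.mapHomologyIso F).hom ≫ τ.app S.homology := by
    rw [ShortComplex.homologyMap_mapNatTrans, Category.assoc, Category.assoc, Iso.inv_hom_id,
      Category.comp_id]
  exact h

variable [HasDerivedCategory.{w₁} C] [HasDerivedCategory.{w₂} D]

/-- An exact functor commutes with the homology functors on derived categories. -/
def mapDerivedCategoryHomologyIso (F : C ⥤ D) [F.Additive] [PreservesFiniteLimits F]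
    [PreservesFiniteColimits F] (i : ℤ) :
    F.mapDerivedCategory ⋙ DerivedCategory.homologyFunctor D i ≅
      DerivedCategory.homologyFunctor C i ⋙ F :=
  letI : Localization.Lifting DerivedCategory.Q
      (HomologicalComplex.quasiIso C (ComplexShape.up ℤ))
      (DerivedCategory.Q ⋙ F.mapDerivedCategory ⋙ DerivedCategory.homologyFunctor D i)
      (F.mapDerivedCategory ⋙ DerivedCategory.homologyFunctor D i) := ⟨Iso.refl _⟩
  letI : Localization.Lifting DerivedCategory.Q
      (HomologicalComplex.quasiIso C (ComplexShape.up ℤ))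
      (DerivedCategory.Q ⋙ DerivedCategory.homologyFunctor C i ⋙ F)
      (DerivedCategory.homologyFunctor C i ⋙ F) := ⟨Iso.refl _⟩
  Localization.liftNatIso DerivedCategory.Q (HomologicalComplex.quasiIso C (ComplexShape.up ℤ))
    (DerivedCategory.Q ⋙ F.mapDerivedCategory ⋙ DerivedCategory.homologyFunctor D i)
    (DerivedCategory.Q ⋙ DerivedCategory.homologyFunctor C i ⋙ F) _ _
    (Functor.isoWhiskerRight F.mapDerivedCategoryFactors (DerivedCategory.homologyFunctor D i) ≪≫
      Functor.isoWhiskerLeft (F.mapHomologicalComplex _)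
        (DerivedCategory.homologyFunctorFactors D i) ≪≫
      mapHomologicalComplexHomologyIso F i ≪≫
      Functor.isoWhiskerRight (DerivedCategory.homologyFunctorFactors C i).symm F)

/-- A chain map from a projective stalk is a P-valued cycle. If it dies in cohomology it lands in
the boundaries, and projectivity lifts it through the preceding differential; the lift is a null
homotopy. -/
lemma Q_map_eq_zero_of_homologyMap_eq_zero {P : C} [Projective P] {K : CochainComplex C ℤ}
    (g : (CochainComplex.singleFunctor C 0).obj P ⟶ K)
    (hg : HomologicalComplex.homologyMap g 0 = 0) : DerivedCategory.Q.map g = 0 := by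
  obtain ⟨f, hf⟩ := CochainComplex.HomComplex.Cochain.fromSingleMk_surjective
    (CochainComplex.HomComplex.Cochain.ofHom g) 0 (add_zero 0)
  let e : P ⟶ ((CochainComplex.singleFunctor C 0).obj P).X 0 :=
    (HomologicalComplex.singleObjXSelf (ComplexShape.up ℤ) 0 P).inv
  have hfe : f = e ≫ g.f 0 := by
    have := congrArg (CochainComplex.HomComplex.Cochain.fromSingleEquiv (add_zero 0)) hf
    rw [CochainComplex.HomComplex.Cochain.fromSingleEquiv_fromSingleMk] at this
    exact this.trans (congrArg (e ≫ ·) (CochainComplex.HomComplex.Cochain.ofHom_v g 0))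
  have hd : e ≫ ((CochainComplex.singleFunctor C 0).obj P).d 0 1 = 0 :=
    (HomologicalComplex.isZero_single_obj_X (ComplexShape.up ℤ) 0 P 1 (by simp)).eq_of_tgt _ _
  let c := HomologicalComplex.liftCycles _ e 1 (by simp) hd
  have hc : (c ≫ HomologicalComplex.cyclesMap g 0) ≫ K.homologyπ 0 = 0 := by
    rw [Category.assoc, ← HomologicalComplex.homologyπ_naturality, hg, comp_zero, comp_zero]
  have hex : (ShortComplex.mk (K.toCycles (-1) 0) (K.homologyπ 0) (by simp)).Exact :=
    ShortComplex.exact_of_g_is_cokernel _ (K.homologyIsCokernel (-1) 0 (by simp))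
  let y := hex.liftFromProjective _ hc
  have hy : y ≫ K.toCycles (-1) 0 = c ≫ HomologicalComplex.cyclesMap g 0 :=
    hex.liftFromProjective_comp _ hc
  have hyf : y ≫ K.d (-1) 0 = f := by
    have := congrArg (· ≫ K.iCycles 0) hy
    simp only [Category.assoc, HomologicalComplex.toCycles_i, HomologicalComplex.cyclesMap_i] at this
    rw [this, ← Category.assoc, HomologicalComplex.liftCycles_i, hfe]
  have hh : Homotopy g 0 := (CochainComplex.HomComplex.Cochain.equivHomotopy g 0).symm
    ⟨CochainComplex.HomComplex.Cochain.fromSingleMk y (by simp), by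
      rw [CochainComplex.HomComplex.Cochain.δ_fromSingleMk y _ 0 0 (add_zero 0), hyf, hf]
      simp⟩
  exact (DerivedCategory.Q_map_eq_of_homotopy C hh).trans (DerivedCategory.Q.map_zero _ _)

/-- A morphism from a projective object in the derived category is determined by its effect on
homology. -/
lemma eq_zero_of_homologyFunctor_map_eq_zero {P : C} [Projective P] {X : DerivedCategory C}
    (f : (DerivedCategory.singleFunctor C 0).obj P ⟶ X)
    (hf : (DerivedCategory.homologyFunctor C 0).map f = 0) : f = 0 := by
  let K := DerivedCategory.Q.objPreimage X
  let e : DerivedCategory.Q.obj K ≅ X := DerivedCategory.Q.objObjPreimageIso X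
  let L := (CochainComplex.singleFunctor C 0).obj P
  have : L.IsKProjective := by
    have (n : ℤ) : Projective (L.X n) := by
      by_cases hn : n = 0
      · subst hn
        exact Projective.of_iso (HomologicalComplex.singleObjXSelf (ComplexShape.up ℤ) 0 P).symm ‹_›
      · exact (HomologicalComplex.isZero_single_obj_X (ComplexShape.up ℤ) 0 P n hn).projective
    exact CochainComplex.isKProjective_of_projective L 0
  let e₁ : DerivedCategory.Q.obj L ≅ (DerivedCategory.singleFunctor C 0).obj P :=
    ((DerivedCategory.singleFunctorIsoCompQ C 0).app P).symm
  obtain ⟨g', hg'⟩ := (CochainComplex.IsKProjective.Qh_map_bijective L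
    ((HomotopyCategory.quotient _ _).obj K)).2
      ((DerivedCategory.quotientCompQhIso C).hom.app L ≫ e₁.hom ≫ f ≫ e.inv ≫
        (DerivedCategory.quotientCompQhIso C).inv.app K)
  obtain ⟨g, rfl⟩ := (HomotopyCategory.quotient _ _).map_surjective g'
  have hg : DerivedCategory.Q.map g = e₁.hom ≫ f ≫ e.inv := by
    have := DerivedCategory.quotientCompQhIso_hom_naturality g
    rw [hg'] at this
    rw [← cancel_epi ((DerivedCategory.quotientCompQhIso C).hom.app L)]
    simpa using this.symm
  have hg0 : DerivedCategory.Q.map g = 0 := by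
    refine Q_map_eq_zero_of_homologyMap_eq_zero g ?_
    have h1 := DerivedCategory.homologyFunctorFactors_hom_naturality g 0
    rw [hg, Functor.map_comp, Functor.map_comp, hf, zero_comp, comp_zero, zero_comp] at h1
    exact (cancel_epi ((DerivedCategory.homologyFunctorFactors C 0).hom.app L)).1
      (h1.symm.trans comp_zero.symm)
  rw [hg0] at hg
  have : e₁.inv ≫ (e₁.hom ≫ f ≫ e.inv) ≫ e.hom = f := by simp
  rw [← this, ← hg, zero_comp, comp_zero]

end homology

/-! ### Towers in subcategories, and the cohomology a tower must see -/

section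
variable {C : Type*} [Category* C] [Preadditive C] [HasZeroObject C] [HasShift C ℤ]
  [∀ n : ℤ, (shiftFunctor C n).Additive] [Pretriangulated C]

lemma HasTower.prop (P : ObjectProperty C) [P.IsTriangulated] [P.IsClosedUnderIsomorphisms]
    {E X : C} {l : List ℤ} (h : HasTower E X l) (hE : P E) : P X := by
  induction h with
  | zero X h0 => exact P.prop_of_isZero h0
  | step X Y n l f g h hT hX ih => exact P.ext_of_isTriangulatedClosed₂ _ hT ih (P.le_shift n _ hE)

lemma splitTower.lift (P : ObjectProperty C) [P.IsTriangulated] [P.IsClosedUnderIsomorphisms]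
    {E X : P.FullSubcategory} {l : List ℤ} (h : splitTower E.obj l X.obj) : splitTower E l X := by
  obtain ⟨Y, hY, ⟨r⟩⟩ := h
  have hPY : P Y := hY.prop P E.property
  exact ⟨⟨Y, hPY⟩, hY.lift P hPY, ⟨ObjectProperty.homMk r.i, ObjectProperty.homMk r.r,
    P.hom_ext r.retract⟩⟩

lemma splitTower.ι (P : ObjectProperty C) [P.IsTriangulated] [P.IsClosedUnderIsomorphisms]
    {E X : P.FullSubcategory} {l : List ℤ} (h : splitTower E l X) : splitTower E.obj l X.obj := by
  obtain ⟨Y, hY, ⟨r⟩⟩ := h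
  exact ⟨Y.obj, hY.map P.ι, ⟨r.map P.ι⟩⟩

end

section
universe v₁ u₁ w₁
variable {C : Type u₁} [Category.{v₁} C] [Abelian C] [HasDerivedCategory.{w₁} C]

lemma isZero_of_isZero_homology (X : DerivedCategory C)
    (h : ∀ i : ℤ, IsZero ((DerivedCategory.homologyFunctor C i).obj X)) : IsZero X := by
  have h1 : X.IsLE 0 := (DerivedCategory.isLE_iff X 0).2 fun i _ => h i
  have h2 : X.IsGE 1 := (DerivedCategory.isGE_iff X 1).2 fun i _ => h i
  exact DerivedCategory.TStructure.t.isZero X 0 1 (by lia)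

lemma homologyFunctor_shift_isZero_iff (X : DerivedCategory C) (n i j : ℤ) (h : n + i = j) :
    IsZero ((DerivedCategory.homologyFunctor C i).obj (X⟦n⟧)) ↔
      IsZero ((DerivedCategory.homologyFunctor C j).obj X) :=
  ((((DerivedCategory.homologyFunctor C 0).shiftIso n i j h).app X).isZero_iff)

lemma homologyFunctor_single_isZero (M : C) (j : ℤ) (h : j ≠ 0) :
    IsZero ((DerivedCategory.homologyFunctor C j).obj
      ((DerivedCategory.singleFunctor C 0).obj M)) := by
  rcases lt_or_gt_of_ne h with h | h
  · exact DerivedCategory.isZero_of_isGE _ 0 j h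
  · exact DerivedCategory.isZero_of_isLE _ 0 j h

def homologySingleIso (M : C) : (DerivedCategory.homologyFunctor C 0).obj
    ((DerivedCategory.singleFunctor C 0).obj M) ≅ M :=
  (DerivedCategory.homologyFunctor _ 0).mapIso
        ((DerivedCategory.singleFunctorIsoCompQ _ 0).app M) ≪≫
        (DerivedCategory.homologyFunctorFactors _ 0).app _ ≪≫
        (HomologicalComplex.homologyFunctorSingleIso C _ 0).app M

/-- The layer M[n] has cohomology only in degree -n, so if -j is absent from the list, the long
exact sequences force H^j to vanish at every stage. All lower bounds for complexities come from
this. -/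
lemma neg_mem_of_splitTower {M : C} {X : DerivedCategory C} {l : List ℤ}
    (h : splitTower ((DerivedCategory.singleFunctor C 0).obj M) l X) {j : ℤ}
    (hj : ¬ IsZero ((DerivedCategory.homologyFunctor C j).obj X)) : -j ∈ l := by
  obtain ⟨Y, hY, ⟨r⟩⟩ := h
  replace hj : ¬ IsZero ((DerivedCategory.homologyFunctor C j).obj Y) := fun h0 => hj (by
    let r' := r.map (DerivedCategory.homologyFunctor C j)
    rw [IsZero.iff_id_eq_zero, ← r'.retract, h0.eq_of_tgt r'.i 0, zero_comp])
  clear r X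
  induction hY with
  | zero X h0 => exact (hj (Functor.map_isZero _ h0)).elim
  | step X Y n l f g h hT hX ih =>
    by_contra hmem
    rw [List.mem_cons, not_or] at hmem
    have h1 : IsZero ((DerivedCategory.homologyFunctor C j).obj X) := by
      by_contra h0
      exact hmem.2 (ih h0)
    have h3 : IsZero ((DerivedCategory.homologyFunctor C j).obj
        (((DerivedCategory.singleFunctor C 0).obj M)⟦n⟧)) :=
      (homologyFunctor_shift_isZero_iff _ n j _ rfl).2
        (homologyFunctor_single_isZero M _ fun h => hmem.1 (by lia))
    exact hj ((DerivedCategory.HomologySequence.exact₂ _ hT j).isZero_X₂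
      (h1.eq_of_src _ _) (h3.eq_of_tgt _ _))
end

/-! ### The effect of twisting and shifting on cohomology and towers -/

section twist
open scoped ModuleCat TensorProduct
open MulOpposite
variable {k : Type u} [Field k] {A : Type u} [Ring A] [Algebra k A] (φ : A ≃ₐ[k] A) (q : ℤ)

def twistShiftHomologyIso (i : ℤ) :
    twistShift k φ q ⋙ DerivedCategory.homologyFunctor _ i ≅
      DerivedCategory.homologyFunctor _ (q + i) ⋙ twist k A φ :=
  Functor.isoWhiskerLeft (twist k A φ).mapDerivedCategory
    ((DerivedCategory.homologyFunctor (ModuleCat.{u} Aᵐᵒᵖ) 0).shiftIso q i (q + i) rfl) ≪≫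
    mapDerivedCategoryHomologyIso (twist k A φ) (q + i)

lemma nonempty_iter_twistShift_homology_iso (m : ℕ) (i j : ℤ) (h : j = m * q + i) :
    Nonempty (iter (twistShift k φ q) m ⋙ DerivedCategory.homologyFunctor _ i ≅
      DerivedCategory.homologyFunctor _ j ⋙ iter (twist k A φ) m) := by
  induction m generalizing i with
  | zero =>
    obtain rfl : j = i := by simpa using h
    exact ⟨Iso.refl _⟩
  | succ m ih =>
    obtain ⟨e⟩ := ih (q + i) (by rw [h]; push_cast; ring)
    exact ⟨Functor.isoWhiskerLeft (iter (twistShift k φ q) m) (twistShiftHomologyIso φ q i) ≪≫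
      Functor.isoWhiskerRight e (twist k A φ)⟩

lemma iter_twist_isZero_iff (m : ℕ) (M : ModuleCat.{u} Aᵐᵒᵖ) :
    IsZero ((iter (twist k A φ) m).obj M) ↔ IsZero M := by
  induction m with
  | zero => rfl
  | succ m ih =>
    rw [← ih]
    exact ⟨fun h => IsZero.of_full_of_faithful_of_isZero (twist k A φ) _ h,
      fun h => Functor.map_isZero (twist k A φ) h⟩

lemma iter_twistShift_homology_isZero_iff (m : ℕ) (X : DMod Aᵐᵒᵖ) (i j : ℤ)
    (h : j = m * q + i) :
    IsZero ((DerivedCategory.homologyFunctor _ i).obj ((iter (twistShift k φ q) m).obj X)) ↔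
      IsZero ((DerivedCategory.homologyFunctor _ j).obj X) := by
  obtain ⟨e⟩ := nonempty_iter_twistShift_homology_iso φ q m i j h
  exact (e.app X).isZero_iff.trans (iter_twist_isZero_iff φ m _)

/-- Twisting fixes the regular module, so a tower over A stays a tower over A after twisting. -/
def twistRegularIso : (twist k A φ).obj (ModuleCat.of Aᵐᵒᵖ A) ≅ ModuleCat.of Aᵐᵒᵖ A :=
  let M : ModuleCat.{u} Aᵐᵒᵖ := (twist k A φ).obj (ModuleCat.of Aᵐᵒᵖ A)
  let e : M ≃ₗ[Aᵐᵒᵖ] A :=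
    { toFun := fun a => φ.symm a
      invFun := fun a => φ a
      left_inv := fun a => φ.apply_symm_apply a
      right_inv := fun a => φ.symm_apply_apply a
      map_add' := fun a b => map_add φ.symm a b
      map_smul' := fun b a => by
        induction b using MulOpposite.rec' with
        | h b =>
          change φ.symm ((show A from a) * φ b) = φ.symm (show A from a) * b
          exact (map_mul φ.symm _ _).trans (congrArg _ (φ.symm_apply_apply b)) }
  e.toModuleIso

/-- Twisting a tower over `A`. -/
lemma splitTower.iter_twistShift [Module.Finite k A] {X : DMod Aᵐᵒᵖ} {l : List ℤ}
    (h : splitTower (regularDb k A).obj l X) (m : ℕ) :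
    splitTower (regularDb k A).obj (l.map (· + m * q)) ((iter (twistShift k φ q) m).obj X) := by
  induction m with
  | zero => 
    have : l.map (· + ((0 : ℕ) : ℤ) * q) = l := by simp
    rw [this]
    exact h
  | succ m ih =>
    obtain ⟨Y, hY, ⟨r⟩⟩ := ih
    let e : (twist k A φ).mapDerivedCategory.obj (regularDb k A).obj ≅ (regularDb k A).obj :=
      ((twist k A φ).mapDerivedCategorySingleFunctor 0).app _ ≪≫
        (DerivedCategory.singleFunctor _ 0).mapIso (twistRegularIso φ)
    have := ((hY.map (twist k A φ).mapDerivedCategory).of_iso_left e).shift q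
    have hl : (l.map (· + m * q)).map (· + q) = l.map (· + ((m + 1 : ℕ) : ℤ) * q) := by
      rw [List.map_map]
      refine List.map_congr_left fun n _ => ?_
      simp only [Function.comp_apply]
      push_cast
      ring
    rw [hl] at this
    exact ⟨_, this, ⟨r.map (twistShift k φ q)⟩⟩

end twist

/-! ### Dévissage of morphisms along towers -/

section
variable {C : Type*} [Category* C] [Preadditive C] [HasZeroObject C] [HasShift C ℤ]
  [∀ n : ℤ, (shiftFunctor C n).Additive] [Pretriangulated C]

omit [HasZeroObject C] [Pretriangulated C] in
lemma eq_zero_of_shift {E Z : C} {n j : ℤ} (h : ∀ f : E ⟶ Z⟦j - n⟧, f = 0)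
    (g : E⟦n⟧ ⟶ Z⟦j⟧) : g = 0 := by
  let e : Z⟦j⟧ ≅ (Z⟦j - n⟧)⟦n⟧ := (shiftFunctorAdd' C (j - n) n j (by lia)).app Z
  obtain ⟨f, hf⟩ := (shiftFunctor C n).map_surjective (g ≫ e.hom)
  rw [← cancel_mono e.hom, zero_comp, ← hf, h f, Functor.map_zero]

/-- Hom(-, Z[j]) is exact in the middle on triangles, and by shifting back the layer E[n]
contributes Hom(E, Z[j - n]). -/
lemma HasTower.hom_eq_zero {E W Z : C} {l : List ℤ} (h : HasTower E W l) {j : ℤ}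
    (H : ∀ n ∈ l, ∀ f : E ⟶ Z⟦j - n⟧, f = 0) (f : W ⟶ Z⟦j⟧) : f = 0 := by
  induction h with
  | zero W h0 => exact h0.eq_of_src _ _
  | step X Y n l u v w hT hX ih =>
    obtain ⟨g, rfl⟩ := Triangle.yoneda_exact₂ _ hT f
      (ih (fun n hn => H n (List.mem_cons_of_mem _ hn)) (u ≫ f))
    have hg : g = 0 := eq_zero_of_shift (H n List.mem_cons_self) g
    subst hg
    exact comp_zero

lemma splitTower.hom_eq_zero {E W Z : C} {l : List ℤ} (h : splitTower E l W) {j : ℤ}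
    (H : ∀ n ∈ l, ∀ f : E ⟶ Z⟦j - n⟧, f = 0) (f : W ⟶ Z⟦j⟧) : f = 0 := by
  obtain ⟨Y, hY, ⟨r⟩⟩ := h
  rw [← Category.id_comp f, ← r.retract, Category.assoc,
    HasTower.hom_eq_zero hY H (r.r ≫ f), comp_zero]

lemma splitTower.isZero {E X : C} {l : List ℤ} (h : splitTower E l X) (hE : IsZero E) :
    IsZero X := by
  rw [IsZero.iff_id_eq_zero]
  let e := (shiftFunctorZero C ℤ).app X
  have h0 := h.hom_eq_zero (j := 0) (fun n _ f => hE.eq_of_src f 0) e.inv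
  rw [← cancel_mono e.inv, Category.id_comp, h0, zero_comp]

/-- A generator has a nonzero morphism to some shift of any nonzero object. -/
lemma IsGenerator.exists_hom_ne_zero [IsTriangulated C] {G Z : C} (hG : IsGenerator G)
    (hZ : ¬ IsZero Z) : ∃ (i : ℤ) (f : G ⟶ Z⟦i⟧), f ≠ 0 := by
  by_contra! H
  obtain ⟨l, hl⟩ := hG.exists_splitTower Z
  let e := (shiftFunctorZero C ℤ).app Z
  have h0 := hl.hom_eq_zero (j := 0) (fun n _ f => H _ f) e.inv
  exact hZ ((IsZero.iff_id_eq_zero _).2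
    (by rw [← cancel_mono e.inv, Category.id_comp, h0, zero_comp]))

end

/-! ### Sequences at bounded distance from a linear function -/

section limits
open Filter Topology

variable {x : ℕ → EReal} {c C : ℝ}

lemma tendsto_ereal_div (h : ∀ n, ∃ y : ℝ, x n = y ∧ |y - n * c| ≤ C) :
    Tendsto (fun n : ℕ => x n / (n : EReal)) atTop (𝓝 (c : EReal)) := by
  choose y hy hyC using h
  have h1 : Tendsto (fun n : ℕ => y n / n) atTop (𝓝 c) := by
    rw [tendsto_iff_dist_tendsto_zero]
    refine squeeze_zero' (.of_forall fun _ => dist_nonneg) ?_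
      (tendsto_const_div_atTop_nhds_zero_nat C)
    filter_upwards [eventually_gt_atTop 0] with n hn
    have hn' : (0 : ℝ) < n := by exact_mod_cast hn
    rw [Real.dist_eq, div_sub' hn'.ne', abs_div, abs_of_pos hn']
    exact div_le_div_of_nonneg_right (hyC n) hn'.le
  refine ((continuous_coe_real_ereal.tendsto c).comp h1).congr fun n => ?_
  rw [hy n]
  rfl

/-- A bounded error is also negligible against log n, so the estimate that yields the entropy gives
the polynomial entropy as well. -/
lemma tendsto_ereal_sub_div_log (h : ∀ n, ∃ y : ℝ, x n = y ∧ |y - n * c| ≤ C) :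
    Tendsto (fun n : ℕ => (x n - (n : EReal) * (c : EReal)) / ((Real.log n : ℝ) : EReal))
      atTop (𝓝 0) := by
  choose y hy hyC using h
  have h1 : Tendsto (fun n : ℕ => (y n - n * c) / Real.log n) atTop (𝓝 0) := by
    have hlog : Tendsto (fun n : ℕ => C / Real.log n) atTop (𝓝 0) :=
      tendsto_const_nhds.div_atTop (Real.tendsto_log_atTop.comp tendsto_natCast_atTop_atTop)
    refine squeeze_zero_norm' ?_ hlog
    filter_upwards [eventually_gt_atTop 1] with n hn
    have hn' : 0 < Real.log n := Real.log_pos (by exact_mod_cast hn)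
    rw [Real.norm_eq_abs, abs_div, abs_of_pos hn']
    exact div_le_div_of_nonneg_right (hyC n) hn'.le
  refine ((continuous_coe_real_ereal.tendsto 0).comp h1).congr fun n => ?_
  rw [hy n]
  rfl

lemma exists_real_of_bounds {z : EReal} {a b : ℝ} (h : (a : EReal) ≤ z) (h' : z ≤ (b : EReal)) :
    ∃ y : ℝ, z = y ∧ a ≤ y ∧ y ≤ b := by
  induction z with
  | bot => simp at h
  | top => simp at h'
  | coe y => exact ⟨y, rfl, by exact_mod_cast h, by exact_mod_cast h'⟩

lemma exists_exp_of_bounds {z : ENNReal} {a b a' : ℝ}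
    (h : ENNReal.ofReal (Real.exp a) ≤ ENNReal.ofReal (Real.exp a') * z)
    (h' : z ≤ ENNReal.ofReal (Real.exp b)) :
    ∃ y : ℝ, ENNReal.log z = y ∧ a - a' ≤ y ∧ y ≤ b := by
  refine exists_real_of_bounds ?_ ?_
  · have := ENNReal.log_le_log h
    rw [ENNReal.log_mul_add, ENNReal.log_ofReal_of_pos (Real.exp_pos _),
      ENNReal.log_ofReal_of_pos (Real.exp_pos _), Real.log_exp, Real.log_exp] at this
    rw [EReal.coe_sub]
    exact EReal.sub_le_of_le_add' this
  · have := ENNReal.log_le_log h'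
    rwa [ENNReal.log_ofReal_of_pos (Real.exp_pos _), Real.log_exp] at this

lemma exists_ofReal_exp {z : ENNReal} (h0 : z ≠ 0) (h : z ≠ ⊤) :
    ∃ a : ℝ, z = ENNReal.ofReal (Real.exp a) :=
  ⟨Real.log z.toReal, by
    rw [Real.exp_log (ENNReal.toReal_pos h0 h), ENNReal.ofReal_toReal h]⟩

/-- Bounds on each residue class modulo `p` give a bound. -/
lemma exists_abs_sub_le_of_mod {p : ℕ} (hp : 0 < p) {Q : ℝ} {P : ℕ → ℝ → Prop}
    (h : ∀ r, ∃ a : ℝ, ∀ m : ℕ, ∀ y, P (r + p * m) y → |y - m * Q| ≤ a) :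
    ∃ C : ℝ, ∀ n y, P n y → |y - n * (Q / p)| ≤ C := by
  choose a ha using h
  -- For each residue r the constant absorbs the error a r and the difference r (Q / p) between n (Q
  -- / p) and (n / p) Q, where n / p is the integral quotient in the latter. Summing over residues
  -- replaces taking a maximum.
  refine ⟨∑ r ∈ Finset.range p, (|a r| + |r * (Q / p)|), fun n y hy => ?_⟩
  have hp' : (p : ℝ) ≠ 0 := by positivity
  have hn : n % p + p * (n / p) = n := Nat.mod_add_div n p
  have h1 := ha (n % p) (n / p) y (by rwa [hn])
  have h2 : (n : ℝ) * (Q / p) = (n % p : ℕ) * (Q / p) + (n / p : ℕ) * Q := by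
    conv_lhs => rw [← hn]
    push_cast
    field_simp
  have h3 : |a (n % p)| + |((n % p : ℕ) : ℝ) * (Q / p)| ≤
      ∑ r ∈ Finset.range p, (|a r| + |r * (Q / p)|) :=
    Finset.single_le_sum (f := fun r : ℕ => |a r| + |(r : ℝ) * (Q / p)|)
      (fun r _ => by positivity) (Finset.mem_range.2 (Nat.mod_lt n hp))
  have h4 := abs_sub (y - (n / p : ℕ) * Q) ((n % p : ℕ) * (Q / p))
  have h5 : y - n * (Q / p) = (y - (n / p : ℕ) * Q) - (n % p : ℕ) * (Q / p) := by rw [h2]; ring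
  rw [h5]
  linarith [le_abs_self (a (n % p))]

end limits

/-! ### Entropy, polynomial entropy and Serre dimensions of the Serre functor -/

section entropy
open scoped ModuleCat TensorProduct
open MulOpposite Filter Topology

lemma iter_map_zero {C : Type*} [Category* C] [HasZeroMorphisms C] (F : C ⥤ C)
    [F.PreservesZeroMorphisms] (n : ℕ) (X Y : C) : (iter F n).map (0 : X ⟶ Y) = 0 := by
  induction n with
  | zero => rfl
  | succ n ih => exact (congrArg F.map ih).trans (F.map_zero _ _)

variable {k : Type u} [Field k] {A : Type u} [Ring A] [Algebra k A]
variable [Module.Finite k A] 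

lemma regularDb_not_isZero [Nontrivial A] : ¬ IsZero (regularDb k A) := by
  intro h
  have h1 : IsZero ((DerivedCategory.homologyFunctor (ModuleCat.{u} Aᵐᵒᵖ) 0).obj
    (regularDb k A).obj) := Functor.map_isZero _ (Functor.map_isZero (boundedFD k A).ι h)
  have h2 : IsZero (ModuleCat.of Aᵐᵒᵖ A) := h1.of_iso (homologySingleIso _).symm
  have := ModuleCat.subsingleton_of_isZero h2
  exact not_subsingleton A this

omit [Module.Finite k A] in
lemma isZero_of_isZero_homology_db (X : Db k A)
    (h : ∀ i : ℤ, IsZero ((DerivedCategory.homologyFunctor _ i).obj X.obj)) : IsZero X := by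
  have := isZero_of_isZero_homology X.obj h
  rw [IsZero.iff_id_eq_zero] at this ⊢
  exact (boundedFD k A).hom_ext this

/-- Morphisms out of a projective module are detected by cohomology, so Hom(A, Z[i]) vanishes
together with H^i(Z). -/
lemma regularDb_hom_eq_zero {Z : Db k A} {i : ℤ}
    (h : IsZero ((DerivedCategory.homologyFunctor _ i).obj Z.obj))
    (f : regularDb k A ⟶ Z⟦i⟧) : f = 0 := by
  let e : (Z⟦i⟧).obj ≅ Z.obj⟦i⟧ := ((boundedFD k A).ι.commShiftIso i).app Z
  have h1 : f.hom ≫ e.hom = 0 := eq_zero_of_homologyFunctor_map_eq_zero _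
    (((homologyFunctor_shift_isZero_iff Z.obj i 0 i (add_zero i)).2 h).eq_of_tgt _ _)
  exact (boundedFD k A).hom_ext ((cancel_mono e.hom).1 (h1.trans zero_comp.symm))

omit [Module.Finite k A] in
lemma Db.exists_homology_bound (X : Db k A) : ∃ K : ℤ, ∀ j : ℤ,
    ¬ IsZero ((DerivedCategory.homologyFunctor _ j).obj X.obj) → |j| ≤ K := by
  obtain ⟨⟨⟨⟨a, ha⟩, ⟨b, hb⟩⟩, -⟩⟩ : Nonempty (boundedFD k A X.obj) := ⟨X.property⟩
  have : X.obj.IsGE a := ha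
  have : X.obj.IsLE b := hb
  refine ⟨|a| + |b|, fun j hj => ?_⟩
  have h1 : a ≤ j := by
    by_contra! h
    exact hj (X.obj.isZero_of_isGE a j h)
  have h2 : j ≤ b := by
    by_contra! h
    exact hj (X.obj.isZero_of_isLE b j h)
  rw [abs_le]
  have := neg_abs_le a
  have := le_abs_self b
  have := abs_nonneg a
  have := abs_nonneg b
  constructor <;> linarith

variable [FinGlobalDim Aᵐᵒᵖ] {p : ℕ} {q : ℤ}

omit [FinGlobalDim Aᵐᵒᵖ] in
lemma IsGenerator.not_isZero [Nontrivial A] {G : Db k A} (hG : IsGenerator G) : ¬ IsZero G := by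
  obtain ⟨l, hl⟩ := hG.exists_splitTower (regularDb k A)
  exact fun h => regularDb_not_isZero (hl.isZero h)

/-- If S^n X were zero, so would be S^{pn} X, as pn ≥ n; but the latter is X up to twist and shift,
and neither operation can kill cohomology. -/
lemma IsTwistedCY.iter_serre_not_isZero (h : IsTwistedCY k A p q) {X : Db k A}
    (hX : ¬ IsZero X) (n : ℕ) : ¬ IsZero ((iter (serreFunctor k A) n).obj X) := by
  intro h0
  have hp := h.1
  obtain ⟨φ, hφ⟩ := h.exists_iter_serre_iso
  obtain ⟨e⟩ := hφ 0 n
  -- Additivity of the Serre functor is bypassed: the identity and the zero map of X have the same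
  -- image under S^n, hence under S^{pn}. The comparison with `twistShift`, which preserves zero
  -- morphisms, then gives the vanishing.
  have h1 : (iter (serreFunctor k A) (0 + p * n)).map (𝟙 X) =
      (iter (serreFunctor k A) (0 + p * n)).map 0 := by
    obtain ⟨d, hd⟩ : ∃ d, 0 + p * n = n + d := ⟨p * n - n, by
      have : n ≤ p * n := Nat.le_mul_of_pos_left n hp
      lia⟩
    rw [hd, iter_add]
    exact congrArg (iter (serreFunctor k A) d).map (h0.eq_of_src _ _)
  have h2 : (iter (twistShift k φ q) n).map (𝟙 X.obj) =
      (iter (twistShift k φ q) n).map (0 : X.obj ⟶ X.obj) := by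
    have n1 := e.hom.naturality (𝟙 X)
    have n2 := e.hom.naturality (0 : X ⟶ X)
    have h3 : (iter (serreFunctor k A) (0 + p * n) ⋙ (boundedFD k A).ι).map (𝟙 X) =
      (iter (serreFunctor k A) (0 + p * n) ⋙ (boundedFD k A).ι).map 0 :=
      congrArg (boundedFD k A).ι.map h1
    rw [h3, n2] at n1
    exact ((cancel_epi (e.hom.app X)).1 n1).symm
  rw [iter_map_zero, CategoryTheory.Functor.map_id, ← IsZero.iff_id_eq_zero] at h2
  refine hX (isZero_of_isZero_homology_db X fun j => ?_)
  exact (iter_twistShift_homology_isZero_iff φ q n X.obj (j - n * q) j (by ring)).1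
    (Functor.map_isZero _ h2)

/-- The homology of the powers of the Serre functor, up to a shift, depends only on the residue
class of the exponent. -/
lemma IsTwistedCY.iter_serre_homology_isZero_iff (h : IsTwistedCY k A p q) (X : Db k A)
    (r m : ℕ) {i j : ℤ} (hij : j = m * q + i) :
    IsZero ((DerivedCategory.homologyFunctor _ i).obj
      ((iter (serreFunctor k A) (r + p * m)).obj X).obj) ↔
    IsZero ((DerivedCategory.homologyFunctor _ j).obj ((iter (serreFunctor k A) r).obj X).obj) := by
  obtain ⟨φ, hφ⟩ := h.exists_iter_serre_iso
  obtain ⟨e⟩ := hφ r m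
  exact (((DerivedCategory.homologyFunctor _ i).mapIso (e.app X)).isZero_iff).trans
    (iter_twistShift_homology_isZero_iff φ q m _ i j hij)

/-- S^{r + pm} X is a twist of S^r X shifted by mq, and the twist fixes A; the shifts of a tower
over A are merely translated by mq. -/
lemma IsTwistedCY.splitTower_iter_serre (h : IsTwistedCY k A p q) {X : Db k A} {r : ℕ}
    {l : List ℤ} (hl : splitTower (regularDb k A) l ((iter (serreFunctor k A) r).obj X)) (m : ℕ) :
    splitTower (regularDb k A) (l.map (· + m * q)) ((iter (serreFunctor k A) (r + p * m)).obj X) := by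
  obtain ⟨φ, hφ⟩ := h.exists_iter_serre_iso
  obtain ⟨e⟩ := hφ r m
  refine splitTower.lift _ (ObjectProperty.prop_of_iso _ (e.app X).symm ?_)
  exact (splitTower.ι _ hl).iter_twistShift φ q m

variable [Nontrivial A]

/-- For n = r + pm everything except the translation by mq depends on r alone, so it suffices to
bound the error in each residue class. The list l builds G from A, l' builds A from G, and l''
builds S^r G from A; a, a', a'' are the logarithms of their weights. -/
lemma IsTwistedCY.complexity_bounds (h : IsTwistedCY k A p q) {G : Db k A} (hG : IsGenerator G)
    (t : ℝ) : ∃ C : ℝ, ∀ n, ∃ y : ℝ,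
      ENNReal.log (complexity t G ((iter (serreFunctor k A) n).obj G)) = y ∧
      |y - n * ((q : ℝ) / p * t)| ≤ C := by
  have hA := isGenerator_regularDb k A
  have key (r : ℕ) : ∃ a : ℝ, ∀ m : ℕ, ∃ y : ℝ,
      ENNReal.log (complexity t G ((iter (serreFunctor k A) (r + p * m)).obj G)) = y ∧
      |y - m * (q * t)| ≤ a := by
    obtain ⟨l, hl⟩ := hA.exists_splitTower G
    obtain ⟨l', hl'⟩ := hG.exists_splitTower (regularDb k A)
    obtain ⟨l'', hl''⟩ := hA.exists_splitTower ((iter (serreFunctor k A) r).obj G)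
    have hne {E X : Db k A} (hX : ¬ IsZero X) {l : List ℤ} (hl : splitTower E l X) : l ≠ [] := by
      rintro rfl
      obtain ⟨Y, ⟨_, hY⟩, ⟨s⟩⟩ := hl
      exact hX ((IsZero.iff_id_eq_zero _).2 (by rw [← s.retract, hY.eq_of_tgt s.i 0, zero_comp]))
    have hr := h.iter_serre_not_isZero hG.not_isZero r
    obtain ⟨a, ha⟩ := exists_ofReal_exp (towerWeight_ne_zero t (hne hG.not_isZero hl))
      (towerWeight_ne_top t l)
    obtain ⟨a', ha'⟩ := exists_ofReal_exp (towerWeight_ne_zero t (hne regularDb_not_isZero hl'))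
      (towerWeight_ne_top t l')
    obtain ⟨a'', ha''⟩ := exists_ofReal_exp (towerWeight_ne_zero t (hne hr hl''))
      (towerWeight_ne_top t l'')
    obtain ⟨j, hj⟩ : ∃ j : ℤ, ¬ IsZero ((DerivedCategory.homologyFunctor _ j).obj
        ((iter (serreFunctor k A) r).obj G).obj) := by
      by_contra! H
      exact hr (isZero_of_isZero_homology_db _ H)
    refine ⟨|a| + |j * t| + |a'| + |a''|, fun m => ?_⟩
    set X := (iter (serreFunctor k A) (r + p * m)).obj G with hX
    -- Build A from G, then S^n G from A by the translated list.
    have hup : complexity t G X ≤ ENNReal.ofReal (Real.exp (a' + a'' + m * q * t)) := by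
      refine (complexity_le_mul hl' regularDb_not_isZero).trans ?_
      rw [ha', add_assoc, Real.exp_add, ENNReal.ofReal_mul (Real.exp_pos _).le]
      gcongr
      refine (complexity_le (h.splitTower_iter_serre hl'' m)).trans_eq ?_
      rw [towerWeight_map_add, ha'', Real.exp_add, ENNReal.ofReal_mul (Real.exp_pos _).le]
      push_cast
      rfl
    -- H^j(S^r G) ≠ 0 becomes H^{j - mq}(S^n G) ≠ 0, so every tower over A contains the shift mq - j
    -- and weighs at least e^{(mq - j)t}. Passing from A to G costs the factor e^a.
    have hlow : ENNReal.ofReal (Real.exp (((m * q - j : ℤ) : ℝ) * t)) ≤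
        ENNReal.ofReal (Real.exp a) * complexity t G X := by
      rw [← ha]
      refine le_trans ?_ (complexity_le_mul hl hG.not_isZero)
      rw [complexity_eq]
      refine le_iInf₂ fun l₀ hl₀ => le_towerWeight_of_mem t ?_
      have hj' : ¬ IsZero ((DerivedCategory.homologyFunctor _ (j - m * q)).obj X.obj) := by
        rwa [hX, h.iter_serre_homology_isZero_iff G r m (j := j) (by ring)]
      have := neg_mem_of_splitTower (splitTower.ι _ hl₀) hj'
      rwa [neg_sub] at this
    obtain ⟨y, hy, h1, h2⟩ := exists_exp_of_bounds hlow hup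
    refine ⟨y, hy, ?_⟩
    push_cast at h1
    rw [abs_le]
    constructor
    · nlinarith [le_abs_self a, le_abs_self (j * t : ℝ), abs_nonneg a', abs_nonneg a'']
    · nlinarith [le_abs_self a', le_abs_self a'', abs_nonneg a, abs_nonneg (j * t : ℝ)]
  obtain ⟨C, hC⟩ := exists_abs_sub_le_of_mod h.1 (Q := q * t)
    (P := fun n y => ENNReal.log (complexity t G ((iter (serreFunctor k A) n).obj G)) = (y : EReal))
    (fun r => by
      obtain ⟨a, ha⟩ := key r
      refine ⟨a, fun m y hy => ?_⟩
      obtain ⟨y', hy', hy''⟩ := ha m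
      obtain rfl : y = y' := by exact_mod_cast hy.symm.trans hy'
      exact hy'')
  refine ⟨C, fun n => ?_⟩
  obtain ⟨y, hy, -⟩ := (key (n % p)).choose_spec (n / p)
  rw [Nat.mod_add_div] at hy
  exact ⟨y, hy, by
    have := hC n y hy
    rwa [mul_div_right_comm] at this⟩

lemma IsTwistedCY.tendsto_entropySeq (h : IsTwistedCY k A p q) {G : Db k A} (hG : IsGenerator G)
    (t : ℝ) : Tendsto (entropySeq t G (serreFunctor k A)) atTop
      (𝓝 (((q : ℝ) / (p : ℝ) * t : ℝ) : EReal)) := by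
  obtain ⟨C, hC⟩ := h.complexity_bounds hG t
  exact tendsto_ereal_div hC

lemma IsTwistedCY.entropy_eq (h : IsTwistedCY k A p q) {G : Db k A} (hG : IsGenerator G)
    (t : ℝ) : entropy t G (serreFunctor k A) = (((q : ℝ) / (p : ℝ) * t : ℝ) : EReal) :=
  (h.tendsto_entropySeq hG t).limsup_eq

lemma IsTwistedCY.polyEntropy_eq_zero (h : IsTwistedCY k A p q) {G : Db k A}
    (hG : IsGenerator G) (t : ℝ) : polyEntropy t G (serreFunctor k A) = 0 := by
  obtain ⟨C, hC⟩ := h.complexity_bounds hG t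
  unfold polyEntropy
  rw [h.entropy_eq hG t]
  exact (tendsto_ereal_sub_div_log hC).limsup_eq

/-- Fix a tower of G over A. A nonzero map G → S^n G'[i] forces H^{i - s}(S^n G') ≠ 0 for one of the
finitely many shifts s of the tower, and this cohomology lies at bounded distance from -nq/p.
Existence of such a map uses that G generates and S^n G' is nonzero. -/
lemma IsTwistedCY.homDegrees_bounds (h : IsTwistedCY k A p q) {G G' : Db k A}
    (hG : IsGenerator G) (hG' : IsGenerator G') : ∃ C : ℝ, ∀ n,
      (homDegrees G G' (serreFunctor k A) n).Nonempty ∧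
      ∀ x ∈ homDegrees G G' (serreFunctor k A) n, ∃ y : ℝ, x = y ∧
        |-y - n * ((q : ℝ) / p)| ≤ C := by
  obtain ⟨l, hl⟩ := (isGenerator_regularDb k A).exists_splitTower G
  obtain ⟨C, hC⟩ := exists_abs_sub_le_of_mod h.1 (Q := q)
    -- The degree is recorded as -y, so that y is compared with +n q/p.
    (P := fun n y => ((-y : ℝ) : EReal) ∈ homDegrees G G' (serreFunctor k A) n)
    (fun r => by
      obtain ⟨K, hK⟩ := Db.exists_homology_bound ((iter (serreFunctor k A) r).obj G')
      refine ⟨K + (l.map fun n : ℤ => |(n : ℝ)|).sum, ?_⟩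
      rintro m y ⟨i, ⟨f, hf⟩, hi⟩
      replace hi : (i : ℝ) = -y := EReal.coe_eq_coe_iff.1 hi
      by_contra! hlt
      refine hf (hl.hom_eq_zero (fun n hn f => regularDb_hom_eq_zero ?_ f) f)
      rw [h.iter_serre_homology_isZero_iff G' r m rfl]
      by_contra h0
      have h1 : |((m * q + (i - n) : ℤ) : ℝ)| ≤ K := by exact_mod_cast hK _ h0
      have h2 : |(n : ℝ)| ≤ (l.map fun n : ℤ => |(n : ℝ)|).sum := by
        refine List.single_le_sum ?_ _ (List.mem_map.2 ⟨n, hn, rfl⟩)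
        intro x hx
        obtain ⟨n, -, rfl⟩ := List.mem_map.1 hx
        exact abs_nonneg _
      have h3 : y - m * q = -((m * q + (i - n) : ℤ) : ℝ) - n := by
        push_cast
        rw [hi]
        ring
      have h4 := abs_sub (-((m * q + (i - n) : ℤ) : ℝ)) n
      rw [← h3, abs_neg] at h4
      linarith)
  refine ⟨C, fun n => ⟨?_, ?_⟩⟩
  · obtain ⟨i, f, hf⟩ := hG.exists_hom_ne_zero (h.iter_serre_not_isZero hG'.not_isZero n)
    exact ⟨_, i, ⟨f, hf⟩, rfl⟩
  · rintro x ⟨i, hi, rfl⟩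
    exact ⟨i, rfl, hC n _ ⟨i, hi, by rw [neg_neg]⟩⟩

/-- The degrees form a nonempty subset of an interval of fixed length around -nq/p, so infimum and
supremum both stay within C of its centre. -/
lemma IsTwistedCY.serreDim_eq (h : IsTwistedCY k A p q) {G G' : Db k A}
    (hG : IsGenerator G) (hG' : IsGenerator G') :
    upperSerreDim G G' (serreFunctor k A) = (((q : ℝ) / (p : ℝ) : ℝ) : EReal) ∧
      lowerSerreDim G G' (serreFunctor k A) = (((q : ℝ) / (p : ℝ) : ℝ) : EReal) := by
  obtain ⟨C, hC⟩ := h.homDegrees_bounds hG hG'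
  have hle (n : ℕ) : ∀ x ∈ homDegrees G G' (serreFunctor k A) n,
      ((-(n * ((q : ℝ) / p)) - C : ℝ) : EReal) ≤ x ∧ x ≤ ((-(n * ((q : ℝ) / p)) + C : ℝ) : EReal) := by
    intro x hx
    obtain ⟨y, rfl, hy⟩ := (hC n).2 x hx
    rw [abs_le] at hy
    rw [EReal.coe_le_coe_iff, EReal.coe_le_coe_iff]
    constructor <;> linarith
  have key {x : ℕ → EReal} (hx : ∀ n : ℕ, ((-(n * ((q : ℝ) / p)) - C : ℝ) : EReal) ≤ x n ∧
      x n ≤ ((-(n * ((q : ℝ) / p)) + C : ℝ) : EReal)) :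
      Tendsto (fun n : ℕ => -x n / (n : EReal)) atTop (𝓝 (((q : ℝ) / p : ℝ) : EReal)) := by
    refine tendsto_ereal_div (C := C) fun n => ?_
    obtain ⟨y, hy, h1, h2⟩ := exists_real_of_bounds (hx n).1 (hx n).2
    refine ⟨-y, by rw [hy]; rfl, ?_⟩
    rw [abs_le]
    constructor <;> linarith
  refine ⟨(key fun n => ?_).limsup_eq, (key fun n => ?_).liminf_eq⟩ <;>
    obtain ⟨x, hx⟩ := (hC n).1
  · exact ⟨le_sInf fun y hy => (hle n y hy).1, (sInf_le hx).trans (hle n x hx).2⟩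
  · exact ⟨(hle n x hx).1.trans (le_sSup hx), sSup_le fun y hy => (hle n y hy).2⟩

end entropy

/-! ### A quasi-isomorphism criterion -/

section quasiIso
variable {R : Type u} [Ring R]

/-- The last hypothesis says that the kernel complex is acyclic; the long exact cohomology sequence
does the rest. -/
lemma quasiIso_of_surjective_of_ker {K L : CochainComplex (ModuleCat.{u} R) ℤ} (f : K ⟶ L)
    (hf : ∀ n, Function.Surjective (f.f n))
    (hker : ∀ n (x : K.X n), f.f n x = 0 → K.d n (n + 1) x = 0 →
      ∃ y : K.X (n - 1), K.d (n - 1) n y = x ∧ f.f (n - 1) y = 0) : QuasiIso f := by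
  have (n : ℤ) : Epi (f.f n) := (ModuleCat.epi_iff_surjective _).2 (hf n)
  have : Epi f := HomologicalComplex.epi_of_epi_f f inferInstance
  let S := ShortComplex.mk (kernel.ι f) f (kernel.condition f)
  have hS : S.ShortExact := { exact := ShortComplex.exact_kernel f }
  have hinj (n : ℤ) : Function.Injective ((kernel.ι f).f n) :=
    (ModuleCat.mono_iff_injective _).1 inferInstance
  have hex (n : ℤ) (x : K.X n) (hx : f.f n x = 0) : ∃ y, (kernel.ι f).f n y = x := by
    have h := hS.exact.map (HomologicalComplex.eval _ _ n)
    exact (ShortComplex.moduleCat_exact_iff _).1 h x hx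
  have hK (n : ℤ) : IsZero (S.X₁.homology n) := by
    rw [← HomologicalComplex.exactAt_iff_isZero_homology,
      HomologicalComplex.exactAt_iff' _ (n - 1) n (n + 1) (by simp) (by simp),
      ShortComplex.moduleCat_exact_iff]
    intro (x : (kernel f).X n) (hx : (kernel f).d n (n + 1) x = 0)
    have h1 : f.f n ((kernel.ι f).f n x) = 0 :=
      congrArg (fun g => (g.f n) x) (kernel.condition f)
    have h2 : K.d n (n + 1) ((kernel.ι f).f n x) = 0 := by
      have := congrArg (fun g => g x) ((kernel.ι f).comm n (n + 1))
      exact this.trans ((congrArg ((kernel.ι f).f (n + 1)) hx).trans (map_zero _))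
    obtain ⟨y, hy, hy'⟩ := hker n _ h1 h2
    obtain ⟨z, rfl⟩ := hex _ y hy'
    refine ⟨z, hinj n ?_⟩
    rw [← hy]
    exact (congrArg (fun g => g z) ((kernel.ι f).comm (n - 1) n)).symm
  rw [quasiIso_iff]
  intro n
  rw [quasiIsoAt_iff_isIso_homologyMap]
  have : Mono (HomologicalComplex.homologyMap f n) :=
    (hS.homology_exact₂ n).mono_g ((hK n).eq_of_src _ _)
  have : Epi (HomologicalComplex.homologyMap f n) :=
    (hS.homology_exact₃ n (n + 1) rfl).epi_f ((hK (n + 1)).eq_of_tgt _ _)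
  exact isIso_of_mono_of_epi _

end quasiIso

/-! ### Total complexes and augmentation of the second factor -/

section tensorAug
open HomologicalComplex

variable {R : Type u} [Ring R] {C₁ C₂ : Type*} [Category* C₁] [Category* C₂] [Preadditive C₁]
  [Preadditive C₂] (T : C₁ ⥤ C₂ ⥤ ModuleCat.{u} R) [T.Additive] [∀ X, (T.obj X).Additive]
  (X : CochainComplex C₁ ℤ) (N : CochainComplex C₂ ℤ) {Y : C₂} (π : N.X 0 ⟶ Y)

lemma moduleCat_sum_apply {M M' : ModuleCat.{u} R} {ι : Type*} (s : Finset ι) (f : ι → (M ⟶ M'))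
    (x : M) : (∑ i ∈ s, f i) x = ∑ i ∈ s, f i x := by
  induction s using Finset.cons_induction with
  | empty => rfl
  | cons a s ha ih =>
    rw [Finset.sum_cons, Finset.sum_cons, ← ih]
    rfl

lemma moduleCat_units_smul {M M' : ModuleCat.{u} R} (f : M ⟶ M') (e : ℤˣ) (x : M) :
    f (e • x) = e • f x := map_zsmul f.hom (e : ℤ) x

lemma eq_one_smul_add_smul_of_eq_zero {V : Type*} [AddCommGroup V] (α : V) {β : V} (h : β = 0)
    (e : ℤˣ) : α = (1 : ℤˣ) • α + e • β := by rw [h, smul_zero, add_zero, one_smul]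

/-- A morphism from the degree zero term of a complex, extended by zero. -/
def augComponent (j : ℤ) : N.X j ⟶ Y := if h : j = 0 then (N.XIsoOfEq h).hom ≫ π else 0

lemma augComponent_zero : augComponent N π 0 = π := by
  simp [augComponent]

lemma augComponent_of_ne {j : ℤ} (h : j ≠ 0) : augComponent N π j = 0 := dif_neg h

variable {N π} in
lemma d_augComponent (hπ : N.d (-1) 0 ≫ π = 0) (j j' : ℤ) :
    N.d j j' ≫ augComponent N π j' = 0 := by
  by_cases h : j' = 0
  · subst h
    rw [augComponent_zero]
    by_cases h' : j + 1 = 0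
    · obtain rfl : j = -1 := by lia
      exact hπ
    · rw [N.shape _ _ h', zero_comp]
  · rw [augComponent_of_ne N π h, comp_zero]

/-- The identity between equal degrees, zero otherwise. -/
def eqComponent (i n : ℤ) : X.X i ⟶ X.X n := if h : i = n then (X.XIsoOfEq h).hom else 0

lemma eqComponent_self (n : ℤ) : eqComponent X n n = 𝟙 _ := by simp [eqComponent]

lemma eqComponent_of_ne {i n : ℤ} (h : i ≠ n) : eqComponent X i n = 0 := dif_neg h

variable {N π} in
/-- The morphism from the total complex of `T(X, N)` to `T(X, Y)` given by an augmentation of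
`N`. -/
def tensorAug (hπ : N.d (-1) 0 ≫ π = 0) : mapBifunctor X N T (ComplexShape.up ℤ) ⟶
    ((T.flip.obj Y).mapHomologicalComplex (ComplexShape.up ℤ)).obj X where
  f n := mapBifunctorDesc fun i j _ =>
    (T.obj (X.X i)).map (augComponent N π j) ≫ (T.map (eqComponent X i n)).app Y
  comm' n n' hnn' := by
    refine mapBifunctor.hom_ext fun i j (h : i + j = n) => ?_
    have hnn' : n + 1 = n' := hnn'
    rw [ι_mapBifunctorDesc_assoc, mapBifunctor.d_eq, Preadditive.add_comp, Preadditive.comp_add,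
      mapBifunctor.ι_D₁_assoc, mapBifunctor.ι_D₂_assoc,
      mapBifunctor.d₁_eq X N T (ComplexShape.up ℤ) (i₁ := i) (i₁' := i + 1) rfl j n'
        (show (i + 1) + j = n' by lia),
      mapBifunctor.d₂_eq X N T (ComplexShape.up ℤ) i (i₂ := j) (i₂' := j + 1) rfl n'
        (show i + (j + 1) = n' by lia)]
    simp only [Linear.units_smul_comp, Category.assoc, ι_mapBifunctorDesc]
    have h2 : (T.obj (X.X i)).map (N.d j (j + 1)) ≫ (T.obj (X.X i)).map
        (augComponent N π (j + 1)) ≫ (T.map (eqComponent X i n')).app Y = 0 := by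
      rw [← Functor.map_comp_assoc, d_augComponent hπ, Functor.map_zero, zero_comp]
    have h1 : (T.obj (X.X i)).map (augComponent N π j) ≫ (T.map (eqComponent X i n)).app Y ≫
        (T.map (X.d n n')).app Y = (T.map (X.d i (i + 1))).app (N.X j) ≫
          (T.obj (X.X (i + 1))).map (augComponent N π j) ≫
            (T.map (eqComponent X (i + 1) n')).app Y := by
      rw [← NatTrans.comp_app, ← Functor.map_comp, ← NatTrans.naturality_assoc,
        ← NatTrans.comp_app, ← Functor.map_comp]
      by_cases hj : j = 0
      · obtain rfl : i = n := by lia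
        obtain rfl : i + 1 = n' := by lia
        rw [eqComponent_self, eqComponent_self, Category.id_comp, Category.comp_id]
      · rw [augComponent_of_ne N π hj, Functor.map_zero, zero_comp, zero_comp]
    refine (Category.assoc _ _ _).trans (h1.trans ?_)
    exact eq_one_smul_add_smul_of_eq_zero _ h2 _

variable {X N π} in
lemma ι_tensorAug (hπ : N.d (-1) 0 ≫ π = 0) (i j n : ℤ) (h : i + j = n) :
    ιMapBifunctor X N T (ComplexShape.up ℤ) i j n h ≫ (tensorAug T X hπ).f n =
      (T.obj (X.X i)).map (augComponent N π j) ≫ (T.map (eqComponent X i n)).app Y :=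
  ι_mapBifunctorDesc (K₁ := X) (K₂ := N) (F := T) (c := ComplexShape.up ℤ)
    (A := (T.obj (X.X n)).obj Y) (fun i j _ =>
      (T.obj (X.X i)).map (augComponent N π j) ≫ (T.map (eqComponent X i n)).app Y) i j h

lemma ι_mapBifunctor_d {i i' j j' n n' : ℤ} (h : i + j = n) (hi : i + 1 = i') (hj : j + 1 = j')
    (hn : n + 1 = n') :
    ιMapBifunctor X N T (ComplexShape.up ℤ) i j n h ≫
      (mapBifunctor X N T (ComplexShape.up ℤ)).d n n' =
    (T.map (X.d i i')).app (N.X j) ≫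
      ιMapBifunctor X N T (ComplexShape.up ℤ) i' j n' (show i' + j = n' by lia) +
    (ComplexShape.up ℤ).ε i • ((T.obj (X.X i)).map (N.d j j') ≫
      ιMapBifunctor X N T (ComplexShape.up ℤ) i j' n' (show i + j' = n' by lia)) := by
  rw [mapBifunctor.d_eq, Preadditive.comp_add, mapBifunctor.ι_D₁, mapBifunctor.ι_D₂,
    mapBifunctor.d₁_eq X N T (ComplexShape.up ℤ) (i₁ := i) (i₁' := i') hi j n'
      (show i' + j = n' by lia),
    mapBifunctor.d₂_eq X N T (ComplexShape.up ℤ) i (i₂ := j) (i₂' := j') hj n'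
      (show i + j' = n' by lia)]
  congr 1
  exact one_smul ℤˣ _

/-- The projection onto a term of the total complex. -/
def prMapBifunctor (n i j : ℤ) : (mapBifunctor X N T (ComplexShape.up ℤ)).X n ⟶
    (T.obj (X.X i)).obj (N.X j) :=
  mapBifunctorDesc fun i' j' _ =>
    (T.map (eqComponent X i' i)).app (N.X j') ≫ (T.obj (X.X i)).map (eqComponent N j' j)

lemma ι_prMapBifunctor_self (i j n : ℤ) (h : i + j = n) :
    ιMapBifunctor X N T (ComplexShape.up ℤ) i j n h ≫ prMapBifunctor T X N n i j = 𝟙 _ := by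
  unfold prMapBifunctor
  rw [ι_mapBifunctorDesc, eqComponent_self, eqComponent_self, CategoryTheory.Functor.map_id,
    CategoryTheory.Functor.map_id]
  exact Category.comp_id _

lemma ι_prMapBifunctor_of_ne {i i' j' n : ℤ} (j : ℤ) (h : i' + j' = n) (hi : i' ≠ i) :
    ιMapBifunctor X N T (ComplexShape.up ℤ) i' j' n h ≫ prMapBifunctor T X N n i j = 0 := by
  unfold prMapBifunctor
  rw [ι_mapBifunctorDesc, eqComponent_of_ne X hi, Functor.map_zero]
  exact zero_comp

variable (b : ℤ)
include b

/-- The identity of a term of the total complex of a bounded above complexes. -/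
lemma sum_prMapBifunctor (hX : ∀ i, b < i → IsZero (X.X i)) (hN : ∀ j, 0 < j → IsZero (N.X j))
    (n : ℤ) : ∑ i : Finset.Icc n b, prMapBifunctor T X N n i (n - i) ≫
      ιMapBifunctor X N T (ComplexShape.up ℤ) i (n - i) n (show (i : ℤ) + (n - i) = n by lia) =
        𝟙 _ := by
  refine mapBifunctor.hom_ext fun i j (h : i + j = n) => ?_
  rw [Preadditive.comp_sum, Category.comp_id]
  by_cases hi : i ∈ Finset.Icc n b
  · rw [Finset.sum_eq_single ⟨i, hi⟩]
    · obtain rfl : j = n - i := by lia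
      rw [← Category.assoc, ι_prMapBifunctor_self, Category.id_comp]
    · intro i' _ hi'
      rw [← Category.assoc, ι_prMapBifunctor_of_ne T X N _ _ fun h => hi' (Subtype.ext h.symm),
        zero_comp]
    · exact fun h => (h (Finset.mem_univ _)).elim
  · refine IsZero.eq_of_src ?_ _ _
    rw [Finset.mem_Icc, not_and_or, not_le, not_le] at hi
    rcases hi with hi | hi
    · exact Functor.map_isZero _ (hN j (by lia))
    · exact Functor.map_isZero (T.flip.obj (N.X j)) (hX i hi)

/-- Surjectivity holds because each map T(X^n, π) is surjective. For acyclicity of the kernel, a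
cycle is cleared column by column, the column being the degree i of the first factor: its first
nonzero column is a cycle of an exact augmented row, so a boundary can be subtracted that moves the
first nonzero column one step up. Columns above b vanish, so the process stops. -/
lemma quasiIso_tensorAug (hX : ∀ i, b < i → IsZero (X.X i)) (hN : ∀ j, 0 < j → IsZero (N.X j))
    (hπ : N.d (-1) 0 ≫ π = 0)
    (hsurj : ∀ i, Function.Surjective ((T.obj (X.X i)).map π))
    (hrow : ∀ i j (x : (T.obj (X.X i)).obj (N.X j)), (T.obj (X.X i)).map (N.d j (j + 1)) x = 0 →
      (T.obj (X.X i)).map (augComponent N π j) x = 0 →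
      ∃ y, (T.obj (X.X i)).map (N.d (j - 1) j) y = x) : QuasiIso (tensorAug T X hπ) := by
  let D := mapBifunctor X N T (ComplexShape.up ℤ)
  let inc (i j n : ℤ) (h : i + j = n) := ιMapBifunctor X N T (ComplexShape.up ℤ) i j n h
  let pr (n i j : ℤ) := prMapBifunctor T X N n i j
  have pr_inc (i j n h) (x) : pr n i j (inc i j n h x) = x :=
    congrArg (fun g => g x) (ι_prMapBifunctor_self T X N i j n h)
  have pr_inc_ne (i j n h) (x) (i' j' : ℤ) (hi : i ≠ i') : pr n i' j' (inc i j n h x) = 0 :=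
    congrArg (fun g => g x) (ι_prMapBifunctor_of_ne T X N j' h hi)
  have ε_inc (i j n h) (x) : (tensorAug T X hπ).f n (inc i j n h x) =
      (T.map (eqComponent X i n)).app Y ((T.obj (X.X i)).map (augComponent N π j) x) :=
    congrArg (fun g => g x) (ι_tensorAug T hπ i j n h)
  have d_inc (i i' j j' n n' : ℤ) (h : i + j = n) (hi : i + 1 = i') (hj : j + 1 = j')
      (hn : n + 1 = n') (x) : D.d n n' (inc i j n h x) =
      inc i' j n' (by omega) ((T.map (X.d i i')).app (N.X j) x) +
        (ComplexShape.up ℤ).ε i • inc i j' n' (by omega)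
          ((T.obj (X.X i)).map (N.d j j') x) :=
    congrArg (fun g => g x) (ι_mapBifunctor_d T X N h hi hj hn)
  have hsum (n : ℤ) (x : D.X n) : x = ∑ i : Finset.Icc n b,
      inc i (n - i) n (by omega) (pr n i (n - i) x) := by
    have := congrArg (fun g => g x) (sum_prMapBifunctor T X N b hX hN n)
    rw [moduleCat_sum_apply] at this
    exact this.symm
  refine quasiIso_of_surjective_of_ker _ (fun n y => ?_) fun n x => ?_
  · obtain ⟨x, rfl⟩ := hsurj n y
    refine ⟨inc n 0 n (add_zero n) x, ?_⟩
    rw [ε_inc, eqComponent_self, augComponent_zero]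
    exact congrArg (fun g => (g.app Y) ((T.obj (X.X n)).map π x)) (T.map_id (X.X n))
  -- Here s bounds the first nonzero column from below and m bounds the number b + 1 - s of columns
  -- still to clear. The start s = n is allowed because N vanishes in positive degrees.
  · suffices H : ∀ (m : ℕ) (s : ℤ), b + 1 - s ≤ m → ∀ x : D.X n, (∀ i < s, pr n i (n - i) x = 0) →
        (tensorAug T X hπ).f n x = 0 → D.d n (n + 1) x = 0 →
          ∃ y : D.X (n - 1), D.d (n - 1) n y = x ∧ (tensorAug T X hπ).f (n - 1) y = 0 by
      refine H (b + 1 - n).toNat n (by omega) x fun i hi => ?_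
      have := ModuleCat.subsingleton_of_isZero
        ((T.obj (X.X i)).map_isZero (hN (n - i) (by omega)))
      exact Subsingleton.elim _ _
    intro m
    induction m with
    | zero =>
      intro s hs x hx _ _
      refine ⟨0, ?_, map_zero _⟩
      rw [map_zero, hsum n x]
      refine (Finset.sum_eq_zero fun i _ => ?_).symm
      have := (Finset.mem_Icc.1 i.2).2
      rw [hx i (by omega), map_zero]
    | succ m ih =>
      intro s hs x hx hεx hdx
      by_cases hzero : pr n s (n - s) x = 0
      · refine ih (s + 1) (by omega) x (fun i hi => ?_) hεx hdx
        rcases (Int.lt_add_one_iff.1 hi).lt_or_eq with h | rfl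
        exacts [hx i h, hzero]
      have hsn : n ≤ s := by
        by_contra! h
        have := ModuleCat.subsingleton_of_isZero
          ((T.obj (X.X s)).map_isZero (hN (n - s) (by omega)))
        exact hzero (Subsingleton.elim _ _)
      have hsb : s ≤ b := by
        by_contra! h
        have := ModuleCat.subsingleton_of_isZero
          ((T.flip.obj (N.X (n - s))).map_isZero (hX s h))
        exact hzero (this.elim _ _)
      have hs' : s ∈ Finset.Icc n b := Finset.mem_Icc.2 ⟨hsn, hsb⟩
      -- In position (s, n - s + 1) of dx only the N-differential of column s survives: the other
      -- possible contribution comes from column s - 1, which is zero.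
      have hdz : (T.obj (X.X s)).map (N.d (n - s) (n - s + 1)) (pr n s (n - s) x) = 0 := by
        have h1 : pr (n + 1) s (n - s + 1) (D.d n (n + 1) x) = 0 := by rw [hdx, map_zero]
        rw [hsum n x, map_sum, map_sum, Finset.sum_eq_single ⟨s, hs'⟩] at h1
        · rw [d_inc s (s + 1) (n - s) (n - s + 1) n (n + 1) _ rfl rfl rfl, map_add,
            pr_inc_ne _ _ _ _ _ _ _ (by omega), zero_add, moduleCat_units_smul, pr_inc,
            smul_eq_zero_iff_eq] at h1
          exact h1
        · rintro ⟨i, hi⟩ - hne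
          have hne' : i ≠ s := fun h => hne (Subtype.ext h)
          rw [d_inc i (i + 1) (n - i) (n - i + 1) n (n + 1) _ rfl rfl rfl, map_add,
            moduleCat_units_smul, pr_inc_ne i _ _ _ _ s _ hne', smul_zero, add_zero]
          by_cases h : i + 1 = s
          · rw [hx i (by omega), map_zero, map_zero, map_zero]
          · exact pr_inc_ne _ _ _ _ _ _ _ h
        · exact fun h => (h (Finset.mem_univ _)).elim
      -- For s = n the augmentation of x sees only this component; for s ≠ n the augmentation
      -- component is zero by definition.
      have haz : (T.obj (X.X s)).map (augComponent N π (n - s)) (pr n s (n - s) x) = 0 := by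
        by_cases h : s = n
        · subst h
          rw [hsum s x, map_sum, Finset.sum_eq_single ⟨s, hs'⟩, ε_inc, eqComponent_self] at hεx
          · refine Eq.trans ?_ hεx
            exact (congrArg (fun g => (g.app Y) ((T.obj (X.X s)).map
              (augComponent N π (s - s)) (pr s s (s - s) x))) (T.map_id (X.X s))).symm
          · rintro ⟨i, hi⟩ - hne
            have hne' : i ≠ s := fun h => hne (Subtype.ext h)
            rw [ε_inc, eqComponent_of_ne X hne', Functor.map_zero]
            rfl
          · exact fun h => (h (Finset.mem_univ _)).elim
        · rw [augComponent_of_ne N π (by omega), Functor.map_zero]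
          rfl
      obtain ⟨y₀, hy₀⟩ := hrow s (n - s) _ hdz haz
      -- The sign compensates the one in the total differential, as its square is 1; so d y₁ is the
      -- component of x in column s plus a term in column s + 1.
      let y₁ : D.X (n - 1) := (ComplexShape.up ℤ).ε s • inc s (n - s - 1) (n - 1) (by omega) y₀
      have hy₁ : D.d (n - 1) n y₁ = (ComplexShape.up ℤ).ε s • inc (s + 1) (n - s - 1) n (by omega)
          ((T.map (X.d s (s + 1))).app (N.X (n - s - 1)) y₀) +
            inc s (n - s) n (by omega) (pr n s (n - s) x) := by
        rw [moduleCat_units_smul,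
          d_inc s (s + 1) (n - s - 1) (n - s) (n - 1) n _ rfl (by omega) (by omega), hy₀, smul_add,
          smul_smul, Int.units_mul_self, one_smul]
      have hεy₁ : (tensorAug T X hπ).f (n - 1) y₁ = 0 := by
        rw [moduleCat_units_smul, ε_inc, augComponent_of_ne N π (by omega), Functor.map_zero]
        exact (congrArg (_ • ·) (map_zero _)).trans (smul_zero _)
      have hdd : D.d n (n + 1) (D.d (n - 1) n y₁) = 0 :=
        congrArg (fun g => g y₁) (D.d_comp_d (n - 1) n (n + 1))
      have hεd : (tensorAug T X hπ).f n (D.d (n - 1) n y₁) = 0 := by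
        have := congrArg (fun g => g y₁) ((tensorAug T X hπ).comm (n - 1) n)
        exact this.symm.trans ((congrArg (fun z => ((((T.flip.obj Y).mapHomologicalComplex
          (ComplexShape.up ℤ)).obj X).d (n - 1) n) z) hεy₁).trans (map_zero _))
      obtain ⟨y, hy, hy'⟩ := ih (s + 1) (by omega) (x - D.d (n - 1) n y₁) (fun i hi => by
          rw [map_sub, hy₁, map_add, moduleCat_units_smul, pr_inc_ne _ _ _ _ _ _ _ (by omega),
            smul_zero, zero_add]
          rcases (Int.lt_add_one_iff.1 hi).lt_or_eq with h | rfl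
          · rw [hx i h, pr_inc_ne _ _ _ _ _ _ _ (by omega), sub_zero]
          · rw [pr_inc, sub_self]) (by rw [map_sub, hεx, hεd, sub_zero])
          (by rw [map_sub, hdx, hdd, sub_zero])
      refine ⟨y + y₁, ?_, ?_⟩
      · rw [map_add, hy, sub_add_cancel]
      · rw [map_add, hy', hεy₁, add_zero]

end tensorAug

/-! ### Bimodules as right modules: flatness and projectivity -/

section rightProjective
variable (k : Type u) [Field k] (A : Type u) [Ring A] [Algebra k A]
open scoped ModuleCat TensorProduct
open MulOpposite

/-- The underlying right module of a bimodule. -/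
abbrev toRight : BimodCat k A ⥤ ModuleCat.{u} Aᵐᵒᵖ :=
  ModuleCat.restrictScalars (Algebra.TensorProduct.includeRight : Aᵐᵒᵖ →ₐ[k] Env k A).toRingHom

variable {k A}

/-- The elements of the underlying right module of a bimodule. -/
def toRightEquiv (M : BimodCat k A) : M ≃ₗ[k] (toRight k A).obj M where
  toFun m := m
  invFun m := m
  map_add' _ _ := rfl
  map_smul' c m := by
    change algebraMap k (Env k A) c • m =
      (Algebra.TensorProduct.includeRight (algebraMap k Aᵐᵒᵖ c) : Env k A) • m
    rw [AlgHom.commutes]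
  left_inv _ := rfl
  right_inv _ := rfl

lemma toRightEquiv_rightAct (M : BimodCat k A) (a : Aᵐᵒᵖ) (m : M) :
    toRightEquiv M (rightAct M a m) = a • toRightEquiv M m := rfl

/-- Left multiplication on the underlying right module of a bimodule, as a linear map. -/
def leftMulLin (a : A) (M : BimodCat k A) : (toRight k A).obj M →ₗ[Aᵐᵒᵖ] (toRight k A).obj M where
  toFun m := toRightEquiv M (leftAct M a ((toRightEquiv M).symm m))
  map_add' m m' := by simp
  map_smul' b m := congrArg (toRightEquiv M)
    (LinearMap.congr_fun (leftAct_rightAct_comm M a b) ((toRightEquiv M).symm m))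

/-- Left multiplication as an endomorphism of the functor `toRight`. -/
def leftMul (a : A) : toRight k A ⟶ toRight k A where
  app M := ModuleCat.ofHom (X := (toRight k A).obj M) (Y := (toRight k A).obj M) (leftMulLin a M)
  naturality M M' f := by
    ext m
    exact (linOf_leftAct (k := k) f a m).symm

section flat
variable {M : BimodCat k A} (f : (toRight k A).obj M →ₗ[Aᵐᵒᵖ] Aᵐᵒᵖ)
variable {V : Type u} [AddCommGroup V] [Module k V] (l : A →ₐ[k] Module.End k V)

/-- Contraction with a linear form on the first factor. -/
def BalTensor.contract : BalTensor (rightAct M) l →ₗ[k] V :=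
  BalTensor.lift (LinearMap.mk₂ k (fun m v => l (unop (f (toRightEquiv M m))) v)
      (fun m m' v => by simp) (fun c m v => by
        have : f (c • toRightEquiv M m) = c • f (toRightEquiv M m) :=
          (f.restrictScalars k).map_smul c _
        simp [this])
      (fun m v v' => by simp) (fun c m v => by simp))
    (fun m a v => by
      have : f (toRightEquiv M (rightAct M (op a) m)) = op a * f (toRightEquiv M m) := by
        rw [toRightEquiv_rightAct, map_smul, smul_eq_mul]
      simp [this])

lemma BalTensor.contract_tmul (m : M) (v : V) :
    BalTensor.contract f l (BalTensor.tmul (rightAct M) l m v) =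
      l (unop (f (toRightEquiv M m))) v := rfl

lemma BalTensor.induction_on {W : Type u} [AddCommGroup W] [Module k W]
    {r : Aᵐᵒᵖ →ₐ[k] Module.End k W} {P : BalTensor r l → Prop} (x : BalTensor r l)
    (h : ∀ w v, P (BalTensor.tmul r l w v)) (h0 : P 0) (hadd : ∀ x y, P x → P y → P (x + y)) :
    P x := by
  obtain ⟨x, rfl⟩ := Submodule.Quotient.mk_surjective _ x
  induction x using TensorProduct.induction_on with
  | zero => exact h0
  | tmul w v => exact h w v
  | add x y hx hy => exact hadd _ _ hx hy

/-- The dual basis expansion coming from a section s of the free cover on the set M. It is asserted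
for all larger finite sets so that two tensors can be expanded over a common index set, which the
additive case of the induction needs. -/
lemma BalTensor.exists_eq_sum (s : (toRight k A).obj M →ₗ[Aᵐᵒᵖ] ((toRight k A).obj M →₀ Aᵐᵒᵖ))
    (hs : Finsupp.linearCombination Aᵐᵒᵖ id ∘ₗ s = LinearMap.id)
    (x : BalTensor (rightAct M) l) :
    ∃ S : Finset M, ∀ S', S ⊆ S' → x = ∑ m ∈ S', BalTensor.tmul (rightAct M) l m
      (BalTensor.contract (Finsupp.lapply (toRightEquiv M m) ∘ₗ s) l x) := by
  classical
  induction x using BalTensor.induction_on with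
  | h0 => exact ⟨∅, fun S' _ => by simp [BalTensor.tmul_zero]⟩
  | hadd x y hx hy =>
    obtain ⟨S, hS⟩ := hx
    obtain ⟨T, hT⟩ := hy
    refine ⟨S ∪ T, fun S' hS' => ?_⟩
    conv_lhs => rw [hS S' (Finset.union_subset_left hS'), hT S' (Finset.union_subset_right hS'),
      ← Finset.sum_add_distrib]
    refine Finset.sum_congr rfl fun m _ => ?_
    rw [map_add, BalTensor.tmul_add]
  | h m v =>
    refine ⟨(s (toRightEquiv M m)).support.map (toRightEquiv M).symm.toEquiv.toEmbedding,
      fun S' hS' => ?_⟩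
    have h1 : m = ∑ x ∈ S', rightAct M (s (toRightEquiv M m) (toRightEquiv M x)) x := by
      apply (toRightEquiv M).injective
      have h2 := LinearMap.congr_fun hs (toRightEquiv M m)
      rw [LinearMap.comp_apply, Finsupp.linearCombination_apply, LinearMap.id_apply,
        Finsupp.sum_of_support_subset _ (s := S'.map (toRightEquiv M).toEquiv.toEmbedding)
          (fun x hx => Finset.mem_map.2 ⟨(toRightEquiv M).symm x,
            hS' (Finset.mem_map.2 ⟨x, hx, rfl⟩), rfl⟩) (fun i a => a • id i) (fun _ _ => zero_smul _ _),
        Finset.sum_map] at h2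
      rw [map_sum]
      exact h2.symm
    conv_lhs => rw [h1, ← BalTensor.mk_apply, map_sum, LinearMap.sum_apply]
    refine Finset.sum_congr rfl fun x _ => ?_
    rw [BalTensor.contract_tmul, ← BalTensor.tmul_balanced]
    rfl

/-- Tensoring with a projective right module is exact. -/
lemma BalTensor.exists_map_eq_of_map_eq_zero [Projective ((toRight k A).obj M)]
    {V V' V'' : Type u} [AddCommGroup V] [Module k V] [AddCommGroup V'] [Module k V']
    [AddCommGroup V''] [Module k V''] {l : A →ₐ[k] Module.End k V} {l' : A →ₐ[k] Module.End k V'}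
    {l'' : A →ₐ[k] Module.End k V''} (f : V →ₗ[k] V') (hf : ∀ a v, f (l a v) = l' a (f v))
    (g : V' →ₗ[k] V'') (hg : ∀ a v, g (l' a v) = l'' a (g v))
    (hfg : ∀ v, g v = 0 → ∃ w, f w = v) (x : BalTensor (rightAct M) l')
    (hx : BalTensor.map (r := rightAct M) (r' := rightAct M) LinearMap.id g (fun _ _ => rfl) hg x = 0) :
    ∃ y, BalTensor.map (r := rightAct M) (r' := rightAct M) LinearMap.id f (fun _ _ => rfl) hf y = x := by
  have : Module.Projective Aᵐᵒᵖ ((toRight k A).obj M) :=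
    (IsProjective.iff_projective _).2 inferInstance
  obtain ⟨s, hs⟩ := Module.projective_def'.1 this
  obtain ⟨S, hS⟩ := BalTensor.exists_eq_sum l' s hs x
  have h1 (h : (toRight k A).obj M →ₗ[Aᵐᵒᵖ] Aᵐᵒᵖ) : g (BalTensor.contract h l' x) = 0 := by
    have : g ∘ₗ BalTensor.contract h l' = BalTensor.contract h l'' ∘ₗ
        BalTensor.map (r := rightAct M) (r' := rightAct M) LinearMap.id g (fun _ _ => rfl) hg :=
      BalTensor.hom_ext fun m v => hg _ v
    have := LinearMap.congr_fun this x
    rw [LinearMap.comp_apply, LinearMap.comp_apply, hx, map_zero] at this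
    exact this
  -- Contractions commute with g, so the coefficients of x in the dual basis expansion lie in the
  -- kernel of g and lift through f one at a time.
  choose w hw using fun m : M =>
    hfg _ (h1 (Finsupp.lapply (toRightEquiv M m) ∘ₗ s))
  refine ⟨∑ m ∈ S, BalTensor.tmul (rightAct M) l m (w m), ?_⟩
  conv_rhs => rw [hS S (Finset.Subset.refl _)]
  rw [map_sum]
  refine Finset.sum_congr rfl fun m _ => ?_
  rw [BalTensor.map_tmul, hw, LinearMap.id_apply]

end flat

lemma BalTensor.map_id_surjective {V W W' : Type u} [AddCommGroup V] [Module k V] [AddCommGroup W]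
    [Module k W] [AddCommGroup W'] [Module k W'] {r : Aᵐᵒᵖ →ₐ[k] Module.End k V}
    {l : A →ₐ[k] Module.End k W} {l' : A →ₐ[k] Module.End k W'} (g : W →ₗ[k] W')
    (hg : ∀ a v, g (l a v) = l' a (g v)) (h : Function.Surjective g) :
    Function.Surjective (BalTensor.map (r := r) (r' := r) LinearMap.id g (fun _ _ => rfl) hg) := by
  intro x
  induction x using BalTensor.induction_on with
  | h0 => exact ⟨0, map_zero _⟩
  | hadd x y hx hy =>
    obtain ⟨x, rfl⟩ := hx
    obtain ⟨y, rfl⟩ := hy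
    exact ⟨x + y, map_add _ _ _⟩
  | h m v =>
    obtain ⟨v, rfl⟩ := h v
    exact ⟨BalTensor.tmul r l m v, rfl⟩

section act
variable {W : Type u} [Ring W] [Algebra k W] {V : Type u} [AddCommGroup V] [Module k V]

/-- The underlying space of a module given by an action. -/
def actEquiv (ρ : W →ₐ[k] Module.End k V) : V ≃ₗ[k] modOfAct ρ where
  toFun v := v
  invFun v := v
  map_add' _ _ := rfl
  map_smul' c v := (modOfAct_smul_base ρ c v).symm
  left_inv _ := rfl
  right_inv _ := rfl

/-- A linear map from a module to an action, as a homomorphism of modules. -/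
def homToAct {N : ModuleCat.{u} W} {ρ : W →ₐ[k] Module.End k V} (f : N →ₗ[k] V)
    (hf : ∀ (w : W) (n : N), f (w • n) = ρ w (f n)) : N ⟶ modOfAct ρ :=
  ModuleCat.ofHom (X := N) (Y := modOfAct ρ)
    { toFun := fun n => actEquiv ρ (f n)
      map_add' := fun n n' => by rw [map_add, map_add]
      map_smul' := fun w n => congrArg (actEquiv ρ) (hf w n) }

end act

lemma tmul_smul_eq (N : BimodCat k A) (a : A) (b : Aᵐᵒᵖ) (n : N) :
    (a ⊗ₜ[k] b : Env k A) • n = leftAct N a (rightAct N b n) := by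
  change _ = (a ⊗ₜ[k] 1 : Env k A) • ((1 : A) ⊗ₜ[k] b : Env k A) • n
  rw [smul_smul, Algebra.TensorProduct.tmul_mul_tmul, mul_one, one_mul]

lemma rightAct_tensorBimod_tmul {M N : BimodCat k A} (b : Aᵐᵒᵖ) (m : M) (n : N) :
    rightAct (((tensorBimod k A).obj M).obj N) b (actEquiv (tensorBimodAct M N)
      (BalTensor.tmul (rightAct M) (leftAct N) m n)) =
    actEquiv (tensorBimodAct M N)
      (BalTensor.tmul (rightAct M) (leftAct N) m (rightAct N b n)) := by
  change tensorBimodAct M N (1 ⊗ₜ b) _ = _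
  refine (congrArg (fun e : Module.End k (BalTensor (rightAct M) (leftAct N)) => e _)
    (Algebra.TensorProduct.lift_tmul _ _ _ _ _)).trans ?_
  rw [map_one, one_mul]
  rfl

lemma leftAct_tensorBimod_tmul {M N : BimodCat k A} (a : A) (m : M) (n : N) :
    leftAct (((tensorBimod k A).obj M).obj N) a (actEquiv (tensorBimodAct M N)
      (BalTensor.tmul (rightAct M) (leftAct N) m n)) =
    actEquiv (tensorBimodAct M N)
      (BalTensor.tmul (rightAct M) (leftAct N) (leftAct M a m) n) := by
  change tensorBimodAct M N (a ⊗ₜ 1) _ = _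
  refine (congrArg (fun e : Module.End k (BalTensor (rightAct M) (leftAct N)) => e _)
    (Algebra.TensorProduct.lift_tmul _ _ _ _ _)).trans ?_
  rw [map_one, mul_one]
  rfl

section homBimod
variable (M : BimodCat k A) (W : ModuleCat.{u} Aᵐᵒᵖ)

/-- The bimodule structure on `Hom_k(M, W)`, `(a f b)(m) = f(ma)b`. -/
def homBimodAct : Env k A →ₐ[k] Module.End k (M →ₗ[k] W) :=
  Algebra.TensorProduct.lift
    (AlgHom.ofLinearMap
      { toFun := fun a => LinearMap.lcomp k W (rightAct M (op a))
        map_add' := fun a b => by ext; simp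
        map_smul' := fun c a => by ext; simp }
      (by ext; simp) (fun a b => by ext; simp))
    (AlgHom.ofLinearMap
      { toFun := fun b => LinearMap.compRight k (actOf (k := k) W b)
        map_add' := fun a b => by ext; simp
        map_smul' := fun c a => by ext; simp }
      (by ext; simp) (fun a b => by ext; simp))
    (fun a b => show _ * _ = _ * _ by ext f; simp)

lemma homBimodAct_tmul (a b : A) (f : M →ₗ[k] W) (m : M) :
    homBimodAct M W (a ⊗ₜ op b) f m = op b • f (rightAct M (op a) m) := by
  exact congrArg (fun e : Module.End k (M →ₗ[k] W) => e f m)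
    (Algebra.TensorProduct.lift_tmul _ _ _ _ _)

lemma homBimodAct_left (a : A) (f : M →ₗ[k] W) (m : M) :
    homBimodAct M W (a ⊗ₜ 1) f m = f (rightAct M (op a) m) :=
  (homBimodAct_tmul M W a 1 f m).trans (one_smul _ _)

lemma homBimodAct_right (b : A) (f : M →ₗ[k] W) (m : M) :
    homBimodAct M W (1 ⊗ₜ op b) f m = op b • f m := by
  rw [homBimodAct_tmul, op_one, map_one, Module.End.one_apply]

variable {M W} {N : BimodCat k A}

/-- The right linear map on `M ⊗_A N` underlying a morphism of right modules. -/
def tensorBimodLin (h : (toRight k A).obj (((tensorBimod k A).obj M).obj N) ⟶ W) :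
    BalTensor (rightAct M) (leftAct N) →ₗ[k] W :=
  linOf h ∘ₗ (toRightEquiv _).toLinearMap ∘ₗ (actEquiv (tensorBimodAct M N)).toLinearMap

lemma tensorBimodLin_rightAct (h : (toRight k A).obj (((tensorBimod k A).obj M).obj N) ⟶ W)
    (b : Aᵐᵒᵖ) (m : M) (n : N) :
    tensorBimodLin h (BalTensor.tmul (rightAct M) (leftAct N) m (rightAct N b n)) =
      b • tensorBimodLin h (BalTensor.tmul _ _ m n) := by
  have h1 : b • toRightEquiv (((tensorBimod k A).obj M).obj N) (actEquiv (tensorBimodAct M N)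
      (BalTensor.tmul (rightAct M) (leftAct N) m n)) = toRightEquiv _ (actEquiv _
        (BalTensor.tmul (rightAct M) (leftAct N) m (rightAct N b n))) :=
    (toRightEquiv_rightAct (((tensorBimod k A).obj M).obj N) b _).symm.trans
      (congrArg (toRightEquiv (((tensorBimod k A).obj M).obj N))
        (rightAct_tensorBimod_tmul b m n))
  exact (congrArg h.hom h1).symm.trans (h.hom.map_smul b _)

/-- The adjoint form of a morphism of right modules on `M ⊗_A N`. -/
def homBimodCurry (h : (toRight k A).obj (((tensorBimod k A).obj M).obj N) ⟶ W) :
    N ⟶ modOfAct (homBimodAct M W) :=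
  homToAct ((BalTensor.mk (rightAct M) (leftAct N)).flip.compr₂ (tensorBimodLin h)) (by
    intro w n
    induction w using TensorProduct.induction_on with
    | zero => exact (congrArg _ (zero_smul (Env k A) n)).trans ((map_zero _).trans
        (LinearMap.congr_fun (map_zero (homBimodAct M W)) _).symm)
    | add a b ha hb => rw [add_smul, map_add, map_add, ha, hb]; rfl
    | tmul a b =>
      ext m
      obtain ⟨b, rfl⟩ := op_surjective b
      rw [homBimodAct_tmul, tmul_smul_eq]
      change tensorBimodLin h (BalTensor.tmul _ _ m (leftAct N a (rightAct N (op b) n))) =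
        op b • tensorBimodLin h (BalTensor.tmul _ _ (rightAct M (op a) m) n)
      rw [← tensorBimodLin_rightAct, BalTensor.tmul_balanced])

/-- The morphism of right modules on `M ⊗_A N` given by its adjoint form. -/
def homBimodUncurry (f : N ⟶ modOfAct (homBimodAct M W)) :
    (toRight k A).obj (((tensorBimod k A).obj M).obj N) ⟶ W :=
  let f' : N →ₗ[k] (M →ₗ[k] W) := (actEquiv (homBimodAct M W)).symm.toLinearMap ∘ₗ linOf f
  have hf (w : Env k A) (n : N) : f' (w • n) = homBimodAct M W w (f' n) := f.hom.map_smul w n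
  let g : BalTensor (rightAct M) (leftAct N) →ₗ[k] W := BalTensor.lift f'.flip (fun m a n => by
    have := LinearMap.congr_fun (hf (a ⊗ₜ 1) n) m
    rw [homBimodAct_left] at this
    exact this.symm)
  have hg (b : Aᵐᵒᵖ) (x : BalTensor (rightAct M) (leftAct N)) :
      g (tensorBimodAct M N (1 ⊗ₜ b) x) = b • g x := by
    induction x using BalTensor.induction_on with
    | h0 => rw [map_zero, map_zero, smul_zero]
    | hadd x y hx hy => rw [map_add, map_add, map_add, hx, hy, smul_add]
    | h m n =>
      have h1 := rightAct_tensorBimod_tmul b m n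
      obtain ⟨b, rfl⟩ := op_surjective b
      have := LinearMap.congr_fun (hf (1 ⊗ₜ op b) n) m
      rw [homBimodAct_right] at this
      exact (congrArg g h1).trans this
  ModuleCat.ofHom (X := (toRight k A).obj (((tensorBimod k A).obj M).obj N)) (Y := W)
    { toFun := fun x => g x
      map_add' := fun x y => map_add g x y
      map_smul' := fun b x => hg b x }

lemma toRight_tensorBimod_hom_ext
    {h h' : (toRight k A).obj (((tensorBimod k A).obj M).obj N) ⟶ W}
    (H : ∀ m n, tensorBimodLin h (BalTensor.tmul _ _ m n) =
      tensorBimodLin h' (BalTensor.tmul _ _ m n)) : h = h' := by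
  have h1 : tensorBimodLin h = tensorBimodLin h' := BalTensor.hom_ext H
  ext x
  exact LinearMap.congr_fun h1 x

/-- Tensor-hom adjunction: right linear maps M ⊗_A N → W are bimodule maps N → Hom_k(M, W), and
Hom_k(M, -) preserves surjections because k is a field. -/
lemma projective_toRight_tensorBimod (M N : BimodCat k A) [Projective N] :
    Projective ((toRight k A).obj (((tensorBimod k A).obj M).obj N)) where
  factors {W V} h g hg := by
    have hg' : Function.Surjective g := (ModuleCat.epi_iff_surjective g).1 hg
    let P : modOfAct (homBimodAct M W) ⟶ modOfAct (homBimodAct M V) :=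
      homOfAct (LinearMap.compRight k (linOf (k := k) g)) (by
        intro w f
        induction w using TensorProduct.induction_on with
        | zero => rw [map_zero, map_zero]; exact map_zero _
        | add a b ha hb =>
          rw [map_add, map_add, LinearMap.add_apply, LinearMap.add_apply, map_add, ha, hb]
        | tmul a b =>
          ext m
          obtain ⟨b, rfl⟩ := op_surjective b
          rw [homBimodAct_tmul, LinearMap.compRight_apply, LinearMap.comp_apply, homBimodAct_tmul]
          exact g.hom.map_smul _ _)
    have hP : Epi P := (ModuleCat.epi_iff_surjective P).2 fun f =>
      Module.projective_lifting_property (linOf (k := k) g) (show M →ₗ[k] V from f) hg'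
    refine ⟨homBimodUncurry (Projective.factorThru (homBimodCurry h) P),
      toRight_tensorBimod_hom_ext fun m n => ?_⟩
    have h1 := congrArg (fun e => (show M →ₗ[k] V from e n) m)
      (Projective.factorThru_comp (homBimodCurry h) P)
    exact h1

end homBimod

end rightProjective

/-! ### Exactness of augmented projective resolutions -/

section rows
variable {R : Type u} [Ring R]

lemma exists_d_eq_of_quasiIso {K L : CochainComplex (ModuleCat.{u} R) ℤ} (f : K ⟶ L) [QuasiIso f]
    (i j l : ℤ) (hij : i + 1 = j) (hjl : j + 1 = l) (x : K.X j) (hx : K.d j l x = 0)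
    (hfx : f.f j x = 0) : ∃ y, K.d i j y = x := by
  have h1 : (ShortComplex.mk (K.iCycles j) (K.d j l) (K.iCycles_d j l)).Exact :=
    ShortComplex.exact_of_f_is_kernel _
      (K.cyclesIsKernel j l ((ComplexShape.up ℤ).next_eq' hjl))
  obtain ⟨z, hz⟩ := (ShortComplex.moduleCat_exact_iff _).1 h1 x hx
  change K.iCycles j z = x at hz
  have h2 : HomologicalComplex.cyclesMap f j z = 0 := by
    apply (ModuleCat.mono_iff_injective (L.iCycles j)).1 inferInstance
    refine (congrArg (fun g => g z) (HomologicalComplex.cyclesMap_i f j)).trans ?_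
    refine (congrArg (f.f j) hz).trans (hfx.trans (map_zero _).symm)
  have h3 : K.homologyπ j z = 0 := by
    apply (ModuleCat.mono_iff_injective (HomologicalComplex.homologyMap f j)).1 inferInstance
    refine (congrArg (fun g => g z) (HomologicalComplex.homologyπ_naturality f j)).trans ?_
    exact (congrArg (L.homologyπ j) h2).trans ((map_zero _).trans (map_zero _).symm)
  have h4 : (ShortComplex.mk (K.toCycles i j) (K.homologyπ j) (K.toCycles_comp_homologyπ i j)).Exact :=
    ShortComplex.exact_of_g_is_cokernel _
      (K.homologyIsCokernel i j ((ComplexShape.up ℤ).prev_eq' hij))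
  obtain ⟨y, hy⟩ := (ShortComplex.moduleCat_exact_iff _).1 h4 z h3
  exact ⟨y, (congrArg (fun g => g y) (K.toCycles_i i j)).symm.trans
    ((congrArg (K.iCycles j) hy).trans hz)⟩

variable {Y : ModuleCat.{u} R} (P : ProjectiveResolution Y)

/-- The augmentation of a projective resolution. -/
def resAug : P.cochainComplex.X 0 ⟶ Y := (P.cochainComplexXIso 0 0).hom ≫ P.π.f 0

lemma resAug_comp : resAug P ≫ (HomologicalComplex.singleObjXSelf (.up ℤ) 0 Y).inv = P.π'.f 0 :=
  (Category.assoc _ _ _).trans P.π'_f_zero.symm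

lemma d_resAug : P.cochainComplex.d (-1) 0 ≫ resAug P = 0 := by
  have h : P.cochainComplex.d (-1) 0 ≫ P.π'.f 0 = 0 := by
    rw [← P.π'.comm]
    have : ((CochainComplex.singleFunctor (ModuleCat.{u} R) 0).obj Y).d (-1) 0 = 0 :=
      HomologicalComplex.single_obj_d _ _ _ _ _
    rw [this, comp_zero]
  rw [← resAug_comp] at h
  rw [← cancel_mono (HomologicalComplex.singleObjXSelf (.up ℤ) 0 Y).inv, zero_comp]
  exact (Category.assoc _ _ _).trans h

lemma resAug_surjective : Function.Surjective (resAug P) := by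
  have h : Epi (P.π.f 0) := ProjectiveResolution.instEpiFNatπ P 0
  have : Epi (resAug P) := @epi_comp _ _ _ _ _ (P.cochainComplexXIso 0 0).hom inferInstance
    (show P.complex.X 0 ⟶ Y from P.π.f 0) h
  exact (ModuleCat.epi_iff_surjective _).1 this

/-- Exactness of the augmented resolution, uniformly in j: the augmentation condition has content
only for j = 0. -/
lemma exists_d_eq_of_augComponent (j : ℤ) (x : P.cochainComplex.X j)
    (hx : P.cochainComplex.d j (j + 1) x = 0)
    (hx' : augComponent P.cochainComplex (resAug P) j x = 0) :
    ∃ y, P.cochainComplex.d (j - 1) j y = x := by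
  refine exists_d_eq_of_quasiIso P.π' (j - 1) j (j + 1) (by lia) rfl x hx ?_
  by_cases hj : j = 0
  · subst hj
    rw [augComponent_zero] at hx'
    refine (congrArg (fun g => g x) (resAug_comp P)).symm.trans ?_
    exact (congrArg (HomologicalComplex.singleObjXSelf (.up ℤ) 0 Y).inv hx').trans (map_zero _)
  · have h : IsZero (((CochainComplex.singleFunctor (ModuleCat.{u} R) 0).obj Y).X j) :=
      HomologicalComplex.isZero_single_obj_X _ _ _ _ hj
    have := ModuleCat.subsingleton_of_isZero h
    exact Subsingleton.elim _ _

end rows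

instance preservesFiniteLimits_restrictScalars {R S : Type u} [Ring R] [Ring S] (f : R →+* S) :
    PreservesFiniteLimits (ModuleCat.restrictScalars.{u} f) where
  preservesFiniteLimits J _ _ :=
    { preservesLimit := fun {F} => by
        have : Small.{u} (Functor.sections (F ⋙ forget (ModuleCat.{u} S))) := inferInstance
        infer_instance }

/-! ### Tensor powers of the dual bimodule as complexes of right modules -/

section tensorPow
variable {k : Type u} [Field k] {A : Type u} [Ring A] [Algebra k A]
open scoped ModuleCat TensorProduct
open MulOpposite

variable (k A) in
/-- The elements of the bimodule `A`. -/
def regEquiv : A ≃ₗ[k] regularBimod k A := actEquiv _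

variable (k A) in
lemma lsmul_commute (a : A) (b : Aᵐᵒᵖ) : Commute (Algebra.lsmul k k A a : Module.End k A)
    (Algebra.lsmul k k A b) := by
  ext x
  simp [mul_assoc]

lemma regEquiv_rightAct (a x : A) :
    rightAct (regularBimod k A) (op a) (regEquiv k A x) = regEquiv k A (x * a) := by
  refine (congrArg (fun e : Module.End k A => regEquiv k A (e x))
    (Algebra.TensorProduct.lift_tmul _ _ (lsmul_commute k A) _ _)).trans ?_
  rw [map_one, one_mul]
  rfl

lemma regEquiv_leftAct (a x : A) :
    leftAct (regularBimod k A) a (regEquiv k A x) = regEquiv k A (a * x) := by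
  refine (congrArg (fun e : Module.End k A => regEquiv k A (e x))
    (Algebra.TensorProduct.lift_tmul _ _ (lsmul_commute k A) _ _)).trans ?_
  rw [map_one, mul_one]
  rfl

lemma tensor_induction_homToAct {N : BimodCat k A} {V : Type u} [AddCommGroup V] [Module k V]
    {ρ : Env k A →ₐ[k] Module.End k V} (f : N →ₗ[k] V)
    (h : ∀ a b n, f (leftAct N a (rightAct N (op b) n)) = ρ (a ⊗ₜ op b) (f n))
    (w : Env k A) (n : N) : f (w • n) = ρ w (f n) := by
  induction w using TensorProduct.induction_on with
  | zero => exact (congrArg f (zero_smul (Env k A) n)).trans ((map_zero _).trans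
      (LinearMap.congr_fun (map_zero ρ) _).symm)
  | add a b ha hb => rw [add_smul, map_add, map_add, ha, hb]; rfl
  | tmul a b =>
    obtain ⟨b, rfl⟩ := op_surjective b
    rw [← h a b n, tmul_smul_eq]

/-- The inclusion of `N` into `A ⊗_A N`. -/
def regTensorInv (N : BimodCat k A) : (toRight k A).obj N ⟶
    (toRight k A).obj (((tensorBimod k A).obj (regularBimod k A)).obj N) :=
  ModuleCat.ofHom (X := (toRight k A).obj N)
    (Y := (toRight k A).obj (((tensorBimod k A).obj (regularBimod k A)).obj N))
    { toFun := fun n => toRightEquiv (((tensorBimod k A).obj (regularBimod k A)).obj N)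
        (actEquiv (tensorBimodAct (regularBimod k A) N)
        (BalTensor.tmul (rightAct (regularBimod k A)) (leftAct N) (regEquiv k A 1) n))
      map_add' := fun _ _ => BalTensor.tmul_add _ _ _ _ _
      map_smul' := fun b n => (congrArg (toRightEquiv
        (((tensorBimod k A).obj (regularBimod k A)).obj N))
        (rightAct_tensorBimod_tmul (M := regularBimod k A) b (regEquiv k A 1) n)).symm }

/-- Multiplication, as a map from `N` to `Hom_k(A, N)`. -/
def mulLin (N : BimodCat k A) : N →ₗ[k] (regularBimod k A →ₗ[k] (toRight k A).obj N) :=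
  LinearMap.mk₂ k (fun n a => toRightEquiv N (leftAct N ((regEquiv k A).symm a) n))
    (by intros; simp) (by intros; simp) (by intros; simp) (by intros; simp)

lemma mulLin_apply (N : BimodCat k A) (n : N) (a : A) :
    mulLin N n (regEquiv k A a) = toRightEquiv N (leftAct N a n) := rfl

lemma mulLin_act (N : BimodCat k A) (a b : A) (n : N) :
    mulLin N (leftAct N a (rightAct N (op b) n)) =
      homBimodAct (regularBimod k A) ((toRight k A).obj N) (a ⊗ₜ op b) (mulLin N n) := by
  ext m
  obtain ⟨x, rfl⟩ := (regEquiv k A).surjective m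
  rw [homBimodAct_tmul, regEquiv_rightAct, mulLin_apply, mulLin_apply, ← toRightEquiv_rightAct]
  have := LinearMap.congr_fun (leftAct_rightAct_comm N (x * a) (op b)) n
  rw [map_mul] at this
  rw [map_mul]
  exact congrArg _ this

/-- The multiplication `A ⊗_A N ⟶ N`. -/
def regTensorHom (N : BimodCat k A) :
    (toRight k A).obj (((tensorBimod k A).obj (regularBimod k A)).obj N) ⟶
      (toRight k A).obj N :=
  homBimodUncurry (homToAct (mulLin N) (tensor_induction_homToAct _ (mulLin_act N)))

/-- As a right module N is a retract of A ⊗_A N, to which the tensor-hom argument applies. -/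
lemma projective_toRight (N : BimodCat k A) [Projective N] : Projective ((toRight k A).obj N) := by
  have := projective_toRight_tensorBimod (regularBimod k A) N
  refine (Retract.mk (regTensorInv N) (regTensorHom N) ?_).projective
  ext n
  change toRightEquiv N (leftAct N (1 : A) n) = _
  rw [map_one]
  rfl

lemma projective_of_sum_eq_id {C : Type*} [Category* C] [Preadditive C] {ι : Type*} (s : Finset ι)
    {X : C} {Y : ι → C} [∀ i, Projective (Y i)] (p : ∀ i, X ⟶ Y i) (q : ∀ i, Y i ⟶ X)
    (h : ∑ i ∈ s, p i ≫ q i = 𝟙 X) : Projective X where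
  factors {E Z} f e he := by
    refine ⟨∑ i ∈ s, p i ≫ Projective.factorThru (q i ≫ f) e, ?_⟩
    rw [Preadditive.sum_comp]
    simp only [Category.assoc, Projective.factorThru_comp]
    simp only [← Category.assoc]
    rw [← Preadditive.sum_comp, h, Category.id_comp]

/-- With X vanishing above b and N above 0, degree n of the total complex involves only the columns
n ≤ i ≤ b. Its identity thus factors through finitely many projective modules. -/
lemma projective_toRight_tensorComplex (X N : CochainComplex (BimodCat k A) ℤ) (b : ℤ)
    (hX : ∀ i, b < i → IsZero (X.X i)) (hN : ∀ j, 0 < j → IsZero (N.X j))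
    (hN' : ∀ j, Projective (N.X j)) (n : ℤ) :
    Projective ((toRight k A).obj ((tensorComplex k A X N).X n)) := by
  have h := congrArg (toRight k A).map (sum_prMapBifunctor (tensorBimod k A) X N b hX hN n)
  rw [Functor.map_sum, CategoryTheory.Functor.map_id] at h
  simp only [Functor.map_comp] at h
  have (i : Finset.Icc n b) : Projective ((toRight k A).obj
      (((tensorBimod k A).obj (X.X i)).obj (N.X (n - i)))) :=
    projective_toRight_tensorBimod _ _
  exact projective_of_sum_eq_id _ _ _ h

lemma isZero_tensorComplex (X N : CochainComplex (BimodCat k A) ℤ) (b : ℤ)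
    (hX : ∀ i, b < i → IsZero (X.X i)) (hN : ∀ j, 0 < j → IsZero (N.X j))
    (n : ℤ) (hn : b < n) : IsZero ((tensorComplex k A X N).X n) := by
  have h := sum_prMapBifunctor (tensorBimod k A) X N b hX hN n
  have : IsEmpty (Finset.Icc n b) := ⟨fun i => by have := i.2; rw [Finset.mem_Icc] at this; lia⟩
  rw [Finset.univ_eq_empty, Finset.sum_empty] at h
  exact (IsZero.iff_id_eq_zero _).2 h.symm

section
variable (M : BimodCat k A) {V : Type u} [AddCommGroup V] [Module k V] (l : A →ₐ[k] Module.End k V)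

/-- The identification of the tensor products with a bimodule and with its right module. -/
def toRightBal : BalTensor (rightAct M) l →ₗ[k] BalTensor (actOf (k := k) ((toRight k A).obj M)) l :=
  BalTensor.map (toRightEquiv M).toLinearMap LinearMap.id (fun _ _ => rfl) (fun _ _ => rfl)

/-- The inverse of `toRightBal`. -/
def toRightBalInv :
    BalTensor (actOf (k := k) ((toRight k A).obj M)) l →ₗ[k] BalTensor (rightAct M) l :=
  BalTensor.map (toRightEquiv M).symm.toLinearMap LinearMap.id (fun _ _ => rfl) (fun _ _ => rfl)

lemma toRightBal_bijective : Function.Bijective (toRightBal M l) := by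
  refine Function.bijective_iff_has_inverse.2 ⟨toRightBalInv M l, fun x => ?_, fun x => ?_⟩
  · have : toRightBalInv M l ∘ₗ toRightBal M l = LinearMap.id := BalTensor.hom_ext fun _ _ => rfl
    exact LinearMap.congr_fun this x
  · have : toRightBal M l ∘ₗ toRightBalInv M l = LinearMap.id := BalTensor.hom_ext fun _ _ => rfl
    exact LinearMap.congr_fun this x

end

lemma toRightBal_act (M : BimodCat k A) (b : Aᵐᵒᵖ)
    (x : BalTensor (rightAct M) (leftAct (dualBimod k A))) :
    toRightBal M _ (tensorBimodAct M (dualBimod k A) (1 ⊗ₜ b) x) =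
      tensorDualAct k A ((toRight k A).obj M) b (toRightBal M _ x) := by
  induction x using BalTensor.induction_on with
  | h0 => simp
  | hadd x y hx hy => simp [hx, hy]
  | h m n =>
    exact congrArg (toRightBal M _)
      (rightAct_tensorBimod_tmul (N := dualBimod k A) b m n)

/-- The comparison of the tensor products of bimodules and of right modules with the dual
bimodule. -/
def toRightTensorDual (M : BimodCat k A) :
    (toRight k A).obj (((tensorBimod k A).obj M).obj (dualBimod k A)) ⟶
      (tensorDual k A).obj ((toRight k A).obj M) :=
  ModuleCat.ofHom (X := (toRight k A).obj (((tensorBimod k A).obj M).obj (dualBimod k A)))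
      (Y := (tensorDual k A).obj ((toRight k A).obj M))
    { toFun := toRightBal M _
      map_add' := map_add (toRightBal M _)
      map_smul' := toRightBal_act M }

instance (M : BimodCat k A) : IsIso (toRightTensorDual M) := by
  have h : Function.Bijective (toRightTensorDual M) := toRightBal_bijective M _
  have : Mono (toRightTensorDual M) := (ModuleCat.mono_iff_injective _).2 h.1
  have : Epi (toRightTensorDual M) := (ModuleCat.epi_iff_surjective _).2 h.2
  exact isIso_of_mono_of_epi _

lemma toRight_tensorBimod_hom_ext' {M N : BimodCat k A} {W : ModuleCat.{u} Aᵐᵒᵖ}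
    {h h' : (toRight k A).obj (((tensorBimod k A).obj M).obj N) ⟶ W}
    (H : ∀ m n, h (toRightEquiv (((tensorBimod k A).obj M).obj N)
      (actEquiv (tensorBimodAct M N) (BalTensor.tmul (rightAct M) (leftAct N) m n))) =
      h' (toRightEquiv (((tensorBimod k A).obj M).obj N)
      (actEquiv (tensorBimodAct M N) (BalTensor.tmul (rightAct M) (leftAct N) m n)))) : h = h' :=
  toRight_tensorBimod_hom_ext H

variable (k A) in
/-- Tensoring with the dual bimodule commutes with the passage to right modules. -/
def toRightTensorDualIso : (tensorBimod k A).flip.obj (dualBimod k A) ⋙ toRight k A ≅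
    toRight k A ⋙ tensorDual k A :=
  NatIso.ofComponents (fun M => asIso (toRightTensorDual M)) (by
    intro M M' f
    exact toRight_tensorBimod_hom_ext' fun m ξ => rfl)

lemma leftMul_toRightTensorDual (a : A) (M : BimodCat k A) :
    (leftMul a).app (((tensorBimod k A).obj M).obj (dualBimod k A)) ≫ toRightTensorDual M =
      toRightTensorDual M ≫ (tensorDual k A).map ((leftMul a).app M) := by
  refine toRight_tensorBimod_hom_ext' fun m ξ => ?_
  exact congrArg (fun x => toRightTensorDual M
    (toRightEquiv (((tensorBimod k A).obj M).obj (dualBimod k A)) x))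
    (leftAct_tensorBimod_tmul (N := dualBimod k A) a m ξ)

section aug
variable (X : CochainComplex (BimodCat k A) ℤ) (N : ProjectiveResolution (dualBimod k A))

/-- The augmentation `X ⊗_A N ⟶ X ⊗_A A^*`. -/
def tensorResAug : tensorComplex k A X N.cochainComplex ⟶
    (((tensorBimod k A).flip.obj (dualBimod k A)).mapHomologicalComplex _).obj X :=
  tensorAug (tensorBimod k A) X (d_resAug N)

/-- The action on a product. -/
def prodAct {W : Type u} [Ring W] [Algebra k W] {V V' : Type u} [AddCommGroup V] [Module k V]
    [AddCommGroup V'] [Module k V'] (l : W →ₐ[k] Module.End k V) (l' : W →ₐ[k] Module.End k V') :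
    W →ₐ[k] Module.End k (V × V') :=
  AlgHom.ofLinearMap
    { toFun := fun a => (l a).prodMap (l' a)
      map_add' := fun a b => by ext <;> simp
      map_smul' := fun c a => by ext <;> simp }
    (by ext <;> simp) (fun a b => by ext <;> simp)

/-- The differential and the augmentation are packed into one map g to a product, so exactness at
every degree of the resolution, including 0, becomes a statement about ker g. Tensoring with the
right projective M preserves it. -/
lemma exists_tensor_row (M : BimodCat k A) [Projective ((toRight k A).obj M)] (j : ℤ)
    (x : BalTensor (rightAct M) (leftAct (N.cochainComplex.X j)))
    (hx : BalTensor.map (r' := rightAct M) LinearMap.id (linOf (N.cochainComplex.d j (j + 1)))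
      (fun _ _ => rfl) (linOf_leftAct _) x = 0)
    (hx' : BalTensor.map (r' := rightAct M) LinearMap.id
      (linOf (augComponent N.cochainComplex (resAug N) j)) (fun _ _ => rfl) (linOf_leftAct _) x = 0) :
    ∃ y, BalTensor.map (r := rightAct M) (r' := rightAct M) LinearMap.id
      (linOf (N.cochainComplex.d (j - 1) j)) (fun _ _ => rfl) (linOf_leftAct _) y = x := by
  let l₁ := leftAct (N.cochainComplex.X (j + 1))
  let l₂ := leftAct (dualBimod k A)
  let l'' := prodAct l₁ l₂
  let f₁ : N.cochainComplex.X j →ₗ[k] N.cochainComplex.X (j + 1) :=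
    linOf (N.cochainComplex.d j (j + 1))
  let f₂ : N.cochainComplex.X j →ₗ[k] dualBimod k A :=
    linOf (augComponent N.cochainComplex (resAug N) j)
  let g : N.cochainComplex.X j →ₗ[k] (N.cochainComplex.X (j + 1) × dualBimod k A) := f₁.prod f₂
  have hg (a : A) (v) : g (leftAct (N.cochainComplex.X j) a v) = l'' a (g v) :=
    Prod.ext (linOf_leftAct _ _ _) (linOf_leftAct _ _ _)
  refine BalTensor.exists_map_eq_of_map_eq_zero (l'' := l'')
    (linOf (N.cochainComplex.d (j - 1) j)) (linOf_leftAct _) g hg (fun v hv => ?_) x ?_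
  · exact exists_d_eq_of_augComponent N j v (congrArg Prod.fst hv) (congrArg Prod.snd hv)
  · have h1 : BalTensor.map (r := rightAct M) (r' := rightAct M) LinearMap.id g
        (fun _ _ => rfl) hg =
        BalTensor.map (r := rightAct M) (r' := rightAct M) (l := l₁) (l' := l'') LinearMap.id
          (LinearMap.inl k _ _) (fun _ _ => rfl) (fun a w => by simp [l'', prodAct]) ∘ₗ
        BalTensor.map (r := rightAct M) (r' := rightAct M) LinearMap.id f₁
          (fun _ _ => rfl) (linOf_leftAct _) +
        BalTensor.map (r := rightAct M) (r' := rightAct M) (l := l₂) (l' := l'') LinearMap.id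
          (LinearMap.inr k _ _) (fun _ _ => rfl) (fun a w => by simp [l'', prodAct]) ∘ₗ
        BalTensor.map (r := rightAct M) (r' := rightAct M) LinearMap.id f₂
          (fun _ _ => rfl) (linOf_leftAct _) := by
      refine BalTensor.hom_ext fun m v => ?_
      refine Eq.trans ?_ (BalTensor.tmul_add _ _ _ _ _)
      refine congrArg (BalTensor.tmul (rightAct M) l'' m) (Prod.ext ?_ ?_)
      · exact (add_zero _).symm
      · exact (zero_add _).symm
    refine (LinearMap.congr_fun h1 x).trans ?_
    rw [LinearMap.add_apply, LinearMap.comp_apply, LinearMap.comp_apply]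
    refine (congrArg₂ (· + ·) ((congrArg _ hx).trans (map_zero _))
      ((congrArg _ hx').trans (map_zero _))).trans (add_zero _)

lemma quasiIso_tensorResAug (b : ℤ) (hX : ∀ i, b < i → IsZero (X.X i))
    (hX' : ∀ i, Projective ((toRight k A).obj (X.X i))) : QuasiIso (tensorResAug X N) := by
  refine quasiIso_tensorAug (tensorBimod k A) X N.cochainComplex (resAug N) b hX
    (fun j hj => CochainComplex.isZero_of_isStrictlyLE _ 0 j hj) (d_resAug N) (fun i => ?_)
    (fun i j x hx hx' => ?_)
  · exact BalTensor.map_id_surjective (r := rightAct (X.X i)) (l := leftAct (N.cochainComplex.X 0))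
      (l' := leftAct (dualBimod k A)) (linOf (resAug N)) (linOf_leftAct _) (resAug_surjective N)
  · have := hX' i
    exact exists_tensor_row N (X.X i) j x hx hx'

variable (k A) in
/-- Tensoring complexes with the dual bimodule commutes with the passage to right modules. -/
def toRightTensorDualComplex :
    ((toRight k A).mapHomologicalComplex (ComplexShape.up ℤ)).obj
      ((((tensorBimod k A).flip.obj (dualBimod k A)).mapHomologicalComplex _).obj X) ≅
    ((tensorDual k A).mapHomologicalComplex (ComplexShape.up ℤ)).obj
      (((toRight k A).mapHomologicalComplex (ComplexShape.up ℤ)).obj X) :=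
  HomologicalComplex.Hom.isoOfComponents (fun i => (toRightTensorDualIso k A).app (X.X i))
    (fun i j _ => ((toRightTensorDualIso k A).hom.naturality (X.d i j)).symm)

/-- Left multiplication on a complex of bimodules, as an endomorphism of the complex of right
modules. -/
abbrev leftMulComplex (a : A) :
    ((toRight k A).mapHomologicalComplex (ComplexShape.up ℤ)).obj X ⟶
      ((toRight k A).mapHomologicalComplex (ComplexShape.up ℤ)).obj X :=
  (NatTrans.mapHomologicalComplex (leftMul a) (ComplexShape.up ℤ)).app X

/-- The comparison of `X ⊗_A N`, as a complex of right modules, with `X ⊗_A A^*`. -/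
def toRightTensorAug :
    ((toRight k A).mapHomologicalComplex (ComplexShape.up ℤ)).obj
      (tensorComplex k A X N.cochainComplex) ⟶
    ((tensorDual k A).mapHomologicalComplex (ComplexShape.up ℤ)).obj
      (((toRight k A).mapHomologicalComplex (ComplexShape.up ℤ)).obj X) :=
  ((toRight k A).mapHomologicalComplex (ComplexShape.up ℤ)).map (tensorResAug X N) ≫
    (toRightTensorDualComplex k A X).hom

lemma leftMul_toRightTensorAug (a : A) :
    leftMulComplex (tensorComplex k A X N.cochainComplex) a ≫ toRightTensorAug X N =
      toRightTensorAug X N ≫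
        ((tensorDual k A).mapHomologicalComplex (ComplexShape.up ℤ)).map (leftMulComplex X a) := by
  have h1 := (NatTrans.mapHomologicalComplex (leftMul (k := k) a) (ComplexShape.up ℤ)).naturality
    (tensorResAug X N)
  have h2 : leftMulComplex ((((tensorBimod k A).flip.obj
      (dualBimod k A)).mapHomologicalComplex _).obj X) a ≫ (toRightTensorDualComplex k A X).hom =
      (toRightTensorDualComplex k A X).hom ≫
        ((tensorDual k A).mapHomologicalComplex (ComplexShape.up ℤ)).map (leftMulComplex X a) := by
    ext i : 1
    exact leftMul_toRightTensorDual a (X.X i)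
  unfold toRightTensorAug
  rw [Category.assoc, ← h2, ← Category.assoc, ← Category.assoc]
  exact congrArg (· ≫ (toRightTensorDualComplex k A X).hom) h1.symm

lemma quasiIso_toRightTensorAug (b : ℤ) (hX : ∀ i, b < i → IsZero (X.X i))
    (hX' : ∀ i, Projective ((toRight k A).obj (X.X i))) : QuasiIso (toRightTensorAug X N) := by
  have := quasiIso_tensorResAug X N b hX hX'
  have : (toRight k A).PreservesHomology := inferInstance
  have : QuasiIso (((toRight k A).mapHomologicalComplex (ComplexShape.up ℤ)).map
    (tensorResAug X N)) := inferInstance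
  unfold toRightTensorAug
  infer_instance

end aug

/-- Being bounded above and termwise projective on the right is what allows the next factor N to be
replaced by A^*, and makes the complex K-projective over the right module category. -/
lemma tensorPow_spec (Δ : ProjectiveResolution (regularBimod k A))
    (N : ProjectiveResolution (dualBimod k A)) (n : ℕ) :
    (∀ i, 0 < i → IsZero ((tensorPow Δ N n).X i)) ∧
      ∀ i, Projective ((toRight k A).obj ((tensorPow Δ N n).X i)) := by
  induction n with
  | zero =>
    exact ⟨fun i hi => CochainComplex.isZero_of_isStrictlyLE Δ.cochainComplex 0 i hi,
      fun i => projective_toRight (Δ.cochainComplex.X i)⟩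
  | succ n ih =>
    have hN : ∀ j, 0 < j → IsZero (N.cochainComplex.X j) :=
      fun j hj => CochainComplex.isZero_of_isStrictlyLE _ 0 j hj
    exact ⟨isZero_tensorComplex _ _ 0 ih.1 hN,
      projective_toRight_tensorComplex _ _ 0 ih.1 hN fun j => inferInstance⟩

end tensorPow

/-! ### Tensor powers compute the powers of the Serre functor -/

section serreTensor
variable {k : Type u} [Field k] {A : Type u} [Ring A] [Algebra k A]
open scoped ModuleCat TensorProduct
open MulOpposite

lemma comm_trans {C : Type*} [Category* C] {X Y Z X' Y' Z' : C} {f : X ⟶ X'} {g : Y ⟶ Y'}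
    {h : Z ⟶ Z'} {u : X ⟶ Y} {v : Y ⟶ Z} {u' : X' ⟶ Y'} {v' : Y' ⟶ Z'} (h1 : f ≫ u' = u ≫ g)
    (h2 : g ≫ v' = v ≫ h) : f ≫ u' ≫ v' = (u ≫ v) ≫ h := by
  rw [← Category.assoc, h1, Category.assoc, h2, Category.assoc]

lemma comm_inv {C : Type*} [Category* C] {X Y X' Y' : C} {f : X ⟶ X'} {g : Y ⟶ Y'}
    {u : X ≅ Y} {u' : X' ≅ Y'} (h : f ≫ u'.hom = u.hom ≫ g) : g ≫ u'.inv = u.inv ≫ f := by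
  rw [Iso.comp_inv_eq, Category.assoc, h, Iso.inv_hom_id_assoc]

lemma Qh_map_bijective_of_strictPerfectHo {R : Type u} [Ring R]
    {K : HomotopyCategory (ModuleCat.{u} R) (ComplexShape.up ℤ)} (hK : strictPerfectHo R K)
    (L : HomotopyCategory (ModuleCat.{u} R) (ComplexShape.up ℤ)) :
    Function.Bijective (fun f : K ⟶ L => DerivedCategory.Qh.map f) := by
  obtain ⟨K : CochainComplex _ _, rfl⟩ := K.quotient_obj_surjective
  have := ((strictPerfectHo_quotient_iff _).1 hK).isKProjective
  exact CochainComplex.IsKProjective.Qh_map_bijective K L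

lemma exists_iso_of_Qh_iso {C : Type*} [Category* C] [Abelian C] [HasDerivedCategory C]
    {K L : HomotopyCategory C (ComplexShape.up ℤ)}
    (hK : ∀ L', Function.Bijective (fun f : K ⟶ L' => DerivedCategory.Qh.map f))
    (hL : ∀ L', Function.Bijective (fun f : L ⟶ L' => DerivedCategory.Qh.map f))
    (e : DerivedCategory.Qh.obj K ≅ DerivedCategory.Qh.obj L) :
    ∃ u : K ≅ L, DerivedCategory.Qh.map u.hom = e.hom := by
  obtain ⟨f, hf⟩ := (hK L).2 e.hom
  obtain ⟨g, hg⟩ := (hL K).2 e.inv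
  dsimp only at hf hg
  refine ⟨⟨f, g, (hK K).1 ?_, (hL L).1 ?_⟩, hf⟩
  · dsimp only
    rw [Functor.map_comp, hf, hg, e.hom_inv_id, CategoryTheory.Functor.map_id]
  · dsimp only
    rw [Functor.map_comp, hf, hg, e.inv_hom_id, CategoryTheory.Functor.map_id]

/-- Derived functors of additive functors are computed by K-projective complexes. -/
lemma exists_leftDerivedDb_iso [Module.Finite k A] [FinGlobalDim Aᵐᵒᵖ]
    (F : ModuleCat.{u} Aᵐᵒᵖ ⥤ ModuleCat.{u} Aᵐᵒᵖ) [F.Additive]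
    (hF : ∀ M : ModuleCat.{u} Aᵐᵒᵖ, Module.Finite Aᵐᵒᵖ M → Module.Finite Aᵐᵒᵖ (F.obj M))
    (P : CochainComplex (ModuleCat.{u} Aᵐᵒᵖ) ℤ) [P.IsKProjective] (X : Db k A)
    (θ : DerivedCategory.Q.obj P ≅ X.obj) :
    ∃ e : DerivedCategory.Q.obj ((F.mapHomologicalComplex (ComplexShape.up ℤ)).obj P) ≅
      ((leftDerivedDb k A F hF).obj X).obj, ∀ (f : P ⟶ P) (g : X ⟶ X),
      DerivedCategory.Q.map f ≫ θ.hom = θ.hom ≫ g.hom →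
      DerivedCategory.Q.map ((F.mapHomologicalComplex (ComplexShape.up ℤ)).map f) ≫ e.hom =
        e.hom ≫ ((leftDerivedDb k A F hF).map g).hom := by
  let K : KbProj Aᵐᵒᵖ := (KbProj.toDb k A).inv.obj X
  let c := (KbProj.toDb k A).asEquivalence.counitIso
  let P' := (HomotopyCategory.quotient (ModuleCat.{u} Aᵐᵒᵖ) (ComplexShape.up ℤ)).obj P
  let ω := (DerivedCategory.quotientCompQhIso (ModuleCat.{u} Aᵐᵒᵖ))
  let e₀ : DerivedCategory.Qh.obj P' ≅ DerivedCategory.Qh.obj K.obj :=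
    ω.app P ≪≫ θ ≪≫ ((boundedFD k A).ι.mapIso (c.app X)).symm
  have hPK := CochainComplex.IsKProjective.Qh_map_bijective P
  -- P and the chosen perfect replacement K of X both compute derived morphisms in the homotopy
  -- category, so their isomorphism lifts there. F can then be applied to it, and faithfulness
  -- transports the square of endomorphisms.
  obtain ⟨w, hw⟩ := exists_iso_of_Qh_iso (K := P') (L := K.obj) (fun L' => hPK L')
    (Qh_map_bijective_of_strictPerfectHo K.property) e₀
  let G := F.mapHomotopyCategory (ComplexShape.up ℤ) ⋙ DerivedCategory.Qh
  refine ⟨ω.symm.app ((F.mapHomologicalComplex (ComplexShape.up ℤ)).obj P) ≪≫ G.mapIso w,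
    fun f g hfg => ?_⟩
  let f' : P' ⟶ P' := (HomotopyCategory.quotient _ _).map f
  let g' : K ⟶ K := (KbProj.toDb k A).inv.map g
  have h1 : DerivedCategory.Qh.map f' ≫ (ω.app P).hom = (ω.app P).hom ≫ DerivedCategory.Q.map f :=
    ω.hom.naturality f
  have h2 : DerivedCategory.Qh.map g'.hom ≫ ((boundedFD k A).ι.mapIso (c.app X)).hom =
      ((boundedFD k A).ι.mapIso (c.app X)).hom ≫ g.hom :=
    congrArg (boundedFD k A).ι.map (c.hom.naturality g)
  have h0 : DerivedCategory.Qh.map f' ≫ e₀.hom = e₀.hom ≫ DerivedCategory.Qh.map g'.hom :=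
    comm_trans h1 (comm_trans hfg (comm_inv h2))
  have h3 : f' ≫ w.hom = w.hom ≫ g'.hom := by
    refine (hPK _).1 ?_
    rw [Functor.map_comp, Functor.map_comp]
    exact (congrArg (DerivedCategory.Qh.map f' ≫ ·) hw).trans
      (h0.trans (congrArg (· ≫ DerivedCategory.Qh.map g'.hom) hw).symm)
  have h4 : DerivedCategory.Q.map ((F.mapHomologicalComplex (ComplexShape.up ℤ)).map f) ≫
      (ω.symm.app ((F.mapHomologicalComplex (ComplexShape.up ℤ)).obj P)).hom =
      (ω.symm.app ((F.mapHomologicalComplex (ComplexShape.up ℤ)).obj P)).hom ≫ G.map f' :=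
    ω.inv.naturality ((F.mapHomologicalComplex (ComplexShape.up ℤ)).map f)
  have h5 : G.map f' ≫ G.map w.hom = G.map w.hom ≫ G.map g'.hom := by
    rw [← Functor.map_comp, h3, Functor.map_comp]
  exact comm_trans h4 h5

/-- Left multiplication on the right module `A`. -/
def mulLeftRight (a : A) : ModuleCat.of Aᵐᵒᵖ A ⟶ ModuleCat.of Aᵐᵒᵖ A :=
  ModuleCat.ofHom
    { toFun := fun x => a * x
      map_add' := mul_add a
      map_smul' := fun b x => (mul_assoc a x b.unop).symm }

variable (k) in
/-- Left multiplication on the regular object. -/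
def regularLeftMul [Module.Finite k A] (a : A) : regularDb k A ⟶ regularDb k A :=
  ObjectProperty.homMk ((DerivedCategory.singleFunctor (ModuleCat.{u} Aᵐᵒᵖ) 0).map (mulLeftRight a))

variable (k A) in
/-- The underlying right module of the bimodule `A`. -/
def toRightRegular : (toRight k A).obj (regularBimod k A) ≅ ModuleCat.of Aᵐᵒᵖ A :=
  let e : ((toRight k A).obj (regularBimod k A) : ModuleCat.{u} Aᵐᵒᵖ) ≃ₗ[Aᵐᵒᵖ] A :=
    { toFun := fun x => (regEquiv k A).symm ((toRightEquiv _).symm x)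
      invFun := fun x => toRightEquiv _ (regEquiv k A x)
      map_add' := fun x y => by simp
      map_smul' := fun b x => (regEquiv k A).injective
        (regEquiv_rightAct b.unop ((regEquiv k A).symm ((toRightEquiv _).symm x)))
      left_inv := fun _ => rfl
      right_inv := fun _ => rfl }
  e.toModuleIso

lemma leftMul_toRightRegular (a : A) : (leftMul a).app (regularBimod k A) ≫ (toRightRegular k A).hom =
    (toRightRegular k A).hom ≫ mulLeftRight a := by
  ext x
  exact congrArg (fun y => (regEquiv k A).symm y)
    (regEquiv_leftAct a ((regEquiv k A).symm ((toRightEquiv _).symm x)))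

/-- Applying an additive functor to a complex concentrated in degree zero. -/
lemma exists_single_map_iso {C D : Type*} [Category* C] [Category* D] [Abelian C] [Abelian D]
    [HasDerivedCategory D] (F : C ⥤ D) [F.Additive] (X : C) :
    ∃ e : DerivedCategory.Q.obj ((F.mapHomologicalComplex (ComplexShape.up ℤ)).obj
      ((CochainComplex.singleFunctor C 0).obj X)) ≅ (DerivedCategory.singleFunctor D 0).obj (F.obj X), ∀ τ : F ⟶ F,
      DerivedCategory.Q.map ((NatTrans.mapHomologicalComplex τ (ComplexShape.up ℤ)).app
        ((CochainComplex.singleFunctor C 0).obj X)) ≫ e.hom =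
      e.hom ≫ (DerivedCategory.singleFunctor D 0).map (τ.app X) := by
  let s := HomologicalComplex.singleMapHomologicalComplex F (ComplexShape.up ℤ) 0
  let c := DerivedCategory.singleFunctorIsoCompQ D 0
  refine ⟨DerivedCategory.Q.mapIso (s.app X) ≪≫ (c.app (F.obj X)).symm, fun τ => ?_⟩
  have h1 : (NatTrans.mapHomologicalComplex τ (ComplexShape.up ℤ)).app
        ((HomologicalComplex.single C (ComplexShape.up ℤ) 0).obj X) ≫ (s.app X).hom =
      (s.app X).hom ≫ (HomologicalComplex.single D (ComplexShape.up ℤ) 0).map (τ.app X) := by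
    refine HomologicalComplex.to_single_hom_ext ?_
    dsimp [s]
    simp only [HomologicalComplex.singleMapHomologicalComplex_hom_app_self,
      HomologicalComplex.single_map_f_self]
    exact comm_trans (τ.naturality _).symm (Iso.inv_hom_id_assoc _ _).symm
  have h2 := congrArg DerivedCategory.Q.map h1
  rw [Functor.map_comp, Functor.map_comp] at h2
  exact comm_trans h2 (comm_inv (u := c.app (F.obj X)) (u' := c.app (F.obj X))
    (c.hom.naturality (τ.app X)))

variable [Module.Finite k A] [FinGlobalDim Aᵐᵒᵖ]
variable (Δ : ProjectiveResolution (regularBimod k A)) (N : ProjectiveResolution (dualBimod k A))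

/-- Induction on n: the tensor power is termwise projective on the right, hence computes the derived
functor of `tensorDual`, and the augmentation of N compares with it. The Serre functor sees only
right modules; carrying the left multiplications along by functoriality is what recovers the
bimodule structure on cohomology. -/
lemma exists_tensorPow_iso (n : ℕ) :
    ∃ e : DerivedCategory.Q.obj (((toRight k A).mapHomologicalComplex (ComplexShape.up ℤ)).obj
      (tensorPow Δ N n)) ≅ ((iter (serreFunctor k A) n).obj (regularDb k A)).obj, ∀ a : A,
      DerivedCategory.Q.map (leftMulComplex (tensorPow Δ N n) a) ≫ e.hom =
        e.hom ≫ ((iter (serreFunctor k A) n).map (regularLeftMul k a)).hom := by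
  induction n with
  | zero =>
    obtain ⟨e, he⟩ : ∃ e : DerivedCategory.Q.obj (((toRight k A).mapHomologicalComplex
        (ComplexShape.up ℤ)).obj ((CochainComplex.singleFunctor (BimodCat k A) 0).obj
          (regularBimod k A))) ≅ (regularDb k A).obj, ∀ a : A,
        DerivedCategory.Q.map (leftMulComplex _ a) ≫ e.hom =
          e.hom ≫ (regularLeftMul k a).hom := by
      obtain ⟨e, he⟩ := exists_single_map_iso (toRight k A) (regularBimod k A)
      refine ⟨e ≪≫ (DerivedCategory.singleFunctor (ModuleCat.{u} Aᵐᵒᵖ) 0).mapIso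
        (toRightRegular k A), fun a => comm_trans (he (leftMul a)) ?_⟩
      have h1 := congrArg (DerivedCategory.singleFunctor (ModuleCat.{u} Aᵐᵒᵖ) 0).map
        (leftMul_toRightRegular (k := k) a)
      rw [Functor.map_comp, Functor.map_comp] at h1
      exact h1
    let π := ((toRight k A).mapHomologicalComplex (ComplexShape.up ℤ)).map Δ.π'
    have hπ : IsIso (DerivedCategory.Q.map π) :=
      (DerivedCategory.isIso_Q_map_iff_quasiIso _ π).2 inferInstance
    refine ⟨@asIso _ _ _ _ (DerivedCategory.Q.map π) hπ ≪≫ e, fun a => ?_⟩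
    have h1 := congrArg DerivedCategory.Q.map
      ((NatTrans.mapHomologicalComplex (leftMul (k := k) a) (ComplexShape.up ℤ)).naturality Δ.π')
    rw [Functor.map_comp, Functor.map_comp] at h1
    exact comm_trans h1.symm (he a)
  | succ n ih =>
    obtain ⟨e, he⟩ := ih
    obtain ⟨h1, h2⟩ := tensorPow_spec Δ N n
    have hle : CochainComplex.IsStrictlyLE (((toRight k A).mapHomologicalComplex
        (ComplexShape.up ℤ)).obj (tensorPow Δ N n)) 0 := by
      rw [CochainComplex.isStrictlyLE_iff]
      exact fun i hi => (toRight k A).map_isZero (h1 i hi)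
    have hproj (i : ℤ) : Projective ((((toRight k A).mapHomologicalComplex
        (ComplexShape.up ℤ)).obj (tensorPow Δ N n)).X i) := h2 i
    have := CochainComplex.isKProjective_of_projective (((toRight k A).mapHomologicalComplex
        (ComplexShape.up ℤ)).obj (tensorPow Δ N n)) 0
    obtain ⟨e', he'⟩ := exists_leftDerivedDb_iso (tensorDual k A) (tensorDual_finite k A)
      (((toRight k A).mapHomologicalComplex (ComplexShape.up ℤ)).obj (tensorPow Δ N n)) _ e
    have haug : IsIso (DerivedCategory.Q.map (toRightTensorAug (tensorPow Δ N n) N)) :=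
      (DerivedCategory.isIso_Q_map_iff_quasiIso _ _).2
        (quasiIso_toRightTensorAug (tensorPow Δ N n) N 0 h1 h2)
    refine ⟨@asIso _ _ _ _ (DerivedCategory.Q.map (toRightTensorAug (tensorPow Δ N n) N)) haug ≪≫ e',
      fun a => ?_⟩
    have h3 := congrArg DerivedCategory.Q.map (leftMul_toRightTensorAug (tensorPow Δ N n) N a)
    rw [Functor.map_comp, Functor.map_comp] at h3
    exact comm_trans h3 (he' _ _ (he a))

end serreTensor

/-! ### The cohomology bimodules of the tensor powers -/

section homology
variable {k : Type u} [Field k] {A : Type u} [Ring A] [Algebra k A]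
open scoped ModuleCat TensorProduct
open MulOpposite

variable (k) in
lemma nonempty_iter_twist_iso (φ : A ≃ₐ[k] A) (m : ℕ) :
    Nonempty (iter (twist k A φ) m ≅ twist k A (φ ^ m)) := by
  induction m with
  | zero =>
    let e (M : ModuleCat.{u} Aᵐᵒᵖ) : (M : ModuleCat.{u} Aᵐᵒᵖ) ≃ₗ[Aᵐᵒᵖ]
        ((twist k A (φ ^ 0)).obj M : ModuleCat.{u} Aᵐᵒᵖ) :=
      { toFun := fun x => x
        invFun := fun x => x
        map_add' := fun _ _ => rfl
        map_smul' := fun _ _ => rfl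
        left_inv := fun _ => rfl
        right_inv := fun _ => rfl }
    exact ⟨NatIso.ofComponents (fun M => (e M).toModuleIso) (fun _ => rfl)⟩
  | succ m ih =>
    obtain ⟨e⟩ := ih
    let e' (M : ModuleCat.{u} Aᵐᵒᵖ) :
        ((twist k A φ).obj ((twist k A (φ ^ m)).obj M) : ModuleCat.{u} Aᵐᵒᵖ) ≃ₗ[Aᵐᵒᵖ]
        ((twist k A (φ ^ (m + 1))).obj M : ModuleCat.{u} Aᵐᵒᵖ) :=
      { toFun := fun x => x
        invFun := fun x => x
        map_add' := fun _ _ => rfl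
        map_smul' := fun b x => by
          obtain ⟨b, rfl⟩ := op_surjective b
          change op ((φ ^ m) (φ b)) • (show M from x) = op ((φ ^ (m + 1)) b) • (show M from x)
          rw [pow_succ]
          rfl
        left_inv := fun _ => rfl
        right_inv := fun _ => rfl }
    exact ⟨Functor.isoWhiskerRight e (twist k A φ) ≪≫ NatIso.ofComponents
      (fun M => (e' M).toModuleIso) (fun _ => rfl)⟩

/-- The elements of a twisted module. -/
def twistEquiv (φ : A ≃ₐ[k] A) (M : ModuleCat.{u} Aᵐᵒᵖ) : (twist k A φ).obj M ≃ₗ[k] M where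
  toFun x := x
  invFun x := x
  map_add' _ _ := rfl
  map_smul' c x := by
    change op (φ (algebraMap k A c)) • (show M from x) = op (algebraMap k A c) • (show M from x)
    rw [AlgEquiv.commutes]
  left_inv _ := rfl
  right_inv _ := rfl

lemma homologySingleIso_naturality {C : Type*} [Category* C] [Abelian C] [HasDerivedCategory C]
    {M M' : C} (f : M ⟶ M') : (DerivedCategory.homologyFunctor C 0).map
      ((DerivedCategory.singleFunctor C 0).map f) ≫ (homologySingleIso M').hom =
      (homologySingleIso M).hom ≫ f :=
  comm_trans (g := (DerivedCategory.homologyFunctor C 0).map (DerivedCategory.Q.map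
      ((CochainComplex.singleFunctor C 0).map f)))
    ((DerivedCategory.homologyFunctor C 0).map_comp _ _ |>.symm.trans
      ((congrArg (DerivedCategory.homologyFunctor C 0).map
        ((DerivedCategory.singleFunctorIsoCompQ C 0).hom.naturality f)).trans
        ((DerivedCategory.homologyFunctor C 0).map_comp _ _)))
    (comm_trans ((DerivedCategory.homologyFunctorFactors C 0).hom.naturality
      ((CochainComplex.singleFunctor C 0).map f))
      ((HomologicalComplex.homologyFunctorSingleIso C (ComplexShape.up ℤ) 0).hom.naturality f))

lemma regTensorHom_tmul (M : BimodCat k A) (a : A) (n : M) :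
    regTensorHom M (toRightEquiv (((tensorBimod k A).obj (regularBimod k A)).obj M)
      (actEquiv (tensorBimodAct (regularBimod k A) M)
        (BalTensor.tmul (rightAct (regularBimod k A)) (leftAct M) (regEquiv k A a) n))) =
      toRightEquiv M (leftAct M a n) := rfl

lemma regTensorInv_apply (M : BimodCat k A) (n : M) : regTensorInv M (toRightEquiv M n) =
    toRightEquiv (((tensorBimod k A).obj (regularBimod k A)).obj M)
      (actEquiv (tensorBimodAct (regularBimod k A) M)
        (BalTensor.tmul (rightAct (regularBimod k A)) (leftAct M) (regEquiv k A 1) n)) := rfl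

/-- The right module `A ⊗_A M` is `M`. -/
def regTensorIso (M : BimodCat k A) :
    (toRight k A).obj (((tensorBimod k A).obj (regularBimod k A)).obj M) ≅ (toRight k A).obj M where
  hom := regTensorHom M
  inv := regTensorInv M
  hom_inv_id := by
    refine toRight_tensorBimod_hom_ext' fun a n => ?_
    obtain ⟨a, rfl⟩ := (regEquiv k A).surjective a
    refine (congrArg (regTensorInv M) (regTensorHom_tmul M a n)).trans ?_
    rw [regTensorInv_apply, ← BalTensor.tmul_balanced, regEquiv_rightAct, one_mul]
    rfl
  inv_hom_id := by
    ext n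
    change toRightEquiv M (leftAct M (1 : A) n) = _
    rw [map_one]
    rfl

lemma leftMul_regTensorIso (M : BimodCat k A) (a : A) :
    (leftMul a).app (((tensorBimod k A).obj (regularBimod k A)).obj M) ≫ (regTensorIso M).hom =
      (regTensorIso M).hom ≫ (leftMul a).app M := by
  refine toRight_tensorBimod_hom_ext' fun b n => ?_
  obtain ⟨b, rfl⟩ := (regEquiv k A).surjective b
  refine (congrArg (fun y => regTensorHom M
    (toRightEquiv (((tensorBimod k A).obj (regularBimod k A)).obj M) y))
    (leftAct_tensorBimod_tmul (M := regularBimod k A) a (regEquiv k A b) n)).trans ?_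
  rw [regEquiv_leftAct]
  change toRightEquiv M (leftAct M (a * b) n) = toRightEquiv M (leftAct M a (leftAct M b n))
  rw [map_mul]
  rfl

variable (k A) in
/-- The right module `A ⊗_A A^*` is `A^*`. -/
def tensorDualRegular : (tensorDual k A).obj (ModuleCat.of Aᵐᵒᵖ A) ≅
    (toRight k A).obj (dualBimod k A) :=
  (tensorDual k A).mapIso (toRightRegular k A).symm ≪≫
    ((toRightTensorDualIso k A).app (regularBimod k A)).symm ≪≫ regTensorIso (dualBimod k A)

lemma tensorDualRegular_leftMul (a : A) :
    (tensorDual k A).map (mulLeftRight a) ≫ (tensorDualRegular k A).hom =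
      (tensorDualRegular k A).hom ≫ (leftMul a).app (dualBimod k A) := by
  have h1 := congrArg (tensorDual k A).map
    (comm_inv (u := toRightRegular k A) (u' := toRightRegular k A) (leftMul_toRightRegular a))
  rw [Functor.map_comp, Functor.map_comp] at h1
  exact comm_trans h1 (comm_trans (comm_inv
    (u := (toRightTensorDualIso k A).app (regularBimod k A))
    (u' := (toRightTensorDualIso k A).app (regularBimod k A))
    (leftMul_toRightTensorDual a (regularBimod k A)))
    (leftMul_regTensorIso (dualBimod k A) a))

variable [Module.Finite k A] [FinGlobalDim Aᵐᵒᵖ]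
variable (Δ : ProjectiveResolution (regularBimod k A)) (N : ProjectiveResolution (dualBimod k A))

lemma exists_tensorPow_homology_iso (n : ℕ) (i : ℤ) :
    ∃ e : (toRight k A).obj ((tensorPow Δ N n).homology i) ≅
      (DerivedCategory.homologyFunctor _ i).obj
        ((iter (serreFunctor k A) n).obj (regularDb k A)).obj, ∀ a : A,
      (leftMul a).app _ ≫ e.hom = e.hom ≫ (DerivedCategory.homologyFunctor _ i).map
        ((iter (serreFunctor k A) n).map (regularLeftMul k a)).hom := by
  obtain ⟨e, he⟩ := exists_tensorPow_iso Δ N n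
  let c₁ := (mapHomologicalComplexHomologyIso (toRight k A) i).app (tensorPow Δ N n)
  let c₂ := (DerivedCategory.homologyFunctorFactors (ModuleCat.{u} Aᵐᵒᵖ) i).app
    (((toRight k A).mapHomologicalComplex (ComplexShape.up ℤ)).obj (tensorPow Δ N n))
  refine ⟨c₁.symm ≪≫ c₂.symm ≪≫ (DerivedCategory.homologyFunctor _ i).mapIso e, fun a => ?_⟩
  refine comm_trans (comm_inv (u := c₁) (u' := c₁)
    (mapHomologicalComplexHomologyIso_natTrans (leftMul a) i (tensorPow Δ N n)))
    (comm_trans (comm_inv (u := c₂) (u' := c₂)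
      ((DerivedCategory.homologyFunctorFactors (ModuleCat.{u} Aᵐᵒᵖ) i).hom.naturality
        (leftMulComplex (tensorPow Δ N n) a))) ?_)
  have := congrArg (DerivedCategory.homologyFunctor (ModuleCat.{u} Aᵐᵒᵖ) i).map (he a)
  rw [Functor.map_comp, Functor.map_comp] at this
  exact this

/-- Periodicity of the cohomology of the tensor powers: up to twist and translation of degrees it
depends only on the residue r, compatibly with left multiplication. -/
lemma IsTwistedCY.exists_tensorPow_homology {p : ℕ} {q : ℤ} (h : IsTwistedCY k A p q) :
    ∃ φ : A ≃ₐ[k] A, ∀ (r m : ℕ) (i j : ℤ), j = m * q + i →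
      ∃ e : (toRight k A).obj ((tensorPow Δ N (r + p * m)).homology i) ≅
        (twist k A (φ ^ m)).obj ((DerivedCategory.homologyFunctor _ j).obj
          ((iter (serreFunctor k A) r).obj (regularDb k A)).obj), ∀ a : A,
      (leftMul a).app _ ≫ e.hom = e.hom ≫ (twist k A (φ ^ m)).map
        ((DerivedCategory.homologyFunctor _ j).map
          ((iter (serreFunctor k A) r).map (regularLeftMul k a)).hom) := by
  obtain ⟨φ, hφ⟩ := h.exists_iter_serre_iso
  refine ⟨φ, fun r m i j hij => ?_⟩
  obtain ⟨e, he⟩ := exists_tensorPow_homology_iso Δ N (r + p * m) i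
  obtain ⟨e₁⟩ := hφ r m
  obtain ⟨e₂⟩ := nonempty_iter_twistShift_homology_iso φ q m i j hij
  obtain ⟨e₃⟩ := nonempty_iter_twist_iso k φ m
  let c := Functor.isoWhiskerRight e₁ (DerivedCategory.homologyFunctor (ModuleCat.{u} Aᵐᵒᵖ) i) ≪≫
    Functor.isoWhiskerLeft (iter (serreFunctor k A) r ⋙ (boundedFD k A).ι)
      (e₂ ≪≫ Functor.isoWhiskerLeft (DerivedCategory.homologyFunctor (ModuleCat.{u} Aᵐᵒᵖ) j) e₃)
  exact ⟨e ≪≫ c.app (regularDb k A), fun a =>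
    comm_trans (he a) (c.hom.naturality (regularLeftMul k a))⟩

lemma exists_iso_single_map {C D : Type*} [Category* C] [Category* D] [Abelian C] [Abelian D]
    [HasDerivedCategory D] (F : C ⥤ D) [F.Additive] (X : C) :
    ∃ e : DerivedCategory.Q.obj ((F.mapHomologicalComplex (ComplexShape.up ℤ)).obj
      ((CochainComplex.singleFunctor C 0).obj X)) ≅ (DerivedCategory.singleFunctor D 0).obj (F.obj X),
      ∀ f : X ⟶ X, DerivedCategory.Q.map ((F.mapHomologicalComplex (ComplexShape.up ℤ)).map
        ((CochainComplex.singleFunctor C 0).map f)) ≫ e.hom =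
      e.hom ≫ (DerivedCategory.singleFunctor D 0).map (F.map f) := by
  let s := HomologicalComplex.singleMapHomologicalComplex F (ComplexShape.up ℤ) 0
  let c := DerivedCategory.singleFunctorIsoCompQ D 0
  refine ⟨DerivedCategory.Q.mapIso (s.app X) ≪≫ (c.app (F.obj X)).symm, fun f => ?_⟩
  have h2 := congrArg DerivedCategory.Q.map (s.hom.naturality f)
  rw [Functor.map_comp, Functor.map_comp] at h2
  exact comm_trans h2 (comm_inv (u := c.app (F.obj X)) (u' := c.app (F.obj X))
    (c.hom.naturality (F.map f)))

/-- The values of the powers of the Serre functor at `A` that are concentrated in degree zero. -/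
def SerrePowIsSingle (r : ℕ) (B : BimodCat k A) : Prop :=
  ∃ e : ((iter (serreFunctor k A) r).obj (regularDb k A)).obj ≅
    (DerivedCategory.singleFunctor _ 0).obj ((toRight k A).obj B), ∀ a : A,
    ((iter (serreFunctor k A) r).map (regularLeftMul k a)).hom ≫ e.hom =
      e.hom ≫ (DerivedCategory.singleFunctor _ 0).map ((leftMul a).app B)

variable (k A) in
lemma serrePowIsSingle_zero : SerrePowIsSingle 0 (regularBimod k A) := by
  refine ⟨(DerivedCategory.singleFunctor (ModuleCat.{u} Aᵐᵒᵖ) 0).mapIso (toRightRegular k A).symm,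
    fun a => ?_⟩
  have h1 := congrArg (DerivedCategory.singleFunctor (ModuleCat.{u} Aᵐᵒᵖ) 0).map
    (comm_inv (u := toRightRegular k A) (u' := toRightRegular k A) (leftMul_toRightRegular a))
  rw [Functor.map_comp, Functor.map_comp] at h1
  exact h1

-- The regular module is its own projective resolution, so its image under the derived functor is
-- the stalk A ⊗_A A^* ≅ A^*.
variable (k A) in
lemma serrePowIsSingle_one : SerrePowIsSingle 1 (dualBimod k A) := by
  let P := (CochainComplex.singleFunctor (ModuleCat.{u} Aᵐᵒᵖ) 0).obj (ModuleCat.of Aᵐᵒᵖ A)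
  have hP (i : ℤ) : Projective (P.X i) := by
    by_cases hi : i = 0
    · subst hi
      exact Projective.of_iso
        (HomologicalComplex.singleObjXSelf (ComplexShape.up ℤ) 0 (ModuleCat.of Aᵐᵒᵖ A)).symm
        inferInstance
    · exact (HomologicalComplex.isZero_single_obj_X _ _ _ _ hi).projective
  have : P.IsKProjective := CochainComplex.isKProjective_of_projective P 0
  let c := (DerivedCategory.singleFunctorIsoCompQ (ModuleCat.{u} Aᵐᵒᵖ) 0)
  obtain ⟨e, he⟩ := exists_leftDerivedDb_iso (tensorDual k A) (tensorDual_finite k A) P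
    (regularDb k A) (c.symm.app _)
  obtain ⟨e', he'⟩ := exists_iso_single_map (tensorDual k A) (ModuleCat.of Aᵐᵒᵖ A)
  refine ⟨e.symm ≪≫ e' ≪≫ (DerivedCategory.singleFunctor (ModuleCat.{u} Aᵐᵒᵖ) 0).mapIso
    (tensorDualRegular k A), fun a => ?_⟩
  have h1 := he ((CochainComplex.singleFunctor (ModuleCat.{u} Aᵐᵒᵖ) 0).map (mulLeftRight a))
    (regularLeftMul k a) (c.inv.naturality (mulLeftRight a))
  have h2 := congrArg (DerivedCategory.singleFunctor (ModuleCat.{u} Aᵐᵒᵖ) 0).map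
    (tensorDualRegular_leftMul (k := k) a)
  rw [Functor.map_comp, Functor.map_comp] at h2
  exact comm_trans (comm_inv (u := e) (u' := e) h1) (comm_trans (he' (mulLeftRight a)) h2)

/-- When S^r A is a stalk B, the power r + pm has a single cohomology bimodule. The twist alters
only the right action; the left action, carried by functoriality, is unchanged. -/
lemma IsTwistedCY.exists_tensorPow_homologyEquiv {p : ℕ} {q : ℤ} (h : IsTwistedCY k A p q) :
    ∃ φ : A ≃ₐ[k] A, ∀ (r : ℕ) (B : BimodCat k A), SerrePowIsSingle r B → ∀ m : ℕ,
      (∀ i : ℤ, i ≠ -(m * q) → IsZero ((tensorPow Δ N (r + p * m)).homology i)) ∧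
      ∃ g : (tensorPow Δ N (r + p * m)).homology (-(m * q)) ≃ₗ[k] B,
        (∀ a x, g (leftAct _ a x) = leftAct B a (g x)) ∧
        ∀ b x, g (rightAct _ (op b) x) = rightAct B (op ((φ ^ m) b)) (g x) := by
  obtain ⟨φ, hφ⟩ := h.exists_tensorPow_homology Δ N
  refine ⟨φ, fun r B hB m => ⟨fun i hi => ?_, ?_⟩⟩
  · obtain ⟨e, -⟩ := hB
    obtain ⟨e', -⟩ := hφ r m i _ rfl
    have h1 : IsZero ((DerivedCategory.homologyFunctor (ModuleCat.{u} Aᵐᵒᵖ) (m * q + i)).obj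
        ((iter (serreFunctor k A) r).obj (regularDb k A)).obj) :=
      (homologyFunctor_single_isZero ((toRight k A).obj B) _ (by lia)).of_iso
        ((DerivedCategory.homologyFunctor (ModuleCat.{u} Aᵐᵒᵖ) (m * q + i)).mapIso e)
    have h2 := ((twist k A (φ ^ m)).map_isZero h1).of_iso e'
    have := ModuleCat.subsingleton_of_isZero h2
    have : Subsingleton ((tensorPow Δ N (r + p * m)).homology i : BimodCat k A) :=
      (toRightEquiv _).toEquiv.subsingleton
    exact ModuleCat.isZero_of_subsingleton _
  · obtain ⟨e, he⟩ := hB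
    obtain ⟨e', he'⟩ := hφ r m (-(m * q)) 0 (by lia)
    let c := (twist k A (φ ^ m)).mapIso ((DerivedCategory.homologyFunctor
      (ModuleCat.{u} Aᵐᵒᵖ) 0).mapIso e ≪≫ homologySingleIso ((toRight k A).obj B))
    have hc (a : A) : (leftMul a).app _ ≫ (e' ≪≫ c).hom =
        (e' ≪≫ c).hom ≫ (twist k A (φ ^ m)).map ((leftMul a).app B) := by
      have h1 := congrArg (DerivedCategory.homologyFunctor (ModuleCat.{u} Aᵐᵒᵖ) 0).map (he a)
      rw [Functor.map_comp, Functor.map_comp] at h1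
      have h2 := congrArg (twist k A (φ ^ m)).map
        (comm_trans h1 (homologySingleIso_naturality ((leftMul a).app B)))
      rw [Functor.map_comp, Functor.map_comp] at h2
      exact comm_trans (he' a) h2
    let f := (e' ≪≫ c).toLinearEquiv
    let f' := f.restrictScalars k
    refine ⟨toRightEquiv _ ≪≫ₗ f' ≪≫ₗ twistEquiv (φ ^ m) _ ≪≫ₗ (toRightEquiv B).symm,
      fun a x => ?_, fun b x => ?_⟩
    · exact congrArg (fun g => g (toRightEquiv _ x)) (hc a)
    · exact f.map_smul (op b) (toRightEquiv _ x)

end homology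

/-! ### Dimensions with values in the extended nonnegative reals -/

section dimk
variable {k : Type u} [Field k] {V V' V'' : Type*} [AddCommGroup V] [Module k V] [AddCommGroup V']
  [Module k V'] [AddCommGroup V''] [Module k V'']

lemma dimk_eq_ofNat_toENat (V : Type*) [AddCommGroup V] [Module k V] :
    dimk k V = ((Cardinal.toENat (Module.rank k V) : ℕ∞) : ENNReal) := rfl

lemma toENat_rank_le_of_injective (f : V →ₗ[k] V') (hf : Function.Injective f) :
    Cardinal.toENat (Module.rank k V) ≤ Cardinal.toENat (Module.rank k V') := by
  have h := LinearMap.lift_rank_le_of_injective f hf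
  have h' := Cardinal.toENat.monotone' h
  simpa using h'

lemma dimk_le_of_injective (f : V →ₗ[k] V') (hf : Function.Injective f) :
    dimk k V ≤ dimk k V' :=
  ENat.toENNReal_le.2 (toENat_rank_le_of_injective f hf)

lemma dimk_congr (f : V ≃ₗ[k] V') : dimk k V = dimk k V' :=
  le_antisymm (dimk_le_of_injective f.toLinearMap f.injective)
    (dimk_le_of_injective f.symm.toLinearMap f.symm.injective)

lemma dimk_le_add (f : V →ₗ[k] V') (g : V' →ₗ[k] V'') (h : ∀ x, g x = 0 → ∃ y, f y = x) :
    dimk k V' ≤ dimk k V + dimk k V'' := by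
  have h1 : Module.rank k V' = Module.rank k (V' ⧸ LinearMap.ker g) +
      Module.rank k (LinearMap.ker g) := (Submodule.rank_quotient_add_rank _).symm
  have h2 : Cardinal.toENat (Module.rank k (V' ⧸ LinearMap.ker g)) ≤
      Cardinal.toENat (Module.rank k V'') :=
    toENat_rank_le_of_injective ((LinearMap.range g).subtype ∘ₗ g.quotKerEquivRange.toLinearMap)
      (Subtype.val_injective.comp g.quotKerEquivRange.injective)
  obtain ⟨s, hs⟩ : ∃ s : LinearMap.ker g →ₗ[k] V, f ∘ₗ s = (LinearMap.ker g).subtype := by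
    let f' : V →ₗ[k] LinearMap.range f := f.rangeRestrict
    obtain ⟨s, hs⟩ := f'.exists_rightInverse_of_surjective (LinearMap.range_eq_top.2
      f.surjective_rangeRestrict)
    refine ⟨s ∘ₗ Submodule.inclusion (fun x hx => h x hx), LinearMap.ext fun x => ?_⟩
    exact congrArg Subtype.val (LinearMap.congr_fun hs ⟨x, h x x.2⟩)
  have h3 : Cardinal.toENat (Module.rank k (LinearMap.ker g)) ≤ Cardinal.toENat (Module.rank k V) :=
    toENat_rank_le_of_injective s (Function.Injective.of_comp (f := f) (by
      rw [← LinearMap.coe_comp, hs]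
      exact Subtype.val_injective))
  rw [dimk_eq_ofNat_toENat V', h1, map_add, ENat.toENNReal_add, add_comm]
  exact add_le_add (ENat.toENNReal_le.2 h3) (ENat.toENNReal_le.2 h2)

lemma dimk_eq_zero_of_subsingleton [Subsingleton V] : dimk k V = 0 := by
  rw [dimk_eq_ofNat_toENat, rank_subsingleton']
  simp

lemma one_le_dimk [Nontrivial V] : 1 ≤ dimk k V := by
  have h : (1 : Cardinal) ≤ Module.rank k V := Cardinal.one_le_iff_pos.2 rank_pos
  have h' : (1 : ℕ∞) ≤ Cardinal.toENat (Module.rank k V) := by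
    simpa using Cardinal.toENat.monotone' h
  have h'' := ENat.toENNReal_le.2 h'
  rwa [ENat.toENNReal_one] at h''

lemma dimk_lt_top [Module.Finite k V] : dimk k V < ⊤ := by
  have := Module.rank_lt_aleph0 k V
  rw [dimk_eq_ofNat_toENat]
  simpa using this

end dimk

/-! ### Linearity, and dimensions of morphisms out of perfect complexes -/

section linear
variable {k : Type u} [Field k] {W : Type u} [Ring W] [Algebra k W]
open scoped ModuleCat

/-- Linearity of H on all maps into Y reduces to scalar endomorphisms of one object isomorphic to Y;
this allows Y to be replaced by an actual complex. -/
lemma map_smul_of_iso {C D : Type*} [Category* C] [Category* D] [Preadditive C] [Preadditive D]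
    [Linear k C] [Linear k D] (H : C ⥤ D) {X Y : C} (e : X ≅ Y) (c : k)
    (h : H.map (c • 𝟙 X) = c • 𝟙 (H.obj X)) (Z : C) (f : Z ⟶ Y) : H.map (c • f) = c • H.map f := by
  have h1 : c • f = (f ≫ e.inv) ≫ (c • 𝟙 X) ≫ e.hom := by
    rw [Linear.smul_comp, Linear.comp_smul, Category.id_comp, Category.assoc, e.inv_hom_id,
      Category.comp_id]
  have h2 : f = (f ≫ e.inv) ≫ e.hom := by rw [Category.assoc, e.inv_hom_id, Category.comp_id]
  rw [h1, H.map_comp, H.map_comp (c • 𝟙 X), h, Linear.smul_comp, Linear.comp_smul, Category.id_comp,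
    ← H.map_comp, ← h2]

lemma homologyFunctor_map_smul {X Y : DMod W} (c : k) (f : X ⟶ Y) (i : ℤ) :
    (DerivedCategory.homologyFunctor (ModuleCat.{u} W) i).map (c • f) =
      c • (DerivedCategory.homologyFunctor (ModuleCat.{u} W) i).map f := by
  let H := DerivedCategory.homologyFunctor (ModuleCat.{u} W) i
  let K : CochainComplex (ModuleCat.{u} W) ℤ := DerivedCategory.Q.objPreimage Y
  have h3 : H.map (c • 𝟙 (DerivedCategory.Q.obj K)) = c • 𝟙 (H.obj (DerivedCategory.Q.obj K)) := by
    rw [← CategoryTheory.Functor.map_id, ← Functor.map_smul]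
    let H' := HomologicalComplex.homologyFunctor (ModuleCat.{u} W) (ComplexShape.up ℤ) i
    let ω : DerivedCategory.Q ⋙ H ≅ H' := DerivedCategory.homologyFunctorFactors (ModuleCat.{u} W) i
    have h4 : H'.map (c • 𝟙 K) = c • 𝟙 (H'.obj K) :=
      (ShortComplex.homologyMap_smul (ShortComplex.Hom.id (K.sc i)) c).trans
        (congrArg (c • ·) (HomologicalComplex.homologyMap_id K i))
    have h5 : H.map (DerivedCategory.Q.map (c • 𝟙 K)) ≫ ω.hom.app K =
        ω.hom.app K ≫ H'.map (c • 𝟙 K) := ω.hom.naturality (c • 𝟙 K)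
    have h6 : H.map (DerivedCategory.Q.map (c • 𝟙 K)) ≫ ω.hom.app K =
        (c • 𝟙 (H.obj (DerivedCategory.Q.obj K))) ≫ ω.hom.app K := by
      rw [h5, h4, Linear.comp_smul, Category.comp_id]
      exact ((Linear.smul_comp _ _ _ c _ _).trans
        (congrArg (c • ·) (Category.id_comp (ω.hom.app K)))).symm
    exact (Iso.cancel_iso_hom_right _ _ (ω.app K)).1 h6
  exact map_smul_of_iso H (DerivedCategory.Q.objObjPreimageIso Y) c h3 X f

variable (k) in
/-- Evaluation of a morphism from the regular module on homology. -/
def homEval (X : DMod W) (i : ℤ) :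
    ((DerivedCategory.singleFunctor (ModuleCat.{u} W) 0).obj (ModuleCat.of W W) ⟶ X⟦i⟧) →ₗ[k]
      (DerivedCategory.homologyFunctor (ModuleCat.{u} W) 0).obj (X⟦i⟧) where
  toFun f := (DerivedCategory.homologyFunctor (ModuleCat.{u} W) 0).map f
    ((homologySingleIso (ModuleCat.of W W)).inv (1 : W))
  map_add' f g := by
    rw [Functor.map_add]
    rfl
  map_smul' c f := by
    rw [homologyFunctor_map_smul]
    rfl

/-- A map out of the regular module is determined by its effect on cohomology, hence by the image of
1. This bounds morphism spaces by cohomology. -/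
lemma homEval_injective (X : DMod W) (i : ℤ) : Function.Injective (homEval k X i) := by
  rw [injective_iff_map_eq_zero]
  intro f hf
  have : Projective (ModuleCat.of W W) := inferInstance
  refine eq_zero_of_homologyFunctor_map_eq_zero f ?_
  rw [← cancel_epi (homologySingleIso (ModuleCat.of W W)).inv, comp_zero]
  ext
  exact hf

lemma dimk_hom_single_le (K : CochainComplex (ModuleCat.{u} W) ℤ) (i : ℤ) :
    dimk k ((DerivedCategory.singleFunctor (ModuleCat.{u} W) 0).obj (ModuleCat.of W W) ⟶
      (DerivedCategory.Q.obj K)⟦i⟧) ≤ dimk k (K.homology i) := by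
  refine (dimk_le_of_injective _ (homEval_injective (k := k) (DerivedCategory.Q.obj K) i)).trans ?_
  let e := ((DerivedCategory.homologyFunctor (ModuleCat.{u} W) 0).shiftIso i 0 i (add_zero i)).app
    (DerivedCategory.Q.obj K) ≪≫ (DerivedCategory.homologyFunctorFactors _ i).app K
  exact (dimk_congr (e.toLinearEquiv.restrictScalars k)).le

/-- Morphisms from an object built from the regular module are bounded by homology. -/
lemma tsum_dimk_hom_le_of_hasTower (K : CochainComplex (ModuleCat.{u} W) ℤ) {Y : DMod W} {l : List ℤ}
    (h : HasTower ((DerivedCategory.singleFunctor (ModuleCat.{u} W) 0).obj (ModuleCat.of W W)) Y l) :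
    ∑' i : ℤ, dimk k (Y ⟶ (DerivedCategory.Q.obj K)⟦i⟧) ≤
      l.length * ∑' i : ℤ, dimk k (K.homology i) := by
  induction h with
  | zero X hX =>
    have (i : ℤ) : dimk k (X ⟶ (DerivedCategory.Q.obj K)⟦i⟧) = 0 := by
      have : Subsingleton (X ⟶ (DerivedCategory.Q.obj K)⟦i⟧) := ⟨fun f g => hX.eq_of_src f g⟩
      exact dimk_eq_zero_of_subsingleton
    simp [this]
  | step X Y n l f g h hT hX ih =>
    let E := (DerivedCategory.singleFunctor (ModuleCat.{u} W) 0).obj (ModuleCat.of W W)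
    have h1 (i : ℤ) : dimk k (Y ⟶ (DerivedCategory.Q.obj K)⟦i⟧) ≤
        dimk k (E⟦n⟧ ⟶ (DerivedCategory.Q.obj K)⟦i⟧) +
          dimk k (X ⟶ (DerivedCategory.Q.obj K)⟦i⟧) :=
      dimk_le_add (Linear.leftComp k _ g) (Linear.leftComp k _ f) fun x hx => by
        obtain ⟨y, hy⟩ := Triangle.yoneda_exact₂ _ hT x hx
        exact ⟨y, hy.symm⟩
    have h2 (i : ℤ) : dimk k (E⟦n⟧ ⟶ (DerivedCategory.Q.obj K)⟦i⟧) ≤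
        dimk k (K.homology (i - n)) := by
      refine le_trans ?_ (dimk_hom_single_le K (i - n))
      let u : E ≅ (E⟦n⟧)⟦-n⟧ := (shiftEquiv (DMod W) n).unitIso.app E
      let v : ((DerivedCategory.Q.obj K)⟦i⟧)⟦-n⟧ ≅ (DerivedCategory.Q.obj K)⟦i - n⟧ :=
        ((shiftFunctorAdd' (DMod W) i (-n) (i - n) (by lia)).app (DerivedCategory.Q.obj K)).symm
      let F : (E⟦n⟧ ⟶ (DerivedCategory.Q.obj K)⟦i⟧) →ₗ[k] (E ⟶ (DerivedCategory.Q.obj K)⟦i - n⟧) :=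
        Linear.leftComp k _ u.hom ∘ₗ Linear.rightComp k _ v.hom ∘ₗ
          (shiftFunctor (DMod W) (-n)).mapLinearMap k
      refine dimk_le_of_injective F ((injective_iff_map_eq_zero F).2 fun x hx => ?_)
      have hx' : u.hom ≫ (shiftFunctor (DMod W) (-n)).map x ≫ v.hom = 0 := hx
      rw [Preadditive.IsIso.comp_left_eq_zero, Preadditive.IsIso.comp_right_eq_zero] at hx'
      exact (shiftFunctor (DMod W) (-n)).map_injective (hx'.trans (Functor.map_zero _ _ _).symm)
    calc ∑' i : ℤ, dimk k (Y ⟶ (DerivedCategory.Q.obj K)⟦i⟧)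
        ≤ ∑' i : ℤ, (dimk k (K.homology (i - n)) +
            dimk k (X ⟶ (DerivedCategory.Q.obj K)⟦i⟧)) :=
          ENNReal.tsum_le_tsum fun i => (h1 i).trans (add_le_add_left (h2 i) _)
      _ = ∑' i : ℤ, dimk k (K.homology (i - n)) +
            ∑' i : ℤ, dimk k (X ⟶ (DerivedCategory.Q.obj K)⟦i⟧) := ENNReal.tsum_add
      _ ≤ ∑' i : ℤ, dimk k (K.homology i) + l.length * ∑' i : ℤ, dimk k (K.homology i) :=
          add_le_add ((Equiv.subRight n).tsum_eq fun i => dimk k (K.homology i)).le ih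
      _ = _ := by
        rw [List.length_cons]
        push_cast
        ring

lemma tsum_dimk_hom_le (K : CochainComplex (ModuleCat.{u} W) ℤ) {Y : DMod W} {l : List ℤ}
    (h : splitTower ((DerivedCategory.singleFunctor (ModuleCat.{u} W) 0).obj (ModuleCat.of W W)) l Y) :
    ∑' i : ℤ, dimk k (Y ⟶ (DerivedCategory.Q.obj K)⟦i⟧) ≤
      l.length * ∑' i : ℤ, dimk k (K.homology i) := by
  obtain ⟨Y', hY, ⟨r⟩⟩ := h
  refine le_trans (ENNReal.tsum_le_tsum fun i => ?_) (tsum_dimk_hom_le_of_hasTower K hY)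
  refine dimk_le_of_injective (Linear.leftComp k _ r.r) fun x y (hxy : r.r ≫ x = r.r ≫ y) => ?_
  have := congrArg (r.i ≫ ·) hxy
  simpa using this

/-- Morphisms from a bounded complex of finitely generated projectives. -/
lemma IsStrictPerfect.exists_tsum_dimk_le {P : CochainComplex (ModuleCat.{u} W) ℤ}
    (hP : IsStrictPerfect W P) : ∃ c : ℕ, ∀ K : CochainComplex (ModuleCat.{u} W) ℤ,
      ∑' i : ℤ, dimk k (DerivedCategory.Q.obj P ⟶ (DerivedCategory.Q.obj K)⟦i⟧) ≤
        c * ∑' i : ℤ, dimk k (K.homology i) := by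
  obtain ⟨l, hl⟩ := hP.prop_of_regular (fun X => ∃ l, splitTower
    ((DerivedCategory.singleFunctor (ModuleCat.{u} W) 0).obj (ModuleCat.of W W)) l X)
    ⟨[0], ObjectProperty.le_retractClosure _ _
      ((HasTower.single _ 0).of_iso ((shiftFunctorZero _ ℤ).app _))⟩
  exact ⟨l.length, fun K => tsum_dimk_hom_le K hl⟩

end linear

/-! ### Uniform bound for the cohomology of the tensor powers -/

section bound
variable {k : Type u} [Field k] {A : Type u} [Ring A] [Algebra k A]
open scoped ModuleCat

lemma Db.tsum_dimk_homology_lt_top (X : Db k A) :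
    ∑' i : ℤ, dimk k ((DerivedCategory.homologyFunctor (ModuleCat.{u} Aᵐᵒᵖ) i).obj X.obj) < ⊤ := by
  obtain ⟨⟨⟨a, ha⟩, ⟨b, hb⟩⟩, hfin⟩ := X.property
  have h (i : ℤ) (hi : i ∉ Finset.Icc a b) :
      dimk k ((DerivedCategory.homologyFunctor (ModuleCat.{u} Aᵐᵒᵖ) i).obj X.obj) = 0 := by
    have hz : IsZero ((DerivedCategory.homologyFunctor (ModuleCat.{u} Aᵐᵒᵖ) i).obj X.obj) := by
      rw [Finset.mem_Icc, not_and_or, not_le, not_le] at hi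
      rcases hi with hi | hi
      · have : X.obj.IsGE a := ha
        exact X.obj.isZero_of_isGE a i hi
      · have : X.obj.IsLE b := hb
        exact X.obj.isZero_of_isLE b i hi
    have := ModuleCat.subsingleton_of_isZero hz
    exact dimk_eq_zero_of_subsingleton
  rw [tsum_eq_sum h]
  refine ENNReal.sum_lt_top.2 fun i _ => ?_
  have := hfin i
  exact dimk_lt_top

variable [Module.Finite k A] [FinGlobalDim Aᵐᵒᵖ]
variable (Δ : ProjectiveResolution (regularBimod k A)) (N : ProjectiveResolution (dualBimod k A))

/-- Twisting preserves dimensions and shifting only reindexes the sum, so the total dimension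
depends on n modulo p alone; the bound is the sum over the p residues. -/
lemma IsTwistedCY.exists_tsum_dimk_tensorPow_le {p : ℕ} {q : ℤ} (h : IsTwistedCY k A p q) :
    ∃ c : ENNReal, c < ⊤ ∧ ∀ n : ℕ, ∑' i : ℤ, dimk k ((tensorPow Δ N n).homology i) ≤ c := by
  obtain ⟨φ, hφ⟩ := h.exists_tensorPow_homology Δ N
  let d (r : ℕ) : ENNReal := ∑' i : ℤ, dimk k
    ((DerivedCategory.homologyFunctor (ModuleCat.{u} Aᵐᵒᵖ) i).obj
      ((iter (serreFunctor k A) r).obj (regularDb k A)).obj)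
  have hd (r : ℕ) : d r < ⊤ := Db.tsum_dimk_homology_lt_top _
  refine ⟨∑ r ∈ Finset.range p, d r, ENNReal.sum_lt_top.2 fun r _ => hd r, fun n => ?_⟩
  have hr : n % p ∈ Finset.range p := Finset.mem_range.2 (Nat.mod_lt n h.1)
  refine le_trans ?_ (Finset.single_le_sum (fun _ _ => zero_le) hr)
  obtain ⟨m, hm⟩ : ∃ m, n = n % p + p * m := ⟨n / p, (Nat.mod_add_div n p).symm⟩
  have h1 (i : ℤ) : dimk k ((tensorPow Δ N n).homology i) = dimk k
      ((DerivedCategory.homologyFunctor (ModuleCat.{u} Aᵐᵒᵖ) (m * q + i)).obj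
      ((iter (serreFunctor k A) (n % p)).obj (regularDb k A)).obj) := by
    conv_lhs => rw [hm]
    obtain ⟨e, -⟩ := hφ (n % p) m i _ rfl
    exact dimk_congr (toRightEquiv _ ≪≫ₗ (e.toLinearEquiv.restrictScalars k) ≪≫ₗ twistEquiv _ _)
  rw [tsum_congr h1]
  exact ((Equiv.addLeft (m * q)).tsum_eq fun i => dimk k
    ((DerivedCategory.homologyFunctor (ModuleCat.{u} Aᵐᵒᵖ) i).obj
      ((iter (serreFunctor k A) (n % p)).obj (regularDb k A)).obj)).le

end bound

/-! ### Restriction of scalars and projectivity -/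

section restrict
variable {R S : Type u} [Ring R] [Ring S]

/-- Restriction is left adjoint to coextension. If S is projective over R, coextension preserves
epimorphisms, so restriction preserves projectives. -/
lemma projective_restrictScalars (f : R →+* S)
    (hf : Projective ((ModuleCat.restrictScalars f).obj (ModuleCat.of S S))) (P : ModuleCat.{u} S)
    [Projective P] : Projective ((ModuleCat.restrictScalars.{u} f).obj P) := by
  have : (ModuleCat.coextendScalars.{u, u, u} f).PreservesEpimorphisms := ⟨fun {M M'} g hg => by
    rw [ModuleCat.epi_iff_surjective]
    intro x
    let y : (ModuleCat.restrictScalars f).obj (ModuleCat.of S S) ⟶ M' :=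
      ModuleCat.ofHom (X := (ModuleCat.restrictScalars f).obj (ModuleCat.of S S))
        (ModuleCat.CoextendScalars.equiv f M' x)
    refine ⟨(ModuleCat.CoextendScalars.equiv f M).symm (Projective.factorThru y g).hom, ?_⟩
    apply (ModuleCat.CoextendScalars.equiv f M').injective
    exact congrArg ModuleCat.Hom.hom (Projective.factorThru_comp y g)⟩
  exact (ModuleCat.restrictCoextendScalarsAdj.{u, u, u} f).map_projective P inferInstance

end restrict

/-! ### Left projective bimodules and reduction along a character -/

section leftModules
variable (k : Type u) [Field k] (A : Type u) [Ring A] [Algebra k A]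
open scoped ModuleCat TensorProduct
open MulOpposite

/-- The underlying left module of a bimodule. -/
abbrev toLeft : BimodCat k A ⥤ ModuleCat.{u} A :=
  ModuleCat.restrictScalars (Algebra.TensorProduct.includeLeft : A →ₐ[k] Env k A).toRingHom

variable {k A}

lemma projective_toLeft (P : BimodCat k A) [Projective P] : Projective ((toLeft k A).obj P) := by
  refine projective_restrictScalars _ ?_ P
  let e : (ModuleCat.of A (A ⊗[k] Aᵐᵒᵖ) : ModuleCat.{u} A) ≃ₗ[A]
      ((toLeft k A).obj (ModuleCat.of (Env k A) (Env k A)) : ModuleCat.{u} A) :=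
    { toFun := fun x => (x : Env k A)
      invFun := fun x => (x : Env k A)
      map_add' := fun _ _ => rfl
      map_smul' := fun a x => by
        change (a • x : A ⊗[k] Aᵐᵒᵖ) = (a ⊗ₜ[k] (1 : Aᵐᵒᵖ) : Env k A) * x
        induction x using TensorProduct.induction_on with
        | zero => simp
        | add x y hx hy => rw [smul_add, hx, hy, mul_add]
        | tmul x y =>
          rw [Algebra.TensorProduct.tmul_mul_tmul, one_mul, TensorProduct.smul_tmul', smul_eq_mul]
      left_inv := fun _ => rfl
      right_inv := fun _ => rfl }
  have : Module.Free A (A ⊗[k] Aᵐᵒᵖ) := inferInstance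
  have : Projective (ModuleCat.of A (A ⊗[k] Aᵐᵒᵖ) : ModuleCat.{u} A) :=
    (IsProjective.iff_projective _).1 inferInstance
  exact Projective.of_iso e.toModuleIso inferInstance

lemma projective_toLeft_regularBimod : Projective ((toLeft k A).obj (regularBimod k A)) := by
  let e : (ModuleCat.of A A : ModuleCat.{u} A) ≃ₗ[A]
      ((toLeft k A).obj (regularBimod k A) : ModuleCat.{u} A) :=
    { toFun := fun x => regEquiv k A x
      invFun := fun x => (regEquiv k A).symm x
      map_add' := fun _ _ => rfl
      map_smul' := fun a x => (regEquiv_leftAct a x).symm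
      left_inv := fun _ => rfl
      right_inv := fun _ => rfl }
  have : Projective (ModuleCat.of A A : ModuleCat.{u} A) :=
    (IsProjective.iff_projective _).1 inferInstance
  exact Projective.of_iso e.toModuleIso inferInstance

variable {S : ShortComplex (BimodCat k A)}

/-- A short exact sequence of bimodules which splits on the left has a left linear retraction. -/
lemma exists_left_retraction (hS : S.ShortExact) (h : Projective ((toLeft k A).obj S.X₃)) :
    ∃ r : S.X₂ →ₗ[k] S.X₁, (∀ a x, r (leftAct _ a x) = leftAct _ a (r x)) ∧
      ∀ x, r (S.f x) = x := by
  have hS' := hS.map_of_exact (toLeft k A)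
  have : Projective (S.map (toLeft k A)).X₃ := h
  let s := hS'.splittingOfProjective
  refine ⟨{
      toFun := fun x => s.r x
      map_add' := fun x y => map_add s.r.hom x y
      map_smul' := fun c x => ?_ }, fun a x => LinearMap.map_smul s.r.hom a x,
    fun x => congrArg (fun g => g x) s.f_r⟩
  have key (X : BimodCat k A) (y : X) : c • y = leftAct X (algebraMap k A c) y := by
    rw [AlgHom.commutes]; rfl
  refine Eq.trans ?_ (key _ _).symm
  refine Eq.trans (congrArg s.r (key _ x)) ?_
  exact LinearMap.map_smul s.r.hom (algebraMap k A c) x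

lemma projective_toLeft_X₁ (hS : S.ShortExact) (h₂ : Projective ((toLeft k A).obj S.X₂))
    (h₃ : Projective ((toLeft k A).obj S.X₃)) : Projective ((toLeft k A).obj S.X₁) := by
  have hS' := hS.map_of_exact (toLeft k A)
  have : Projective (S.map (toLeft k A)).X₃ := h₃
  let s := hS'.splittingOfProjective
  exact @Retract.projective _ _ _ _ { i := (S.map (toLeft k A)).f, r := s.r, retract := s.f_r } h₂

section character
variable (χ : A →ₐ[k] k)

/-- The right submodule spanned by the elements `a m - χ(a) m`. -/
def charSub (M : BimodCat k A) : Submodule Aᵐᵒᵖ ((toRight k A).obj M) :=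
  Submodule.span Aᵐᵒᵖ {x | ∃ (a : A) (m : M), x = toRightEquiv M (leftAct M a m - χ a • m)}

variable {χ} in
lemma mem_charSub {M : BimodCat k A} (a : A) (m : M) :
    toRightEquiv M (leftAct M a m - χ a • m) ∈ charSub χ M :=
  Submodule.subset_span ⟨a, m, rfl⟩

lemma charSub_le_comap {M M' : BimodCat k A} (f : M ⟶ M') :
    charSub χ M ≤ (charSub χ M').comap ((toRight k A).map f).hom := by
  refine Submodule.span_le.2 ?_
  rintro _ ⟨a, m, rfl⟩
  have : ((toRight k A).map f).hom (toRightEquiv M (leftAct M a m - χ a • m)) =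
      toRightEquiv M' (leftAct M' a (linOf (k := k) f m) - χ a • linOf (k := k) f m) := by
    rw [← linOf_leftAct, ← map_smul, ← map_sub]
    rfl
  change _ ∈ charSub χ M'
  rw [this]
  exact mem_charSub a _

/-- The functor `k_χ ⊗_A -` from bimodules to right modules. -/
def charQuot : BimodCat k A ⥤ ModuleCat.{u} Aᵐᵒᵖ where
  obj M := ModuleCat.of Aᵐᵒᵖ (((toRight k A).obj M) ⧸ charSub χ M)
  map f := ModuleCat.ofHom (Submodule.mapQ _ _ _ (charSub_le_comap χ f))
  map_id M := by
    ext x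
    rfl
  map_comp f g := by
    ext x
    rfl

instance : (charQuot χ).Additive where
  map_add {M M' f g} := by
    ext x
    obtain ⟨x, rfl⟩ := Submodule.mkQ_surjective (charSub χ M) x
    rfl

/-- The class of an element in `k_χ ⊗_A M`. -/
def charMk (M : BimodCat k A) : (toRight k A).obj M →ₗ[Aᵐᵒᵖ] (charQuot χ).obj M :=
  Submodule.mkQ _

lemma charMk_surjective (M : BimodCat k A) : Function.Surjective (charMk χ M) :=
  Submodule.mkQ_surjective _

lemma charMk_eq_zero {M : BimodCat k A} (x : (toRight k A).obj M) :
    charMk χ M x = 0 ↔ x ∈ charSub χ M := Submodule.Quotient.mk_eq_zero _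

lemma charMk_leftAct (M : BimodCat k A) (a : A) (m : M) :
    charMk χ M (toRightEquiv M (leftAct M a m)) = charMk χ M (toRightEquiv M (χ a • m)) := by
  rw [← sub_eq_zero, ← map_sub, ← map_sub]
  exact (charMk_eq_zero χ _).2 (mem_charSub a m)

lemma charQuot_map_apply {M M' : BimodCat k A} (f : M ⟶ M') (x : (toRight k A).obj M) :
    (charQuot χ).map f (charMk χ M x) = charMk χ M' ((toRight k A).map f x) := rfl

/-- The functor k_χ ⊗_A - is right exact, and a sequence that splits over A on the left stays exact
under it. The left linear retraction r provides injectivity. -/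
lemma charQuot_shortExact (hS : S.ShortExact) (h : Projective ((toLeft k A).obj S.X₃)) :
    (S.map (charQuot χ)).ShortExact := by
  obtain ⟨r, hr, hrf⟩ := exists_left_retraction hS h
  have hR := hS.map_of_exact (toRight k A)
  have hepi : Function.Surjective ((toRight k A).map S.g) :=
    (ModuleCat.epi_iff_surjective _).1 hR.epi_g
  have hlift (z) (hz : z ∈ charSub χ S.X₃) : ∃ y ∈ charSub χ S.X₂, (toRight k A).map S.g y = z := by
    refine Submodule.span_induction (p := fun z _ => ∃ y ∈ charSub χ S.X₂,
      (toRight k A).map S.g y = z) ?_ ⟨0, zero_mem _, map_zero _⟩ ?_ ?_ hz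
    · rintro _ ⟨a, m, rfl⟩
      obtain ⟨n, hn⟩ := hepi m
      let n' : S.X₂ := n
      refine ⟨_, mem_charSub a n', ?_⟩
      change toRightEquiv _ (linOf (k := k) S.g (leftAct S.X₂ a n' - χ a • n')) = _
      replace hn : linOf (k := k) S.g n' = m := hn
      rw [map_sub (linOf (k := k) S.g), map_smul (linOf (k := k) S.g), linOf_leftAct, hn]
    · rintro _ _ _ _ ⟨y, hy, rfl⟩ ⟨y', hy', rfl⟩
      exact ⟨y + y', add_mem hy hy', map_add _ _ _⟩
    · rintro b _ _ ⟨y, hy, rfl⟩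
      exact ⟨b • y, Submodule.smul_mem _ _ hy, map_smul ((toRight k A).map S.g).hom _ _⟩
  -- The submodule is spanned over the right action, for which r is not linear; the claim is
  -- therefore proved for all right multiples of y at once.
  have hret (y) (hy : y ∈ charSub χ S.X₂) (b : Aᵐᵒᵖ) : toRightEquiv S.X₁
      (r (rightAct S.X₂ b ((toRightEquiv S.X₂).symm y))) ∈ charSub χ S.X₁ := by
    revert b
    refine Submodule.span_induction (p := fun y _ => ∀ b, toRightEquiv S.X₁
      (r (rightAct S.X₂ b ((toRightEquiv S.X₂).symm y))) ∈ charSub χ S.X₁) ?_ ?_ ?_ ?_ hy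
    · rintro _ ⟨a, m, rfl⟩ b
      rw [LinearEquiv.symm_apply_apply, map_sub, map_smul, map_sub, map_smul]
      have : rightAct S.X₂ b (leftAct S.X₂ a m) = leftAct S.X₂ a (rightAct S.X₂ b m) :=
        (LinearMap.congr_fun (leftAct_rightAct_comm S.X₂ a b) m).symm
      rw [this, hr]
      exact mem_charSub a _
    · intro b
      simp only [map_zero, zero_mem]
    · intro y y' _ _ h h' b
      simp only [map_add]
      exact add_mem (h b) (h' b)
    · intro c y _ h b
      have : rightAct S.X₂ b ((toRightEquiv S.X₂).symm (c • y)) =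
          rightAct S.X₂ (b * c) ((toRightEquiv S.X₂).symm y) := by
        rw [map_mul]; rfl
      rw [this]
      exact h _
  have hmono : Mono (S.map (charQuot χ)).f := by
    rw [ModuleCat.mono_iff_injective]
    refine (injective_iff_map_eq_zero (S.map (charQuot χ)).f.hom).2 fun x hx => ?_
    obtain ⟨x, rfl⟩ := charMk_surjective χ _ x
    have h1 := (charMk_eq_zero χ _).1 ((charQuot_map_apply χ S.f x).symm.trans hx)
    have h2 := hret _ h1 1
    rw [map_one] at h2
    refine (charMk_eq_zero χ _).2 ?_
    have h3 := hrf ((toRightEquiv S.X₁).symm x)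
    exact (congrArg (· ∈ charSub χ S.X₁) (congrArg (toRightEquiv S.X₁) h3)).mp h2
  have hepi' : Epi (S.map (charQuot χ)).g := by
    rw [ModuleCat.epi_iff_surjective]
    intro z
    obtain ⟨z, rfl⟩ := charMk_surjective χ _ z
    obtain ⟨y, rfl⟩ := hepi z
    exact ⟨charMk χ _ y, rfl⟩
  refine { exact := ?_ }
  rw [ShortComplex.moduleCat_exact_iff]
  intro y hy
  obtain ⟨y, rfl⟩ := charMk_surjective χ _ y
  obtain ⟨y', hy', h'⟩ := hlift _ ((charMk_eq_zero χ _).1 ((charQuot_map_apply χ S.g y).symm.trans hy))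
  obtain ⟨x, hx⟩ := (ShortComplex.moduleCat_exact_iff _).1 hR.exact (y - y')
    (((map_sub ((toRight k A).map S.g).hom y y').trans (sub_eq_zero.2 h'.symm)))
  refine ⟨charMk χ _ x, (charQuot_map_apply χ S.f x).trans ?_⟩
  refine (congrArg (charMk χ S.X₂) hx).trans ?_
  rw [map_sub, (charMk_eq_zero χ y').2 hy', sub_zero]

/-- The algebra homomorphism `χ ⊗ id`. -/
def charHom : Env k A →ₐ[k] Aᵐᵒᵖ :=
  Algebra.TensorProduct.lift ((Algebra.ofId k Aᵐᵒᵖ).comp χ) (AlgHom.id k Aᵐᵒᵖ)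
    (fun a b => Algebra.commutes (χ a) b)

lemma charHom_tmul (a : A) (b : Aᵐᵒᵖ) : charHom χ (a ⊗ₜ b) = algebraMap k Aᵐᵒᵖ (χ a) * b :=
  Algebra.TensorProduct.lift_tmul _ _ _ _ _

/-- Right modules as bimodules, with `A` acting through `χ` on the left. -/
abbrev charBimod : ModuleCat.{u} Aᵐᵒᵖ ⥤ BimodCat k A :=
  ModuleCat.restrictScalars (charHom χ).toRingHom

lemma charMk_smul (M : BimodCat k A) (w : Env k A) (m : M) :
    charMk χ M (toRightEquiv M (w • m)) = charHom χ w • charMk χ M (toRightEquiv M m) := by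
  induction w using TensorProduct.induction_on with
  | zero => rw [zero_smul (Env k A) m, map_zero, map_zero, map_zero, zero_smul]
  | add a b ha hb => rw [add_smul (M := M), map_add, map_add, ha, hb, map_add, add_smul]
  | tmul a b =>
    rw [tmul_smul_eq, charMk_leftAct, charHom_tmul, ← map_smul (charMk χ M)]
    congr 1
    rw [mul_smul, map_smul, toRightEquiv_rightAct]
    exact algebra_compatible_smul Aᵐᵒᵖ (χ a) (b • toRightEquiv M m)

/-- The unit of the adjunction between `charQuot` and `charBimod`. -/
def charUnit (M : BimodCat k A) : M ⟶ (charBimod χ).obj ((charQuot χ).obj M) :=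
  ModuleCat.ofHom (X := M) (Y := (charBimod χ).obj ((charQuot χ).obj M))
    { toFun := fun m => charMk χ M (toRightEquiv M m)
      map_add' := fun m m' => by rw [map_add, map_add]; rfl
      map_smul' := fun w m => charMk_smul χ M w m }

lemma charUnit_naturality {M M' : BimodCat k A} (f : M ⟶ M') :
    f ≫ charUnit χ M' = charUnit χ M ≫ (charBimod χ).map ((charQuot χ).map f) := rfl

/-- A bimodule homomorphism to a bimodule on which `A` acts through `χ` factors. -/
def charDesc {M : BimodCat k A} {V : ModuleCat.{u} Aᵐᵒᵖ} (f : M ⟶ (charBimod χ).obj V) :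
    (charQuot χ).obj M ⟶ V :=
  ModuleCat.ofHom (Submodule.liftQ (charSub χ M)
    ({ toFun := fun x => (f ((toRightEquiv M).symm x) : (charBimod χ).obj V)
       map_add' := fun x y => map_add f.hom _ _
       map_smul' := fun b x => (map_smul f.hom ((1 : A) ⊗ₜ[k] b : Env k A) _).trans (by
        change charHom χ _ • (_ : V) = _
        rw [charHom_tmul, map_one, map_one, one_mul]
        rfl) } : (toRight k A).obj M →ₗ[Aᵐᵒᵖ] V) (by
      refine Submodule.span_le.2 ?_
      rintro _ ⟨a, m, rfl⟩
      change f (leftAct M a m - χ a • m) = 0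
      refine (map_sub f.hom _ _).trans (sub_eq_zero.2 ?_)
      refine (map_smul f.hom (a ⊗ₜ[k] (1 : Aᵐᵒᵖ) : Env k A) m).trans ?_
      refine Eq.trans ?_ (map_smul f.hom (algebraMap k (Env k A) (χ a)) m).symm
      change charHom χ _ • (_ : V) = charHom χ _ • (_ : V)
      rw [charHom_tmul, mul_one, AlgHom.commutes]))

lemma charUnit_charDesc {M : BimodCat k A} {V : ModuleCat.{u} Aᵐᵒᵖ}
    (f : M ⟶ (charBimod χ).obj V) : charUnit χ M ≫ (charBimod χ).map (charDesc χ f) = f := rfl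

lemma charUnit_hom_ext {M : BimodCat k A} {V : ModuleCat.{u} Aᵐᵒᵖ}
    {f g : (charQuot χ).obj M ⟶ V}
    (h : charUnit χ M ≫ (charBimod χ).map f = charUnit χ M ≫ (charBimod χ).map g) : f = g := by
  ext x
  obtain ⟨x, rfl⟩ := charMk_surjective χ _ x
  exact congrArg (fun e => e ((toRightEquiv M).symm x)) h

/-- This functor is left adjoint to `charBimod`, which preserves epimorphisms. -/
lemma projective_charQuot (P : BimodCat k A) [Projective P] : Projective ((charQuot χ).obj P) where
  factors {E X} f e he := by
    have : Epi ((charBimod χ).map e) := inferInstance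
    refine ⟨charDesc χ (Projective.factorThru (charUnit χ P ≫ (charBimod χ).map f)
      ((charBimod χ).map e)), charUnit_hom_ext χ ?_⟩
    rw [CategoryTheory.Functor.map_comp, reassoc_of% charUnit_charDesc, Projective.factorThru_comp]

variable {χ} in
lemma isIso_charUnit {M : BimodCat k A} (h : ∀ a m, leftAct M a m = χ a • m) :
    IsIso (charUnit χ M) := by
  rw [ConcreteCategory.isIso_iff_bijective]
  have hbot : charSub χ M = ⊥ := by
    refine (Submodule.span_eq_bot).2 ?_
    rintro _ ⟨a, m, rfl⟩
    rw [h, sub_self, map_zero]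
  refine ⟨(injective_iff_map_eq_zero (charUnit χ M).hom).2 fun m hm => ?_, fun x => ?_⟩
  · have := (charMk_eq_zero χ (toRightEquiv M m)).1 hm
    rw [hbot, Submodule.mem_bot] at this
    exact (toRightEquiv M).injective (this.trans (map_zero _).symm)
  · obtain ⟨x, rfl⟩ := charMk_surjective χ _ x
    exact ⟨(toRightEquiv M).symm x, rfl⟩

/-- Extensions of a left projective bimodule `K` with `k_χ ⊗_A K` projective by a bimodule on which
`A` acts through `χ` split. -/
lemma exists_section_of_char (hS : S.ShortExact) (h : Projective ((toLeft k A).obj S.X₃))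
    (hq : Projective ((charQuot χ).obj S.X₃)) (hχ : ∀ a m, leftAct S.X₁ a m = χ a • m) :
    ∃ s : S.X₃ ⟶ S.X₂, s ≫ S.g = 𝟙 _ := by
  have hS' := charQuot_shortExact χ hS h
  have : Projective (S.map (charQuot χ)).X₃ := hq
  let σ := hS'.splittingOfProjective
  have := isIso_charUnit hχ
  obtain ⟨ρ, hρ⟩ : ∃ ρ : (charQuot χ).obj S.X₂ ⟶ (charQuot χ).obj S.X₁,
    (charQuot χ).map S.f ≫ ρ = 𝟙 _ := ⟨σ.r, σ.f_r⟩
  -- Because A acts through χ on the subobject, its unit is invertible, and the right linear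
  -- retraction after reduction pulls back to a retraction of bimodules.
  let r : S.X₂ ⟶ S.X₁ := charUnit χ S.X₂ ≫ (charBimod χ).map ρ ≫ inv (charUnit χ S.X₁)
  have hr : S.f ≫ r = 𝟙 _ := by
    have h2 : (charBimod χ).map ((charQuot χ).map S.f) ≫ (charBimod χ).map ρ = 𝟙 _ := by
      rw [← CategoryTheory.Functor.map_comp, hρ, CategoryTheory.Functor.map_id]
    dsimp only [r]
    rw [← Category.assoc, charUnit_naturality, Category.assoc, reassoc_of% h2, IsIso.hom_inv_id]
  have := hS.epi_g
  let s := ShortComplex.Splitting.ofExactOfRetraction S hS.exact r hr inferInstance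
  exact ⟨s.s, s.s_g⟩

end character
end leftModules

/-! ### Projective resolutions that are finite whenever possible -/

section resolution
variable {R : Type u} [Ring R]

/-- The case distinction serves two aims: finite generation passes to the cover, and a projective
module covers itself, so that the resolution stops as soon as a syzygy is projective. -/
lemma exists_cover (M : ModuleCat.{u} R) : ∃ (F : ModuleCat.{u} R) (π : F ⟶ M), Epi π ∧
    Projective F ∧ (Module.Finite R M → Module.Finite R F) ∧ (Projective M → IsIso π) := by
  by_cases hM : Projective M
  · exact ⟨M, 𝟙 M, inferInstance, hM, id, fun _ => inferInstance⟩
  by_cases hf : Module.Finite R M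
  · obtain ⟨n, f, hf'⟩ := Module.Finite.exists_fin' R M
    let F : ModuleCat.{u} R := ModuleCat.of R (ULift.{u} (Fin n) → R)
    let g : F ⟶ M := ModuleCat.ofHom (f ∘ₗ LinearMap.funLeft R R ULift.up)
    have hg : Function.Surjective g :=
      hf'.comp (LinearMap.funLeft_surjective_of_injective R R _ ULift.up_injective)
    exact ⟨F, g, (ModuleCat.epi_iff_surjective _).2 hg, inferInstance, fun _ => inferInstance,
      fun h => absurd h hM⟩
  · exact ⟨Projective.over M, Projective.π M, inferInstance, inferInstance, fun h => absurd h hf,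
      fun h => absurd h hM⟩

/-- A projective module mapping onto `M`, finitely generated if `M` is, and equal to `M` if `M` is
projective. -/
def cover (M : ModuleCat.{u} R) : ModuleCat.{u} R := (exists_cover M).choose

/-- The projection from the cover of a module. -/
def coverπ (M : ModuleCat.{u} R) : cover M ⟶ M := (exists_cover M).choose_spec.choose

instance (M : ModuleCat.{u} R) : Epi (coverπ M) := (exists_cover M).choose_spec.choose_spec.1

instance (M : ModuleCat.{u} R) : Projective (cover M) :=
  (exists_cover M).choose_spec.choose_spec.2.1

instance (M : ModuleCat.{u} R) [h : Module.Finite R M] : Module.Finite R (cover M) :=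
  (exists_cover M).choose_spec.choose_spec.2.2.1 h

instance (M : ModuleCat.{u} R) [h : Projective M] : IsIso (coverπ M) :=
  (exists_cover M).choose_spec.choose_spec.2.2.2 h

/-- The iterated syzygies of a module. -/
def coverSyzygy (M : ModuleCat.{u} R) : ℕ → ModuleCat.{u} R
  | 0 => M
  | n + 1 => kernel (coverπ (coverSyzygy M n))

/-- The inclusion of a syzygy. -/
def coverι (M : ModuleCat.{u} R) (n : ℕ) : coverSyzygy M (n + 1) ⟶ cover (coverSyzygy M n) :=
  kernel.ι _

lemma coverι_coverπ (M : ModuleCat.{u} R) (n : ℕ) : coverι M n ≫ coverπ (coverSyzygy M n) = 0 :=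
  kernel.condition _

instance (M : ModuleCat.{u} R) (n : ℕ) : Mono (coverι M n) :=
  inferInstanceAs (Mono (kernel.ι _))

lemma cover_shortExact (M : ModuleCat.{u} R) (n : ℕ) :
    (ShortComplex.mk _ _ (coverι_coverπ M n)).ShortExact :=
  { exact := ShortComplex.exact_kernel _
    mono_f := inferInstanceAs (Mono (coverι M n))
    epi_g := inferInstanceAs (Epi (coverπ _)) }

/-- The complex of the covers of the iterated syzygies. -/
def coverComplex (M : ModuleCat.{u} R) : ChainComplex (ModuleCat.{u} R) ℕ :=
  ChainComplex.of (fun n => cover (coverSyzygy M n))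
    (fun n => coverπ (coverSyzygy M (n + 1)) ≫ coverι M n)
    (fun n => by simp [reassoc_of% coverι_coverπ])

lemma coverComplex_d (M : ModuleCat.{u} R) (n : ℕ) : (coverComplex M).d (n + 1) n =
    coverπ (coverSyzygy M (n + 1)) ≫ coverι M n := 
  ChainComplex.of_d (fun n => cover (coverSyzygy M n))
    (fun n => coverπ (coverSyzygy M (n + 1)) ≫ coverι M n) n

/-- The augmentation of the complex of covers. -/
def coverAug (M : ModuleCat.{u} R) : (coverComplex M).X 0 ⟶ M := coverπ M

lemma coverComplex_d_coverAug (M : ModuleCat.{u} R) :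
    (coverComplex M).d 1 0 ≫ coverAug M = 0 :=
  (congrArg (· ≫ coverAug M) (coverComplex_d M 0)).trans
    ((Category.assoc _ _ _).trans
      ((congrArg (coverπ _ ≫ ·) (coverι_coverπ M 0)).trans comp_zero))

lemma exact_cover (M : ModuleCat.{u} R) (n : ℕ) {Z : ModuleCat.{u} R}
    (j : coverSyzygy M n ⟶ Z) [Mono j]
    (h : (coverπ (coverSyzygy M (n + 1)) ≫ coverι M n) ≫ coverπ (coverSyzygy M n) ≫ j = 0) :
    (ShortComplex.mk _ _ h).Exact := by
  rw [ShortComplex.moduleCat_exact_iff]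
  intro x hx
  have hx' : coverπ (coverSyzygy M n) x = 0 :=
    (ModuleCat.mono_iff_injective j).1 inferInstance (hx.trans (map_zero j.hom).symm)
  obtain ⟨z, rfl⟩ := (ShortComplex.moduleCat_exact_iff _).1 (cover_shortExact M n).exact x hx'
  obtain ⟨y, rfl⟩ := (ModuleCat.epi_iff_surjective (coverπ (coverSyzygy M (n + 1)))).1
    inferInstance z
  exact ⟨y, rfl⟩

lemma coverComplex_exactAt_succ (M : ModuleCat.{u} R) (n : ℕ) :
    (coverComplex M).ExactAt (n + 1) := by
  rw [HomologicalComplex.exactAt_iff' _ (n + 1 + 1) (n + 1) n (by simp) (by simp)]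
  have h := exact_cover M (n + 1) (coverι M n) (by simp [reassoc_of% coverι_coverπ])
  refine (ShortComplex.exact_iff_of_iso ?_).1 h
  exact ShortComplex.isoMk (Iso.refl _) (Iso.refl _) (Iso.refl _)
    ((Category.id_comp _).trans ((coverComplex_d M (n + 1)).trans (Category.comp_id _).symm))
    ((Category.id_comp _).trans ((coverComplex_d M n).trans (Category.comp_id _).symm))

/-- The projective resolution given by the complex of covers. -/
def coverResolution (M : ModuleCat.{u} R) : ProjectiveResolution M where
  complex := coverComplex M
  projective n := inferInstanceAs (Projective (cover _))
  π := (ChainComplex.toSingle₀Equiv _ _).symm ⟨coverAug M, coverComplex_d_coverAug M⟩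
  quasiIso := ⟨fun n => by
    cases n
    · rw [ChainComplex.quasiIsoAt₀_iff, ShortComplex.quasiIso_iff_of_zeros']
      · have h := exact_cover M 0 (𝟙 (coverSyzygy M 0))
          ((Category.assoc _ _ _).trans ((congrArg (coverπ _ ≫ ·)
            ((congrArg (coverι M 0 ≫ ·) (Category.comp_id _)).trans (coverι_coverπ M 0))).trans
              comp_zero))
        refine (ShortComplex.exact_and_epi_g_iff_of_iso ?_).2 ⟨h, ?_⟩
        · refine ShortComplex.isoMk (Iso.refl _) (Iso.refl _) (Iso.refl _) ?_ ?_
          · exact (Category.id_comp _).trans ((coverComplex_d M 0).symm.trans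
              (Category.comp_id _).symm)
          · refine (Category.id_comp _).trans (Eq.trans ?_ (Category.comp_id _).symm)
            exact (ChainComplex.toSingle₀Equiv_symm_apply_f_zero (coverAug M)
              (coverComplex_d_coverAug M)).trans (Category.comp_id (coverπ M)).symm
        · exact epi_comp (coverπ (coverSyzygy M 0)) (𝟙 _)
      all_goals rfl
    · rw [quasiIsoAt_iff_exactAt']
      · apply coverComplex_exactAt_succ
      · apply ChainComplex.exactAt_succ_single_obj⟩

instance [IsNoetherianRing R] (M : ModuleCat.{u} R) [h : Module.Finite R M] (n : ℕ) :
    Module.Finite R (coverSyzygy M n) := by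
  induction n with
  | zero => exact h
  | succ n ih =>
    exact Module.Finite.of_injective (coverι M n).hom
      ((ModuleCat.mono_iff_injective _).1 inferInstance)

/-- Each syzygy lowers the dimension by one. The subtraction is truncated, and the bound 0 is
reached correctly: a projective syzygy is its own cover, so the next one is zero. -/
lemma hasProjectiveDimensionLT_coverSyzygy (M : ModuleCat.{u} R) (d : ℕ)
    [h : HasProjectiveDimensionLT M d] (n : ℕ) :
    HasProjectiveDimensionLT (coverSyzygy M n) (d - n) := by
  induction n with
  | zero => exact h
  | succ n ih =>
    by_cases hd : d - n ≤ 1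
    · have h1 : HasProjectiveDimensionLT (coverSyzygy M n) 1 :=
        hasProjectiveDimensionLT_of_ge _ (d - n) 1 hd
      have : Projective (coverSyzygy M n) := projective_iff_hasProjectiveDimensionLT_one.2 h1
      have h2 : IsZero (coverSyzygy M (n + 1)) := isZero_kernel_of_mono (coverπ (coverSyzygy M n))
      have := h2.hasProjectiveDimensionLT_zero
      exact hasProjectiveDimensionLT_of_ge _ 0 _ (Nat.zero_le _)
    · obtain ⟨m, hm⟩ : ∃ m, d - n = m + 2 := ⟨d - n - 2, by lia⟩
      have h1 : d - (n + 1) = m + 1 := by lia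
      rw [h1]
      rw [hm] at ih
      exact ((cover_shortExact M n).hasProjectiveDimensionLT_X₃_iff m
        (inferInstanceAs (Projective (cover _)))).1 ih

lemma isZero_coverComplex (M : ModuleCat.{u} R) (d : ℕ) [HasProjectiveDimensionLT M d] (n : ℕ)
    (hn : d ≤ n) : IsZero ((coverResolution M).complex.X n) := by
  have h := hasProjectiveDimensionLT_coverSyzygy M d n
  rw [Nat.sub_eq_zero_of_le hn] at h
  have h0 : IsZero (coverSyzygy M n) := isZero_of_hasProjectiveDimensionLT_zero _
  have : Projective (coverSyzygy M n) := h0.projective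
  have e : cover (coverSyzygy M n) ≅ coverSyzygy M n := asIso (coverπ (coverSyzygy M n))
  exact h0.of_iso e

end resolution

section strictPerfect
variable {R : Type u} [Ring R]

lemma isStrictPerfect_coverResolution [IsNoetherianRing R] (M : ModuleCat.{u} R)
    [Module.Finite R M] (d : ℕ) [HasProjectiveDimensionLT M d] :
    IsStrictPerfect R (coverResolution M).cochainComplex := by
  have hz (i : ℤ) (hi : ∀ n : ℕ, n < d → i ≠ -n) : IsZero ((coverResolution M).cochainComplex.X i) := by
    by_cases h0 : i ≤ 0
    · obtain ⟨n, rfl⟩ : ∃ n : ℕ, i = -n := ⟨(-i).toNat, by lia⟩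
      have hn : d ≤ n := not_lt.1 fun h => hi n h rfl
      exact (isZero_coverComplex M d n hn).of_iso ((coverResolution M).cochainComplexXIso (-n) n rfl)
    · exact (coverResolution M).cochainComplex.isZero_of_isStrictlyLE 0 i (by lia)
  refine ⟨⟨-d, ?_⟩, ⟨0, inferInstance⟩, fun i => ?_⟩
  · rw [CochainComplex.isStrictlyGE_iff]
    exact fun i hi => hz i fun n hn => by lia
  · by_cases h0 : i ≤ 0
    · obtain ⟨n, rfl⟩ : ∃ n : ℕ, i = -n := ⟨(-i).toNat, by lia⟩
      let e := (coverResolution M).cochainComplexXIso (-n) n rfl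
      have : Module.Finite R ((coverResolution M).complex.X n) :=
        inferInstanceAs (Module.Finite R (cover (coverSyzygy M n)))
      exact ⟨Projective.of_iso e.symm inferInstance, Module.Finite.equiv e.symm.toLinearEquiv⟩
    · have h := hz i fun n _ => by lia
      have := ModuleCat.subsingleton_of_isZero h
      exact ⟨h.projective, inferInstance⟩

end strictPerfect

/-! ### Finite projective dimension over the enveloping algebra -/

section elementary
variable {k : Type u} [Field k] {A : Type u} [Ring A] [Algebra k A]
open scoped ModuleCat TensorProduct
open MulOpposite

instance isNoetherianRing_env [Module.Finite k A] : IsNoetherianRing (Env k A) := by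
  have : Module.Finite k (Env k A) := inferInstance
  exact IsNoetherianRing.of_finite k (Env k A)

lemma finite_base_of_finite_env [Module.Finite k A] (M : BimodCat k A)
    [Module.Finite (Env k A) M] : Module.Finite k M := by
  have : Module.Finite k (Env k A) := inferInstance
  exact Module.Finite.trans (Env k A) M

/-- A cyclic left submodule of M is artinian and contains a simple submodule, which the radical
annihilates. Lifts of the coordinate idempotents of A / rad A act on it, and a nonzero e_i s is an
eigenvector for the i-th coordinate character. -/
lemma IsElementary.exists_char [Module.Finite k A] (hel : IsElementary k A) (M : BimodCat k A)
    [Nontrivial M] : ∃ (χ : A →ₐ[k] k) (m : M), m ≠ 0 ∧ ∀ a, leftAct M a m = χ a • m := by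
  obtain ⟨r, f, hf, hker⟩ := hel
  have : IsArtinianRing A := IsArtinianRing.of_finite k A
  obtain ⟨m, hm⟩ := exists_ne (0 : M)
  let m' : (toLeft k A).obj M := m
  let L := Submodule.span A {m'}
  have hL : Nontrivial L := ⟨⟨⟨m', Submodule.mem_span_singleton_self m'⟩, 0, fun h => hm
    (congrArg Subtype.val h)⟩⟩
  have : IsArtinian A L := inferInstance
  obtain ⟨S, hS⟩ : ∃ S : Submodule A L, IsAtom S := by
    obtain h | ⟨S, hS, -⟩ := eq_bot_or_exists_atom_le (⊤ : Submodule A L)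
    · exact absurd h.symm bot_ne_top
    · exact ⟨S, hS⟩
  have : IsSimpleModule A S := isSimpleModule_iff_isAtom.2 hS
  have hJ : Ring.jacobson A ≤ Module.annihilator A S :=
    IsSemisimpleModule.jacobson_le_annihilator A S
  have hJ' (a : A) (ha : f a = 0) (s : S) : a • s = 0 := by
    have : a ∈ RingHom.ker f := ha
    rw [hker] at this
    exact Module.mem_annihilator.1 (hJ this) s
  choose e he using fun i => hf (Pi.single i 1)
  have : Nontrivial S := IsSimpleModule.nontrivial A S
  obtain ⟨s, hs⟩ := exists_ne (0 : S)
  -- The element 1 minus the sum of the e_i lies in the radical, hence kills s.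
  have hsum : s = ∑ i, e i • s := by
    rw [← Finset.sum_smul, ← sub_eq_zero]
    nth_rw 1 [← one_smul A s]
    rw [← sub_smul]
    refine hJ' _ ?_ s
    rw [map_sub, map_one, map_sum]
    simp only [he]
    rw [sub_eq_zero]
    ext j
    simp [Finset.sum_apply]
  obtain ⟨i, hi⟩ : ∃ i, e i • s ≠ 0 := by
    by_contra! h
    exact hs (hsum.trans (Finset.sum_eq_zero fun i _ => h i))
  refine ⟨(Pi.evalAlgHom k (fun _ => k) i).comp f, (((e i • s : S) : L) : (toLeft k A).obj M), fun h => hi ?_, fun a => ?_⟩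
  · exact Subtype.ext (Subtype.ext h)
  · have h1 : a • (e i • s) = algebraMap k A (f a i) • (e i • s) := by
      rw [← sub_eq_zero, smul_smul, smul_smul, ← sub_smul]
      refine hJ' _ ?_ s
      rw [map_sub, map_mul, map_mul, he, AlgHom.commutes, sub_eq_zero]
      ext j
      by_cases hj : j = i
      · subst hj; simp
      · simp [hj]
    refine (congrArg (fun x : S => ((x : L) : (toLeft k A).obj M)) h1).trans ?_
    change (algebraMap k A (f a i) ⊗ₜ[k] (1 : Aᵐᵒᵖ) : Env k A) • (_ : M) =
      algebraMap k (Env k A) (f a i) • (_ : M)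
    rfl

/-- The sub-bimodule on which `A` acts through `χ` on the left. -/
def charPart (χ : A →ₐ[k] k) (M : BimodCat k A) : Submodule (Env k A) M where
  carrier := {m | ∀ a, leftAct M a m = χ a • m}
  add_mem' h h' a := by rw [map_add, h a, h' a, smul_add]
  zero_mem' a := by rw [map_zero, smul_zero]
  smul_mem' w m hm a := by
    induction w using TensorProduct.induction_on with
    | zero => rw [zero_smul (Env k A) m, map_zero, smul_zero]
    | add x y hx hy => rw [add_smul (M := M), map_add, hx, hy, smul_add]
    | tmul b c =>
      have h1 : (b ⊗ₜ[k] c : Env k A) • m = χ b • rightAct M c m := by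
        rw [tmul_smul_eq, ← map_smul, ← hm b]
        exact LinearMap.congr_fun (leftAct_rightAct_comm M b c) m
      rw [h1, map_smul, smul_comm (χ a)]
      congr 1
      refine (LinearMap.congr_fun (leftAct_rightAct_comm M a c) m).trans ?_
      exact (congrArg (rightAct M c) (hm a)).trans (map_smul _ _ _)

/-- Pull f back along g: the kernel of the pulled back map embeds into that of f, so A acts on it
through χ and the extension of K splits. -/
lemma exists_lift_of_char (χ : A →ₐ[k] k) {K E F : BimodCat k A}
    (hK : Projective ((toLeft k A).obj K)) (hq : Projective ((charQuot χ).obj K)) (f : E ⟶ F)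
    [Epi f] (hf : ∀ x, f x = 0 → ∀ a, leftAct E a x = χ a • x) (g : K ⟶ F) :
    ∃ h : K ⟶ E, h ≫ f = g := by
  let S : ShortComplex (BimodCat k A) := ShortComplex.mk (kernel.ι (pullback.snd f g))
    (pullback.snd f g) (kernel.condition _)
  have hS : S.ShortExact := { exact := ShortComplex.exact_kernel _ }
  have hmono : Mono (S.f ≫ pullback.fst f g) := ⟨fun u v huv => by
    rw [← cancel_mono S.f]
    refine pullback.hom_ext (by simpa using huv) ?_
    have hz : S.f ≫ pullback.snd f g = 0 := S.zero
    rw [Category.assoc, Category.assoc, hz, comp_zero, comp_zero]⟩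
  have hzero : (S.f ≫ pullback.fst f g) ≫ f = 0 := by
    have hz : S.f ≫ pullback.snd f g = 0 := S.zero
    rw [Category.assoc, pullback.condition, reassoc_of% hz, zero_comp]
  obtain ⟨s, hs⟩ := exists_section_of_char χ hS hK hq fun a m => by
    apply (ModuleCat.mono_iff_injective _).1 hmono
    have h1 := hf ((S.f ≫ pullback.fst f g) m) (congrArg (fun e => e m) hzero) a
    have h2 := linOf_leftAct (k := k) (S.f ≫ pullback.fst f g) a m
    exact h2.trans (h1.trans ((linOf (k := k) (S.f ≫ pullback.fst f g)).map_smul (χ a) m).symm)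
  refine ⟨s ≫ pullback.fst f g, ?_⟩
  have hs' : s ≫ pullback.snd f g = 𝟙 K := hs
  rw [Category.assoc, pullback.condition, reassoc_of% hs', Category.id_comp]

/-- Induction on the dimension of the kernel. A nonzero kernel contains an eigenvector for some χ;
with V the χ-part of the kernel, f factors through E / V, the lift to E / V exists by induction, and
the lift from there to E is the case of a single character. -/
lemma exists_lift_of_finite [Module.Finite k A] (hel : IsElementary k A) {K : BimodCat k A}
    (hK : Projective ((toLeft k A).obj K)) (hq : ∀ χ, Projective ((charQuot χ).obj K)) (n : ℕ) :
    ∀ {E F : BimodCat k A} (f : E ⟶ F) [Epi f] (_ : Module.Finite k (LinearMap.ker (linOf (k := k) f)))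
      (_ : Module.finrank k (LinearMap.ker (linOf (k := k) f)) ≤ n) (g : K ⟶ F),
      ∃ h : K ⟶ E, h ≫ f = g := by
  induction n with
  | zero =>
    intro E F f _ _ hn g
    have hker : LinearMap.ker (linOf (k := k) f) = ⊥ :=
      Submodule.finrank_eq_zero.1 (Nat.le_zero.1 hn)
    have : Mono f := (ModuleCat.mono_iff_injective f).2
      (LinearMap.ker_eq_bot (f := linOf (k := k) f).1 hker)
    have : IsIso f := isIso_of_mono_of_epi f
    exact ⟨g ≫ inv f, by simp⟩
  | succ n ih =>
    intro E F f _ hfin hn g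
    by_cases hker : LinearMap.ker f.hom = ⊥
    · have : Mono f := (ModuleCat.mono_iff_injective f).2 (LinearMap.ker_eq_bot.1 hker)
      have : IsIso f := isIso_of_mono_of_epi f
      exact ⟨g ≫ inv f, by simp⟩
    let M : BimodCat k A := ModuleCat.of (Env k A) (LinearMap.ker f.hom)
    have : Nontrivial M := (Submodule.nontrivial_iff_ne_bot).2 hker
    obtain ⟨χ, m, hm, hχ⟩ := hel.exists_char M
    let V : Submodule (Env k A) E := LinearMap.ker f.hom ⊓ charPart χ E
    have hmV : (m : LinearMap.ker f.hom).1 ∈ V :=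
      ⟨(m : LinearMap.ker f.hom).2, fun a => congrArg Subtype.val (hχ a)⟩
    let Q : BimodCat k A := ModuleCat.of (Env k A) (E ⧸ V)
    let π : E ⟶ Q := ModuleCat.ofHom V.mkQ
    let f' : Q ⟶ F := ModuleCat.ofHom (V.liftQ f.hom inf_le_left)
    have hπf : π ≫ f' = f := rfl
    have : Epi π := (ModuleCat.epi_iff_surjective _).2 V.mkQ_surjective
    have : Epi f' := epi_of_epi_fac hπf
    let p : LinearMap.ker (linOf (k := k) f) →ₗ[k] LinearMap.ker (linOf (k := k) f') :=
      (linOf (k := k) π).restrict fun x hx => hx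
    have hp : Function.Surjective p := by
      rintro ⟨y, hy⟩
      obtain ⟨x, rfl⟩ := V.mkQ_surjective y
      exact ⟨⟨x, hy⟩, rfl⟩
    have hfin' : Module.Finite k (LinearMap.ker (linOf (k := k) f')) := Module.Finite.of_surjective p hp
    have hlt : Module.finrank k (LinearMap.ker (linOf (k := k) f')) <
        Module.finrank k (LinearMap.ker (linOf (k := k) f)) := by
      rw [← LinearMap.finrank_range_add_finrank_ker p, LinearMap.range_eq_top.2 hp, finrank_top]
      refine Nat.lt_add_of_pos_right (Module.finrank_pos_iff_exists_ne_zero.2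
        ⟨⟨⟨(m : LinearMap.ker f.hom).1, (m : LinearMap.ker f.hom).2⟩, ?_⟩, ?_⟩)
      · refine Subtype.ext ?_
        exact (Submodule.Quotient.mk_eq_zero V).2 hmV
      · intro h0
        exact hm (Subtype.ext (congrArg (fun x => x.1.1) h0))
    obtain ⟨g', hg'⟩ := ih f' hfin' (by lia) g
    obtain ⟨h, hh⟩ := exists_lift_of_char χ hK (hq χ) π
      (fun x hx => ((Submodule.Quotient.mk_eq_zero V).1 hx).2) g'
    exact ⟨h, by rw [← hπf, reassoc_of% hh, hg']⟩

/-- Over an elementary algebra a finite-dimensional left projective bimodule `K` is projective if the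
right modules `k_χ ⊗_A K` are. -/
lemma projective_of_charQuot [Module.Finite k A] (hel : IsElementary k A) (K : BimodCat k A)
    [Module.Finite (Env k A) K] (hK : Projective ((toLeft k A).obj K))
    (hq : ∀ χ, Projective ((charQuot χ).obj K)) : Projective K := by
  have : Module.Finite k (cover K) := finite_base_of_finite_env (cover K)
  obtain ⟨s, hs⟩ := exists_lift_of_finite hel hK hq _ (coverπ K) inferInstance le_rfl (𝟙 K)
  exact Retract.projective { i := s, r := coverπ K, retract := hs }

/-- Dimension shifting: passing to the syzygy of K keeps left projectivity and lowers by one the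
bound for each k_χ ⊗_A K, as reduction along χ preserves the exact sequence and the projectivity of
the cover. The bottom case is `projective_of_charQuot`. -/
lemma hasProjectiveDimensionLE_bimod [Module.Finite k A] (hel : IsElementary k A) (d : ℕ) :
    ∀ (K : BimodCat k A) [Module.Finite (Env k A) K], Projective ((toLeft k A).obj K) →
      (∀ χ, HasProjectiveDimensionLE ((charQuot χ).obj K) d) → HasProjectiveDimensionLE K d := by
  induction d with
  | zero =>
    intro K _ hK h
    rw [← projective_iff_hasProjectiveDimensionLE_zero]
    exact projective_of_charQuot hel K hK fun χ =>
      (projective_iff_hasProjectiveDimensionLE_zero _).2 (h χ)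
  | succ d ih =>
    intro K _ hK h
    have hS := cover_shortExact K 0
    have hL := projective_toLeft_X₁ hS (projective_toLeft (cover K)) hK
    have : Module.Finite (Env k A) (coverSyzygy K 1) := inferInstance
    have h1 := ih (coverSyzygy K 1) hL fun χ =>
      ((charQuot_shortExact χ hS hK).hasProjectiveDimensionLT_X₃_iff d
        (projective_charQuot χ (cover K))).1 (h χ)
    exact (hS.hasProjectiveDimensionLT_X₃_iff d (inferInstanceAs (Projective (cover K)))).2 h1

/-- An elementary algebra of finite global dimension has finite projective dimension over its
enveloping algebra. -/
lemma IsElementary.exists_hasProjectiveDimensionLE [Module.Finite k A] [h : FinGlobalDim Aᵐᵒᵖ]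
    (hel : IsElementary k A) : ∃ d : ℕ, HasProjectiveDimensionLE (regularBimod k A) d := by
  obtain ⟨d, hd⟩ := h.exists_bound
  have : Module.Finite (Env k A) (regularBimod k A) := modOfAct_finite _
  exact ⟨d, hasProjectiveDimensionLE_bimod hel d _ projective_toLeft_regularBimod fun χ => hd _⟩

end elementary

/-! ### The dual complex is independent of the resolution -/

section homotopy
variable {C : Type*} [Category* C] [Preadditive C]

/-- The homotopy between the opposite morphisms of complexes. -/
def opHomotopy {ι : Type*} {c : ComplexShape ι} {K L : HomologicalComplex C c} {f g : K ⟶ L}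
    (h : Homotopy f g) : Homotopy ((HomologicalComplex.opFunctor C c).map f.op)
      ((HomologicalComplex.opFunctor C c).map g.op) where
  hom i j := (h.hom j i).op
  zero i j hij := by
    rw [h.zero j i hij]
    rfl
  comm i := by
    refine (congrArg Quiver.Hom.op (h.comm i)).trans ?_
    rw [add_comm (dNext i h.hom)]
    rfl

end homotopy

section dualComplex
variable {C : Type*} [Category* C] [Abelian C] (D : Cᵒᵖ ⥤ C) [D.Additive] {X : C}

/-- The map on dual complexes. -/
def dualComplexMap (P Q : ProjectiveResolution X) (f : P.complex ⟶ Q.complex) :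
    dualComplex D Q ⟶ dualComplex D P :=
  HomologicalComplex.extendMap ((D.mapHomologicalComplex (ComplexShape.up ℕ)).map
    ((HomologicalComplex.opFunctor C (ComplexShape.down ℕ)).map f.op :
      (HomologicalComplex.op Q.complex : CochainComplex Cᵒᵖ ℕ) ⟶
        (HomologicalComplex.op P.complex : CochainComplex Cᵒᵖ ℕ))) ComplexShape.embeddingUpNat

lemma dualComplexMap_id (P : ProjectiveResolution X) : dualComplexMap D P P (𝟙 _) = 𝟙 _ := by
  refine Eq.trans ?_ (HomologicalComplex.extendMap_id _ _)
  refine congrArg (fun f => HomologicalComplex.extendMap f ComplexShape.embeddingUpNat) ?_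
  exact (D.mapHomologicalComplex (ComplexShape.up ℕ)).map_id
    (HomologicalComplex.op P.complex : CochainComplex Cᵒᵖ ℕ)

lemma dualComplexMap_comp (P Q R : ProjectiveResolution X) (f : P.complex ⟶ Q.complex)
    (g : Q.complex ⟶ R.complex) :
    dualComplexMap D P R (f ≫ g) = dualComplexMap D Q R g ≫ dualComplexMap D P Q f := by
  refine Eq.trans ?_ (HomologicalComplex.extendMap_comp _ _ _)
  refine congrArg (fun f => HomologicalComplex.extendMap f ComplexShape.embeddingUpNat) ?_
  exact (D.mapHomologicalComplex (ComplexShape.up ℕ)).map_comp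
    ((HomologicalComplex.opFunctor C (ComplexShape.down ℕ)).map g.op :
      (HomologicalComplex.op R.complex : CochainComplex Cᵒᵖ ℕ) ⟶
        (HomologicalComplex.op Q.complex : CochainComplex Cᵒᵖ ℕ))
    ((HomologicalComplex.opFunctor C (ComplexShape.down ℕ)).map f.op :
      (HomologicalComplex.op Q.complex : CochainComplex Cᵒᵖ ℕ) ⟶
        (HomologicalComplex.op P.complex : CochainComplex Cᵒᵖ ℕ))

/-- Homotopic maps induce homotopic maps on dual complexes. -/
def dualComplexHomotopy {P Q : ProjectiveResolution X} {f g : P.complex ⟶ Q.complex}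
    (h : Homotopy f g) : Homotopy (dualComplexMap D P Q f) (dualComplexMap D P Q g) :=
  Homotopy.extend (D.mapHomotopy (c := ComplexShape.up ℕ) (opHomotopy h))
    ComplexShape.embeddingUpNat

/-- The dual complexes of two projective resolutions are homotopy equivalent. -/
def dualComplexEquiv (P Q : ProjectiveResolution X) :
    HomotopyEquiv (dualComplex D P) (dualComplex D Q) where
  hom := dualComplexMap D Q P (ProjectiveResolution.homotopyEquiv P Q).inv
  inv := dualComplexMap D P Q (ProjectiveResolution.homotopyEquiv P Q).hom
  homotopyHomInvId :=
    (Homotopy.ofEq (dualComplexMap_comp D P Q P _ _).symm).trans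
      ((dualComplexHomotopy D (ProjectiveResolution.homotopyEquiv P Q).homotopyHomInvId).trans
        (Homotopy.ofEq (dualComplexMap_id D P)))
  homotopyInvHomId :=
    (Homotopy.ofEq (dualComplexMap_comp D Q P Q _ _).symm).trans
      ((dualComplexHomotopy D (ProjectiveResolution.homotopyEquiv P Q).homotopyInvHomId).trans
        (Homotopy.ofEq (dualComplexMap_id D Q)))

/-- The components of the dual complex. -/
def dualComplexXIso (P : ProjectiveResolution X) (n : ℕ) (i : ℤ) (h : (n : ℤ) = i) :
    (dualComplex D P).X i ≅ D.obj (Opposite.op (P.complex.X n)) :=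
  HomologicalComplex.extendXIso _ ComplexShape.embeddingUpNat h

lemma dualComplex_d (P : ProjectiveResolution X) (n m : ℕ) (i j : ℤ) (h : (n : ℤ) = i)
    (h' : (m : ℤ) = j) : (dualComplex D P).d i j = (dualComplexXIso D P n i h).hom ≫
      D.map (P.complex.d m n).op ≫ (dualComplexXIso D P m j h').inv :=
  HomologicalComplex.extend_d_eq _ ComplexShape.embeddingUpNat h h'

lemma isZero_dualComplex (P : ProjectiveResolution X) (i : ℤ) (h : i < 0) :
    IsZero ((dualComplex D P).X i) :=
  HomologicalComplex.isZero_extend_X _ ComplexShape.embeddingUpNat i fun n hn => by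
    have : (n : ℤ) = i := hn
    lia

lemma exists_Q_dualComplex_iso [HasDerivedCategory C] (P Q : ProjectiveResolution X) :
    Nonempty (DerivedCategory.Q.obj (dualComplex D P) ≅
      DerivedCategory.Q.obj (dualComplex D Q)) := by
  have h : QuasiIso (dualComplexEquiv D P Q).hom := inferInstance
  exact ⟨@asIso _ _ _ _ (DerivedCategory.Q.map (dualComplexEquiv D P Q).hom)
    ((DerivedCategory.isIso_Q_map_iff_quasiIso _ _).2 h)⟩

end dualComplex

/-! ### Duals of finitely generated projective bimodules -/

section bimodDual
variable {k : Type u} [Field k] {A : Type u} [Ring A] [Algebra k A]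
open scoped ModuleCat TensorProduct
open MulOpposite

variable (k A) in
/-- The anti-automorphism `a ⊗ b ↦ b ⊗ a`, as a linear map. -/
def envFlip : Env k A →ₗ[k] Env k A :=
  (MulOpposite.opLinearEquiv k).symm.toLinearMap ∘ₗ (envSwap k A).toLinearMap

lemma envFlip_apply (w : Env k A) : envFlip k A w = (envSwap k A w).unop := rfl

lemma envFlip_tmul (a b : A) : envFlip k A (a ⊗ₜ op b) = b ⊗ₜ op a := by
  rw [envFlip_apply, envSwap_tmul, unop_op]

lemma envFlip_mul (v w : Env k A) : envFlip k A (v * w) = envFlip k A w * envFlip k A v := by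
  rw [envFlip_apply, map_mul, unop_mul]; rfl

lemma envFlip_envFlip (w : Env k A) : envFlip k A (envFlip k A w) = w := by
  induction w using TensorProduct.induction_on with
  | zero => rw [map_zero, map_zero]
  | add v w hv hw => rw [map_add, map_add, hv, hw]
  | tmul a b =>
    obtain ⟨b, rfl⟩ := op_surjective b
    rw [envFlip_tmul, envFlip_tmul]

/-- The elements of the dual of a bimodule. -/
def dualEquiv (M : BimodCat k A) : (M →ₗ[Env k A] Env k A) ≃+
    (bimodDual k A).obj (Opposite.op M) where
  toFun f := actEquiv (bimodDualAct k M) f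
  invFun f := (actEquiv (bimodDualAct k M)).symm f
  left_inv _ := rfl
  right_inv _ := rfl
  map_add' _ _ := rfl

lemma dualEquiv_symm_smul {M : BimodCat k A} (w : Env k A)
    (f : (bimodDual k A).obj (Opposite.op M)) (m : M) :
    (dualEquiv M).symm (w • f) m = (dualEquiv M).symm f m * envFlip k A w := rfl

/-- A dual basis of `M` gives one of its dual. -/
lemma eq_sum_envFlip_smul {M : BimodCat k A} {n : ℕ} {x : Fin n → M}
    {ξ : Fin n → (M →ₗ[Env k A] Env k A)} (h : ∀ m, m = ∑ s, ξ s m • x s)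
    (f : (bimodDual k A).obj (Opposite.op M)) :
    f = ∑ s, envFlip k A ((dualEquiv M).symm f (x s)) • dualEquiv M (ξ s) := by
  apply (dualEquiv M).symm.injective
  ext m
  have h1 : (dualEquiv M).symm f m = ∑ s, ξ s m * (dualEquiv M).symm f (x s) := by
    conv_lhs => rw [h m, map_sum]
    exact Finset.sum_congr rfl fun s _ => map_smul ((dualEquiv M).symm f) _ _
  refine h1.trans ?_
  rw [map_sum, LinearMap.sum_apply]
  refine Finset.sum_congr rfl fun s _ => ?_
  rw [dualEquiv_symm_smul, envFlip_envFlip, AddEquiv.symm_apply_apply]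

/-- The homomorphism `w ↦ w x`. -/
def smulHom {N : BimodCat k A} (x : N) : (ModuleCat.of (Env k A) (Env k A) : BimodCat k A) ⟶ N :=
  ModuleCat.ofHom (LinearMap.toSpanSingleton (Env k A) N x)

/-- Evaluation of the dual of `M` at `x`, followed by the flip and the action on `m`. -/
def evalHom {M : BimodCat k A} (x : M) {H : BimodCat k A} (m : H) :
    (bimodDual k A).obj (Opposite.op M) ⟶ H :=
  ModuleCat.ofHom (X := (bimodDual k A).obj (Opposite.op M)) (Y := H)
    { toFun := fun f => envFlip k A ((dualEquiv M).symm f x) • m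
      map_add' := fun f g => by
        rw [map_add, LinearMap.add_apply, map_add, add_smul]
      map_smul' := fun w f =>
        (congrArg (fun v => envFlip k A v • m) (dualEquiv_symm_smul w f x)).trans (by
          rw [envFlip_mul, envFlip_envFlip, mul_smul]
          rfl) }

/-- A dual basis factors the identity of the dual through finitely many copies of A^e: evaluate at
x_s, flip to obtain a left linear map, and multiply ξ_s by the result. -/
lemma projective_bimodDual (M : BimodCat k A) [Projective M] [Module.Finite (Env k A) M] :
    Projective ((bimodDual k A).obj (Opposite.op M)) ∧
      Module.Finite (Env k A) ((bimodDual k A).obj (Opposite.op M)) := by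
  obtain ⟨n, x, ξ, h⟩ := exists_dualBasis M
  constructor
  · have : Projective (ModuleCat.of (Env k A) (Env k A) : BimodCat k A) :=
      (IsProjective.iff_projective _).1 inferInstance
    refine projective_of_sum_eq_id (Y := fun _ => (ModuleCat.of (Env k A) (Env k A) : BimodCat k A))
      Finset.univ (fun s => evalHom (x s) (1 : Env k A))
      (fun s => smulHom (dualEquiv M (ξ s))) ?_
    ext f
    rw [ModuleCat.hom_sum, LinearMap.sum_apply]
    refine Eq.trans (Finset.sum_congr rfl fun s _ => ?_) (eq_sum_envFlip_smul h f).symm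
    exact congrArg (fun v : Env k A => v • dualEquiv M (ξ s)) (mul_one _)
  · classical
    refine ⟨⟨Finset.univ.image fun s => dualEquiv M (ξ s), ?_⟩⟩
    refine eq_top_iff.2 fun f _ => ?_
    rw [eq_sum_envFlip_smul h f]
    refine Submodule.sum_mem _ fun s _ => Submodule.smul_mem _ _ (Submodule.subset_span ?_)
    exact Finset.mem_coe.2 (Finset.mem_image_of_mem _ (Finset.mem_univ s))

lemma isStrictPerfect_dualComplex {X : BimodCat k A} (P : ProjectiveResolution X)
    [∀ n, Module.Finite (Env k A) (P.complex.X n)] (d : ℕ)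
    (hd : ∀ n, d ≤ n → IsZero (P.complex.X n)) :
    IsStrictPerfect (Env k A) (dualComplex (bimodDual k A) P) := by
  refine ⟨⟨0, ?_⟩, ⟨d, ?_⟩, fun i => ?_⟩
  · rw [CochainComplex.isStrictlyGE_iff]
    exact fun i hi => isZero_dualComplex _ P i hi
  · rw [CochainComplex.isStrictlyLE_iff]
    intro i hi
    obtain ⟨n, rfl⟩ : ∃ n : ℕ, (n : ℤ) = i := ⟨i.toNat, by lia⟩
    exact (Functor.map_isZero _ (hd n (by lia)).op).of_iso (dualComplexXIso _ P n n rfl)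
  · by_cases hi : i < 0
    · have h := isZero_dualComplex (bimodDual k A) P i hi
      have := ModuleCat.subsingleton_of_isZero h
      exact ⟨h.projective, inferInstance⟩
    · obtain ⟨n, rfl⟩ : ∃ n : ℕ, (n : ℤ) = i := ⟨i.toNat, by lia⟩
      let e := dualComplexXIso (bimodDual k A) P n n rfl
      obtain ⟨h1, h2⟩ := projective_bimodDual (P.complex.X n)
      exact ⟨Projective.of_iso e.symm h1, Module.Finite.equiv e.symm.toLinearEquiv⟩

end bimodDual

/-! ### Complexes with one cohomology object -/

section single
variable {C : Type*} [Category* C] [Abelian C] [HasDerivedCategory C]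

lemma exists_Q_shift_iso_single (K : CochainComplex C ℤ) (j : ℤ)
    (h : ∀ i, i ≠ j → IsZero (K.homology i)) :
    Nonempty ((DerivedCategory.Q.obj K)⟦j⟧ ≅
      (DerivedCategory.singleFunctor C 0).obj (K.homology j)) := by
  have h1 (i : ℤ) (hi : i ≠ j) : IsZero
      ((DerivedCategory.homologyFunctor C i).obj (DerivedCategory.Q.obj K)) :=
    (h i hi).of_iso ((DerivedCategory.homologyFunctorFactors C i).app K)
  have h2 : (DerivedCategory.Q.obj K).IsGE j := by
    rw [DerivedCategory.isGE_iff]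
    exact fun i hi => h1 i hi.ne
  have h3 : (DerivedCategory.Q.obj K).IsLE j := by
    rw [DerivedCategory.isLE_iff]
    exact fun i hi => h1 i hi.ne'
  obtain ⟨M, ⟨e⟩⟩ :=
    DerivedCategory.exists_iso_singleFunctor_obj_of_isGE_of_isLE (DerivedCategory.Q.obj K) j
  let e' : (DerivedCategory.Q.obj K)⟦j⟧ ≅ (DerivedCategory.singleFunctor C 0).obj M :=
    (shiftFunctor _ j).mapIso e ≪≫
      ((DerivedCategory.singleFunctors C).shiftIso j 0 j (add_zero j)).app M
  have e'' : K.homology j ≅ M := ((DerivedCategory.homologyFunctorFactors C j).app K).symm ≪≫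
    ((DerivedCategory.homologyFunctor C 0).shiftIso j 0 j (by simp)).symm.app _ ≪≫
    (DerivedCategory.homologyFunctor C 0).mapIso e' ≪≫ homologySingleIso M
  exact ⟨e' ≪≫ (DerivedCategory.singleFunctor C 0).mapIso e''.symm⟩

end single

/-! ### A trace detects a nonzero morphism out of the inverse dualizing complex -/

section trace
variable {k : Type u} [Field k] {A : Type u} [Ring A] [Algebra k A]
open scoped ModuleCat TensorProduct
open MulOpposite

variable {H : BimodCat k A} (τ : H →ₗ[k] k)

/-- The pairing `(a, m) ↦ τ(a m)`. -/
def tracePairing : regularBimod k A →ₗ[k] H →ₗ[k] k :=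
  LinearMap.compr₂ ((leftAct H).toLinearMap ∘ₗ (regEquiv k A).symm.toLinearMap) τ

lemma tracePairing_apply (a : A) (m : H) :
    tracePairing τ (regEquiv k A a) m = τ (leftAct H a m) := by
  change τ (leftAct H ((regEquiv k A).symm (regEquiv k A a)) m) = _
  rw [LinearEquiv.symm_apply_apply]

variable {τ} (hτ : ∀ a m, τ (leftAct H a m) = τ (rightAct H (op a) m))
include hτ

/-- The trace property makes the pairing balanced over A^e, where the flip turns the left module H
into a right one. The pairing is thus a functional on H ⊗_{A^e} A = H/[A, H]. -/
lemma tracePairing_smul (w : Env k A) (y : regularBimod k A) (m : H) :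
    tracePairing τ (w • y) m = tracePairing τ y (envFlip k A w • m) := by
  induction w using TensorProduct.induction_on with
  | zero => rw [zero_smul (Env k A) y, map_zero (envFlip k A), zero_smul (Env k A) m, map_zero,
      map_zero, LinearMap.zero_apply]
  | add v w hv hw => rw [add_smul (M := regularBimod k A), map_add, LinearMap.add_apply, hv, hw,
      map_add (envFlip k A), add_smul (M := H), map_add]
  | tmul a b =>
    obtain ⟨b, rfl⟩ := op_surjective b
    obtain ⟨c, rfl⟩ := (regEquiv k A).surjective y
    rw [envFlip_tmul, tmul_smul_eq, tmul_smul_eq, regEquiv_rightAct, regEquiv_leftAct,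
      tracePairing_apply, tracePairing_apply, map_mul, Module.End.mul_apply, hτ, map_mul,
      Module.End.mul_apply]
    have h1 := LinearMap.congr_fun (leftAct_rightAct_comm H b (op a)) m
    have h2 := LinearMap.congr_fun (leftAct_rightAct_comm H c (op a)) (leftAct H b m)
    exact congrArg τ (h2.symm.trans (congrArg (leftAct H c) h1.symm))

/-- By balancedness the scalars ξ_s(u) move back to the first argument, where they reassemble u. The
value therefore depends on u only through its image in A. -/
lemma sum_tracePairing {M : BimodCat k A} (ε : M ⟶ regularBimod k A) {n : ℕ} {x : Fin n → M}
    {ξ : Fin n → (M →ₗ[Env k A] Env k A)} (h : ∀ m, m = ∑ s, ξ s m • x s) (u : M) (m : H) :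
    ∑ s, tracePairing τ (ε (x s)) (envFlip k A (ξ s u) • m) = tracePairing τ (ε u) m := by
  conv_rhs => rw [h u]
  have h1 : ε (∑ s, ξ s u • x s) = ∑ s, ξ s u • ε (x s) := by
    refine (map_sum ε.hom _ _).trans (Finset.sum_congr rfl fun s _ => ?_)
    exact map_smul ε.hom _ _
  rw [h1, map_sum, LinearMap.sum_apply]
  exact Finset.sum_congr rfl fun s _ => (tracePairing_smul hτ _ _ _).symm

/-- The evaluation at a lift of `1 ∈ A` is not a coboundary. -/
lemma evalHom_ne_comp {M M' : BimodCat k A} [Projective M] [Module.Finite (Env k A) M]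
    [Projective M'] [Module.Finite (Env k A) M'] (d : M' ⟶ M) (ε : M ⟶ regularBimod k A)
    (hd : d ≫ ε = 0) (x : M) (hx : ε x = regEquiv k A 1) (m : H) (hm : τ m ≠ 0)
    (g : (bimodDual k A).obj (Opposite.op M') ⟶ H) :
    evalHom x m ≠ (bimodDual k A).map d.op ≫ g := by
  intro hg
  obtain ⟨n, y, ξ, h⟩ := exists_dualBasis M
  obtain ⟨n', y', ξ', h'⟩ := exists_dualBasis M'
  -- The left side is a functional of the homomorphism out of the dual of M. On evaluation at x it
  -- gives τ(m), as x lifts 1; on anything factoring through the dual of d it gives pairings with ε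
  -- ∘ d = 0.
  have h1 : ∑ s, tracePairing τ (ε (y s)) (evalHom x m (dualEquiv M (ξ s))) = τ m := by
    refine (sum_tracePairing hτ ε h x m).trans ?_
    rw [hx, tracePairing_apply, map_one]
    rfl
  have h2 (s : Fin n) : g ((bimodDual k A).map d.op (dualEquiv M (ξ s))) =
      ∑ t, envFlip k A (ξ s (d (y' t))) • g (dualEquiv M' (ξ' t)) := by
    refine (congrArg g (eq_sum_envFlip_smul h' _)).trans ((map_sum g.hom _ _).trans ?_)
    exact Finset.sum_congr rfl fun t _ => map_smul g.hom _ _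
  apply hm
  rw [← h1, hg]
  refine (Finset.sum_congr rfl fun s _ =>
    (congrArg (tracePairing τ (ε (y s))) (h2 s)).trans (map_sum _ _ _)).trans ?_
  rw [Finset.sum_comm]
  refine Finset.sum_eq_zero fun t _ => ?_
  refine (sum_tracePairing hτ ε h (d (y' t)) (g (dualEquiv M' (ξ' t)))).trans ?_
  have h3 : ε (d (y' t)) = 0 := congrArg (fun e => e (y' t)) hd
  rw [h3, map_zero, LinearMap.zero_apply]

/-- Evaluation at a lift of 1 ∈ A is a degree zero map from Θ to the stalk H, representing the class
of m in H/[A, H], where τ is nonzero on it. A null homotopy would factor the evaluation through the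
first differential, which the trace excludes; perfectness of the dual complex carries non-nullity to
the derived category. -/
lemma exists_Q_dualComplex_ne_zero (P : ProjectiveResolution (regularBimod k A))
    [∀ n, Module.Finite (Env k A) (P.complex.X n)]
    (hP : IsStrictPerfect (Env k A) (dualComplex (bimodDual k A) P)) (m : H) (hm : τ m ≠ 0) :
    ∃ f : DerivedCategory.Q.obj (dualComplex (bimodDual k A) P) ⟶
      (DerivedCategory.singleFunctor _ 0).obj H, f ≠ 0 := by
  let ε : P.complex.X 0 ⟶ regularBimod k A := P.π.f 0
  have hdε : P.complex.d 1 0 ≫ ε = 0 := P.complex_d_comp_π_f_zero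
  obtain ⟨z, hz⟩ := resAug_surjective P (regEquiv k A 1)
  let x : P.complex.X 0 := (P.cochainComplexXIso 0 0).hom z
  have hx : ε x = regEquiv k A 1 := hz
  let D := dualComplex (bimodDual k A) P
  let e0 := dualComplexXIso (bimodDual k A) P 0 0 rfl
  let φ : D.X 0 ⟶ H := e0.hom ≫ evalHom x m
  let f : D ⟶ (CochainComplex.singleFunctor (BimodCat k A) 0).obj H :=
    HomologicalComplex.mkHomToSingle φ fun i hi => by
      have : i + 1 = 0 := hi
      exact (isZero_dualComplex (bimodDual k A) P i (by lia)).eq_of_src _ _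
  have hf : f.f 0 = φ ≫ (HomologicalComplex.singleObjXSelf (ComplexShape.up ℤ) 0 H).inv :=
    HomologicalComplex.mkHomToSingle_f _ _
  have hnot (η : Homotopy f 0) : False := by
    have h1 := η.comm 0
    rw [dNext_eq η.hom (show (ComplexShape.up ℤ).Rel 0 1 from rfl),
      prevD_eq η.hom (show (ComplexShape.up ℤ).Rel (-1) 0 from rfl)] at h1
    have h2 : ((CochainComplex.singleFunctor (BimodCat k A) 0).obj H).d (-1) 0 = 0 :=
      HomologicalComplex.single_obj_d _ _ _ _ _
    rw [h2, comp_zero, add_zero, HomologicalComplex.zero_f, add_zero, hf,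
      dualComplex_d (bimodDual k A) P 0 1 0 1 rfl rfl] at h1
    obtain ⟨θ, hθ⟩ : ∃ θ : D.X 1 ⟶ H,
        η.hom 1 0 = θ ≫ (HomologicalComplex.singleObjXSelf (ComplexShape.up ℤ) 0 H).inv :=
      ⟨η.hom 1 0 ≫ (HomologicalComplex.singleObjXSelf (ComplexShape.up ℤ) 0 H).hom,
        ((Category.assoc _ _ _).trans ((congrArg (η.hom 1 0 ≫ ·) (Iso.hom_inv_id _)).trans
          (Category.comp_id _))).symm⟩
    refine evalHom_ne_comp hτ (P.complex.d 1 0) ε hdε x hx m hm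
      ((dualComplexXIso (bimodDual k A) P 1 1 rfl).inv ≫ θ) ?_
    rw [← cancel_epi e0.hom, ← cancel_mono
      (HomologicalComplex.singleObjXSelf (ComplexShape.up ℤ) 0 H).inv]
    rw [hθ] at h1
    simp only [Category.assoc, φ] at h1 ⊢
    exact h1
  have hK := (strictPerfectHo_quotient_iff D).2 hP
  have hne : DerivedCategory.Qh.map ((HomotopyCategory.quotient _ _).map f) ≠ 0 := by
    intro h0
    have := (Qh_map_bijective_of_strictPerfectHo hK _).1 (h0.trans
      (DerivedCategory.Qh.map_zero _ _).symm)
    exact hnot (HomotopyCategory.homotopyOfEq _ _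
      (this.trans ((HomotopyCategory.quotient _ _).map_zero _ _).symm))
  have hne' : DerivedCategory.Q.map f ≠ 0 := by
    intro h0
    apply hne
    have h1 := (DerivedCategory.quotientCompQhIso (BimodCat k A)).hom.naturality f
    rw [← cancel_mono ((DerivedCategory.quotientCompQhIso (BimodCat k A)).hom.app _), zero_comp]
    exact h1.trans (by rw [h0, comp_zero])
  refine ⟨DerivedCategory.Q.map f ≫ (DerivedCategory.singleFunctorIsoCompQ _ 0).inv.app H,
    fun h0 => hne' ?_⟩
  rw [← cancel_mono ((DerivedCategory.singleFunctorIsoCompQ (BimodCat k A) 0).inv.app H)]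
  exact h0.trans zero_comp.symm

end trace

/-! ### Characters of the algebra and the automorphism -/

section characters
variable {k : Type u} [Field k] {A : Type u} [Ring A] [Algebra k A]

/-- Dedekind independence of characters inside a finite-dimensional dual space. -/
lemma finite_characters [Module.Finite k A] : Finite (A →ₐ[k] k) := by
  have h1 : LinearIndependent k (fun χ : A →ₐ[k] k => χ.toLinearMap) := by
    have h := (linearIndependent_monoidHom A k).comp
      (fun χ : A →ₐ[k] k => (χ : A →* k)) (fun χ χ' h => AlgHom.ext fun a => DFunLike.congr_fun h a)
    refine LinearIndependent.of_comp (M' := A → k)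
      { toFun := fun f => f, map_add' := fun _ _ => rfl, map_smul' := fun _ _ => rfl } h
  exact h1.finite

/-- Pigeonhole on the characters χ ∘ φ^n: two coincide, and the common power of φ cancels since φ is
bijective. -/
lemma exists_pow_comp_eq [Module.Finite k A] (χ : A →ₐ[k] k) (φ : A ≃ₐ[k] A) :
    ∃ m : ℕ, 0 < m ∧ ∀ l a, χ ((φ ^ (m * l)) a) = χ a := by
  have := finite_characters (k := k) (A := A)
  obtain ⟨i, j, hij, h⟩ := Finite.exists_ne_map_eq_of_infinite
    (fun n : ℕ => χ.comp (φ ^ n : A ≃ₐ[k] A).toAlgHom)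
  wlog hlt : i < j generalizing i j
  · exact this j i hij.symm h.symm (by lia)
  have h1 (a : A) : χ ((φ ^ (j - i)) a) = χ a := by
    obtain ⟨b, rfl⟩ := (φ ^ i).surjective a
    have h2 : χ ((φ ^ i) b) = χ ((φ ^ j) b) := DFunLike.congr_fun h b
    rw [h2]
    conv_rhs => rw [show j = j - i + i by lia, pow_add]
    rfl
  refine ⟨j - i, by lia, fun l => ?_⟩
  induction l with
  | zero => intro a; rw [mul_zero, pow_zero]; rfl
  | succ l ih =>
    intro a
    rw [mul_add, mul_one, pow_add]
    exact (ih _).trans (h1 a)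

lemma IsElementary.nonempty_char [Nontrivial A] (hel : IsElementary k A) :
    Nonempty (A →ₐ[k] k) := by
  obtain ⟨r, f, hf, hker⟩ := hel
  have h0 : f 1 ≠ 0 := by
    intro h
    have h1 : (1 : A) ∈ RingHom.ker f := h
    rw [hker] at h1
    exact (Ring.jacobson_lt_top A).ne ((Ideal.eq_top_iff_one _).2 h1)
  obtain ⟨i, -⟩ := Function.ne_iff.1 h0
  exact ⟨(Pi.evalAlgHom k (fun _ => k) i).comp f⟩

end characters

/-! ### Bounds and nonvanishing of Hochschild cohomology and homology -/

section nonvanishing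
variable {k : Type u} [Field k] {A : Type u} [Ring A] [Algebra k A]
open scoped ModuleCat TensorProduct
open MulOpposite

lemma one_le_tsum_dimk {X : DMod (Env k A)} {K : CochainComplex (BimodCat k A) ℤ} (j : ℤ)
    (h : ∀ i, i ≠ j → IsZero (K.homology i))
    (hX : ∃ f : X ⟶ (DerivedCategory.singleFunctor _ 0).obj (K.homology j), f ≠ 0) :
    1 ≤ ∑' i : ℤ, dimk k (X ⟶ (DerivedCategory.Q.obj K)⟦i⟧) := by
  obtain ⟨e⟩ := exists_Q_shift_iso_single K j h
  obtain ⟨f, hf⟩ := hX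
  have : Nontrivial (X ⟶ (DerivedCategory.Q.obj K)⟦j⟧) := ⟨f ≫ e.inv, 0, fun h0 => hf (by
    rw [← cancel_mono e.inv, h0, zero_comp])⟩
  exact (one_le_dimk (k := k)).trans
    (ENNReal.le_tsum (f := fun i : ℤ => dimk k (X ⟶ (DerivedCategory.Q.obj K)⟦i⟧)) j)

variable (k A) in
lemma Q_resolution_iso (P : ProjectiveResolution (regularBimod k A)) :
    Nonempty (DerivedCategory.Q.obj P.cochainComplex ≅
      (DerivedCategory.singleFunctor _ 0).obj (regularBimod k A)) :=
  ⟨@asIso _ _ _ _ (DerivedCategory.Q.map P.π')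
    ((DerivedCategory.isIso_Q_map_iff_quasiIso _ _).2 inferInstance) ≪≫
    ((DerivedCategory.singleFunctorIsoCompQ (BimodCat k A) 0).app (regularBimod k A)).symm⟩

/-- The bimodule homomorphism `A ⟶ H` given by a central element. -/
lemma exists_hom_of_central {H : BimodCat k A} (x : H) (hx : x ≠ 0)
    (h : ∀ a, leftAct H a x = rightAct H (op a) x) : ∃ f : regularBimod k A ⟶ H, f ≠ 0 := by
  let g : regularBimod k A →ₗ[k] H :=
    (LinearMap.applyₗ x ∘ₗ (leftAct H).toLinearMap) ∘ₗ (regEquiv k A).symm.toLinearMap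
  have hg (a : A) : g (regEquiv k A a) = leftAct H a x := by
    change leftAct H ((regEquiv k A).symm (regEquiv k A a)) x = _
    rw [LinearEquiv.symm_apply_apply]
  have hsmul (w : Env k A) (y : regularBimod k A) : g (w • y) = w • g y := by
    induction w using TensorProduct.induction_on with
    | zero => rw [zero_smul (Env k A) y, zero_smul (Env k A) (g y), map_zero]
    | add v w hv hw => rw [add_smul (M := regularBimod k A), map_add, hv, hw, add_smul (M := H)]
    | tmul a b =>
      obtain ⟨b, rfl⟩ := op_surjective b
      obtain ⟨c, rfl⟩ := (regEquiv k A).surjective y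
      rw [tmul_smul_eq, tmul_smul_eq, regEquiv_rightAct, regEquiv_leftAct, hg, hg, map_mul, map_mul,
        Module.End.mul_apply, Module.End.mul_apply, h b]
      exact congrArg (leftAct H a) (LinearMap.congr_fun (leftAct_rightAct_comm H c (op b)) x)
  refine ⟨ModuleCat.ofHom (X := regularBimod k A) (Y := H)
    { toFun := g, map_add' := map_add g, map_smul' := hsmul }, fun h0 => hx ?_⟩
  have h1 : g (regEquiv k A 1) = 0 := congrArg (fun e => e (regEquiv k A 1)) h0
  rw [hg, map_one] at h1
  exact h1

lemma IsElementary.exists_strictPerfect_resolution [Module.Finite k A] [FinGlobalDim Aᵐᵒᵖ]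
    (hel : IsElementary k A) :
    ∃ P : ProjectiveResolution (regularBimod k A),
      (∀ n, Module.Finite (Env k A) (P.complex.X n)) ∧
      IsStrictPerfect (Env k A) P.cochainComplex ∧
      IsStrictPerfect (Env k A) (dualComplex (bimodDual k A) P) := by
  obtain ⟨d, hd⟩ := hel.exists_hasProjectiveDimensionLE
  have : Module.Finite (Env k A) (regularBimod k A) := modOfAct_finite _
  have hfin (n : ℕ) : Module.Finite (Env k A)
      ((coverResolution (regularBimod k A)).complex.X n) :=
    inferInstanceAs (Module.Finite (Env k A) (cover (coverSyzygy (regularBimod k A) n)))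
  exact ⟨coverResolution _, hfin, isStrictPerfect_coverResolution _ (d + 1),
    isStrictPerfect_dualComplex _ (d + 1) (isZero_coverComplex _ (d + 1))⟩

lemma tsum_dimk_congr {X Y : DMod (Env k A)} (e : X ≅ Y) (K : CochainComplex (BimodCat k A) ℤ) :
    ∑' i : ℤ, dimk k (X ⟶ (DerivedCategory.Q.obj K)⟦i⟧) =
      ∑' i : ℤ, dimk k (Y ⟶ (DerivedCategory.Q.obj K)⟦i⟧) :=
  tsum_congr fun _ => dimk_congr (Linear.homCongr k e (Iso.refl _))

variable [Module.Finite k A] [FinGlobalDim Aᵐᵒᵖ]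
  (Δ : ProjectiveResolution (regularBimod k A)) (N : ProjectiveResolution (dualBimod k A))

/-- Replacing Δ by a finite resolution of A, the sums are at most the length of a tower for it over
A^e times the uniformly bounded total cohomology. -/
lemma IsTwistedCY.exists_coh_le {p : ℕ} {q : ℤ} (h : IsTwistedCY k A p q)
    (hel : IsElementary k A) :
    ∃ c : ENNReal, c < ⊤ ∧ ∀ n, ∑' i : ℤ, dimk k (serreHHCoh Δ N n i) ≤ c := by
  obtain ⟨P, -, hP, -⟩ := hel.exists_strictPerfect_resolution
  obtain ⟨c, hc⟩ := hP.exists_tsum_dimk_le (k := k)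
  obtain ⟨C, hC, hle⟩ := h.exists_tsum_dimk_tensorPow_le Δ N
  obtain ⟨e⟩ := Q_resolution_iso k A Δ
  obtain ⟨e'⟩ := Q_resolution_iso k A P
  refine ⟨c * C, ENNReal.mul_lt_top (ENNReal.natCast_lt_top c) hC, fun n => ?_⟩
  refine (tsum_dimk_congr (e ≪≫ e'.symm) _).le.trans ((hc _).trans ?_)
  gcongr
  exact hle n

lemma IsTwistedCY.exists_hom_le {p : ℕ} {q : ℤ} (h : IsTwistedCY k A p q)
    (hel : IsElementary k A) :
    ∃ c : ENNReal, c < ⊤ ∧ ∀ n, ∑' i : ℤ, dimk k (serreHHHom Δ N n i) ≤ c := by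
  obtain ⟨P, -, -, hP⟩ := hel.exists_strictPerfect_resolution
  obtain ⟨c, hc⟩ := hP.exists_tsum_dimk_le (k := k)
  obtain ⟨C, hC, hle⟩ := h.exists_tsum_dimk_tensorPow_le Δ N
  obtain ⟨e⟩ := exists_Q_dualComplex_iso (bimodDual k A) Δ P
  refine ⟨c * C, ENNReal.mul_lt_top (ENNReal.natCast_lt_top c) hC, fun n => ?_⟩
  -- Homology is indexed by -i, which does not affect the sum over all degrees.
  refine ((Equiv.neg ℤ).tsum_eq fun i : ℤ => dimk k (BimodHom
    (dualComplex (bimodDual k A) Δ) (tensorPow Δ N n) i)).le.trans ?_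
  refine (tsum_dimk_congr e _).le.trans ((hc _).trans ?_)
  gcongr
  exact hle n

variable [Nontrivial A]

/-- For exponents 1 + p l with χ ∘ φ^l = χ, the single cohomology bimodule is A^* twisted on the
right, and χ is central in it: χ(x b) = χ(φ^l(b) x) since χ is multiplicative with commutative
values. -/
lemma IsTwistedCY.frequently_one_le_coh {p : ℕ} {q : ℤ} (h : IsTwistedCY k A p q)
    (hel : IsElementary k A) :
    ∃ᶠ n in Filter.atTop, 1 ≤ ∑' i : ℤ, dimk k (serreHHCoh Δ N n i) := by
  obtain ⟨χ⟩ := hel.nonempty_char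
  obtain ⟨φ, hφ⟩ := h.exists_tensorPow_homologyEquiv Δ N
  obtain ⟨m, hm, hχ⟩ := exists_pow_comp_eq χ φ
  rw [Filter.frequently_atTop]
  intro a
  -- The multiple m a of the period m keeps χ fixed and makes the exponent at least a.
  refine ⟨1 + p * (m * a), ?_, ?_⟩
  · have := Nat.le_mul_of_pos_left a (Nat.mul_pos h.1 hm)
    rw [← mul_assoc]
    lia
  obtain ⟨h0, g, hgl, hgr⟩ := hφ 1 _ (serrePowIsSingle_one k A) (m * a)
  let ξ : dualBimod k A := (toDual k A).symm χ.toLinearMap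
  have hξ : toDual k A ξ = χ.toLinearMap := LinearEquiv.apply_symm_apply _ _
  obtain ⟨f, hf⟩ := exists_hom_of_central (g.symm ξ) (fun h1 => by
    have h2 : ξ = 0 := by rw [← g.apply_symm_apply ξ, h1, map_zero]
    rw [h2, map_zero] at hξ
    have h3 : (0 : k) = χ 1 := LinearMap.congr_fun hξ 1
    rw [map_one] at h3
    exact zero_ne_one h3) (fun b => by
    apply g.injective
    rw [hgl, hgr, LinearEquiv.apply_symm_apply]
    apply (toDual k A).injective
    ext x
    rw [toDual_leftAct, toDual_rightAct, hξ]
    change χ (x * b) = χ (_ * x)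
    rw [map_mul, map_mul, hχ, mul_comm])
  obtain ⟨e⟩ := Q_resolution_iso k A Δ
  refine one_le_tsum_dimk _ h0 ⟨e.hom ≫ (DerivedCategory.singleFunctor _ 0).map f, fun h1 => hf ?_⟩
  apply (DerivedCategory.singleFunctor _ 0).map_injective
  rw [← cancel_epi e.hom, h1, CategoryTheory.Functor.map_zero, comp_zero]

/-- For exponents p l with χ ∘ φ^l = χ, the single cohomology bimodule is A twisted on the right, on
which χ takes the same value at b x and x φ^l(b). It is therefore a trace, nonzero on the element 1.
-/
lemma IsTwistedCY.frequently_one_le_hom {p : ℕ} {q : ℤ} (h : IsTwistedCY k A p q)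
    (hel : IsElementary k A) :
    ∃ᶠ n in Filter.atTop, 1 ≤ ∑' i : ℤ, dimk k (serreHHHom Δ N n i) := by
  obtain ⟨χ⟩ := hel.nonempty_char
  obtain ⟨φ, hφ⟩ := h.exists_tensorPow_homologyEquiv Δ N
  obtain ⟨m, hm, hχ⟩ := exists_pow_comp_eq χ φ
  obtain ⟨P, hfin, -, hP⟩ := hel.exists_strictPerfect_resolution
  rw [Filter.frequently_atTop]
  intro a
  refine ⟨0 + p * (m * a), ?_, ?_⟩
  · have := Nat.le_mul_of_pos_left a (Nat.mul_pos h.1 hm)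
    rw [← mul_assoc]
    lia
  obtain ⟨h0, g, hgl, hgr⟩ := hφ 0 _ (serrePowIsSingle_zero k A) (m * a)
  let τ := χ.toLinearMap ∘ₗ (regEquiv k A).symm.toLinearMap ∘ₗ g.toLinearMap
  have hτ (b : A) (x) : τ (leftAct _ b x) = τ (rightAct _ (op b) x) := by
    change χ ((regEquiv k A).symm (g (leftAct _ b x))) =
      χ ((regEquiv k A).symm (g (rightAct _ (op b) x)))
    obtain ⟨c, hc⟩ := (regEquiv k A).surjective (g x)
    rw [hgl, hgr, ← hc, regEquiv_leftAct, regEquiv_rightAct, LinearEquiv.symm_apply_apply,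
      LinearEquiv.symm_apply_apply, map_mul, map_mul, hχ, mul_comm]
  obtain ⟨f, hf⟩ := exists_Q_dualComplex_ne_zero hτ P hP (g.symm (regEquiv k A 1)) (by
    change χ ((regEquiv k A).symm (g (g.symm (regEquiv k A 1)))) ≠ 0
    rw [LinearEquiv.apply_symm_apply, LinearEquiv.symm_apply_apply, map_one]
    exact one_ne_zero)
  obtain ⟨e⟩ := exists_Q_dualComplex_iso (bimodDual k A) Δ P
  have h1 := one_le_tsum_dimk (k := k) (X := DerivedCategory.Q.obj (dualComplex (bimodDual k A) Δ)) _ h0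
    ⟨e.hom ≫ f, fun h1 => hf (by rw [← cancel_epi e.hom, h1, comp_zero])⟩
  exact h1.trans ((Equiv.neg ℤ).tsum_eq fun i : ℤ => dimk k (BimodHom
    (dualComplex (bimodDual k A) Δ) (tensorPow Δ N (0 + p * (m * a))) i)).ge

end nonvanishing

/-- The bound c gives the limsup at most 0. Terms with s n = 0 contribute logarithm -∞, so only the
limsup is controlled; infinitely many terms with s n ≥ 1 suffice for it to be at least 0. -/
lemma limsup_log_div_eq_zero {s : ℕ → ENNReal} {c : ENNReal} (hc : c < ⊤) (hs : ∀ n, s n ≤ c)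
    (h : ∃ᶠ n in Filter.atTop, 1 ≤ s n) :
    Filter.limsup (fun n : ℕ => ENNReal.log (s n) / (n : EReal)) Filter.atTop = 0 := by
  apply le_antisymm
  · obtain ⟨n, hn⟩ := h.exists
    have h1 : 1 ≤ c := hn.trans (hs n)
    obtain ⟨y, hy⟩ : ∃ y : ℝ, ENNReal.log c = y := by
      refine ⟨(ENNReal.log c).toReal, (EReal.coe_toReal ?_ ?_).symm⟩
      · exact fun h => hc.ne (ENNReal.log_eq_top_iff.1 h)
      · exact fun h => (zero_lt_one.trans_le h1).ne' (ENNReal.log_eq_bot_iff.1 h)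
    have h2 := tendsto_ereal_div (x := fun _ => ENNReal.log c) (c := 0) (C := |y|) fun n =>
      ⟨y, hy, by simp⟩
    refine le_trans (Filter.limsup_le_limsup (.of_forall fun n => ?_)) h2.limsup_eq.le
    exact EReal.div_le_div_right_of_nonneg (by positivity) (ENNReal.log_monotone (hs n))
  · refine Filter.le_limsup_of_frequently_le' (h.mono fun n hn => ?_)
    refine EReal.div_nonneg ?_ (by positivity)
    rw [← ENNReal.log_one]
    exact ENNReal.log_monotone hn

end CYEntropy
end

theorem theorem3 (k A : Type u) [Field k] [Ring A] [Nontrivial A] [Algebra k A]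
    [Module.Finite k A] [FinGlobalDim Aᵐᵒᵖ] (p : ℕ) (q : ℤ) (h : IsTwistedCY k A p q) :
    (∃ G : Db k A, IsGenerator G) ∧
    (∀ G : Db k A, IsGenerator G → ∀ t : ℝ,
      Filter.Tendsto (entropySeq t G (serreFunctor k A)) Filter.atTop
        (nhds (((q : ℝ) / (p : ℝ) * t : ℝ) : EReal)) ∧
      entropy t G (serreFunctor k A) = (((q : ℝ) / (p : ℝ) * t : ℝ) : EReal) ∧
      polyEntropy t G (serreFunctor k A) = 0) ∧
    (IsElementary k A →
      ∀ (Δ : ProjectiveResolution (regularBimod k A)) (N : ProjectiveResolution (dualBimod k A)),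
        hhCohEntropy Δ N = 0 ∧ hhHomEntropy Δ N = 0) ∧
    (∀ G G' : Db k A, IsGenerator G → IsGenerator G' →
      upperSerreDim G G' (serreFunctor k A) = (((q : ℝ) / (p : ℝ) : ℝ) : EReal) ∧
      lowerSerreDim G G' (serreFunctor k A) = (((q : ℝ) / (p : ℝ) : ℝ) : EReal)) := by
  refine ⟨⟨_, isGenerator_regularDb k A⟩, fun G hG t => ⟨h.tendsto_entropySeq hG t,
    h.entropy_eq hG t, h.polyEntropy_eq_zero hG t⟩, fun hel Δ N => ?_,
    fun G G' hG hG' => h.serreDim_eq hG hG'⟩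
  obtain ⟨c, hc, hle⟩ := h.exists_coh_le Δ N hel
  obtain ⟨c', hc', hle'⟩ := h.exists_hom_le Δ N hel
  exact ⟨limsup_log_div_eq_zero hc hle (h.frequently_one_le_coh Δ N hel),
    limsup_log_div_eq_zero hc' hle' (h.frequently_one_le_hom Δ N hel)⟩
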